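/- Let $S=S[1\ldots n]$ be a text over a linearly ordered (possibly infinite) alphabet $\Sigma$, and let $1\le m\le n$. Let $T$ be the $m$-trimmed suffix tree of $S$: take the compacted trie of the words $S[i\ldots n]\$$, $1\le i\le n$, where $\$\notin\Sigma$; make explicit every implicit node at string depth exactly $m$; and remove all nodes at string depth greater than $m$. Write $\mathcal L(x)$ for the label of the path from the root to the node $x$. An edge $(u,v)$ of $T$ (with $u$ the parent) is heavy if the number of leaves below $u$ is less than twice the number of leaves below $v$, and light otherwise; a heavy path is a maximal downward path of heavy edges (possibly with no edge). Let $P$ be a heavy path, $u$ a vertex of $P$, $(u,v)$ a light edge, and $z$ a leaf of $T$ in the subtree of $v$ with $\mathcal L(z)=\mathcal L(u)\cdot c\cdot s$, where $c\in\Sigma$ and $s\in\Sigma^*$. A node $z'$ of $T$ is a $P$-light occurrence of $z$ if $\mathcal L(z')=\mathcal L(u)\cdot c'\cdot s$ for some $c'\in\Sigma\setminus\{c\}$ that is not the first symbol of the heavy edge leaving $u$ (if there is such an edge). A leaf whose label contains $\$$ has no $P$-light occurrences. For a leaf $z$, let $\mathrm{light}(z)$ be the number of positions $j$ at which a word $w=S[j\ldots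 j+|\mathcal L(z)|-1]$ at Hamming distance at most $1$ from $\mathcal L(z)$ occurs such that $w=\mathcal L(z')$ for some heavy path $P$ and some $P$-light occurrence $z'$ of $z$. Then there is an algorithm that, given $S$ and $m$, computes $\mathrm{light}(z)$ for all leaves $z$ of $T$ in $O(n\log n)$ total time and linear space. More precisely, one fixed word RAM program, which accesses the letters of $S$ only by comparing them, does so for all alphabets, all $S$ and all $m$ in at most $C\,n(\lfloor\log_2 n\rfloor+1)$ steps, with a constant number of arrays of at most $Cn$ cells and machine words of $C(\lfloor\log_2 n\rfloor+1)$ bits, for an absolute constant $C$; the number $\mathrm{light}(z)$ is output at every position $i\in[1\ldots n]$ such that $\mathcal L(z)$ is a prefix of $S[i\ldots n]\$$. -/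

import Mathlib

/-! ## Strings, suffix trees and heavy paths

Positions are counted from `0`. A node of a trie is identified with its locus, that is, with the
word spelled on the path from the root to it. The end marker `$` is `none`, a letter `a` of the
alphabet is `some a`. -/

namespace Mappability

variable {α : Type*}

/-- Words over the alphabet `α` extended by the end marker `$`. -/
abbrev Word (α : Type*) := List (Option α)

/-- The suffix of `S` that starts at position `i`, followed by `$`. -/
def suffixWord (S : List α) (i : ℕ) : Word α := (S.drop i).map some ++ [none]

/-- The nodes of the uncompacted trie of the nonempty suffixes of `S`, each followed by `$`. -/
def IsLocus (S : List α) (p : Word α) : Prop := ∃ i < S.length, p <+: suffixWord S i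

/-- The nodes of the suffix tree of `S` (the compacted trie of the suffixes): the root, the
leaves, and the loci that branch. -/
def IsSuffixTreeNode (S : List α) (p : Word α) : Prop :=
  IsLocus S p ∧
    (p = [] ∨ (∃ i < S.length, p = suffixWord S i) ∨
      ∃ c d : Option α, c ≠ d ∧ IsLocus S (p ++ [c]) ∧ IsLocus S (p ++ [d]))

/-- The nodes of the `m`-trimmed suffix tree: nodes of depth more than `m` are removed, and the
(possibly implicit) nodes of depth exactly `m` are explicit. -/
def IsNode (S : List α) (m : ℕ) (p : Word α) : Prop :=
  (IsSuffixTreeNode S p ∧ p.length ≤ m) ∨ (IsLocus S p ∧ p.length = m)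

/-- `v` is a child of `u` in the `m`-trimmed suffix tree. -/
def IsEdge (S : List α) (m : ℕ) (u v : Word α) : Prop :=
  IsNode S m u ∧ IsNode S m v ∧ u <+: v ∧ u ≠ v ∧
    ∀ x, IsNode S m x → u <+: x → x <+: v → x = u ∨ x = v

/-- `z` is a leaf of the `m`-trimmed suffix tree: a node without children. -/
def IsLeaf (S : List α) (m : ℕ) (z : Word α) : Prop :=
  IsNode S m z ∧ ∀ v, ¬ IsEdge S m z v

/-- The leaves in the subtree rooted in `u`. -/
def leavesBelow (S : List α) (m : ℕ) (u : Word α) : Set (Word α) :=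
  {z | IsLeaf S m z ∧ u <+: z}

/-- The edge `(u, v)` is heavy. -/
def IsHeavyEdge (S : List α) (m : ℕ) (u v : Word α) : Prop :=
  IsEdge S m u v ∧ (leavesBelow S m u).ncard < 2 * (leavesBelow S m v).ncard

/-- The edge `(u, v)` is light. -/
def IsLightEdge (S : List α) (m : ℕ) (u v : Word α) : Prop :=
  IsEdge S m u v ∧ ¬ IsHeavyEdge S m u v

/-- `P` is a heavy path: a maximal downward path (possibly without edges) of heavy edges. -/
def IsHeavyPath (S : List α) (m : ℕ) (P : List (Word α)) : Prop :=
  P ≠ [] ∧ (∀ u ∈ P, IsNode S m u) ∧ P.IsChain (IsHeavyEdge S m) ∧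
    (∀ u ∈ P.head?, ∀ v, ¬ IsHeavyEdge S m v u) ∧
    (∀ u ∈ P.getLast?, ∀ v, ¬ IsHeavyEdge S m u v)

/-- The node `z'` is a `P`-light occurrence of the leaf `z`: for a light edge `(u, v)` emerging
from a vertex `u` of `P` such that `z` lies in the subtree of `v`, the label of `z` is `u·c·s` and
the label of `z'` is `u·c'·s`, where `c'` is a letter other than `c` and other than the symbol of
the heavy edge that emerges from `u` (if there is one). Here `c·s` consists of letters of the
alphabet, it does not contain `$`. -/
def IsLightOcc (S : List α) (m : ℕ) (P : List (Word α)) (z z' : Word α) : Prop :=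
  IsLeaf S m z ∧ IsNode S m z' ∧
    ∃ u ∈ P, ∃ v, IsLightEdge S m u v ∧ v <+: z ∧
      ∃ (c c' : α) (s : List α),
        z = u ++ some c :: s.map some ∧ z' = u ++ some c' :: s.map some ∧
        c' ≠ c ∧ ∀ x, IsHeavyEdge S m u x → ¬ (u ++ [some c'] <+: x)

/-- The factor of `S` of length `l` at position `j`, as a word over the extended alphabet. -/
def factor (S : List α) (j l : ℕ) : Word α := ((S.drop j).take l).map some

/-- Hamming distance of two words of the same length. -/
def hamDist [DecidableEq α] (x y : Word α) : ℕ :=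
  (x.zip y).countP fun p => p.1 ≠ p.2

/-- The word `w` has a `k`-ham occurrence at position `j` of `S`. -/
def IsHamOcc [DecidableEq α] (k : ℕ) (S : List α) (w : Word α) (j : ℕ) : Prop :=
  j + w.length ≤ S.length ∧ hamDist w (factor S j w.length) ≤ k

/-- The 1-ham occurrences of the label of `z` that correspond to a `P`-light occurrence of `z`
for some heavy path `P`: the factor of `S` at the position is the label of that occurrence. -/
def lightHamOccs [DecidableEq α] (S : List α) (m : ℕ) (z : Word α) : Set ℕ :=
  {j | IsHamOcc 1 S z j ∧
    ∃ P, IsHeavyPath S m P ∧ ∃ z', IsLightOcc S m P z z' ∧ factor S j z.length = z'}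

/-! ## A word RAM

A structured random access machine with finitely many variables and arrays (those named in the
program), unit-cost operations on machine words, and read-only access to the text through
comparisons of letters. -/

/-- Binary operations on machine words; truth values are `0` and `1`. -/
inductive BinOp
  | add | sub | mul | div | mod | lt | eq

/-- The value of a binary operation (before the overflow check). -/
def BinOp.app : BinOp → ℕ → ℕ → ℕ
  | .add, a, b => a + b
  | .sub, a, b => a - b
  | .mul, a, b => a * b
  | .div, a, b => a / b
  | .mod, a, b => a % b
  | .lt, a, b => if a < b then 1 else 0
  | .eq, a, b => if a = b then 1 else 0

/-- Expressions: constants, variables, array cells, binary operations, and the test whether the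
letter of the text at one position is smaller than the letter at another. -/
inductive Expr
  | const (k : ℕ)
  | var (x : ℕ)
  | cell (a : ℕ) (i : Expr)
  | bin (o : BinOp) (e f : Expr)
  | letterLt (i j : Expr)

/-- The number of operations needed to evaluate an expression. -/
def Expr.cost : Expr → ℕ
  | .const _ => 1
  | .var _ => 1
  | .cell _ i => i.cost + 1
  | .bin _ e f => e.cost + f.cost + 1
  | .letterLt i j => i.cost + j.cost + 1

/-- Programs. An array name is a constant of the program, it is never computed. -/
inductive Prog
  | skip
  | assign (x : ℕ) (e : Expr)
  | store (a : ℕ) (i e : Expr)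
  | seq (p q : Prog)
  | ite (e : Expr) (p q : Prog)
  | loop (e : Expr) (p : Prog)

/-- The contents of the variables and of the arrays. -/
structure Store where
  vars : ℕ → ℕ
  arrs : ℕ → ℕ → ℕ

/-- Assignment to a variable. -/
def Store.setVar (σ : Store) (x k : ℕ) : Store :=
  { σ with vars := Function.update σ.vars x k }

/-- Assignment to an array cell. -/
def Store.setCell (σ : Store) (a i k : ℕ) : Store :=
  { σ with arrs := Function.update σ.arrs a (Function.update (σ.arrs a) i k) }

/-- At the start, variable `0` holds the length of the text, variable `1` holds `m`, and
everything else is zero. -/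
def Store.init (n m : ℕ) : Store where
  vars x := if x = 0 then n else if x = 1 then m else 0
  arrs _ _ := 0

/-- Evaluation of an expression on the text `S`, with machine words of `w` bits and arrays of
`L` cells; it fails on an overflow and on an access out of bounds. -/
def Expr.eval [LinearOrder α] (S : List α) (w L : ℕ) (σ : Store) : Expr → Option ℕ
  | .const k => if k < 2 ^ w then some k else none
  | .var x => if σ.vars x < 2 ^ w then some (σ.vars x) else none
  | .cell a i => do
      let k ← i.eval S w L σ
      if k < L then some (σ.arrs a k) else none
  | .bin o e f => do
      let k ← e.eval S w L σ
      let l ← f.eval S w L σ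
      if o.app k l < 2 ^ w then some (o.app k l) else none
  | .letterLt i j => do
      let k ← i.eval S w L σ
      let l ← j.eval S w L σ
      match S[k]?, S[l]? with
      | some a, some b => some (if a < b then 1 else 0)
      | _, _ => none

/-- `Exec S w L p σ t τ`: on the text `S`, with words of `w` bits and arrays of `L` cells, the
program `p` started in `σ` halts after `t` steps in `τ`, without any failure. -/
inductive Exec [LinearOrder α] (S : List α) (w L : ℕ) : Prog → Store → ℕ → Store → Prop
  | skip (σ : Store) : Exec S w L .skip σ 1 σ
  | assign (σ : Store) (x : ℕ) (e : Expr) (k : ℕ) (he : e.eval S w L σ = some k) :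
      Exec S w L (.assign x e) σ (e.cost + 1) (σ.setVar x k)
  | store (σ : Store) (a : ℕ) (i e : Expr) (j k : ℕ) (hi : i.eval S w L σ = some j)
      (hj : j < L) (he : e.eval S w L σ = some k) :
      Exec S w L (.store a i e) σ (i.cost + e.cost + 1) (σ.setCell a j k)
  | seq (σ ρ τ : Store) (p q : Prog) (s t : ℕ) (hp : Exec S w L p σ s ρ)
      (hq : Exec S w L q ρ t τ) : Exec S w L (.seq p q) σ (s + t) τ
  | ite_true (σ τ : Store) (e : Expr) (p q : Prog) (k t : ℕ) (he : e.eval S w L σ = some k)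
      (hk : k ≠ 0) (hp : Exec S w L p σ t τ) : Exec S w L (.ite e p q) σ (e.cost + 1 + t) τ
  | ite_false (σ τ : Store) (e : Expr) (p q : Prog) (t : ℕ) (he : e.eval S w L σ = some 0)
      (hq : Exec S w L q σ t τ) : Exec S w L (.ite e p q) σ (e.cost + 1 + t) τ
  | loop_true (σ ρ τ : Store) (e : Expr) (p : Prog) (k s t : ℕ) (he : e.eval S w L σ = some k)
      (hk : k ≠ 0) (hp : Exec S w L p σ s ρ) (hl : Exec S w L (.loop e p) ρ t τ) :
      Exec S w L (.loop e p) σ (e.cost + 1 + s + t) τ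
  | loop_false (σ : Store) (e : Expr) (p : Prog) (he : e.eval S w L σ = some 0) :
      Exec S w L (.loop e p) σ (e.cost + 1) σ

end Mappability

/-! Why the number of light occurrences can be computed in time `O(n log n)`.

**Reduction to positions.** A leaf whose label contains the end marker has no light occurrence. Let
`z` be the factor of length `m` at position `i`. A factor of length `m` at `j` is the label of a
light occurrence of `z` exactly if, for some `d < m`, the two factors have the same prefix of length
`d`, different letters number `d`, and the same tail of length `m - d - 1`, and both edges that
leave the locus of the common prefix towards the two leaves are light (`LightPair`,
`lightHamOccs_leafWord`): the edge towards `j` is light because it is not the heavy edge. The number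
`d` is determined by `i` and `j`, so the pairs can be counted node by node.

**Size of the light lists.** For a node of depth `d` consider the positions `i` whose factor enters
a light child. A light edge at least halves the number of leaves below, so each `i` is listed at
most `log n` times, and all lists together have at most `n log n` entries (`sum_lightSize_le`).

**Counting at a node.** A listed `i` contributes the listed `j` whose tail behind the letter number
`d` is the same, without those `j` that have the same factor of length `m`
(`ncard_lightPair`); two listed positions with equal tails and equal letter number `d` have equal
factors. So it suffices to have, for every listed position, a label of the class of its tail, and
to count labels.

**Classes of tails.** Two tails of length `l` that end at the end of the factors are equal if the
suffixes of the reversed text that start there agree on `l` letters. In the suffix array of the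
reversed text the classes are intervals, separated by the boundaries at which the longest common
prefix is shorter than `l`. Nodes are handled in the order of increasing depth, so `l` decreases
and classes only merge. The smaller class is relabelled, which at least doubles the class of each
relabelled element; hence all mergers take time `O(n log n)`. The potential is `partitionWeight`.

**Tables.** Letters are only compared in a merge sort, which replaces them by numbers. Suffix arrays
are computed by prefix doubling with counting sort, the longest common prefixes by the algorithm of
Kasai et al. The nodes of the suffix tree are represented by the boundaries between the intervals of
their children (`IsBoundaryTree`), found with a stack. Numbers of leaves are differences of prefix
sums, which gives the heavy children (`IsHeavyTree`).

**Programs.** A weakest-precondition calculus `wp` treats correctness, running time and the bounds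
on cells and numbers at once: every stored number is at most `8 n`, and intermediate results exceed
this bound by a constant factor only, so that words of `O(log n)` bits suffice (`exec_of_wp`).
Specifications are in continuation form: `wp` of a program holds for `Q` if `Q` follows from what
the program establishes. The constants in the time bounds are generous. -/

/-! ### A weakest-precondition calculus for the word RAM -/

namespace Mappability

variable {α : Type*} [LinearOrder α]

/-- The data that stay fixed during a run: the text, the number of cells of an array, and a common
bound for all numbers that are ever stored. -/
structure Machine (α : Type*) where
  S : List α
  L : ℕ
  B : ℕ

/-- The value of an expression, failures disregarded. -/
def Expr.val (M : Machine α) (σ : Store) : Expr → ℕ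
  | .const k => k
  | .var x => σ.vars x
  | .cell a i => σ.arrs a (i.val M σ)
  | .bin o e f => o.app (e.val M σ) (f.val M σ)
  | .letterLt i j =>
      match M.S[i.val M σ]?, M.S[j.val M σ]? with
      | some a, some b => if a < b then 1 else 0
      | _, _ => 0

/-- All accesses to arrays and to the text are within bounds, and no product is formed. -/
def Expr.ok (M : Machine α) (σ : Store) : Expr → Prop
  | .const _ => True
  | .var _ => True
  | .cell _ i => i.ok M σ ∧ i.val M σ < M.L
  | .bin o e f => o ≠ .mul ∧ e.ok M σ ∧ f.ok M σ
  | .letterLt i j => i.ok M σ ∧ j.ok M σ ∧ i.val M σ < M.S.length ∧ j.val M σ < M.S.length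

/-- In a store all of whose numbers are at most `B`, the values of a product-free expression and
of its subexpressions are at most `wt * B`. -/
def Expr.wt : Expr → ℕ
  | .const k => k + 1
  | .var _ => 1
  | .cell _ i => i.wt
  | .bin _ e f => e.wt + f.wt
  | .letterLt i j => i.wt + j.wt

/-- The largest weight of an expression in a program. -/
def Prog.wt : Prog → ℕ
  | .skip => 0
  | .assign _ e => e.wt
  | .store _ i e => max i.wt e.wt
  | .seq p q => max p.wt q.wt
  | .ite e p q => max e.wt (max p.wt q.wt)
  | .loop e p => max e.wt p.wt

/-- The variables that a program assigns to. -/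
def Prog.wv : Prog → List ℕ
  | .skip => []
  | .assign x _ => [x]
  | .store _ _ _ => []
  | .seq p q => p.wv ++ q.wv
  | .ite _ p q => p.wv ++ q.wv
  | .loop _ p => p.wv

/-- The arrays that a program writes to. -/
def Prog.wa : Prog → List ℕ
  | .skip => []
  | .assign _ _ => []
  | .store a _ _ => [a]
  | .seq p q => p.wa ++ q.wa
  | .ite _ p q => p.wa ++ q.wa
  | .loop _ p => p.wa

/-- At most `k` rounds of a loop with condition `e`, whose body acts on postconditions by `f`. -/
def loopIter (M : Machine α) (e : Expr) (f : (Store → ℕ → Prop) → Store → ℕ → Prop)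
    (Q : Store → ℕ → Prop) : ℕ → Store → ℕ → Prop
  | 0 => fun _ _ => False
  | k + 1 => fun σ t => e.ok M σ ∧ (e.val M σ = 0 → Q σ (t + e.cost + 1)) ∧
      (e.val M σ ≠ 0 → f (loopIter M e f Q k) σ (t + e.cost + 1))

/-- `wp M p Q σ t`: the program `p`, started in `σ` at time `t`, halts without a failure in a
store and at a time that satisfy `Q`, and all numbers that it stores are at most `M.B`. -/
def wp (M : Machine α) : Prog → (Store → ℕ → Prop) → Store → ℕ → Prop
  | .skip, Q, σ, t => Q σ (t + 1)
  | .assign x e, Q, σ, t => e.ok M σ ∧ e.val M σ ≤ M.B ∧ Q (σ.setVar x (e.val M σ)) (t + e.cost + 1)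
  | .store a i e, Q, σ, t => i.ok M σ ∧ i.val M σ < M.L ∧ e.ok M σ ∧ e.val M σ ≤ M.B ∧
      Q (σ.setCell a (i.val M σ) (e.val M σ)) (t + i.cost + e.cost + 1)
  | .seq p q, Q, σ, t => wp M p (wp M q Q) σ t
  | .ite e p q, Q, σ, t => e.ok M σ ∧ (e.val M σ ≠ 0 → wp M p Q σ (t + e.cost + 1)) ∧
      (e.val M σ = 0 → wp M q Q σ (t + e.cost + 1))
  | .loop e p, Q, σ, t => ∃ k, loopIter M e (wp M p) Q k σ t

/-- All numbers in the store are at most `B`. -/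
def Bounded (B : ℕ) (σ : Store) : Prop :=
  (∀ x, σ.vars x ≤ B) ∧ ∀ a i, σ.arrs a i ≤ B

/-- The stores agree outside the variables and arrays that `p` writes. -/
def Frame (p : Prog) (σ τ : Store) : Prop :=
  (∀ x, x ∉ p.wv → τ.vars x = σ.vars x) ∧ ∀ a, a ∉ p.wa → τ.arrs a = σ.arrs a

theorem Bounded.setVar {B : ℕ} {σ : Store} (h : Bounded B σ) (x : ℕ) {k : ℕ} (hk : k ≤ B) :
    Bounded B (σ.setVar x k) := by
  refine ⟨fun y => ?_, h.2⟩
  simp only [Store.setVar, Function.update_apply]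
  split_ifs
  · exact hk
  · exact h.1 y

theorem Bounded.setCell {B : ℕ} {σ : Store} (h : Bounded B σ) (a i : ℕ) {k : ℕ} (hk : k ≤ B) :
    Bounded B (σ.setCell a i k) := by
  refine ⟨h.1, fun b j => ?_⟩
  simp only [Store.setCell, Function.update_apply]
  split_ifs with h1
  · simp only [Function.update_apply]
    split_ifs
    · exact hk
    · exact h.2 a j
  · exact h.2 b j

theorem Expr.one_le_wt (e : Expr) : 1 ≤ e.wt := by
  induction e <;> simp only [Expr.wt] <;> omega

theorem BinOp.app_le {o : BinOp} (ho : o ≠ .mul) {a b x y B : ℕ} (ha : a ≤ x * B) (hb : b ≤ y * B)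
    (hx : 1 ≤ x) (hB : 1 ≤ B) : o.app a b ≤ (x + y) * B := by
  have h1 : x * B ≤ (x + y) * B := Nat.mul_le_mul_right _ (by omega)
  have h2 : 1 ≤ (x + y) * B := Nat.mul_pos (by omega) hB
  cases o with
  | add => simp only [BinOp.app]; rw [Nat.add_mul]; omega
  | sub => simp only [BinOp.app]; omega
  | mul => exact absurd rfl ho
  | div => simp only [BinOp.app]; exact (Nat.div_le_self _ _).trans (ha.trans h1)
  | mod => simp only [BinOp.app]; exact (Nat.mod_le _ _).trans (ha.trans h1)
  | lt => simp only [BinOp.app]; split_ifs <;> omega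
  | eq => simp only [BinOp.app]; split_ifs <;> omega

theorem Expr.eval_eq {M : Machine α} {σ : Store} {w : ℕ} (hσ : Bounded M.B σ) (hB : 1 ≤ M.B)
    (e : Expr) (hok : e.ok M σ) (hw : e.wt * M.B < 2 ^ w) :
    e.eval M.S w M.L σ = some (e.val M σ) ∧ e.val M σ ≤ e.wt * M.B := by
  induction e with
  | const k =>
    have : k ≤ (k + 1) * M.B := (Nat.le_succ k).trans (Nat.le_mul_of_pos_right _ hB)
    simp only [Expr.wt] at hw
    exact ⟨by simp only [Expr.eval, Expr.val]; rw [if_pos (by omega)], this⟩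
  | var x =>
    have h := hσ.1 x
    simp only [Expr.wt] at hw
    exact ⟨by simp only [Expr.eval, Expr.val]; rw [if_pos (by omega)],
      by simpa only [Expr.val, Expr.wt, one_mul] using h⟩
  | cell a i ih =>
    obtain ⟨h1, h2⟩ := hok
    obtain ⟨h3, h4⟩ := ih h1 hw
    refine ⟨by simp [Expr.eval, Expr.val, h3, h2], ?_⟩
    simp only [Expr.val, Expr.wt]
    exact (hσ.2 _ _).trans (Nat.le_mul_of_pos_left _ i.one_le_wt)
  | bin o e f ihe ihf =>
    obtain ⟨h0, h1, h2⟩ := hok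
    simp only [Expr.wt] at hw
    have h1' := ihe h1 (lt_of_le_of_lt (Nat.mul_le_mul_right _ (by omega)) hw)
    have h2' := ihf h2 (lt_of_le_of_lt (Nat.mul_le_mul_right _ (by omega)) hw)
    have h3 := BinOp.app_le h0 h1'.2 h2'.2 e.one_le_wt hB
    refine ⟨?_, h3⟩
    simp only [Expr.eval, Expr.val, h1'.1, h2'.1, Option.bind_eq_bind, Option.bind_some]
    rw [if_pos (by omega)]
  | letterLt i j ihi ihj =>
    obtain ⟨h1, h2, h3, h4⟩ := hok
    simp only [Expr.wt] at hw
    have h1' := ihi h1 (lt_of_le_of_lt (Nat.mul_le_mul_right _ (by omega)) hw)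
    have h2' := ihj h2 (lt_of_le_of_lt (Nat.mul_le_mul_right _ (by omega)) hw)
    have h5 : 1 ≤ (i.wt + j.wt) * M.B := Nat.mul_pos (by have := i.one_le_wt; omega) hB
    refine ⟨?_, ?_⟩
    · simp [Expr.eval, Expr.val, h1'.1, h2'.1, List.getElem?_eq_getElem h3,
        List.getElem?_eq_getElem h4]
    · simp only [Expr.val, Expr.wt, List.getElem?_eq_getElem h3, List.getElem?_eq_getElem h4]
      split_ifs <;> omega

theorem wp_mono {M : Machine α} {p : Prog} {Q R : Store → ℕ → Prop} (h : ∀ τ s, Q τ s → R τ s)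
    {σ : Store} {t : ℕ} (hp : wp M p Q σ t) : wp M p R σ t := by
  induction p generalizing Q R σ t with
  | skip => exact h _ _ hp
  | assign x e => exact ⟨hp.1, hp.2.1, h _ _ hp.2.2⟩
  | store a i e => exact ⟨hp.1, hp.2.1, hp.2.2.1, hp.2.2.2.1, h _ _ hp.2.2.2.2⟩
  | seq p q ihp ihq => exact ihp (fun τ s hq => ihq h hq) hp
  | ite e p q ihp ihq => exact ⟨hp.1, fun h1 => ihp h (hp.2.1 h1), fun h1 => ihq h (hp.2.2 h1)⟩
  | loop e p ih =>
    obtain ⟨k, hk⟩ := hp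
    refine ⟨k, ?_⟩
    induction k generalizing σ t with
    | zero => exact hk
    | succ k ihk =>
      exact ⟨hk.1, fun h1 => h _ _ (hk.2.1 h1), fun h1 => ih (fun τ s hq => ihk hq) (hk.2.2 h1)⟩

theorem loopIter_mono {M : Machine α} {e : Expr} {p : Prog} {Q R : Store → ℕ → Prop}
    (h : ∀ τ s, Q τ s → R τ s) {k : ℕ} {σ : Store} {t : ℕ}
    (hp : loopIter M e (wp M p) Q k σ t) : loopIter M e (wp M p) R k σ t := by
  induction k generalizing σ t with
  | zero => exact hp
  | succ k ihk =>
    exact ⟨hp.1, fun h1 => h _ _ (hp.2.1 h1), fun h1 => wp_mono (fun τ s hq => ihk hq) (hp.2.2 h1)⟩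

theorem Frame.refl (p : Prog) (σ : Store) : Frame p σ σ := ⟨fun _ _ => rfl, fun _ _ => rfl⟩

theorem Frame.trans {p : Prog} {σ τ ρ : Store} (h : Frame p σ τ) (h' : Frame p τ ρ) :
    Frame p σ ρ :=
  ⟨fun x hx => (h'.1 x hx).trans (h.1 x hx), fun x hx => (h'.2 x hx).trans (h.2 x hx)⟩

theorem Frame.mono {p q : Prog} {σ τ : Store} (h : Frame p σ τ) (hv : ∀ x ∈ p.wv, x ∈ q.wv)
    (ha : ∀ x ∈ p.wa, x ∈ q.wa) : Frame q σ τ :=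
  ⟨fun x hx => h.1 x fun h' => hx (hv x h'), fun x hx => h.2 x fun h' => hx (ha x h')⟩

theorem wp_frame {M : Machine α} {p : Prog} {Q : Store → ℕ → Prop} {σ : Store} {t : ℕ}
    (hp : wp M p Q σ t) : wp M p (fun τ s => Q τ s ∧ Frame p σ τ) σ t := by
  induction p generalizing Q σ t with
  | skip => exact ⟨hp, Frame.refl _ _⟩
  | assign x e =>
    refine ⟨hp.1, hp.2.1, hp.2.2, fun y hy => ?_, fun _ _ => rfl⟩
    exact Function.update_of_ne (by simpa [Prog.wv] using hy) _ _
  | store a i e =>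
    refine ⟨hp.1, hp.2.1, hp.2.2.1, hp.2.2.2.1, hp.2.2.2.2, fun _ _ => rfl, fun y hy => ?_⟩
    exact Function.update_of_ne (by simpa [Prog.wa] using hy) _ _
  | seq p q ihp ihq =>
    refine wp_mono (p := p) ?_ (ihp hp)
    intro τ s ⟨h1, h2⟩
    refine wp_mono ?_ (ihq h1)
    intro ρ r ⟨h3, h4⟩
    exact ⟨h3, Frame.trans (h2.mono (by simp +contextual [Prog.wv]) (by simp +contextual [Prog.wa]))
      (h4.mono (by simp +contextual [Prog.wv]) (by simp +contextual [Prog.wa]))⟩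
  | ite e p q ihp ihq =>
    refine ⟨hp.1, fun h1 => wp_mono ?_ (ihp (hp.2.1 h1)), fun h1 => wp_mono ?_ (ihq (hp.2.2 h1))⟩
    · intro τ s ⟨h3, h4⟩
      exact ⟨h3, h4.mono (by simp +contextual [Prog.wv]) (by simp +contextual [Prog.wa])⟩
    · intro τ s ⟨h3, h4⟩
      exact ⟨h3, h4.mono (by simp +contextual [Prog.wv]) (by simp +contextual [Prog.wa])⟩
  | loop e p ih =>
    obtain ⟨k, hk⟩ := hp
    refine ⟨k, ?_⟩
    induction k generalizing σ t with
    | zero => exact hk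
    | succ k ihk =>
      refine ⟨hk.1, fun h1 => ⟨hk.2.1 h1, Frame.refl _ _⟩, fun h1 => wp_mono ?_ (ih (hk.2.2 h1))⟩
      intro τ s ⟨h3, h4⟩
      have h4' : Frame (.loop e p) σ τ := h4
      exact loopIter_mono (fun _ _ h => ⟨h.1, h4'.trans h.2⟩) (ihk h3)

/-- The calculus is sound: on words of `w` bits such that `2 ^ w` exceeds `p.wt * B`, the program
runs without a failure. -/
theorem exec_of_wp {M : Machine α} {w : ℕ} {p : Prog} (hB : 1 ≤ M.B) (hw : p.wt * M.B < 2 ^ w)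
    {Q : Store → ℕ → Prop} {σ : Store} {t : ℕ} (hσ : Bounded M.B σ) (hp : wp M p Q σ t) :
    ∃ s τ, Exec M.S w M.L p σ s τ ∧ Bounded M.B τ ∧ Q τ (t + s) := by
  have hle : ∀ {a b : ℕ}, a ≤ b → b * M.B < 2 ^ w → a * M.B < 2 ^ w := fun h h' =>
    lt_of_le_of_lt (Nat.mul_le_mul_right _ h) h'
  induction p generalizing Q σ t with
  | skip => exact ⟨1, σ, .skip σ, hσ, hp⟩
  | assign x e =>
    obtain ⟨h1, h2, h3⟩ := hp
    exact ⟨_, _, .assign σ x e _ (e.eval_eq hσ hB h1 hw).1, hσ.setVar x h2, h3⟩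
  | store a i e =>
    obtain ⟨h1, h2, h3, h4, h5⟩ := hp
    refine ⟨_, _, .store σ a i e _ _ (i.eval_eq hσ hB h1 (hle (le_max_left _ _) hw)).1 h2
      (e.eval_eq hσ hB h3 (hle (le_max_right _ _) hw)).1, hσ.setCell _ _ h4, ?_⟩
    rwa [← add_assoc, ← add_assoc]
  | seq p q ihp ihq =>
    obtain ⟨s, τ, h1, h2, h3⟩ := ihp (hle (le_max_left _ _) hw) hσ hp
    obtain ⟨s', τ', h1', h2', h3'⟩ := ihq (hle (le_max_right _ _) hw) h2 h3
    exact ⟨_, _, .seq _ _ _ _ _ _ _ h1 h1', h2', by rwa [← add_assoc]⟩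
  | ite e p q ihp ihq =>
    have he := (e.eval_eq hσ hB hp.1 (hle (le_max_left _ _) hw)).1
    by_cases h0 : e.val M σ = 0
    · obtain ⟨s, τ, h1, h2, h3⟩ := ihq (hle ((le_max_right _ _).trans (le_max_right _ _)) hw) hσ
        (hp.2.2 h0)
      rw [h0] at he
      exact ⟨_, _, .ite_false _ _ _ _ _ _ he h1, h2, by rwa [← add_assoc, ← add_assoc]⟩
    · obtain ⟨s, τ, h1, h2, h3⟩ := ihp (hle ((le_max_left _ _).trans (le_max_right _ _)) hw) hσ
        (hp.2.1 h0)
      exact ⟨_, _, .ite_true _ _ _ _ _ _ _ he h0 h1, h2, by rwa [← add_assoc, ← add_assoc]⟩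
  | loop e p ih =>
    obtain ⟨k, hk⟩ := hp
    induction k generalizing σ t with
    | zero => exact hk.elim
    | succ k ihk =>
      have he := (e.eval_eq hσ hB hk.1 (hle (le_max_left _ _) hw)).1
      by_cases h0 : e.val M σ = 0
      · rw [h0] at he
        exact ⟨_, _, .loop_false _ _ _ he, hσ, by rw [← add_assoc]; exact hk.2.1 h0⟩
      · obtain ⟨s, τ, h1, h2, h3⟩ := ih (hle (le_max_right _ _) hw) hσ (hk.2.2 h0)
        obtain ⟨s', τ', h1', h2', h3'⟩ := ihk h2 h3
        refine ⟨_, _, .loop_true _ _ _ _ _ _ _ _ he h0 h1 h1', h2', ?_⟩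
        rwa [← add_assoc, ← add_assoc, ← add_assoc]

/-! ### Rules for loops -/

/-- The rule for loops: `I` is the invariant, `μ` a measure that decreases. -/
theorem wp_while {M : Machine α} {e : Expr} {p : Prog} {Q : Store → ℕ → Prop} {σ : Store} {t : ℕ}
    (I : Store → ℕ → Prop) (μ : Store → ℕ) (h0 : I σ t)
    (hstep : ∀ τ s, Frame p σ τ → I τ s → e.ok M τ ∧
      (e.val M τ = 0 → Q τ (s + e.cost + 1)) ∧
      (e.val M τ ≠ 0 → wp M p (fun τ' s' => I τ' s' ∧ μ τ' < μ τ) τ (s + e.cost + 1))) :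
    wp M (.loop e p) Q σ t := by
  have key : ∀ k τ s, Frame p σ τ → I τ s → μ τ < k → loopIter M e (wp M p) Q k τ s := by
    intro k
    induction k with
    | zero => intro τ s _ _ h; omega
    | succ k ih =>
      intro τ s hf hI hμ
      obtain ⟨h1, h2, h3⟩ := hstep τ s hf hI
      refine ⟨h1, h2, fun h => wp_mono ?_ (wp_frame (h3 h))⟩
      intro τ' s' ⟨⟨h4, h5⟩, h6⟩
      exact ih τ' s' (hf.trans h6) h4 (by omega)
  exact ⟨μ σ + 1, key _ σ t (Frame.refl _ _) h0 (by omega)⟩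

/-- `for x := lo to hi - 1 do p`. -/
def Prog.for (x : ℕ) (lo hi : Expr) (p : Prog) : Prog :=
  .seq (.assign x lo) (.loop (.bin .lt (.var x) hi)
    (.seq p (.assign x (.bin .add (.var x) (.const 1)))))

/-- The rule for counting loops, with an invariant that mentions the time. -/
theorem wp_for_time {M : Machine α} {x : ℕ} {lo hi : Expr} {p : Prog} {Q : Store → ℕ → Prop}
    {σ : Store} {t : ℕ} (a N : ℕ) (I : ℕ → Store → ℕ → Prop)
    (hlo : lo.ok M σ) (ha : lo.val M σ = a) (haN : a ≤ N) (hN : N ≤ M.B)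
    (hhi : ∀ τ, Frame (.for x lo hi p) σ τ → hi.ok M τ ∧ hi.val M τ = N)
    (hx : x ∉ p.wv)
    (hI : ∀ k τ s v, I k τ s → I k (τ.setVar x v) s)
    (h0 : I a σ (t + lo.cost + 1))
    (hstep : ∀ k τ s, a ≤ k → k < N → Frame (.for x lo hi p) σ τ → τ.vars x = k → I k τ s →
      wp M p (fun τ' s' => I (k + 1) τ' (s' + 4)) τ (s + hi.cost + 3))
    (hQ : ∀ τ s, Frame (.for x lo hi p) σ τ → τ.vars x = N → I N τ s → Q τ (s + hi.cost + 3)) :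
    wp M (.for x lo hi p) Q σ t := by
  refine ⟨hlo, by rw [ha]; omega, ?_⟩
  have hf0 : Frame (.for x lo hi p) σ (σ.setVar x (lo.val M σ)) := by
    refine ⟨fun y hy => ?_, fun _ _ => rfl⟩
    refine Function.update_of_ne ?_ _ _
    rintro rfl
    exact hy (by simp [Prog.for, Prog.wv])
  refine wp_while (fun τ s => Frame (.for x lo hi p) σ τ ∧ τ.vars x ≤ N ∧ a ≤ τ.vars x ∧
    I (τ.vars x) τ s) (fun τ => N - τ.vars x) ?_ ?_
  · refine ⟨hf0, ?_⟩
    simp only [Store.setVar, Function.update_self, ha]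
    refine ⟨haN, le_rfl, ?_⟩
    exact hI _ _ _ _ h0
  · rintro τ s - ⟨hf, h1, h1', h2⟩
    obtain ⟨h3, h4⟩ := hhi τ hf
    refine ⟨⟨by simp, trivial, h3⟩, ?_, ?_⟩
    · intro h5
      simp only [Expr.val, BinOp.app, h4] at h5
      have h6 : τ.vars x = N := by
        by_contra h
        rw [if_pos (by omega)] at h5
        omega
      rw [h6] at h2
      have := hQ τ s hf h6 h2
      simp only [Expr.cost]
      convert this using 1
      omega
    · intro h5
      simp only [Expr.val, BinOp.app, h4] at h5
      have h6 : τ.vars x < N := by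
        by_contra h
        exact h5 (if_neg h)
      have h7 := wp_frame (hstep _ τ s h1' h6 hf rfl h2)
      simp only [Expr.cost]
      rw [show s + (1 + hi.cost + 1) + 1 = s + hi.cost + 3 by omega]
      refine wp_mono (p := p) ?_ h7
      intro τ' s' ⟨h8, h9⟩
      have hxk : τ'.vars x = τ.vars x := h9.1 x hx
      refine ⟨⟨by simp, trivial, trivial⟩, ?_, ?_⟩
      · simp only [Expr.val, BinOp.app, hxk]; omega
      · have hv : Expr.val M τ' (.bin .add (.var x) (.const 1)) = τ.vars x + 1 := by
          simp only [Expr.val, BinOp.app, hxk]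
        rw [hv]
        simp only [Store.setVar, Function.update_self]
        refine ⟨⟨hf.trans ?_, by omega, by omega, ?_⟩, by omega⟩
        · refine ⟨fun y hy => ?_, fun b hb => h9.2 b (by simpa [Prog.for, Prog.wa] using hb)⟩
          have hy' : y ≠ x ∧ y ∉ p.wv := by
            simp only [Prog.for, Prog.wv, List.mem_append, List.mem_singleton] at hy
            exact ⟨fun h => hy (by simp [h]), fun h => hy (by simp [h])⟩
          simp only [Function.update_of_ne hy'.1]
          exact h9.1 y hy'.2
        · exact hI _ _ _ _ h8

/-- The rule for counting loops whose body takes at most `c` steps. -/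
theorem wp_for {M : Machine α} {x : ℕ} {lo hi : Expr} {p : Prog} {Q : Store → ℕ → Prop}
    {σ : Store} {t : ℕ} (a N c : ℕ) (I : ℕ → Store → Prop)
    (hlo : lo.ok M σ) (ha : lo.val M σ = a) (haN : a ≤ N) (hN : N ≤ M.B)
    (hhi : ∀ τ, Frame (.for x lo hi p) σ τ → hi.ok M τ ∧ hi.val M τ = N)
    (hx : x ∉ p.wv)
    (hI : ∀ k τ v, I k τ → I k (τ.setVar x v))
    (h0 : I a σ)
    (hstep : ∀ k τ s, a ≤ k → k < N → Frame (.for x lo hi p) σ τ → τ.vars x = k → I k τ →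
      wp M p (fun τ' s' => I (k + 1) τ' ∧ s' ≤ s + c) τ s)
    (hQ : ∀ τ s, Frame (.for x lo hi p) σ τ → τ.vars x = N → I N τ →
      s ≤ t + lo.cost + hi.cost + 4 + (c + hi.cost + 7) * (N - a) → Q τ s) :
    wp M (.for x lo hi p) Q σ t := by
  refine wp_for_time a N
    (fun k τ s => I k τ ∧ s ≤ t + lo.cost + 1 + (c + hi.cost + 7) * (k - a)) hlo ha haN hN hhi hx
    (fun k τ s v h => ⟨hI k τ v h.1, h.2⟩) ⟨h0, by omega⟩ ?_ ?_
  · intro k τ s hak hkN hf hk ⟨h1, h2⟩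
    refine wp_mono ?_ (hstep k τ (s + hi.cost + 3) hak hkN hf hk h1)
    intro τ' s' ⟨h3, h4⟩
    refine ⟨h3, ?_⟩
    rw [show k + 1 - a = (k - a) + 1 by omega, Nat.mul_add]
    omega
  · intro τ s hf hx ⟨h1, h2⟩
    exact hQ τ _ hf hx h1 (by omega)

theorem setVar_vars (σ : Store) (x k y : ℕ) :
    (σ.setVar x k).vars y = if y = x then k else σ.vars y := by
  simp [Store.setVar, Function.update_apply]

theorem setVar_arrs (σ : Store) (x k : ℕ) : (σ.setVar x k).arrs = σ.arrs := rfl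

theorem setCell_vars (σ : Store) (a i k : ℕ) : (σ.setCell a i k).vars = σ.vars := rfl

theorem setCell_arrs (σ : Store) (a i k b : ℕ) :
    (σ.setCell a i k).arrs b = if b = a then Function.update (σ.arrs a) i k else σ.arrs b := by
  simp [Store.setCell, Function.update_apply]

theorem app_add (a b : ℕ) : BinOp.add.app a b = a + b := rfl

theorem app_sub (a b : ℕ) : BinOp.sub.app a b = a - b := rfl

theorem app_lt_eq_zero (a b : ℕ) : BinOp.lt.app a b = 0 ↔ ¬ a < b := by
  simp only [BinOp.app]
  split_ifs <;> simp_all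

theorem app_eq_eq_zero (a b : ℕ) : BinOp.eq.app a b = 0 ↔ ¬ a = b := by
  simp only [BinOp.app]
  split_ifs <;> simp_all

theorem letterLt_val {M : Machine α} {σ : Store} {i j : Expr} {a b : α}
    (hi : M.S[i.val M σ]? = some a) (hj : M.S[j.val M σ]? = some b) :
    (Expr.letterLt i j).val M σ = if a < b then 1 else 0 := by
  simp only [Expr.val, hi, hj]

attribute [simp] setVar_vars setVar_arrs setCell_vars setCell_arrs wp Expr.val Expr.ok Expr.cost
  app_add app_sub app_lt_eq_zero app_eq_eq_zero

/-! ### Counting sort -/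

-- Abbreviations for programs and expressions; names in `v` are numbers of variables, names in
-- `a` are numbers of arrays.

infixr:30 " ;; " => Prog.seq
infixl:65 " +ₑ " => Expr.bin BinOp.add
infixl:65 " -ₑ " => Expr.bin BinOp.sub
infix:50 " <ₑ " => Expr.bin BinOp.lt
infix:50 " =ₑ " => Expr.bin BinOp.eq

-- Inputs: `vN` is the length of the text and `vM` is `m`. The counter of most loops is `vk`.
-- Arrays: `aT` holds numbers that stand for the letters; `aA`, `aB`, `aN`, `aKEY` and `aCNT` are
-- working space of the sorting procedures.

notation "vN" => (0 : ℕ)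
notation "vM" => (1 : ℕ)
notation "vk" => (2 : ℕ)
notation "aA" => (1 : ℕ)
notation "aB" => (2 : ℕ)
notation "aT" => (3 : ℕ)
notation "aN" => (4 : ℕ)
notation "aKEY" => (5 : ℕ)
notation "aCNT" => (6 : ℕ)

/-- The number of elements of `[0, n)` that are `r`-smaller than `x`. -/
def rankOf (r : ℕ → ℕ → Prop) [DecidableRel r] (n x : ℕ) : ℕ :=
  ((Finset.range n).filter fun y => r y x).card

theorem rankOf_lt_rankOf {r : ℕ → ℕ → Prop} [DecidableRel r] {n x y : ℕ} (hx : x < n)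
    (htr : ∀ a b c, r a b → r b c → r a c) (hirr : ∀ a, ¬ r a a) (h : r x y) :
    rankOf r n x < rankOf r n y := by
  apply Finset.card_lt_card
  refine ⟨fun z hz => ?_, fun hs => ?_⟩
  · simp only [Finset.mem_filter] at hz ⊢
    exact ⟨hz.1, htr _ _ _ hz.2 h⟩
  · have := hs (Finset.mem_filter.mpr ⟨Finset.mem_range.mpr hx, h⟩)
    exact hirr x (Finset.mem_filter.mp this).2

theorem rankOf_lt {r : ℕ → ℕ → Prop} [DecidableRel r] {n x : ℕ} (hx : x < n)
    (hirr : ∀ a, ¬ r a a) : rankOf r n x < n := by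
  have : rankOf r n x < (Finset.range n).card := by
    apply Finset.card_lt_card
    refine ⟨Finset.filter_subset _ _, fun hs => ?_⟩
    exact hirr x (Finset.mem_filter.mp (hs (Finset.mem_range.mpr hx))).2
  simpa using this

/-- The order of a stable sort by the key `κ`. -/
def stableLt (κ : ℕ → ℕ) (x y : ℕ) : Prop := κ x < κ y ∨ (κ x = κ y ∧ x < y)

instance (κ : ℕ → ℕ) : DecidableRel (stableLt κ) := fun _ _ => instDecidableOr

theorem stableLt_trans {κ : ℕ → ℕ} (a b c : ℕ) (h : stableLt κ a b) (h' : stableLt κ b c) :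
    stableLt κ a c := by
  unfold stableLt at *; omega

theorem stableLt_irrefl {κ : ℕ → ℕ} (a : ℕ) : ¬ stableLt κ a a := by
  unfold stableLt; omega

theorem rankOf_stableLt_iff {κ : ℕ → ℕ} {n x y : ℕ} (hx : x < n) (hy : y < n) :
    rankOf (stableLt κ) n x < rankOf (stableLt κ) n y ↔ stableLt κ x y := by
  refine ⟨fun h => ?_, rankOf_lt_rankOf hx stableLt_trans stableLt_irrefl⟩
  by_contra h'
  rcases eq_or_ne x y with rfl | hne
  · omega
  · have : stableLt κ y x := by unfold stableLt at *; omega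
    have := rankOf_lt_rankOf hy stableLt_trans stableLt_irrefl this
    omega

theorem rankOf_stableLt_inj {κ : ℕ → ℕ} {n x y : ℕ} (hx : x < n) (hy : y < n)
    (h : rankOf (stableLt κ) n x = rankOf (stableLt κ) n y) : x = y := by
  by_contra hne
  have h1 := (rankOf_stableLt_iff (κ := κ) hx hy).not.mp (by omega)
  have h2 := (rankOf_stableLt_iff (κ := κ) hy hx).not.mp (by omega)
  unfold stableLt at h1 h2; omega

/-- `A` permutes `[0, n)`. -/
def IsPerm (n : ℕ) (A : ℕ → ℕ) : Prop :=
  (∀ x < n, A x < n) ∧ ∀ x < n, ∀ y < n, A x = A y → x = y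

theorem IsPerm.image {n : ℕ} {A : ℕ → ℕ} (h : IsPerm n A) :
    (Finset.range n).image A = Finset.range n := by
  apply Finset.eq_of_subset_of_card_le
  · intro y hy
    obtain ⟨x, hx, rfl⟩ := Finset.mem_image.mp hy
    exact Finset.mem_range.mpr (h.1 x (Finset.mem_range.mp hx))
  · rw [Finset.card_image_of_injOn]
    intro x hx y hy hxy
    exact h.2 x (by simpa using hx) y (by simpa using hy) hxy

theorem IsPerm.surj {n : ℕ} {A : ℕ → ℕ} (h : IsPerm n A) {y : ℕ} (hy : y < n) :
    ∃ x < n, A x = y := by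
  have : y ∈ (Finset.range n).image A := by rw [h.image]; simpa using hy
  simpa using this

theorem isPerm_of_surj {n : ℕ} {A : ℕ → ℕ} (h1 : ∀ x < n, A x < n)
    (h2 : ∀ y < n, ∃ x < n, A x = y) : IsPerm n A := by
  refine ⟨h1, fun x hx y hy hxy => ?_⟩
  have hs : Function.Surjective fun x : Fin n => (⟨A x, h1 x x.2⟩ : Fin n) := by
    intro y
    obtain ⟨x, hx, h⟩ := h2 y y.2
    exact ⟨⟨x, hx⟩, Fin.ext h⟩
  have := Finite.injective_iff_surjective.mpr hs
  have := @this ⟨x, hx⟩ ⟨y, hy⟩ (Fin.ext hxy)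
  simpa using this

theorem IsPerm.card_filter {n : ℕ} {A : ℕ → ℕ} (h : IsPerm n A) (p : ℕ → Prop)
    [DecidablePred p] : ((Finset.range n).filter p).card =
      ((Finset.range n).filter fun x => p (A x)).card := by
  conv_lhs => rw [← h.image]
  rw [Finset.filter_image, Finset.card_image_of_injOn]
  intro x hx y hy hxy
  simp only [Finset.coe_filter, Finset.mem_range, Set.mem_ofPred_eq] at hx hy
  exact h.2 x hx.1 y hy.1 hxy

theorem card_filter_range_succ (p : ℕ → Prop) [DecidablePred p] (k : ℕ) :
    ((Finset.range (k + 1)).filter p).card =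
      ((Finset.range k).filter p).card + if p k then 1 else 0 := by
  rw [Finset.range_add_one, Finset.filter_insert]
  split_ifs
  · rw [Finset.card_insert_of_notMem (by simp)]
  · rfl

theorem isPerm_rankOf (κ : ℕ → ℕ) (n : ℕ) : IsPerm n (rankOf (stableLt κ) n) :=
  ⟨fun _ hx => rankOf_lt hx stableLt_irrefl, fun _ hx _ hy h => rankOf_stableLt_inj hx hy h⟩

/-- `B` is the permutation `A`, stably sorted by the keys `K`. -/
structure IsStableSort (n : ℕ) (K A B : ℕ → ℕ) : Prop where
  perm : IsPerm n B
  sorted : ∀ a b, a < b → b < n → ∃ x < n, ∃ y < n, A x = B a ∧ A y = B b ∧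
    (K (B a) < K (B b) ∨ (K (B a) = K (B b) ∧ x < y))

theorem isStableSort_of_rankOf {n : ℕ} {K A B : ℕ → ℕ} (hA : IsPerm n A)
    (h : ∀ x < n, B (rankOf (stableLt fun x => K (A x)) n x) = A x) : IsStableSort n K A B := by
  have hr := isPerm_rankOf (fun x => K (A x)) n
  refine ⟨isPerm_of_surj (fun a ha => ?_) fun y hy => ?_, fun a b hab hb => ?_⟩
  · obtain ⟨x, hx, rfl⟩ := hr.surj ha
    rw [h x hx]
    exact hA.1 x hx
  · obtain ⟨x, hx, rfl⟩ := hA.surj hy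
    exact ⟨_, hr.1 x hx, h x hx⟩
  · obtain ⟨x, hx, rfl⟩ := hr.surj (hab.trans hb)
    obtain ⟨y, hy, rfl⟩ := hr.surj hb
    refine ⟨x, hx, y, hy, (h x hx).symm, (h y hy).symm, ?_⟩
    rw [h x hx, h y hy]
    exact (rankOf_stableLt_iff hx hy).mp hab

/-- Stable counting sort of the permutation in array `aA` by the keys in `aKEY`; the result is
written to `aB`. -/
def csort : Prog :=
  .for vk (.const 0) (.var vN +ₑ .const 2) (.store aCNT (.var vk) (.const 0)) ;;
  .for vk (.const 0) (.var vN) (.store aCNT (.cell aKEY (.var vk) +ₑ .const 1)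
    (.cell aCNT (.cell aKEY (.var vk) +ₑ .const 1) +ₑ .const 1)) ;;
  .for vk (.const 1) (.var vN +ₑ .const 1) (.store aCNT (.var vk)
    (.cell aCNT (.var vk) +ₑ .cell aCNT (.var vk -ₑ .const 1))) ;;
  .for vk (.const 0) (.var vN) (
    .store aB (.cell aCNT (.cell aKEY (.cell aA (.var vk)))) (.cell aA (.var vk)) ;;
    .store aCNT (.cell aKEY (.cell aA (.var vk)))
      (.cell aCNT (.cell aKEY (.cell aA (.var vk))) +ₑ .const 1))

/-- The size of a machine suffices for texts of length `n`. -/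
structure Machine.Fits (M : Machine α) (n : ℕ) : Prop where
  pos : 1 ≤ n
  len : M.S.length = n
  cells : 8 * n ≤ M.L
  bound : 8 * n ≤ M.B

theorem wp_csort {M : Machine α} {n : ℕ} (hM : M.Fits n) {σ : Store} {t : ℕ}
    {Q : Store → ℕ → Prop} (hn : σ.vars vN = n) (hA : IsPerm n (σ.arrs aA))
    (hK : ∀ i < n, σ.arrs aKEY i ≤ n)
    (hQ : ∀ τ s, Frame csort σ τ → s ≤ t + 300 * n →
      IsStableSort n (σ.arrs aKEY) (σ.arrs aA) (τ.arrs aB) → Q τ s) : wp M csort Q σ t := by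
  obtain ⟨h1, -, hL, hB⟩ := hM
  have key : wp M csort (fun τ s => s ≤ t + 300 * n ∧
      (∀ x < n, τ.arrs aB (rankOf (stableLt fun x => σ.arrs aKEY (σ.arrs aA x)) n x) =
        σ.arrs aA x)) σ t := by
    unfold csort
    refine wp_for 0 (n + 2) 3 (fun k τ => ∀ j < k, τ.arrs aCNT j = 0) (by simp) rfl (by omega)
      (by omega) ?_ (by decide) (by simp) (by simp) ?_ ?_
    · intro τ hf
      have := hf.1 vN (by decide)
      simp [this, hn]
    · intro k τ s _ hk hf hx hI
      simp only [wp, Expr.ok, Expr.val, hx, setCell_arrs, if_true, Expr.cost]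
      refine ⟨trivial, by omega, trivial, by omega, ?_, by omega⟩
      intro j hj
      rw [Function.update_apply]
      split_ifs
      · rfl
      · exact hI j (by omega)
    intro τ1 s1 hf1 _ hI1 hs1
    have hn1 : τ1.vars vN = n := (hf1.1 vN (by decide)).trans hn
    have hK1 : τ1.arrs aKEY = σ.arrs aKEY := hf1.2 aKEY (by decide)
    have hA1 : τ1.arrs aA = σ.arrs aA := hf1.2 aA (by decide)
    clear hf1
    -- cell `j + 1` counts the elements with key `j`
    refine wp_for 0 n 20 (fun k τ => ∀ j < n + 2, τ.arrs aCNT j =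
      ((Finset.range k).filter fun i => σ.arrs aKEY i + 1 = j).card) (by simp) rfl (by omega)
      (by omega) ?_ (by decide) (by simp) ?_ ?_ ?_
    · intro τ hf
      have := hf.1 vN (by decide)
      simp [this, hn1]
    · intro j hj
      simpa using hI1 j hj
    · intro k τ s _ hk hf hx hI
      have hKk : τ.arrs aKEY = σ.arrs aKEY := (hf.2 aKEY (by decide)).trans hK1
      have hkey := hK k hk
      have hc := hI (σ.arrs aKEY k + 1) (by omega)
      have hcard : ((Finset.range k).filter fun i =>
        σ.arrs aKEY i + 1 = σ.arrs aKEY k + 1).card ≤ k :=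
        (Finset.card_filter_le _ _).trans (by simp)
      simp only [wp, Expr.ok, Expr.val, hx, setCell_arrs, if_true, Expr.cost, hKk, BinOp.app]
      refine ⟨⟨by simp, ⟨trivial, by omega⟩, trivial⟩, by omega,
        ⟨by simp, ⟨⟨by simp, ⟨trivial, by omega⟩, trivial⟩, by omega⟩, trivial⟩, by omega, ?_,
          by omega⟩
      intro j hj
      rw [Function.update_apply, card_filter_range_succ, hc, hI j hj]
      split_ifs with h1 h2 h2
      · rw [h1]
      · omega
      · omega
      · rfl
    intro τ2 s2 hf2 _ hI2 hs2
    have hn2 : τ2.vars vN = n := (hf2.1 vN (by decide)).trans hn1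
    have hK2 : τ2.arrs aKEY = σ.arrs aKEY := (hf2.2 aKEY (by decide)).trans hK1
    have hA2 : τ2.arrs aA = σ.arrs aA := (hf2.2 aA (by decide)).trans hA1
    clear hf2 hn1 hK1 hA1 hI1
    -- prefix sums turn the counters into the numbers of elements with smaller keys
    refine wp_for 1 (n + 1) 20 (fun k τ => (∀ j < k, τ.arrs aCNT j =
      ((Finset.range n).filter fun i => σ.arrs aKEY i < j).card) ∧ ∀ j, k ≤ j → j < n + 1 →
      τ.arrs aCNT j = ((Finset.range n).filter fun i => σ.arrs aKEY i + 1 = j).card) (by simp) rfl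
      (by omega) (by omega) ?_ (by decide) (by simp) ?_ ?_ ?_
    · intro τ hf
      have := hf.1 vN (by decide)
      simp [this, hn2]
    · refine ⟨fun j hj => ?_, fun j _ hj => hI2 j (by omega)⟩
      obtain rfl : j = 0 := by omega
      rw [hI2 0 (by omega)]
      simp
    · intro k τ s hk0 hk hf hx hI
      have h3 := hI.1 (k - 1) (by omega)
      have h4 := hI.2 k le_rfl hk
      have hsum : ((Finset.range n).filter fun i => σ.arrs aKEY i < k).card =
          ((Finset.range n).filter fun i => σ.arrs aKEY i + 1 = k).card +
          ((Finset.range n).filter fun i => σ.arrs aKEY i < k - 1).card := by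
        rw [← Finset.card_union_of_disjoint, ← Finset.filter_or]
        · congr 1
          apply Finset.filter_congr
          intro i _
          omega
        · exact Finset.disjoint_filter.mpr fun i _ => by omega
      have hcard : ((Finset.range n).filter fun i => σ.arrs aKEY i < k).card ≤ n :=
        (Finset.card_filter_le _ _).trans (by simp)
      simp only [wp, Expr.ok, Expr.val, hx, setCell_arrs, if_true, Expr.cost, BinOp.app]
      refine ⟨trivial, by omega, ⟨by simp, ⟨trivial, by omega⟩, ⟨by simp, trivial, trivial⟩,
        by omega⟩, by omega, ⟨?_, ?_⟩, by omega⟩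
      · intro j hj
        rw [Function.update_apply]
        split_ifs with h5
        · rw [h3, h4, h5, hsum]
        · exact hI.1 j (by omega)
      · intro j hj hj'
        rw [Function.update_of_ne (by omega)]
        exact hI.2 j (by omega) hj'
    intro τ3 s3 hf3 _ hI3 hs3
    have hn3 : τ3.vars vN = n := (hf3.1 vN (by decide)).trans hn2
    have hK3 : τ3.arrs aKEY = σ.arrs aKEY := (hf3.2 aKEY (by decide)).trans hK2
    have hA3 : τ3.arrs aA = σ.arrs aA := (hf3.2 aA (by decide)).trans hA2
    clear hf3 hn2 hK2 hA2 hI2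
    -- each element is put at its rank; the counter of its key has been increased by the elements
    -- with the same key that came before
    set κ : ℕ → ℕ := fun x => σ.arrs aKEY (σ.arrs aA x) with hκ
    have hrank : ∀ x, x < n → rankOf (stableLt κ) n x =
        ((Finset.range n).filter fun i => σ.arrs aKEY i < κ x).card +
        ((Finset.range x).filter fun y => κ y = κ x).card := by
      intro x hx
      rw [hA.card_filter, rankOf, show ((Finset.range x).filter fun y => κ y = κ x) =
        ((Finset.range n).filter fun y => κ y = κ x ∧ y < x) by
          ext y; simp only [Finset.mem_filter, Finset.mem_range]; omega]
      rw [← Finset.card_union_of_disjoint, ← Finset.filter_or]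
      · rfl
      · exact Finset.disjoint_filter.mpr fun i _ => by intro h; have : κ i < κ x := h; omega
    refine wp_for 0 n 60 (fun k τ => (∀ j ≤ n, τ.arrs aCNT j =
      ((Finset.range n).filter fun i => σ.arrs aKEY i < j).card +
        ((Finset.range k).filter fun y => κ y = j).card) ∧
      ∀ x < k, τ.arrs aB (rankOf (stableLt κ) n x) = σ.arrs aA x) (by simp) rfl
      (by omega) (by omega) ?_ (by decide) (by simp) ?_ ?_ ?_
    · intro τ hf
      have := hf.1 vN (by decide)
      simp [this, hn3]
    · refine ⟨fun j hj => ?_, by simp⟩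
      simpa using hI3.1 j (by omega)
    · intro k τ s _ hk hf hx hI
      have hKk : τ.arrs aKEY = σ.arrs aKEY := (hf.2 aKEY (by decide)).trans hK3
      have hAk : τ.arrs aA = σ.arrs aA := (hf.2 aA (by decide)).trans hA3
      have hak := hA.1 k hk
      have hkey := hK _ hak
      have hκk : σ.arrs aKEY (σ.arrs aA k) = κ k := rfl
      have hc : τ.arrs aCNT (κ k) = rankOf (stableLt κ) n k := by
        rw [hrank k hk, hI.1 _ hkey]
      have hr : rankOf (stableLt κ) n k < n := rankOf_lt hk stableLt_irrefl
      rw [hκk] at hkey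
      simp only [wp, Expr.ok, Expr.val, hx, setCell_arrs, setCell_vars, if_true, Expr.cost,
        BinOp.app, hKk, hAk, hκk, hc, show (aCNT = aB) = False by simp, if_false,
        show (aKEY = aB) = False by simp, show (aA = aB) = False by simp,
        show (aB = aCNT) = False by simp]
      refine ⟨⟨⟨⟨trivial, by omega⟩, by omega⟩, by omega⟩, by omega, ⟨trivial, by omega⟩,
        by omega, ⟨⟨trivial, by omega⟩, by omega⟩, by omega,
        ⟨by simp, ⟨⟨⟨trivial, by omega⟩, by omega⟩, by omega⟩, trivial⟩, by omega,
        ⟨?_, ?_⟩, by omega⟩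
      · intro j hj
        rw [card_filter_range_succ, Function.update_apply]
        split_ifs with h1 h2 h2
        · rw [h1, hrank k hk]; omega
        · omega
        · omega
        · exact hI.1 j hj
      · intro x hxk
        rw [Function.update_apply]
        split_ifs with h1
        · rw [rankOf_stableLt_inj (by omega) hk h1]
        · refine hI.2 x (lt_of_le_of_ne (by omega) ?_)
          rintro rfl
          exact h1 rfl
    intro τ4 s4 hf4 _ hI4 hs4
    simp only [Expr.cost] at hs1 hs2 hs3 hs4
    exact ⟨by omega, hI4.2⟩
  refine wp_mono ?_ (wp_frame key)
  exact fun τ s h => hQ τ s h.2 h.1.1 (isStableSort_of_rankOf hA h.1.2)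

/-! ### Names of letters -/

-- The width of the blocks is `vw`. The halves of the current block are `[vi, vie)` and `[vj, vje)`,
-- and it ends at `vnx`.

notation "vw" => (3 : ℕ)
notation "vi" => (4 : ℕ)
notation "vj" => (5 : ℕ)
notation "vie" => (6 : ℕ)
notation "vje" => (7 : ℕ)
notation "vnx" => (8 : ℕ)

/-- Names of the terms of a sequence: the name increases by one at the positions in `s`. -/
def nameOf (s : ℕ → Prop) [DecidablePred s] : ℕ → ℕ
  | 0 => 1
  | x + 1 => nameOf s x + if s (x + 1) then 1 else 0

theorem nameOf_mono {s : ℕ → Prop} [DecidablePred s] {x y : ℕ} (h : x ≤ y) :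
    nameOf s x ≤ nameOf s y := by
  induction y, h using Nat.le_induction with
  | base => rfl
  | succ y _ ih => exact ih.trans (by simp [nameOf])

theorem one_le_nameOf {s : ℕ → Prop} [DecidablePred s] (x : ℕ) : 1 ≤ nameOf s x :=
  nameOf_mono (Nat.zero_le x)

theorem nameOf_le {s : ℕ → Prop} [DecidablePred s] (x : ℕ) : nameOf s x ≤ x + 1 := by
  induction x with
  | zero => simp [nameOf]
  | succ x ih =>
    simp only [nameOf]
    split_ifs <;> omega

/-- If the sequence `key` is sorted, its names are ordered like its terms. -/
theorem nameOf_lt_iff {β : Type*} [LinearOrder β] {key : ℕ → β} {s : ℕ → Prop} [DecidablePred s]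
    {n : ℕ} (hs : ∀ x, 0 < x → x < n → (s x ↔ key (x - 1) ≠ key x))
    (hk : ∀ x y, x < y → y < n → key x ≤ key y) {x y : ℕ} (hx : x < n) (hy : y < n) :
    nameOf s x < nameOf s y ↔ key x < key y := by
  have main : ∀ y, y < n → ∀ x ≤ y, nameOf s x < nameOf s y ↔ key x < key y := by
    intro y
    induction y with
    | zero => intro _ x hx; obtain rfl : x = 0 := by omega
              simp
    | succ y ih =>
      intro hy x hx
      rcases Nat.lt_or_ge y x with h | h
      · obtain rfl : x = y + 1 := by omega
        simp
      · have h1 := ih (by omega) x h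
        have h2 := hs (y + 1) (by omega) hy
        simp only [Nat.add_sub_cancel] at h2
        have h3 := hk y (y + 1) (by omega) hy
        have h4 : nameOf s x ≤ nameOf s y := nameOf_mono h
        have h5 : key x ≤ key y := by
          rcases eq_or_lt_of_le h with rfl | h
          · rfl
          · exact hk _ _ h (by omega)
        simp only [nameOf]
        by_cases h6 : s (y + 1)
        · rw [if_pos h6]
          have h7 := lt_of_le_of_ne h3 (h2.mp h6)
          exact ⟨fun _ => lt_of_le_of_lt h5 h7, fun _ => by omega⟩
        · rw [if_neg h6, add_zero, h1]
          have h7 : key y = key (y + 1) := by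
            by_contra h8
            exact h6 (h2.mpr h8)
          rw [h7]
  rcases Nat.le_total x y with h | h
  · exact main y hy x h
  · have h1 : nameOf s y ≤ nameOf s x := nameOf_mono h
    have h2 : key y ≤ key x := by
      rcases eq_or_lt_of_le h with rfl | h
      · rfl
      · exact hk _ _ h hx
    exact ⟨fun h => by omega, fun h => absurd h (not_lt.mpr h2)⟩

/-- The state of the merge of the sorted blocks `[lo, ie)` and `[ie, je)` of `A` into the block
`[lo, je)` of `B`: the first `k` cells of `B` are final, and `i` and `j` are the next candidates. -/
structure MergeInv (ℓ : ℕ → α) (A B : ℕ → ℕ) (n W lo ie je k i j : ℕ) : Prop where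
  dvd : 2 * W ∣ lo
  ie_eq : ie = min (lo + W) n
  je_eq : je = min (ie + W) n
  lo_le : lo ≤ i
  i_le : i ≤ ie
  le_j : ie ≤ j
  j_le : j ≤ je
  lo_le_k : lo ≤ k
  sum : i + j = k + ie
  sorted : ∀ x y, x < y → y < k → x / (2 * W) = y / (2 * W) → ℓ (B x) ≤ ℓ (B y)
  lt : ∀ x < k, B x < n
  cover : ∀ y, (y < i ∨ (ie ≤ y ∧ y < j)) → ∃ x < k, B x = A y
  le_rest : ∀ x, lo ≤ x → x < k → ∀ y, ((i ≤ y ∧ y < ie) ∨ (j ≤ y ∧ y < je)) → ℓ (B x) ≤ ℓ (A y)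

theorem MergeInv.take {ℓ : ℕ → α} {A B : ℕ → ℕ} {n W lo ie je k i j i' j' p : ℕ}
    (h : MergeInv ℓ A B n W lo ie je k i j) (hW : 1 ≤ W) (hp : A p < n)
    (hc : (p = i ∧ i < ie ∧ i' = i + 1 ∧ j' = j) ∨ (p = j ∧ j < je ∧ i' = i ∧ j' = j + 1))
    (hmin : ∀ y, ((i ≤ y ∧ y < ie) ∨ (j ≤ y ∧ y < je)) → ℓ (A p) ≤ ℓ (A y)) :
    MergeInv ℓ A (Function.update B k (A p)) n W lo ie je (k + 1) i' j' := by
  obtain ⟨h1, h2, h3, h4, h5, h6, h7, h8, h9, h10, h11, h12, h13⟩ := h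
  have hpr : (i ≤ p ∧ p < ie) ∨ (j ≤ p ∧ p < je) := by omega
  refine ⟨h1, h2, h3, by omega, by omega, by omega, by omega, by omega, by omega, ?_, ?_, ?_, ?_⟩
  · intro x y hxy hy hdiv
    rw [Function.update_of_ne (by omega)]
    rcases Nat.lt_or_ge y k with hyk | hyk
    · rw [Function.update_of_ne (by omega)]
      exact h10 x y hxy hyk hdiv
    · obtain rfl : y = k := by omega
      rw [Function.update_self]
      refine h13 x ?_ hxy p hpr
      obtain ⟨q, rfl⟩ := h1
      have : q ≤ y / (2 * W) :=
        (Nat.le_div_iff_mul_le (by omega)).mpr (by linarith [mul_comm q (2 * W)])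
      rw [← hdiv, Nat.le_div_iff_mul_le (by omega)] at this
      linarith [mul_comm q (2 * W)]
  · intro x hx
    rw [Function.update_apply]
    split_ifs
    · exact hp
    · exact h11 x (by omega)
  · intro y hy
    by_cases hyp : y = p
    · exact ⟨k, by omega, by rw [Function.update_self, hyp]⟩
    · obtain ⟨x, hx, hx'⟩ := h12 y (by omega)
      exact ⟨x, by omega, by rw [Function.update_of_ne (by omega), hx']⟩
  · intro x hx hxk y hy
    rw [Function.update_apply]
    split_ifs
    · exact hmin y (by omega)
    · exact h13 x hx (by omega) y (by omega)

/-- The invariant of a pass of merge sort: the first `k` cells of `B` are final, and `nx` is the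
end of the current block. -/
def PassInv (ℓ : ℕ → α) (A B : ℕ → ℕ) (n W nx ie je k i j : ℕ) : Prop :=
  (k = nx ∧ (k < n → 2 * W ∣ k) ∧ k ≤ n ∧
    (∀ x y, x < y → y < k → x / (2 * W) = y / (2 * W) → ℓ (B x) ≤ ℓ (B y)) ∧
    (∀ x < k, B x < n) ∧ ∀ y < k, ∃ x < k, B x = A y) ∨
  (k < nx ∧ nx = je ∧ ∃ lo, MergeInv ℓ A B n W lo ie je k i j)

theorem MergeInv.passInv {ℓ : ℕ → α} {A B : ℕ → ℕ} {n W lo ie je k i j : ℕ}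
    (h : MergeInv ℓ A B n W lo ie je k i j) : PassInv ℓ A B n W je ie je k i j := by
  obtain ⟨h1, h2, h3, h4, h5, h6, h7, h8, h9, h10, h11, h12, h13⟩ := id h
  rcases Nat.lt_or_ge k je with hk | hk
  · exact Or.inr ⟨hk, rfl, lo, h⟩
  · refine Or.inl ⟨by omega, fun hn => ?_, by omega, h10, h11, fun y hy => h12 y (by omega)⟩
    obtain rfl : k = lo + 2 * W := by omega
    exact Dvd.dvd.add h1 dvd_rfl

theorem PassInv.mergeInv {ℓ : ℕ → α} {A B : ℕ → ℕ} {n W nx ie je k i j : ℕ}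
    (h : PassInv ℓ A B n W nx ie je k i j) (hk : k = nx) (hkn : k < n) :
    MergeInv ℓ A B n W k (min (k + W) n) (min (min (k + W) n + W) n) k k (min (k + W) n) := by
  rcases h with ⟨-, h1, h2, h3, h4, h5⟩ | ⟨h, -⟩
  · exact ⟨h1 hkn, rfl, rfl, by omega, by omega, by omega, by omega, by omega, rfl, h3, h4,
      fun y hy => h5 y (by omega), fun x hx hx' => by omega⟩
  · omega

/-- `A` is sorted within each block of length `W`. -/
def BlockSorted (ℓ : ℕ → α) (A : ℕ → ℕ) (n W : ℕ) : Prop :=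
  ∀ x y, x < y → y < n → x / W = y / W → ℓ (A x) ≤ ℓ (A y)

theorem BlockSorted.of_dvd {ℓ : ℕ → α} {A : ℕ → ℕ} {n W a x y : ℕ} (h : BlockSorted ℓ A n W)
    (ha : W ∣ a) (hx : a ≤ x) (hxy : x ≤ y) (hy : y < a + W) (hyn : y < n) :
    ℓ (A x) ≤ ℓ (A y) := by
  obtain ⟨q, rfl⟩ := ha
  rcases eq_or_lt_of_le hxy with rfl | hxy
  · rfl
  have hq : ∀ z, W * q ≤ z → z < W * q + W → z / W = q := fun z hz hz' =>
    Nat.div_eq_of_lt_le (by rwa [mul_comm]) (by rwa [Nat.succ_mul, mul_comm])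
  exact h x y hxy hyn ((hq x hx (by omega)).trans (hq y (by omega) hy).symm)

/-- The beginning of a block of merge sort: sets the bounds of the two halves. -/
def openBlock : Prog :=
  .ite (.var vk =ₑ .var vnx) (
    .assign vi (.var vk) ;;
    .ite (.var vk +ₑ .var vw <ₑ .var vN) (.assign vie (.var vk +ₑ .var vw))
      (.assign vie (.var vN)) ;;
    .assign vj (.var vie) ;;
    .ite (.var vie +ₑ .var vw <ₑ .var vN) (.assign vje (.var vie +ₑ .var vw))
      (.assign vje (.var vN)) ;;
    .assign vnx (.var vje)) .skip

/-- Moves the smaller of the two candidates to `aB`. -/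
def takeSmaller : Prog :=
  .ite (.var vi <ₑ .var vie)
    (.ite (.var vj <ₑ .var vje)
      (.ite (.letterLt (.cell aA (.var vj)) (.cell aA (.var vi)))
        (.store aB (.var vk) (.cell aA (.var vj)) ;; .assign vj (.var vj +ₑ .const 1))
        (.store aB (.var vk) (.cell aA (.var vi)) ;; .assign vi (.var vi +ₑ .const 1)))
      (.store aB (.var vk) (.cell aA (.var vi)) ;; .assign vi (.var vi +ₑ .const 1)))
    (.store aB (.var vk) (.cell aA (.var vj)) ;; .assign vj (.var vj +ₑ .const 1))

/-- One pass of merge sort, which merges adjacent blocks of length `vw` of `aA`. -/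
def mergePass : Prog :=
  .assign vnx (.const 0) ;;
  .for vk (.const 0) (.var vN) (openBlock ;; takeSmaller) ;;
  .for vk (.const 0) (.var vN) (.store aA (.var vk) (.cell aB (.var vk)))

/-- The invariant of a pass, read off a store. -/
def PassInvAt (ℓ : ℕ → α) (A : ℕ → ℕ) (n W k : ℕ) (τ : Store) : Prop :=
  PassInv ℓ A (τ.arrs aB) n W (τ.vars vnx) (τ.vars vie) (τ.vars vje) k (τ.vars vi) (τ.vars vj)

theorem wp_openBlock {M : Machine α} {n : ℕ} (hM : M.Fits n) {ℓ : ℕ → α} {σ : Store} {t W k : ℕ}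
    {A : ℕ → ℕ} (hn : σ.vars vN = n) (hw : σ.vars vw = W) (hW : 1 ≤ W)
    (hk : σ.vars vk = k) (hkn : k < n) (hI : PassInvAt ℓ A n W k σ) :
    wp M openBlock (fun τ s => s ≤ t + 50 ∧ k < τ.vars vje ∧ τ.vars vnx = τ.vars vje ∧
      ∃ lo, MergeInv ℓ A (τ.arrs aB) n W lo (τ.vars vie) (τ.vars vje) k (τ.vars vi) (τ.vars vj))
      σ t := by
  obtain ⟨h1, -, hL, hB⟩ := hM
  unfold openBlock
  by_cases hnx : k = σ.vars vnx
  · have h := hI.mergeInv hnx hkn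
    simp only [wp, Expr.ok, Expr.val, app_add, app_lt_eq_zero, app_eq_eq_zero, Expr.cost,
      setVar_arrs, setVar_vars, hk, hn, hw, ← hnx, Nat.reduceEqDiff, if_true, if_false, ne_eq,
      reduceCtorEq, not_false_eq_true, not_true_eq_false, true_and, and_true, true_imp_iff,
      false_imp_iff, OfNat.zero_ne_ofNat, not_not]
    refine ⟨by omega, fun c1 => ⟨by omega, by omega, fun c2 => ?_, fun c2 => ?_⟩,
      fun c1 => ⟨by omega, by omega, fun c2 => ?_, fun c2 => ?_⟩⟩
    · rw [min_eq_left (by omega : k + W ≤ n), min_eq_left (by omega)] at h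
      exact ⟨by omega, by omega, by omega, by omega, ⟨k, h⟩⟩
    · rw [min_eq_left (by omega : k + W ≤ n), min_eq_right (by omega)] at h
      exact ⟨by omega, by omega, by omega, by omega, ⟨k, h⟩⟩
    · rw [min_eq_right (by omega : n ≤ k + W), min_eq_left (by omega)] at h
      exact ⟨by omega, by omega, by omega, by omega, ⟨k, h⟩⟩
    · rw [min_eq_right (by omega : n ≤ k + W), min_eq_right (by omega)] at h
      exact ⟨by omega, by omega, by omega, by omega, ⟨k, h⟩⟩
  · simp only [wp, Expr.ok, Expr.val, BinOp.app, Expr.cost, hk, hnx, if_false]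
    refine ⟨⟨by simp, trivial, trivial⟩, fun h => absurd rfl h, fun _ => ⟨by omega, ?_⟩⟩
    rcases hI with ⟨h, -⟩ | ⟨h2, h3, lo, h4⟩
    · exact absurd h hnx
    · exact ⟨by omega, h3, lo, h4⟩

/-- One step of a merge. A candidate is moved if it is at most the other candidate, or if the other
half is exhausted; both halves are sorted, so it is at most everything that remains. -/
theorem wp_takeSmaller {M : Machine α} {n : ℕ} (hM : M.Fits n) {ℓ : ℕ → α}
    (hℓ : ∀ i < n, M.S[i]? = some (ℓ i)) {σ : Store} {t W k lo : ℕ} (hW : 1 ≤ W)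
    (hA : IsPerm n (σ.arrs aA)) (hS : BlockSorted ℓ (σ.arrs aA) n W) (hk : σ.vars vk = k)
    (hkj : k < σ.vars vje) (hnx : σ.vars vnx = σ.vars vje)
    (hI : MergeInv ℓ (σ.arrs aA) (σ.arrs aB) n W lo (σ.vars vie) (σ.vars vje) k
      (σ.vars vi) (σ.vars vj)) :
    wp M takeSmaller (fun τ s => s ≤ t + 50 ∧ PassInvAt ℓ (σ.arrs aA) n W (k + 1) τ) σ t := by
  obtain ⟨h1, hlen, hL, hB⟩ := hM
  have e1 := hI.dvd
  have e2 := hI.ie_eq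
  have e3 := hI.je_eq
  have e4 := hI.lo_le
  have e5 := hI.i_le
  have e6 := hI.le_j
  have e7 := hI.j_le
  have e8 := hI.sum
  have hd1 : W ∣ lo := (Dvd.intro_left 2 rfl).trans e1
  have hsortL : ∀ x y, lo ≤ x → x ≤ y → y < σ.vars vie → ℓ (σ.arrs aA x) ≤ ℓ (σ.arrs aA y) :=
    fun x y hx hxy hy => hS.of_dvd hd1 hx hxy (by omega) (by omega)
  have hsortR : ∀ x y, σ.vars vie ≤ x → x ≤ y → y < σ.vars vje →
      ℓ (σ.arrs aA x) ≤ ℓ (σ.arrs aA y) :=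
    fun x y hx hxy hy => hS.of_dvd (hd1.add dvd_rfl) (by omega) hxy (by omega) (by omega)
  have takeI : σ.vars vi < σ.vars vie → (∀ y, σ.vars vj ≤ y → y < σ.vars vje →
      ℓ (σ.arrs aA (σ.vars vi)) ≤ ℓ (σ.arrs aA y)) →
      MergeInv ℓ (σ.arrs aA) (Function.update (σ.arrs aB) k (σ.arrs aA (σ.vars vi))) n W lo
        (σ.vars vie) (σ.vars vje) (k + 1) (σ.vars vi + 1) (σ.vars vj) := by
    intro g1 g2
    refine hI.take hW (hA.1 _ (by omega)) (Or.inl ⟨rfl, g1, rfl, rfl⟩) ?_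
    rintro y (⟨g3, g4⟩ | ⟨g3, g4⟩)
    · exact hsortL _ _ e4 g3 g4
    · exact g2 y g3 g4
  have takeJ : σ.vars vj < σ.vars vje → (∀ y, σ.vars vi ≤ y → y < σ.vars vie →
      ℓ (σ.arrs aA (σ.vars vj)) ≤ ℓ (σ.arrs aA y)) →
      MergeInv ℓ (σ.arrs aA) (Function.update (σ.arrs aB) k (σ.arrs aA (σ.vars vj))) n W lo
        (σ.vars vie) (σ.vars vje) (k + 1) (σ.vars vi) (σ.vars vj + 1) := by
    intro g1 g2
    refine hI.take hW (hA.1 _ (by omega)) (Or.inr ⟨rfl, g1, rfl, rfl⟩) ?_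
    rintro y (⟨g3, g4⟩ | ⟨g3, g4⟩)
    · exact g2 y g3 g4
    · exact hsortR _ _ e6 g3 g4
  unfold takeSmaller
  simp only [wp, Expr.ok, Expr.val, app_add, app_lt_eq_zero, Expr.cost, hk, setCell_arrs, PassInvAt,
    hnx, setVar_arrs, setVar_vars, setCell_vars, not_not, Nat.reduceEqDiff, if_true, if_false,
      ne_eq, reduceCtorEq, not_false_eq_true, true_and, and_true]
  refine ⟨fun c1 => ⟨fun c2 => ?_, fun c2 => ?_⟩, fun c1 => ?_⟩
  · have hj := hA.1 (σ.vars vj) (by omega)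
    have hi := hA.1 (σ.vars vi) (by omega)
    simp only [hℓ _ hj, hℓ _ hi, ite_eq_right_iff, one_ne_zero, imp_false, not_not]
    refine ⟨⟨by omega, by omega, by omega, by omega⟩, fun c3 => ?_, fun c3 => ?_⟩
    · exact ⟨by omega, by omega, by omega, by omega, by omega,
        (takeJ c2 fun y g1 g2 => c3.le.trans (hsortL _ _ e4 g1 g2)).passInv⟩
    · exact ⟨by omega, by omega, by omega, by omega, by omega,
        (takeI c1 fun y g1 g2 => (not_lt.mp c3).trans (hsortR _ _ e6 g1 g2)).passInv⟩
  · have hi := hA.1 (σ.vars vi) (by omega)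
    exact ⟨by omega, by omega, by omega, by omega, by omega,
      (takeI c1 fun y g1 g2 => by omega).passInv⟩
  · have hj := hA.1 (σ.vars vj) (by omega)
    exact ⟨by omega, by omega, by omega, by omega, by omega,
      (takeJ (by omega) fun y g1 g2 => by omega).passInv⟩

/-- A pass doubles the length of the sorted blocks. It is a single loop over the cells of the
target, so that its linear running time is immediate. -/
theorem wp_mergePass {M : Machine α} {n : ℕ} (hM : M.Fits n) {ℓ : ℕ → α}
    (hℓ : ∀ i < n, M.S[i]? = some (ℓ i)) {σ : Store} {t W : ℕ}
    {Q : Store → ℕ → Prop} (hn : σ.vars vN = n) (hw : σ.vars vw = W) (hW : 1 ≤ W) (hWn : W < n)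
    (hA : IsPerm n (σ.arrs aA)) (hS : BlockSorted ℓ (σ.arrs aA) n W)
    (hQ : ∀ τ s, Frame mergePass σ τ → s ≤ t + 200 * n → IsPerm n (τ.arrs aA) →
      BlockSorted ℓ (τ.arrs aA) n (2 * W) → Q τ s) : wp M mergePass Q σ t := by
  obtain ⟨h1, hlen, hL, hB⟩ := id hM
  have key : wp M mergePass (fun τ s => s ≤ t + 200 * n ∧ IsPerm n (τ.arrs aA) ∧
      BlockSorted ℓ (τ.arrs aA) n (2 * W)) σ t := by
    unfold mergePass
    refine ⟨trivial, by simp, ?_⟩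
    refine wp_for 0 n 100 (fun k τ => PassInvAt ℓ (σ.arrs aA) n W k τ) (by simp) rfl (by omega)
      (by omega) ?_ (by decide) (by simp [PassInvAt]) ?_ ?_ ?_
    · intro τ hf
      have := hf.1 vN (by decide)
      simp [this, hn]
    · exact Or.inl ⟨by simp, by simp, by simp, by simp, by simp, by simp⟩
    · intro k τ s _ hk hf hx hI
      have hnk : τ.vars vN = n := by rw [hf.1 vN (by decide)]; simp [hn]
      have hwk : τ.vars vw = W := by rw [hf.1 vw (by decide)]; simp [hw]
      have hAk : τ.arrs aA = σ.arrs aA := by rw [hf.2 aA (by decide)]; simp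
      clear hf
      refine wp_mono (p := openBlock) ?_ (wp_frame (wp_openBlock hM hnk hwk hW hx hk hI))
      rintro τ' s' ⟨⟨hs', hje, hnx, lo, hI'⟩, hf⟩
      have hA' : τ'.arrs aA = σ.arrs aA := (hf.2 aA (by decide)).trans hAk
      refine wp_mono ?_ (wp_takeSmaller hM hℓ hW (by rwa [hA']) (by rwa [hA'])
        ((hf.1 vk (by decide)).trans hx) hje hnx (by rwa [hA']))
      rintro τ2 s2 ⟨hs2, hI2⟩
      exact ⟨by rwa [hA'] at hI2, by omega⟩
    intro τ1 s1 hf1 _ hI1 hs1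
    have hn1 : τ1.vars vN = n := by rw [hf1.1 vN (by decide)]; simp [hn]
    clear hf1
    have hI2 : IsPerm n (τ1.arrs aB) ∧ BlockSorted ℓ (τ1.arrs aB) n (2 * W) := by
      rcases hI1 with ⟨-, -, -, g1, g2, g3⟩ | ⟨g1, g2, lo, g3⟩
      · refine ⟨isPerm_of_surj g2 fun y hy => ?_, g1⟩
        obtain ⟨x, hx, rfl⟩ := hA.surj hy
        exact g3 x hx
      · have := g3.je_eq
        omega
    refine wp_for 0 n 20 (fun k τ => τ.arrs aB = τ1.arrs aB ∧
      ∀ x < k, τ.arrs aA x = τ1.arrs aB x) (by simp) rfl (by omega) (by omega) ?_ (by decide)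
      (by simp) (by simp) ?_ ?_
    · intro τ hf
      have := hf.1 vN (by decide)
      simp [this, hn1]
    · intro k τ s _ hk hf hx ⟨hI, hI'⟩
      have := hI2.1.1 k hk
      simp only [wp, Expr.ok, Expr.val, Expr.cost, hx, hI, setCell_arrs, if_true,
        show (aB = aA) = False by simp, if_false]
      refine ⟨trivial, by omega, ⟨trivial, by omega⟩, by omega, ⟨trivial, ?_⟩, by omega⟩
      intro x hxk
      rw [Function.update_apply]
      split_ifs with h2
      · rw [h2]
      · exact hI' x (by omega)
    intro τ2 s2 hf2 _ hI2' hs2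
    simp only [Expr.cost] at hs1 hs2
    refine ⟨by omega, ⟨fun x hx => ?_, fun x hx y hy => ?_⟩, fun x y hxy hy => ?_⟩
    · rw [hI2'.2 x hx]
      exact hI2.1.1 x hx
    · rw [hI2'.2 x hx, hI2'.2 y hy]
      exact hI2.1.2 x hx y hy
    · rw [hI2'.2 x (by omega), hI2'.2 y hy]
      exact hI2.2 x y hxy hy
  refine wp_mono ?_ (wp_frame key)
  exact fun τ s h => hQ τ s h.2 h.1.1 h.1.2.1 h.1.2.2

/-- A text over `[1, n]`, padded by zeros. -/
structure IsText (n : ℕ) (T : ℕ → ℕ) : Prop where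
  pos : ∀ i < n, 1 ≤ T i
  le : ∀ i < n, T i ≤ n
  pad : ∀ i, n ≤ i → T i = 0

/-- Sorts the positions of the text by their letters, and stores the names of the letters
in `aT`. -/
def letterNames : Prog :=
  .for vk (.const 0) (.var vN) (.store aA (.var vk) (.var vk)) ;;
  .assign vw (.const 1) ;;
  .loop (.var vw <ₑ .var vN) (mergePass ;; .assign vw (.var vw +ₑ .var vw)) ;;
  .store aT (.cell aA (.const 0)) (.const 1) ;;
  .for vk (.const 1) (.var vN) (.store aT (.cell aA (.var vk))
    (.cell aT (.cell aA (.var vk -ₑ .const 1)) +ₑ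
    .letterLt (.cell aA (.var vk -ₑ .const 1)) (.cell aA (.var vk))))

theorem wp_letterNames {M : Machine α} {n : ℕ} (hM : M.Fits n) {ℓ : ℕ → α}
    (hℓ : ∀ i < n, M.S[i]? = some (ℓ i)) {σ : Store} {t : ℕ}
    {Q : Store → ℕ → Prop} (hn : σ.vars vN = n) (hT : ∀ i, n ≤ i → σ.arrs aT i = 0)
    (hQ : ∀ τ s, Frame letterNames σ τ → s ≤ t + 1000 * (n * (Nat.log 2 n + 1)) →
      IsText n (τ.arrs aT) →
      (∀ i < n, ∀ j < n, (τ.arrs aT i < τ.arrs aT j ↔ ℓ i < ℓ j)) → Q τ s) :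
    wp M letterNames Q σ t := by
  obtain ⟨h1, hlen, hL, hB⟩ := id hM
  have key : wp M letterNames (fun τ s => s ≤ t + 1000 * (n * (Nat.log 2 n + 1)) ∧
      IsText n (τ.arrs aT) ∧
      (∀ i < n, ∀ j < n, (τ.arrs aT i < τ.arrs aT j ↔ ℓ i < ℓ j))) σ t := by
    unfold letterNames
    refine wp_for 0 n 10 (fun k τ => ∀ i < k, τ.arrs aA i = i) (by simp) rfl (by omega) (by omega)
      ?_ (by decide) (by simp) (by simp) ?_ ?_
    · intro τ hf
      have := hf.1 vN (by decide)
      simp [this, hn]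
    · intro k τ s _ hk hf hx hI
      simp only [wp, Expr.ok, Expr.val, hx, setCell_arrs, if_true, Expr.cost]
      refine ⟨trivial, by omega, trivial, by omega, ?_, by omega⟩
      intro j hj
      rw [Function.update_apply]
      split_ifs with h
      · exact h.symm
      · exact hI j (by omega)
    intro τ1 s1 hf1 _ hI1 hs1
    have hn1 : τ1.vars vN = n := (hf1.1 vN (by decide)).trans hn
    have hT1 : τ1.arrs aT = σ.arrs aT := hf1.2 aT (by decide)
    clear hf1
    simp only [Expr.cost] at hs1
    refine ⟨trivial, by simp; omega, ?_⟩
    -- after `r` passes the blocks of length `2 ^ r` are sorted; there are at most `log n + 1`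
    -- passes
    refine wp_while (fun τ s => ∃ r, τ.vars vw = 2 ^ r ∧ τ.vars vw ≤ 2 * n ∧ r ≤ Nat.log 2 n + 1 ∧
      IsPerm n (τ.arrs aA) ∧ BlockSorted ℓ (τ.arrs aA) n (τ.vars vw) ∧
      s ≤ t + 40 * n + 220 * (n * r)) (fun τ => n - τ.vars vw) ?_ ?_
    · refine ⟨0, by simp, by simp; omega, by omega, ⟨?_, ?_⟩, ?_, by simp; omega⟩
      · intro x hx
        simp only [setVar_arrs]
        rwa [hI1 x hx]
      · intro x hx y hy
        simp only [setVar_arrs]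
        rw [hI1 x hx, hI1 y hy]
        exact id
      · intro x y hxy _ h
        simp at h
        omega
    · rintro τ s hf ⟨r, hr, hwn, hrl, hA, hS, hs⟩
      have hnτ : τ.vars vN = n := by rw [hf.1 vN (by decide)]; simpa using hn1
      have hTτ : τ.arrs aT = σ.arrs aT := by rw [hf.2 aT (by decide)]; simpa using hT1
      clear hf
      refine ⟨by simp, ?_, ?_⟩
      · intro hc
        have hc : n ≤ τ.vars vw := by simpa [hnτ] using hc
        have hsorted : ∀ x y, x < y → y < n → ℓ (τ.arrs aA x) ≤ ℓ (τ.arrs aA y) := fun x y hxy hy =>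
          hS x y hxy hy (by rw [Nat.div_eq_of_lt (by omega), Nat.div_eq_of_lt (by omega)])
        have hA0 := hA.1 0 (by omega)
        have hrl' : n * r ≤ n * (Nat.log 2 n + 1) := Nat.mul_le_mul_left _ hrl
        have hnn : n ≤ n * (Nat.log 2 n + 1) := Nat.le_mul_of_pos_right _ (by omega)
        set A := τ.arrs aA with hAdef
        have hA0' : τ.arrs aA 0 < n := hA0
        let sx : ℕ → Prop := fun x => ℓ (A (x - 1)) < ℓ (A x)
        refine ⟨⟨trivial, show 0 < M.L by omega⟩, by simp only [Expr.val]; omega, trivial,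
          by simp only [Expr.val]; omega, ?_⟩
        -- equal letters get equal names: the name increases where neighbours in sorted order differ
        refine wp_for 1 n 40 (fun k τ' => (∀ x < k, τ'.arrs aT (A x) = nameOf sx x) ∧
          ∀ i, n ≤ i → τ'.arrs aT i = 0) (by simp) rfl (by omega) (by omega) ?_ (by decide)
          (by simp) ?_ ?_ ?_
        · intro τ' hf
          have : τ'.vars vN = n := by rw [hf.1 vN (by decide)]; simpa using hnτ
          simp [this]
        · refine ⟨fun x hx => ?_, fun i hi => ?_⟩
          · obtain rfl : x = 0 := by omega
            simp [nameOf, hAdef]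
          · simp only [setCell_arrs, if_true, Expr.val]
            rw [Function.update_of_ne (by omega), hTτ]
            exact hT i hi
        · intro k τ' s' hk0 hk hf hx hI
          have hAk : τ'.arrs aA = A := by rw [hf.2 aA (by decide)]; simp [hAdef]
          have hp := hA.1 (k - 1) (by omega)
          have hq := hA.1 k hk
          have hT' := hI.1 (k - 1) (by omega)
          have hnm := nameOf_le (s := sx) k
          have hnk : nameOf sx k =
              nameOf sx (k - 1) + if ℓ (A (k - 1)) < ℓ (A k) then 1 else 0 := by
            obtain ⟨k, rfl⟩ : ∃ k', k = k' + 1 := ⟨k - 1, by omega⟩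
            rfl
          simp only [wp, Expr.ok, Expr.val, hx, setCell_arrs, if_true, Expr.cost, app_add, app_sub,
            hAk, hT', hℓ _ hp, hℓ _ hq]
          rw [← hnk]
          refine ⟨⟨trivial, by omega⟩, by omega, ⟨by simp, ⟨⟨⟨by simp, trivial, trivial⟩, by omega⟩,
            by omega⟩, ⟨⟨by simp, trivial, trivial⟩, by omega⟩, ⟨trivial, by omega⟩, by omega,
            by omega⟩, by omega, ⟨fun x hxk => ?_, fun i hi => ?_⟩, by omega⟩
          · rw [Function.update_apply]
            split_ifs with h
            · rw [hA.2 x (by omega) k hk h]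
            · refine hI.1 x (lt_of_le_of_ne (by omega) ?_)
              rintro rfl
              exact h rfl
          · rw [Function.update_of_ne (by omega)]
            exact hI.2 i hi
        · intro τ2 s2 hf2 _ hI2 hs2
          simp only [Expr.cost] at hs2
          refine ⟨by simp at hs2; omega, ⟨fun i hi => ?_, fun i hi => ?_, hI2.2⟩,
            fun i hi j hj => ?_⟩
          · obtain ⟨x, hx, rfl⟩ := hA.surj hi
            rw [hI2.1 x hx]
            exact one_le_nameOf x
          · obtain ⟨x, hx, rfl⟩ := hA.surj hi
            rw [hI2.1 x hx]
            have := nameOf_le (s := sx) x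
            omega
          · obtain ⟨x, hx, rfl⟩ := hA.surj hi
            obtain ⟨y, hy, rfl⟩ := hA.surj hj
            rw [hI2.1 x hx, hI2.1 y hy]
            refine nameOf_lt_iff (key := fun x => ℓ (A x)) (fun x hx0 hx => ?_) hsorted hx hy
            have h := hsorted (x - 1) x (by omega) hx
            exact ⟨fun h => ne_of_lt h, fun h' => lt_of_le_of_ne h h'⟩
      · intro hc
        have hc : τ.vars vw < n := by simpa [hnτ] using hc
        refine wp_mergePass hM hℓ hnτ rfl (by rw [hr]; exact Nat.one_le_two_pow) hc hA hS ?_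
        intro τ' s' hf hs' hA' hS'
        have hw' : τ'.vars vw = τ.vars vw := hf.1 vw (by decide)
        simp only [wp, Expr.ok, Expr.val, Expr.cost, app_add, setVar_vars, setVar_arrs, if_true,
          hw']
        simp only [Expr.cost] at hs'
        have hrl : r ≤ Nat.log 2 n := Nat.le_log_of_pow_le (by norm_num) (by omega)
        refine ⟨⟨by simp, trivial, trivial⟩, by omega, ⟨r + 1, ?_, by omega, by omega, hA', ?_,
          ?_⟩, ?_⟩
        · rw [hr, pow_succ]; ring
        · rwa [two_mul] at hS'
        · rw [Nat.mul_succ]; omega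
        · have : 1 ≤ τ.vars vw := by rw [hr]; exact Nat.one_le_two_pow
          omega
  refine wp_mono ?_ (wp_frame key)
  exact fun τ s h => hQ τ s h.2 h.1.1 h.1.2.1 h.1.2.2

/-! ### The suffix array by prefix doubling -/

notation "aM" => (7 : ℕ)

/-- The suffixes of `T` from `i` and from `j` on agree on the first `d` symbols. -/
def Agree (T : ℕ → ℕ) (d i j : ℕ) : Prop := ∀ k < d, T (i + k) = T (j + k)

/-- The suffix of `T` from `i` on is lexicographically smaller than that from `j` on, already on
the first `h` symbols. -/
def LexLt (T : ℕ → ℕ) (h i j : ℕ) : Prop := ∃ k < h, Agree T k i j ∧ T (i + k) < T (j + k)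

theorem Agree.symm {T : ℕ → ℕ} {d i j : ℕ} (h : Agree T d i j) : Agree T d j i :=
  fun k hk => (h k hk).symm

theorem Agree.trans {T : ℕ → ℕ} {d i j k : ℕ} (h : Agree T d i j) (h' : Agree T d j k) :
    Agree T d i k := fun l hl => (h l hl).trans (h' l hl)

theorem Agree.refl (T : ℕ → ℕ) (d i : ℕ) : Agree T d i i := fun _ _ => rfl

theorem Agree.mono {T : ℕ → ℕ} {d d' i j : ℕ} (h : Agree T d i j) (hd : d' ≤ d) :
    Agree T d' i j := fun k hk => h k (by omega)

theorem agree_add {T : ℕ → ℕ} {a b i j : ℕ} :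
    Agree T (a + b) i j ↔ Agree T a i j ∧ Agree T b (i + a) (j + a) := by
  refine ⟨fun h => ⟨h.mono (by omega), fun k hk => ?_⟩, fun h k hk => ?_⟩
  · rw [add_assoc, add_assoc]
    exact h _ (by omega)
  · rcases Nat.lt_or_ge k a with hka | hka
    · exact h.1 k hka
    · have := h.2 (k - a) (by omega)
      rwa [add_assoc, add_assoc, Nat.add_sub_cancel' hka] at this

theorem agree_succ {T : ℕ → ℕ} {d i j : ℕ} :
    Agree T (d + 1) i j ↔ Agree T d i j ∧ T (i + d) = T (j + d) := by
  rw [agree_add]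
  refine and_congr_right fun _ => ⟨fun h => by simpa using h 0 (by omega), fun h k hk => ?_⟩
  obtain rfl : k = 0 := by omega
  simpa using h

theorem lexLt_or_agree_or_lexLt (T : ℕ → ℕ) (h i j : ℕ) :
    LexLt T h i j ∨ Agree T h i j ∨ LexLt T h j i := by
  induction h with
  | zero => exact Or.inr (Or.inl fun k hk => absurd hk (by omega))
  | succ h ih =>
    rcases ih with ⟨k, hk, h1⟩ | h1 | ⟨k, hk, h1⟩
    · exact Or.inl ⟨k, by omega, h1⟩
    · rcases lt_trichotomy (T (i + h)) (T (j + h)) with h2 | h2 | h2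
      · exact Or.inl ⟨h, by omega, h1, h2⟩
      · exact Or.inr (Or.inl (agree_succ.mpr ⟨h1, h2⟩))
      · exact Or.inr (Or.inr ⟨h, by omega, h1.symm, h2⟩)
    · exact Or.inr (Or.inr ⟨k, by omega, h1⟩)

theorem LexLt.not_agree {T : ℕ → ℕ} {h i j : ℕ} (hl : LexLt T h i j) : ¬ Agree T h i j := by
  obtain ⟨k, hk, -, h2⟩ := hl
  intro h
  have := h k hk
  omega

theorem lexLt_add {T : ℕ → ℕ} {a b i j : ℕ} :
    LexLt T (a + b) i j ↔ LexLt T a i j ∨ (Agree T a i j ∧ LexLt T b (i + a) (j + a)) := by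
  constructor
  · rintro ⟨k, hk, h1, h2⟩
    rcases Nat.lt_or_ge k a with hka | hka
    · exact Or.inl ⟨k, hka, h1, h2⟩
    · obtain ⟨k, rfl⟩ : ∃ l, k = a + l := ⟨k - a, by omega⟩
      have h3 := agree_add.mp h1
      exact Or.inr ⟨h3.1, k, by omega, h3.2, by rwa [add_assoc, add_assoc]⟩
  · rintro (⟨k, hk, h⟩ | ⟨h, k, hk, h1, h2⟩)
    · exact ⟨k, by omega, h⟩
    · exact ⟨a + k, by omega, agree_add.mpr ⟨h, h1⟩, by rwa [← add_assoc, ← add_assoc]⟩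

/-- The numbers `N i` are ordered like the factors of `T` of length `h` that start at `i`. -/
def IsNaming (T N : ℕ → ℕ) (h : ℕ) : Prop := ∀ i j, N i < N j ↔ LexLt T h i j

theorem IsNaming.eq_iff {T N : ℕ → ℕ} {h i j : ℕ} (hN : IsNaming T N h) :
    N i = N j ↔ Agree T h i j := by
  have h1 := hN i j
  have h2 := hN j i
  rcases lexLt_or_agree_or_lexLt T h i j with h3 | h3 | h3
  · have := h1.mpr h3
    exact ⟨fun h => by omega, fun h => absurd h h3.not_agree⟩
  · have h4 : ¬ LexLt T h i j := fun h => h.not_agree h3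
    have h5 : ¬ LexLt T h j i := fun h => h.not_agree h3.symm
    rw [← h1] at h4
    rw [← h2] at h5
    exact ⟨fun _ => h3, fun _ => by omega⟩
  · have := h2.mpr h3
    exact ⟨fun h => by omega, fun h => absurd h.symm h3.not_agree⟩

theorem IsNaming.double {T N N' : ℕ → ℕ} {h : ℕ} (hN : IsNaming T N h)
    (h' : ∀ i j, N' i < N' j ↔ N i < N j ∨ (N i = N j ∧ N (i + h) < N (j + h))) :
    IsNaming T N' (h + h) := by
  intro i j
  rw [h', lexLt_add, hN, hN.eq_iff, hN]

/-- The pair of names that makes up the name for the doubled length. -/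
def pairKey (N : ℕ → ℕ) (h i : ℕ) : ℕ ×ₗ ℕ := toLex (N i, N (i + h))

theorem pairKey_lt_iff {N : ℕ → ℕ} {h i j : ℕ} :
    pairKey N h i < pairKey N h j ↔ N i < N j ∨ (N i = N j ∧ N (i + h) < N (j + h)) := by
  simp [pairKey, Prod.Lex.toLex_lt_toLex]

theorem pairKey_le_iff {N : ℕ → ℕ} {h i j : ℕ} :
    pairKey N h i ≤ pairKey N h j ↔ N i < N j ∨ (N i = N j ∧ N (i + h) ≤ N (j + h)) := by
  simp [pairKey, Prod.Lex.toLex_le_toLex]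

theorem pairKey_eq_iff {N : ℕ → ℕ} {h i j : ℕ} :
    pairKey N h i = pairKey N h j ↔ N i = N j ∧ N (i + h) = N (j + h) := by
  simp [pairKey]

/-- The positions sorted by `pairKey`. -/
def sortPairs : Prog :=
  .for vk (.const 0) (.var vN) (
    .store aA (.var vk) (.var vk) ;;
    .store aKEY (.var vk) (.cell aN (.var vk +ₑ .var vw))) ;;
  csort ;;
  .for vk (.const 0) (.var vN) (
    .store aA (.var vk) (.cell aB (.var vk)) ;;
    .store aKEY (.var vk) (.cell aN (.var vk))) ;;
  csort

/-- Replaces the names of factors of length `vw` by those of the factors of the doubled length. -/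
def doubleNames : Prog :=
  sortPairs ;;
  .assign vi (.const 1) ;;
  .store aM (.cell aB (.const 0)) (.const 1) ;;
  .for vk (.const 1) (.var vN) (
    .ite (.cell aN (.cell aB (.var vk -ₑ .const 1)) =ₑ .cell aN (.cell aB (.var vk)))
      (.ite (.cell aN (.cell aB (.var vk -ₑ .const 1) +ₑ .var vw) =ₑ
          .cell aN (.cell aB (.var vk) +ₑ .var vw))
        .skip (.assign vi (.var vi +ₑ .const 1)))
      (.assign vi (.var vi +ₑ .const 1)) ;;
    .store aM (.cell aB (.var vk)) (.var vi)) ;;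
  .for vk (.const 0) (.var vN) (.store aN (.var vk) (.cell aM (.var vk)))

/-- Radix sort: stable sorting by the second components and then by the first ones. -/
theorem wp_sortPairs {M : Machine α} {n : ℕ} (hM : M.Fits n) {σ : Store} {t h : ℕ}
    {Q : Store → ℕ → Prop} (hn : σ.vars vN = n) (hh : σ.vars vw = h) (hhn : h < n)
    (hN : IsText n (σ.arrs aN))
    (hQ : ∀ τ s, Frame sortPairs σ τ → s ≤ t + 700 * n → IsPerm n (τ.arrs aB) →
      (∀ a b, a < b → b < n →
        pairKey (σ.arrs aN) h (τ.arrs aB a) ≤ pairKey (σ.arrs aN) h (τ.arrs aB b)) → Q τ s) :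
    wp M sortPairs Q σ t := by
  obtain ⟨h1, hlen, hL, hB⟩ := id hM
  have hNle : ∀ i, σ.arrs aN i ≤ n := fun i => by
    rcases Nat.lt_or_ge i n with h | h
    · exact hN.le i h
    · rw [hN.pad i h]; omega
  have key : wp M sortPairs (fun τ s => s ≤ t + 700 * n ∧ IsPerm n (τ.arrs aB) ∧
      (∀ a b, a < b → b < n →
        pairKey (σ.arrs aN) h (τ.arrs aB a) ≤ pairKey (σ.arrs aN) h (τ.arrs aB b))) σ t := by
    unfold sortPairs
    refine wp_for 0 n 20 (fun k τ => ∀ i < k, τ.arrs aA i = i ∧ τ.arrs aKEY i = σ.arrs aN (i + h))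
      (by simp) rfl (by omega) (by omega) ?_ (by decide) (by simp) (by simp) ?_ ?_
    · intro τ hf
      have := hf.1 vN (by decide)
      simp [this, hn]
    · intro k τ s _ hk hf hx hI
      have hw : τ.vars vw = h := (hf.1 vw (by decide)).trans hh
      have hN' : τ.arrs aN = σ.arrs aN := hf.2 aN (by decide)
      have := hNle (k + h)
      simp only [wp, Expr.ok, Expr.val, hx, setCell_arrs, setCell_vars, if_true, Expr.cost, app_add,
        hw, hN', Nat.reduceEqDiff, if_false]
      refine ⟨trivial, by omega, trivial, by omega, trivial, by omega, ⟨⟨by simp, trivial, trivial⟩,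
        by omega⟩, by omega, ?_, by omega⟩
      intro i hi
      simp only [Function.update_apply]
      split_ifs with h
      · simp [h]
      · exact hI i (by omega)
    intro τ1 s1 hf1 _ hI1 hs1
    have hn1 : τ1.vars vN = n := (hf1.1 vN (by decide)).trans hn
    have hw1 : τ1.vars vw = h := (hf1.1 vw (by decide)).trans hh
    have hN1 : τ1.arrs aN = σ.arrs aN := hf1.2 aN (by decide)
    clear hf1
    refine wp_csort hM hn1 ⟨fun x hx => ?_, fun x hx y hy hxy => ?_⟩ (fun i hi => ?_) ?_
    · rw [(hI1 x hx).1]; exact hx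
    · rwa [(hI1 x hx).1, (hI1 y hy).1] at hxy
    · rw [(hI1 i hi).2]; exact hNle _
    intro τ2 s2 hf2 hs2 hsort1
    have hn2 : τ2.vars vN = n := (hf2.1 vN (by decide)).trans hn1
    have hN2 : τ2.arrs aN = σ.arrs aN := (hf2.2 aN (by decide)).trans hN1
    clear hf2
    refine wp_for 0 n 20 (fun k τ => τ.arrs aB = τ2.arrs aB ∧
      ∀ i < k, τ.arrs aA i = τ2.arrs aB i ∧ τ.arrs aKEY i = σ.arrs aN i)
      (by simp) rfl (by omega) (by omega) ?_ (by decide) (by simp) (by simp) ?_ ?_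
    · intro τ hf
      have := hf.1 vN (by decide)
      simp [this, hn2]
    · intro k τ s _ hk hf hx ⟨hI0, hI⟩
      have hN' : τ.arrs aN = σ.arrs aN := (hf.2 aN (by decide)).trans hN2
      have := hNle k
      have := hsort1.perm.1 k hk
      simp only [wp, Expr.ok, Expr.val, hx, setCell_arrs, setCell_vars, if_true, Expr.cost,
        hN', Nat.reduceEqDiff, if_false, hI0]
      refine ⟨trivial, by omega, ⟨trivial, by omega⟩, by omega, trivial, by omega, ⟨trivial,
        by omega⟩, by omega, ⟨by simp, ?_⟩, by omega⟩
      intro i hi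
      simp only [Function.update_apply]
      split_ifs with h
      · simp [h]
      · exact hI i (by omega)
    intro τ3 s3 hf3 _ ⟨_, hI3⟩ hs3
    have hn3 : τ3.vars vN = n := (hf3.1 vN (by decide)).trans hn2
    clear hf3
    refine wp_csort hM hn3 ⟨fun x hx => ?_, fun x hx y hy hxy => ?_⟩ (fun i hi => ?_) ?_
    · rw [(hI3 x hx).1]; exact hsort1.perm.1 x hx
    · rw [(hI3 x hx).1, (hI3 y hy).1] at hxy
      exact hsort1.perm.2 x hx y hy hxy
    · rw [(hI3 i hi).2]; exact hNle _
    intro τ4 s4 _ hs4 hsort2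
    simp only [Expr.cost] at hs1 hs3
    refine ⟨by omega, hsort2.perm, fun a b hab hb => ?_⟩
    -- ties of the second sort are in the order that the first sort left
    obtain ⟨x, hx, y, hy, e1, e2, h3⟩ := hsort2.sorted a b hab hb
    have ha' := hsort2.perm.1 a (by omega)
    have hb' := hsort2.perm.1 b hb
    rw [(hI3 _ ha').2, (hI3 _ hb').2] at h3
    rw [(hI3 x hx).1] at e1
    rw [(hI3 y hy).1] at e2
    rw [pairKey_le_iff]
    refine h3.imp id fun ⟨h3, h4⟩ => ⟨h3, ?_⟩
    obtain ⟨x1, _, y1, _, _, _, h5⟩ := hsort1.sorted x y h4 hy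
    rw [e1, e2, (hI1 _ ha').2, (hI1 _ hb').2] at h5
    omega
  refine wp_mono ?_ (wp_frame key)
  exact fun τ s h => hQ τ s h.2 h.1.1 h.1.2.1 h.1.2.2

theorem wp_doubleNames {M : Machine α} {n : ℕ} (hM : M.Fits n) {σ : Store} {t h : ℕ}
    {Q : Store → ℕ → Prop} (hn : σ.vars vN = n) (hh : σ.vars vw = h) (hhn : h < n)
    (hN : IsText n (σ.arrs aN))
    (hQ : ∀ τ s, Frame doubleNames σ τ → s ≤ t + 900 * n → IsText n (τ.arrs aN) →
      (∀ i j, τ.arrs aN i < τ.arrs aN j ↔ σ.arrs aN i < σ.arrs aN j ∨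
        (σ.arrs aN i = σ.arrs aN j ∧ σ.arrs aN (i + h) < σ.arrs aN (j + h))) → Q τ s) :
    wp M doubleNames Q σ t := by
  obtain ⟨h1, hlen, hL, hB⟩ := id hM
  have key : wp M doubleNames (fun τ s => s ≤ t + 900 * n ∧ IsText n (τ.arrs aN) ∧
      (∀ i < n, ∀ j < n, τ.arrs aN i < τ.arrs aN j ↔
        pairKey (σ.arrs aN) h i < pairKey (σ.arrs aN) h j)) σ t := by
    unfold doubleNames
    refine wp_sortPairs hM hn hh hhn hN ?_
    intro τ1 s1 hf1 hs1 hP hsorted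
    have hn1 : τ1.vars vN = n := (hf1.1 vN (by decide)).trans hn
    have hw1 : τ1.vars vw = h := (hf1.1 vw (by decide)).trans hh
    have hN1 : τ1.arrs aN = σ.arrs aN := hf1.2 aN (by decide)
    clear hf1
    have hP0 := hP.1 0 (by omega)
    refine ⟨trivial, by simp only [Expr.val]; omega, ⟨trivial, show 0 < M.L by omega⟩,
      show τ1.arrs aB 0 < M.L by omega, trivial, by simp only [Expr.val]; omega, ?_⟩
    set P := τ1.arrs aB with hPdef
    let sx : ℕ → Prop := fun x => pairKey (σ.arrs aN) h (P (x - 1)) ≠ pairKey (σ.arrs aN) h (P x)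
    refine wp_for 1 n 60 (fun k τ => τ.vars vi = nameOf sx (k - 1) ∧
      ∀ x < k, τ.arrs aM (P x) = nameOf sx x) (by simp) rfl (by omega) (by omega) ?_ (by decide)
      (by simp) ?_ ?_ ?_
    · intro τ hf
      have : τ.vars vN = n := by rw [hf.1 vN (by decide)]; simpa using hn1
      simp [this]
    · refine ⟨by simp [nameOf], fun x hx => ?_⟩
      obtain rfl : x = 0 := by omega
      simp [nameOf, hPdef]
    · intro k τ s hk0 hk hf hx ⟨hI1, hI2⟩
      have hw' : τ.vars vw = h := by rw [hf.1 vw (by decide)]; simpa using hw1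
      have hN' : τ.arrs aN = σ.arrs aN := by rw [hf.2 aN (by decide)]; simpa using hN1
      have hP' : τ.arrs aB = P := by rw [hf.2 aB (by decide)]; simp [hPdef]
      clear hf
      have hp := hP.1 (k - 1) (by omega)
      have hq := hP.1 k hk
      have hnk := nameOf_le (s := sx) k
      have hnk' := nameOf_le (s := sx) (k - 1)
      have hnm : nameOf sx k = nameOf sx (k - 1) + if sx k then 1 else 0 := by
        obtain ⟨k, rfl⟩ : ∃ k', k = k' + 1 := ⟨k - 1, by omega⟩
        rfl
      have hsx : sx k ↔ ¬ (σ.arrs aN (P (k - 1)) = σ.arrs aN (P k) ∧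
          σ.arrs aN (P (k - 1) + h) = σ.arrs aN (P k + h)) := by
        rw [← pairKey_eq_iff]
      have fin : ∀ x < k + 1, Function.update (τ.arrs aM) (P k) (nameOf sx k) (P x) =
          nameOf sx x := by
        intro x hxk
        rw [Function.update_apply]
        split_ifs with h
        · rw [hP.2 x (by omega) k hk h]
        · refine hI2 x (lt_of_le_of_ne (by omega) ?_)
          rintro rfl
          exact h rfl
      simp only [wp, Expr.ok, Expr.val, hx, setCell_arrs, setCell_vars, if_true, Expr.cost, app_add,
        app_sub, hw', hN', hP', setVar_vars, setVar_arrs, app_eq_eq_zero, Nat.reduceEqDiff,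
          if_false,
        ne_eq, reduceCtorEq, not_false_eq_true, true_and, and_true, not_not, hI1,
        Nat.add_sub_cancel]
      refine ⟨by omega, fun c1 => ⟨by omega, fun c2 => ?_, fun c2 => ?_⟩, fun c1 => ?_⟩
      · have e : nameOf sx k = nameOf sx (k - 1) := by
          rw [hnm, if_neg (by rw [hsx]; simp [c1, c2]), add_zero]
        rw [← e]
        exact ⟨by omega, by omega, by omega, ⟨rfl, fin⟩, by omega⟩
      · have e : nameOf sx k = nameOf sx (k - 1) + 1 := by
          rw [hnm, if_pos (by rw [hsx]; simp [c2])]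
        rw [← e]
        exact ⟨by omega, by omega, by omega, by omega, ⟨rfl, fin⟩, by omega⟩
      · have e : nameOf sx k = nameOf sx (k - 1) + 1 := by
          rw [hnm, if_pos (by rw [hsx]; simp [c1])]
        rw [← e]
        exact ⟨by omega, by omega, by omega, by omega, ⟨rfl, fin⟩, by omega⟩
    intro τ2 s2 hf2 _ ⟨_, hI2⟩ hs2
    have hn2 : τ2.vars vN = n := by rw [hf2.1 vN (by decide)]; simpa using hn1
    have hN2 : τ2.arrs aN = σ.arrs aN := by rw [hf2.2 aN (by decide)]; simpa using hN1
    clear hf2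
    have hM2 : ∀ i < n, 1 ≤ τ2.arrs aM i ∧ τ2.arrs aM i ≤ n := by
      intro i hi
      obtain ⟨x, hx, rfl⟩ := hP.surj hi
      rw [hI2 x hx]
      have := nameOf_le (s := sx) x
      exact ⟨one_le_nameOf x, by omega⟩
    refine wp_for 0 n 20 (fun k τ => τ.arrs aM = τ2.arrs aM ∧
      (∀ i < k, τ.arrs aN i = τ2.arrs aM i) ∧ ∀ i, n ≤ i → τ.arrs aN i = 0)
      (by simp) rfl (by omega) (by omega) ?_ (by decide) (by simp) ?_ ?_ ?_
    · intro τ hf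
      have := hf.1 vN (by decide)
      simp [this, hn2]
    · refine ⟨rfl, by simp, fun i hi => ?_⟩
      rw [hN2]
      exact hN.pad i hi
    · intro k τ s _ hk hf hx ⟨hI0, hI, hI'⟩
      have := hM2 k hk
      simp only [wp, Expr.ok, Expr.val, hx, setCell_arrs, if_true, Expr.cost, hI0]
      refine ⟨trivial, by omega, ⟨trivial, by omega⟩, by omega, ⟨by simp, fun i hi => ?_,
        fun i hi => ?_⟩, by omega⟩
      · rw [Function.update_apply]
        split_ifs with h
        · rw [h]
        · exact hI i (by omega)
      · rw [Function.update_of_ne (by omega)]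
        exact hI' i hi
    intro τ3 s3 _ _ ⟨_, hI3, hI3'⟩ hs3
    simp only [Expr.cost] at hs2 hs3
    refine ⟨by omega, ⟨fun i hi => ?_, fun i hi => ?_, hI3'⟩, fun i hi j hj => ?_⟩
    · rw [hI3 i hi]; exact (hM2 i hi).1
    · rw [hI3 i hi]; exact (hM2 i hi).2
    · rw [hI3 i hi, hI3 j hj]
      obtain ⟨x, hx, rfl⟩ := hP.surj hi
      obtain ⟨y, hy, rfl⟩ := hP.surj hj
      rw [hI2 x hx, hI2 y hy]
      exact nameOf_lt_iff (key := fun x => pairKey (σ.arrs aN) h (P x)) (fun x _ _ => Iff.rfl)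
        hsorted hx hy
  refine wp_mono ?_ (wp_frame key)
  rintro τ s ⟨⟨g1, g2, g3⟩, hf⟩
  refine hQ τ s hf g1 g2 fun i j => ?_
  rcases Nat.lt_or_ge i n with hi | hi <;> rcases Nat.lt_or_ge j n with hj | hj
  · rw [g3 i hi j hj, pairKey_lt_iff]
  · rw [g2.pad j hj, hN.pad j hj, hN.pad (j + h) (by omega)]
    omega
  · have := g2.pos j hj
    have := hN.pos j hj
    rw [g2.pad i hi, hN.pad i hi]
    omega
  · rw [g2.pad i hi, hN.pad i hi, hN.pad (i + h) (by omega), g2.pad j hj, hN.pad j hj,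
      hN.pad (j + h) (by omega)]
    omega

-- The suffix array, its inverse, and the common prefixes of neighbours.

notation "aSA" => (8 : ℕ)
notation "aRK" => (9 : ℕ)
notation "aHH" => (10 : ℕ)

theorem LexLt.mono {T : ℕ → ℕ} {h h' i j : ℕ} (hl : LexLt T h i j) (hh : h ≤ h') :
    LexLt T h' i j := by
  obtain ⟨k, hk, h1⟩ := hl
  exact ⟨k, by omega, h1⟩

/-- Words between two words with a common prefix share that prefix. -/
theorem Agree.of_between {T : ℕ → ℕ} {d h i j k : ℕ} (hd : d ≤ h) (ha : Agree T d i k)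
    (h1 : ¬ LexLt T h j i) (h2 : ¬ LexLt T h k j) : Agree T d i j := by
  rcases lexLt_or_agree_or_lexLt T d i j with ⟨l, hl, h3, h4⟩ | h3 | h3
  · refine absurd ⟨l, by omega, ?_, ?_⟩ h2
    · exact (ha.mono (by omega)).symm.trans h3
    · rwa [← ha l hl]
  · exact h3
  · exact absurd (h3.mono hd) h1

/-- Dropping a common first letter does not change the lexicographic order. -/
theorem LexLt.tail {T : ℕ → ℕ} {h i j : ℕ} (hl : LexLt T h i j) (he : T i = T j) :
    LexLt T h (i + 1) (j + 1) := by
  obtain ⟨k, hk, h1, h2⟩ := hl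
  rcases k with - | k
  · simp only [add_zero] at h2; omega
  · rw [add_comm k 1] at h1 h2
    exact ⟨k, by omega, (agree_add.mp h1).2, by rwa [add_assoc, add_assoc]⟩

/-- Because of the padding, distinct suffixes agree at most up to the end of the text. -/
theorem IsText.agree_le {n : ℕ} {T : ℕ → ℕ} (hT : IsText n T) {d i j : ℕ} (hi : i < n) (hj : j < n)
    (hij : i ≠ j) (h : Agree T d i j) : i + d ≤ n ∧ j + d ≤ n := by
  rcases Nat.lt_or_ge i j with hlt | hlt
  · by_contra hc
    have h1 := h (n - j) (by omega)
    rw [hT.pad (j + (n - j)) (by omega)] at h1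
    have := hT.pos (i + (n - j)) (by omega)
    omega
  · by_contra hc
    have h1 := h (n - i) (by omega)
    rw [hT.pad (i + (n - i)) (by omega)] at h1
    have := hT.pos (j + (n - i)) (by omega)
    omega

/-- `sa` lists the positions of the text in lexicographic order of their suffixes, `rk` is the
inverse of `sa`, and `hh x` is one more than the length of the longest common prefix of the
suffixes number `x - 1` and `x`. The value `hh 0 = 0` serves as a sentinel. -/
structure IsSuffixArray (n : ℕ) (T sa rk hh : ℕ → ℕ) : Prop where
  sa_lt : ∀ x < n, sa x < n
  rk_lt : ∀ i < n, rk i < n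
  rk_sa : ∀ x < n, rk (sa x) = x
  sa_rk : ∀ i < n, sa (rk i) = i
  lcp : ∀ x, 0 < x → x < n → ∀ d, Agree T d (sa (x - 1)) (sa x) ↔ d < hh x
  hh_zero : hh 0 = 0
  hh_le : ∀ x < n, hh x ≤ n
  between : ∀ d x y z, x ≤ y → y ≤ z → z < n → Agree T d (sa x) (sa z) → Agree T d (sa x) (sa y)

/-- Kasai's computation of the longest common prefixes of neighbours in the suffix array. -/
def kasai : Prog :=
  .assign vi (.const 0) ;;
  .for vk (.const 0) (.var vN) (
    .ite (.const 0 <ₑ .cell aRK (.var vk)) (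
      .assign vj (.cell aSA (.cell aRK (.var vk) -ₑ .const 1)) ;;
      .loop (.cell aT (.var vk +ₑ .var vi) =ₑ .cell aT (.var vj +ₑ .var vi))
        (.assign vi (.var vi +ₑ .const 1)) ;;
      .store aHH (.cell aRK (.var vk)) (.var vi +ₑ .const 1) ;;
      .ite (.const 0 <ₑ .var vi) (.assign vi (.var vi -ₑ .const 1)) .skip) .skip)

/-- The suffix array of the text in `aT`, its inverse, and the longest common prefixes. -/
def suffixArray : Prog :=
  .for vk (.const 0) (.var vN) (.store aN (.var vk) (.cell aT (.var vk))) ;;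
  .assign vw (.const 1) ;;
  .loop (.var vw <ₑ .var vN) (doubleNames ;; .assign vw (.var vw +ₑ .var vw)) ;;
  .for vk (.const 0) (.var vN) (
    .store aSA (.cell aN (.var vk) -ₑ .const 1) (.var vk) ;;
    .store aRK (.var vk) (.cell aN (.var vk) -ₑ .const 1)) ;;
  kasai

/-- The common prefix of the suffix at `k` with its predecessor is at most one letter shorter than
that of the suffix at `k - 1`. The variable `vi` keeps its length. It decreases by at most one in
each round and never exceeds `n`, so the comparisons take linear time altogether. -/
theorem wp_kasai {M : Machine α} {n : ℕ} (hM : M.Fits n) {σ : Store} {t : ℕ} {T : ℕ → ℕ}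
    {Q : Store → ℕ → Prop} (hn : σ.vars vN = n) (hT : IsText n T) (hTσ : σ.arrs aT = T)
    {sa rk : ℕ → ℕ} (hsa : ∀ x < n, σ.arrs aSA x = sa x) (hrk : ∀ i < n, σ.arrs aRK i = rk i)
    (sa_lt : ∀ x < n, sa x < n) (rk_lt : ∀ i < n, rk i < n) (rk_sa : ∀ x < n, rk (sa x) = x)
    (sa_rk : ∀ i < n, sa (rk i) = i)
    (between : ∀ d x y z, x ≤ y → y ≤ z → z < n → Agree T d (sa x) (sa z) →
      Agree T d (sa x) (sa y))
    (tail : ∀ i j, i + 1 < n → j + 1 < n → T i = T j → rk i < rk j → rk (i + 1) < rk (j + 1))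
    (h0 : σ.arrs aHH 0 = 0)
    (hQ : ∀ τ s, Frame kasai σ τ → s ≤ t + 200 * n →
      (∀ x, 0 < x → x < n → ∀ d, Agree T d (sa (x - 1)) (sa x) ↔ d < τ.arrs aHH x) →
      τ.arrs aHH 0 = 0 → (∀ x < n, τ.arrs aHH x ≤ n) → Q τ s) :
    wp M kasai Q σ t := by
  obtain ⟨h1, hlen, hL, hB⟩ := id hM
  have key : wp M kasai (fun τ s => s ≤ t + 200 * n ∧
      (∀ x, 0 < x → x < n → ∀ d, Agree T d (sa (x - 1)) (sa x) ↔ d < τ.arrs aHH x) ∧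
      τ.arrs aHH 0 = 0 ∧ (∀ x < n, τ.arrs aHH x ≤ n)) σ t := by
    unfold kasai
    refine ⟨trivial, by simp, ?_⟩
    -- the summand `20 * vi` covers the successful comparisons, and `100 * k` the decrements of
    -- `vi`; some suffix smaller than that at `k` agrees with it on `vi` letters
    refine wp_for_time 0 n (fun k τ s => τ.vars vi < n ∧ s ≤ t + 10 + 100 * k + 20 * τ.vars vi ∧
      (τ.vars vi = 0 ∨ k = n ∨ ∃ j < n, rk j < rk k ∧ Agree T (τ.vars vi) j k) ∧
      τ.arrs aHH 0 = 0 ∧ ∀ i < k, 0 < rk i →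
        τ.arrs aHH (rk i) ≤ n ∧
        ∀ d, Agree T d (sa (rk i - 1)) i ↔ d < τ.arrs aHH (rk i)) (by simp) rfl (by omega)
        (by omega) ?_ (by decide) (by simp) ?_ ?_ ?_
    · intro τ hf
      have : τ.vars vN = n := by rw [hf.1 vN (by decide)]; simpa using hn
      simp [this]
    · simp [h0]; omega
    · intro k τ s _ hk hf hx ⟨hin, hs, hj, hz, hI⟩
      have hTτ : τ.arrs aT = T := by rw [hf.2 aT (by decide)]; simpa using hTσ
      have hsaτ : ∀ x < n, τ.arrs aSA x = sa x := by rw [hf.2 aSA (by decide)]; simpa using hsa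
      have hrkτ : ∀ x < n, τ.arrs aRK x = rk x := by rw [hf.2 aRK (by decide)]; simpa using hrk
      clear hf
      have hrkk := rk_lt k hk
      refine ⟨⟨by simp, trivial, trivial, by simp only [Expr.val, hx]; omega⟩, fun hpos => ?_,
        fun hneg => ?_⟩
      · simp only [Expr.val, hx, hrkτ k hk, app_lt_eq_zero, not_not, ne_eq] at hpos
        have hsk : sa (rk k - 1) < n := sa_lt _ (by omega)
        have hne : sa (rk k - 1) ≠ k := by
          intro h
          have := rk_sa (rk k - 1) (by omega)
          rw [h] at this
          omega
        -- the predecessor lies between that smaller suffix and the suffix at `k`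
        have hin0 : Agree T (τ.vars vi) (sa (rk k - 1)) k := by
          rcases hj with h | h | ⟨j, hj, hjk, ha⟩
          · rw [h]; exact fun k hk => absurd hk (by omega)
          · omega
          · have ha' : Agree T (τ.vars vi) (sa (rk j)) (sa (rk k)) := by
              rwa [sa_rk j hj, sa_rk k hk]
            have h2 := between _ _ (rk k - 1) _ (by omega) (by omega) hrkk ha'
            have := h2.symm.trans ha'
            rwa [sa_rk k hk] at this
        have hval : Expr.val M τ (.cell aSA (.cell aRK (.var vk) -ₑ .const 1)) = sa (rk k - 1) := by
          simp only [Expr.val, app_sub, hx, hrkτ k hk, hsaτ _ (show rk k - 1 < n by omega)]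
        refine ⟨⟨⟨by simp, ⟨trivial, by simp only [Expr.val, hx]; omega⟩, trivial⟩,
          by simp only [Expr.val, hx, hrkτ k hk, app_sub]; omega⟩, by rw [hval]; omega, ?_⟩
        rw [hval]
        simp only [Expr.cost]
        refine wp_while (M := M) (fun τ' s' => τ'.arrs = τ.arrs ∧ Agree T (τ'.vars vi)
          (sa (rk k - 1)) k ∧
          τ'.vars vk = k ∧ τ'.vars vj = sa (rk k - 1) ∧
          s' ≤ t + 45 + 100 * k + 20 * τ'.vars vi) (fun τ' => n - τ'.vars vi) ?_ ?_
        · simp only [setVar_arrs, setVar_vars, Nat.reduceEqDiff, if_false, if_true, hx]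
          exact ⟨trivial, hin0, trivial, trivial, by omega⟩
        · rintro τ' s' - ⟨harr, ha, hk', hj', hs'⟩
          have hle := hT.agree_le hsk hk hne ha
          simp only [wp, Expr.ok, Expr.val, Expr.cost, hk', hj', app_eq_eq_zero, app_add, harr,
            hTτ, ne_eq, reduceCtorEq, not_false_eq_true, true_and, and_true, not_not, setVar_vars,
            setVar_arrs, if_true, Nat.reduceEqDiff, if_false, app_lt_eq_zero, app_sub, hrkτ k hk,
            setCell_arrs, setCell_vars]
          refine ⟨by omega, fun hc => ?_, fun hc => ?_⟩
          · have hcp : ∀ d, Agree T d (sa (rk k - 1)) k ↔ d < τ'.vars vi + 1 := by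
              intro d
              refine ⟨fun h => ?_, fun h => ha.mono (by omega)⟩
              by_contra hd
              exact hc (h (τ'.vars vi) (by omega)).symm
            have hupd : Function.update (τ.arrs aHH) (rk k) (τ'.vars vi + 1) 0 = 0 := by
              rw [Function.update_of_ne (by omega)]; exact hz
            have hall : ∀ i < k + 1, 0 < rk i →
                Function.update (τ.arrs aHH) (rk k) (τ'.vars vi + 1) (rk i) ≤ n ∧
                ∀ d, Agree T d (sa (rk i - 1)) i ↔
                  d < Function.update (τ.arrs aHH) (rk k) (τ'.vars vi + 1) (rk i) := by
              intro i hi hi0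
              by_cases hik : i = k
              · rw [hik, Function.update_self]
                exact ⟨by omega, hcp⟩
              · have : rk i ≠ rk k := by
                  intro h
                  have h2 := sa_rk i (by omega)
                  rw [h, sa_rk k hk] at h2
                  exact hik h2.symm
                rw [Function.update_of_ne this]
                exact hI i (by omega) hi0
            refine ⟨by omega, by omega, by omega, fun hp => ⟨by omega, by omega, by omega, ?_,
              hupd, hall⟩, fun hp => ⟨by omega, by omega, ?_, hupd, hall⟩⟩
            · by_cases hk1 : k + 1 = n
              · exact Or.inr (Or.inl hk1)
              by_cases hv1 : τ'.vars vi - 1 = 0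
              · exact Or.inl hv1
              · have hj1 : sa (rk k - 1) + 1 < n := by omega
                -- dropping the common first letter of the predecessor and of the suffix at `k`
                -- keeps their order
                refine Or.inr (Or.inr ⟨sa (rk k - 1) + 1, hj1, tail _ _ hj1 (by omega) ?_ ?_, ?_⟩)
                · simpa using ha 0 hp
                · rw [rk_sa _ (by omega)]; omega
                · have : Agree T (1 + (τ'.vars vi - 1)) (sa (rk k - 1)) k := ha.mono (by omega)
                  exact (agree_add.mp this).2
            · exact Or.inl (by omega)
          · have ha' : Agree T (τ'.vars vi + 1) (sa (rk k - 1)) k := agree_succ.mpr ⟨ha, hc.symm⟩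
            have hle' := hT.agree_le hsk hk hne ha'
            exact ⟨by omega, ⟨ha', by omega⟩, by omega⟩
      · simp only [Expr.val, hx, hrkτ k hk, app_lt_eq_zero] at hneg
        have hv0 : τ.vars vi = 0 := by
          rcases hj with h | h | ⟨j, hj, hjk, ha⟩
          · exact h
          · omega
          · omega
        simp only [wp, Expr.cost]
        refine ⟨hin, by omega, Or.inl hv0, hz, fun i hi hi0 => ?_⟩
        have : i ≠ k := by rintro rfl; omega
        exact hI i (by omega) hi0
    · intro τ s hf hx ⟨hin, hs, _, hz, hI⟩
      simp only [Expr.cost]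
      refine ⟨by omega, fun x hx0 hxn d => ?_, hz, fun x hxn => ?_⟩
      · have := (hI (sa x) (sa_lt x hxn) (by rwa [rk_sa x hxn])).2 d
        rwa [rk_sa x hxn] at this
      · rcases Nat.eq_zero_or_pos x with rfl | hx0
        · rw [hz]; omega
        · have := (hI (sa x) (sa_lt x hxn) (by rwa [rk_sa x hxn])).1
          rwa [rk_sa x hxn] at this
  refine wp_mono ?_ (wp_frame key)
  exact fun τ s h => hQ τ s h.2 h.1.1 h.1.2.1 h.1.2.2.1 h.1.2.2.2

/-- Names of factors of length `vw`, with zeros behind the end of the text, order the suffixes by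
their prefixes of this length. After at most `log n + 1` doublings the length is at least `n`, all
names are different, and they are the ranks of the suffixes, counted from `1`. -/
theorem wp_suffixArray {M : Machine α} {n : ℕ} (hM : M.Fits n) {σ : Store} {t : ℕ}
    {Q : Store → ℕ → Prop} (hn : σ.vars vN = n) (hT : IsText n (σ.arrs aT))
    (hN : ∀ i, n ≤ i → σ.arrs aN i = 0) (h0 : σ.arrs aHH 0 = 0)
    (hQ : ∀ τ s, Frame suffixArray σ τ → s ≤ t + 2500 * (n * (Nat.log 2 n + 1)) →
      IsSuffixArray n (σ.arrs aT) (τ.arrs aSA) (τ.arrs aRK) (τ.arrs aHH) →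
      (∀ i, n ≤ i → τ.arrs aN i = 0) → Q τ s) :
    wp M suffixArray Q σ t := by
  obtain ⟨h1, hlen, hL, hB⟩ := id hM
  generalize hTdef : σ.arrs aT = T at hT
  have key : wp M suffixArray (fun τ s => s ≤ t + 2500 * (n * (Nat.log 2 n + 1)) ∧
      IsSuffixArray n T (τ.arrs aSA) (τ.arrs aRK) (τ.arrs aHH) ∧
      (∀ i, n ≤ i → τ.arrs aN i = 0)) σ t := by
    unfold suffixArray
    refine wp_for 0 n 10 (fun k τ => τ.arrs aT = T ∧ (∀ i < k, τ.arrs aN i = T i) ∧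
      ∀ i, n ≤ i → τ.arrs aN i = 0) (by simp) rfl (by omega) (by omega)
      ?_ (by decide) (by simp) ⟨hTdef, by simp, hN⟩ ?_ ?_
    · intro τ hf
      have := hf.1 vN (by decide)
      simp [this, hn]
    · intro k τ s _ hk hf hx ⟨hI0, hI, hI'⟩
      have := hT.le k hk
      simp only [wp, Expr.ok, Expr.val, hx, setCell_arrs, if_true, Expr.cost, hI0]
      refine ⟨trivial, by omega, ⟨trivial, by omega⟩, by omega, ⟨by simp, fun i hi => ?_,
        fun i hi => ?_⟩, by omega⟩
      · rw [Function.update_apply]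
        split_ifs with h
        · rw [h]
        · exact hI i (by omega)
      · rw [Function.update_of_ne (by omega)]
        exact hI' i hi
    intro τ1 s1 hf1 _ ⟨hT1, hI1, hI1'⟩ hs1
    have hn1 : τ1.vars vN = n := (hf1.1 vN (by decide)).trans hn
    have h01 : τ1.arrs aHH 0 = 0 := by rwa [hf1.2 aHH (by decide)]
    have hNT : τ1.arrs aN = T := by
      funext i
      rcases Nat.lt_or_ge i n with h | h
      · exact hI1 i h
      · rw [hI1' i h, hT.pad i h]
    clear hf1 hI1 hI1'
    simp only [Expr.cost] at hs1
    refine ⟨trivial, by simp; omega, ?_⟩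
    refine wp_while (M := M) (fun τ s => ∃ r, τ.vars vw = 2 ^ r ∧ r ≤ Nat.log 2 n + 1 ∧
      IsText n (τ.arrs aN) ∧ IsNaming T (τ.arrs aN) (τ.vars vw) ∧
      s ≤ t + 40 * n + 920 * (n * r)) (fun τ => n - τ.vars vw) ?_ ?_
    · refine ⟨0, by simp, by omega, by simpa [hNT], ?_, by simp; omega⟩
      intro i j
      simp [hNT, LexLt, Agree]
    · rintro τ s hf ⟨r, hr, hrl, hTx, hNm, hs⟩
      have hnτ : τ.vars vN = n := by rw [hf.1 vN (by decide)]; simpa using hn1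
      have hTτ : τ.arrs aT = T := by rw [hf.2 aT (by decide)]; simpa using hT1
      have h0τ : τ.arrs aHH 0 = 0 := by rw [hf.2 aHH (by decide)]; simpa using h01
      clear hf
      refine ⟨by simp, ?_, ?_⟩
      · intro hc
        have hc : n ≤ τ.vars vw := by simpa [hnτ] using hc
        have hrl' : n * r ≤ n * (Nat.log 2 n + 1) := Nat.mul_le_mul_left _ hrl
        have hnn : n ≤ n * (Nat.log 2 n + 1) := Nat.le_mul_of_pos_right _ (by omega)
        have hinj : ∀ i < n, ∀ j < n, τ.arrs aN i = τ.arrs aN j → i = j := by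
          intro i hi j hj h
          by_contra hne
          have := hT.agree_le hi hj hne (hNm.eq_iff.mp h)
          omega
        have hperm : IsPerm n (fun i => τ.arrs aN i - 1) := by
          refine ⟨fun i hi => ?_, fun i hi j hj h => hinj i hi j hj ?_⟩
          · have := hTx.pos i hi
            have := hTx.le i hi
            show τ.arrs aN i - 1 < n
            omega
          · have := hTx.pos i hi
            have := hTx.pos j hj
            simp only at h
            omega
        refine wp_for 0 n 40 (fun k τ' => τ'.arrs aN = τ.arrs aN ∧
          ∀ i < k, τ'.arrs aSA (τ.arrs aN i - 1) = i ∧ τ'.arrs aRK i = τ.arrs aN i - 1)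
          (by simp) rfl (by omega) (by omega) ?_ (by decide) (by simp) (by simp) ?_ ?_
        · intro τ' hf
          have := hf.1 vN (by decide)
          simp [this, hnτ]
        · intro k τ' s' _ hk hf hx ⟨hI0, hI⟩
          have hp := hperm.1 k hk
          simp only at hp
          simp only [wp, Expr.ok, Expr.val, hx, setCell_arrs, if_true, Expr.cost, hI0, app_sub,
            Nat.reduceEqDiff, if_false, setCell_vars, ne_eq, reduceCtorEq, not_false_eq_true,
            true_and, and_true]
          refine ⟨by omega, by omega, by omega, by omega, by omega, by omega, fun i hi => ?_,
            by omega⟩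
          rw [Function.update_apply, Function.update_apply]
          by_cases hik : i = k
          · subst hik
            simp
          · rw [if_neg fun h => hik (hperm.2 i (by omega) k hk h), if_neg hik]
            exact hI i (by omega)
        intro τ2 s2 hf2 _ ⟨hN2, hI2⟩ hs2
        have hn2 : τ2.vars vN = n := (hf2.1 vN (by decide)).trans hnτ
        have hT2 : τ2.arrs aT = T := (hf2.2 aT (by decide)).trans hTτ
        have h02 : τ2.arrs aHH 0 = 0 := by rwa [hf2.2 aHH (by decide)]
        clear hf2
        have rk_lt : ∀ i < n, τ2.arrs aRK i < n := fun i hi => by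
          rw [(hI2 i hi).2]; exact hperm.1 i hi
        have sa_rk : ∀ i < n, τ2.arrs aSA (τ2.arrs aRK i) = i := fun i hi => by
          rw [(hI2 i hi).2]; exact (hI2 i hi).1
        have sa_lt : ∀ x < n, τ2.arrs aSA x < n := by
          intro x hx
          obtain ⟨i, hi, rfl⟩ := hperm.surj hx
          rw [(hI2 i hi).1]; exact hi
        have rk_sa : ∀ x < n, τ2.arrs aRK (τ2.arrs aSA x) = x := by
          intro x hx
          obtain ⟨i, hi, rfl⟩ := hperm.surj hx
          rw [(hI2 i hi).1, (hI2 i hi).2]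
        have hlt : ∀ i < n, ∀ j < n, τ2.arrs aRK i < τ2.arrs aRK j ↔ LexLt T (τ.vars vw) i j := by
          intro i hi j hj
          rw [(hI2 i hi).2, (hI2 j hj).2, ← hNm]
          have := hTx.pos i hi
          have := hTx.pos j hj
          omega
        have between : ∀ d x y z, x ≤ y → y ≤ z → z < n →
            Agree T d (τ2.arrs aSA x) (τ2.arrs aSA z) →
            Agree T d (τ2.arrs aSA x) (τ2.arrs aSA y) := by
          intro d x y z hxy hyz hz ha
          have hx1 := sa_lt x (by omega)
          have hy1 := sa_lt y (by omega)
          have hz1 := sa_lt z hz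
          have hx2 := rk_sa x (by omega)
          have hy2 := rk_sa y (by omega)
          have hz2 := rk_sa z hz
          by_cases hxz : τ2.arrs aSA x = τ2.arrs aSA z
          · rw [hxz, hz2] at hx2
            have : x = y := by omega
            rw [this]
            exact Agree.refl _ _ _
          · have hd := hT.agree_le hx1 hz1 hxz ha
            refine ha.of_between (h := τ.vars vw) (by omega) ?_ ?_
            · rw [← hlt _ hy1 _ hx1]; omega
            · rw [← hlt _ hz1 _ hy1]; omega
        refine wp_kasai hM hn2 hT hT2 (fun _ _ => rfl) (fun _ _ => rfl) sa_lt rk_lt rk_sa sa_rk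
          between ?_ h02 ?_
        · intro i j hi hj he hij
          rw [hlt _ (by omega) _ (by omega)] at hij ⊢
          exact hij.tail he
        · intro τ3 s3 hf3 hs3 g1 g2 g3
          have e1 : τ3.arrs aSA = τ2.arrs aSA := hf3.2 aSA (by decide)
          have e2 : τ3.arrs aRK = τ2.arrs aRK := hf3.2 aRK (by decide)
          have e3 : τ3.arrs aN = τ2.arrs aN := hf3.2 aN (by decide)
          simp only [Expr.cost] at hs2 hs3
          rw [e1, e2, e3, hN2]
          exact ⟨by omega, ⟨sa_lt, rk_lt, rk_sa, sa_rk, g1, g2, g3, between⟩, hTx.pad⟩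
      · intro hc
        have hc : τ.vars vw < n := by simpa [hnτ] using hc
        refine wp_doubleNames hM hnτ rfl hc hTx ?_
        intro τ' s' hf hs' hT' hN'
        have hw' : τ'.vars vw = τ.vars vw := hf.1 vw (by decide)
        simp only [wp, Expr.ok, Expr.val, Expr.cost, app_add, setVar_vars, setVar_arrs, if_true,
          hw']
        simp only [Expr.cost] at hs'
        have hrl : r ≤ Nat.log 2 n := Nat.le_log_of_pow_le (by norm_num) (by omega)
        refine ⟨⟨by simp, trivial, trivial⟩, by omega, ⟨r + 1, ?_, by omega, hT',
          hNm.double hN', ?_⟩, ?_⟩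
        · rw [hr, pow_succ]; ring
        · rw [Nat.mul_succ]; omega
        · have : 1 ≤ τ.vars vw := by rw [hr]; exact Nat.one_le_two_pow
          omega
  refine wp_mono ?_ (wp_frame key)
  exact fun τ s h => hQ τ s h.2 h.1.1 (hTdef ▸ h.1.2.1) h.1.2.2

/-! ### The suffix tree as an array of boundaries -/

/-- The suffixes number `x` and `y` of a suffix array with common prefixes `hh` agree on the first
`d` symbols. -/
def SameClass (hh : ℕ → ℕ) (d x y : ℕ) : Prop :=
  ∀ z, (x < z ∧ z ≤ y) ∨ (y < z ∧ z ≤ x) → d < hh z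

open Classical in
/-- The number of leaves of the trimmed suffix tree below the locus of depth `d` on the path to the
suffix number `x`. A leaf is represented by the first suffix of its class, that is, by a `y` with
`hh y ≤ m`. -/
noncomputable def leafCount (hh : ℕ → ℕ) (n m d x : ℕ) : ℕ :=
  ((Finset.range n).filter fun y => SameClass hh d x y ∧ hh y ≤ m).card

/-- The path to the suffix number `x` enters a subtree with at most half of the leaves below the
locus of depth `d`. -/
def IsLightAt (hh : ℕ → ℕ) (n m d x : ℕ) : Prop :=
  2 * leafCount hh n m (d + 1) x ≤ leafCount hh n m d x

/-- The number of leaves that start before position `x` of the suffix array. -/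
def leavesBefore (hh : ℕ → ℕ) (m x : ℕ) : ℕ := ((Finset.range x).filter fun y => hh y ≤ m).card

theorem leavesBefore_mono {hh : ℕ → ℕ} {m x y : ℕ} (h : x ≤ y) :
    leavesBefore hh m x ≤ leavesBefore hh m y :=
  Finset.card_le_card (Finset.filter_subset_filter _ (Finset.range_subset_range.mpr h))

theorem leavesBefore_le (hh : ℕ → ℕ) (m x : ℕ) : leavesBefore hh m x ≤ x :=
  (Finset.card_filter_le _ _).trans (by simp)

theorem SameClass.refl (hh : ℕ → ℕ) (d x : ℕ) : SameClass hh d x x := fun z hz => by omega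

theorem SameClass.symm {hh : ℕ → ℕ} {d x y : ℕ} (h : SameClass hh d x y) : SameClass hh d y x :=
  fun z hz => h z hz.symm

theorem SameClass.mono {hh : ℕ → ℕ} {d d' x y : ℕ} (h : SameClass hh d x y) (hd : d' ≤ d) :
    SameClass hh d' x y := fun z hz => lt_of_le_of_lt hd (h z hz)

theorem sameClass_iff_of_interval {hh : ℕ → ℕ} {d c e x y : ℕ} (hc : hh c ≤ d)
    (he : hh e ≤ d) (hin : ∀ z, c < z → z < e → d < hh z) (hcx : c ≤ x) (hxe : x < e) :
    SameClass hh d x y ↔ c ≤ y ∧ y < e := by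
  refine ⟨fun h => ⟨?_, ?_⟩, fun h z hz => hin z (by omega) (by omega)⟩
  · by_contra hy
    have := h c (by omega)
    omega
  · by_contra hy
    have := h e (by omega)
    omega

theorem leafCount_eq_of_interval {hh : ℕ → ℕ} {n m d c e x : ℕ} (hc : hh c ≤ d)
    (he : hh e ≤ d) (hen : e ≤ n) (hin : ∀ z, c < z → z < e → d < hh z) (hcx : c ≤ x)
    (hxe : x < e) : leafCount hh n m d x = leavesBefore hh m e - leavesBefore hh m c := by
  classical
  have h : (Finset.range n).filter (fun y => SameClass hh d x y ∧ hh y ≤ m) =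
      (Finset.range e).filter (fun y => hh y ≤ m) \
        (Finset.range c).filter (fun y => hh y ≤ m) := by
    ext y
    simp only [Finset.mem_filter, Finset.mem_range, Finset.mem_sdiff,
      sameClass_iff_of_interval hc he hin hcx hxe]
    omega
  rw [leafCount, leavesBefore, leavesBefore, ← Finset.card_sdiff_of_subset]
  · convert congrArg Finset.card h
  · exact Finset.filter_subset_filter _ (Finset.range_subset_range.mpr (by omega))

/-- The branching structure of the suffix tree. A position `b` with `0 < b < n` is a boundary
between two children of the node of depth `hh b - 1` whose interval contains `b - 1` and `b`. The
child to the left of `b` is `[pe b, b)`, the interval of the node ends in `rr b`, and `nx b` is the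
next boundary of the same node (`0` if there is none). -/
structure IsBoundaryTree (n : ℕ) (hh pe rr nx : ℕ → ℕ) : Prop where
  pe_lt : ∀ b, 0 < b → b < n → pe b < b
  hh_pe : ∀ b, 0 < b → b < n → hh (pe b) ≤ hh b
  pe_gap : ∀ b, 0 < b → b < n → ∀ y, pe b < y → y < b → hh b < hh y
  lt_rr : ∀ b, 0 < b → b < n → b < rr b
  rr_le : ∀ b, 0 < b → b < n → rr b ≤ n
  hh_rr : ∀ b, 0 < b → b < n → hh (rr b) < hh b
  rr_gap : ∀ b, 0 < b → b < n → ∀ y, b < y → y < rr b → hh b ≤ hh y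
  nx_gap : ∀ b, 0 < b → b < n → nx b = 0 → ∀ y, b < y → y < rr b → hh b < hh y
  lt_nx : ∀ b, 0 < b → b < n → nx b ≠ 0 → b < nx b
  hh_nx : ∀ b, 0 < b → b < n → nx b ≠ 0 → hh (nx b) = hh b
  nx_lt : ∀ b, 0 < b → b < n → nx b ≠ 0 → nx b < rr b
  gap_nx : ∀ b, 0 < b → b < n → nx b ≠ 0 → ∀ y, b < y → y < nx b → hh b < hh y

/-- `hh` is an array of common prefixes, with sentinels at `0` and `n`. -/
structure IsLcpArray (n : ℕ) (hh : ℕ → ℕ) : Prop where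
  zero : hh 0 = 0
  last : hh n = 0
  pos : ∀ x, 0 < x → x < n → 0 < hh x
  le : ∀ x, x ≤ n → hh x ≤ n

/-- The invariant of the stack computation of the boundaries, before position `k` is handled. -/
structure StackInv (n : ℕ) (hh : ℕ → ℕ) (k : ℕ) (pe rr nx : ℕ → ℕ) : Prop where
  pe_lt : ∀ b, 0 < b → b < k → pe b < b
  hh_pe : ∀ b, 0 < b → b < k → hh (pe b) ≤ hh b
  pe_gap : ∀ b, 0 < b → b < k → ∀ y, pe b < y → y < b → hh b < hh y
  rr_eq : ∀ c y, 0 < c → c < y → y < k → hh y < hh c → (∀ z, c < z → z < y → hh c ≤ hh z) →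
    rr c = y
  nx_spec : ∀ c, 0 < c → nx c ≠ 0 → c < nx c ∧ nx c < k ∧ pe (nx c) = c ∧ hh (nx c) = hh c
  nx_pe : ∀ b, 0 < b → b < k → hh (pe b) = hh b → nx (pe b) = b

theorem StackInv.isBoundaryTree {n : ℕ} {hh pe rr nx : ℕ → ℕ} (hl : IsLcpArray n hh)
    (h : StackInv n hh (n + 1) pe rr nx) : IsBoundaryTree n hh pe rr nx := by
  have hr : ∀ b, 0 < b → b < n → b < rr b ∧ rr b ≤ n ∧ hh (rr b) < hh b ∧
      ∀ y, b < y → y < rr b → hh b ≤ hh y := by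
    intro b hb hbn
    have hex : ∃ y, b < y ∧ hh y < hh b := ⟨n, hbn, by rw [hl.last]; exact hl.pos b hb hbn⟩
    classical
    have h1 := Nat.find_spec hex
    have h2 : ∀ z, z < Nat.find hex → ¬ (b < z ∧ hh z < hh b) := fun z => Nat.find_min hex
    have h3 : Nat.find hex ≤ n :=
      Nat.find_min' hex ⟨hbn, by rw [hl.last]; exact hl.pos b hb hbn⟩
    have h4 := h.rr_eq b (Nat.find hex) hb h1.1 (by omega) h1.2 fun z hz hz' => by
      have := h2 z hz'
      omega
    rw [h4]
    exact ⟨h1.1, h3, h1.2, fun y hy hy' => by have := h2 y hy'; omega⟩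
  have hx : ∀ b, 0 < b → b < n → nx b ≠ 0 → ∀ y, b < y → y < nx b → hh b < hh y := by
    intro b hb hbn h0 y hy hy'
    obtain ⟨h1, h2, h3, h4⟩ := h.nx_spec b hb h0
    rw [← h4]
    exact h.pe_gap (nx b) (by omega) h2 y (by omega) hy'
  refine ⟨fun b hb hbn => h.pe_lt b hb (by omega), fun b hb hbn => h.hh_pe b hb (by omega),
    fun b hb hbn => h.pe_gap b hb (by omega), fun b hb hbn => (hr b hb hbn).1,
    fun b hb hbn => (hr b hb hbn).2.1, fun b hb hbn => (hr b hb hbn).2.2.1,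
    fun b hb hbn => (hr b hb hbn).2.2.2, ?_, fun b hb hbn h0 => (h.nx_spec b hb h0).1,
    fun b hb hbn h0 => (h.nx_spec b hb h0).2.2.2, ?_, hx⟩
  · intro b hb hbn h0 y hy hy'
    have hge := (hr b hb hbn).2.2.2
    by_contra hlt
    -- the first later boundary of the same node has `b` as its predecessor
    classical
    have hex : ∃ y, b < y ∧ hh y ≤ hh b := ⟨y, hy, by omega⟩
    have h1 := Nat.find_spec hex
    have h2 : ∀ z, z < Nat.find hex → ¬ (b < z ∧ hh z ≤ hh b) := fun z => Nat.find_min hex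
    have h3 : Nat.find hex ≤ y := Nat.find_min' hex ⟨hy, by omega⟩
    set b' := Nat.find hex
    have h4 : hh b' = hh b := le_antisymm h1.2 (hge b' h1.1 (by omega))
    have hrn := (hr b hb hbn).2.1
    have h5 : pe b' = b := by
      rcases lt_trichotomy (pe b') b with h6 | h6 | h6
      · have := h.pe_gap b' (by omega) (by omega) b h6 h1.1
        omega
      · exact h6
      · have := h2 (pe b') (h.pe_lt b' (by omega) (by omega))
        have := h.hh_pe b' (by omega) (by omega)
        omega
    have := h.nx_pe b' (by omega) (by omega) (by rw [h5, h4])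
    rw [h5] at this
    omega
  · intro b hb hbn h0
    obtain ⟨h1, h2, h3, h4⟩ := h.nx_spec b hb h0
    by_contra hc
    have h5 := hr b hb hbn
    rcases eq_or_lt_of_le (not_lt.mp hc) with h6 | h6
    · rw [h6] at h5; omega
    · have := hx b hb hbn h0 (rr b) h5.1 h6
      omega

namespace IsBoundaryTree

variable {n m : ℕ} {hh pe rr nx : ℕ → ℕ}

/-- `b` is the first boundary of its node. -/
def IsFirst (hh pe : ℕ → ℕ) (b : ℕ) : Prop := hh (pe b) < hh b

/-- `[c, e)` is the interval of a child of the node with first boundary `f`. -/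
structure IsChild (hh pe rr : ℕ → ℕ) (f c e : ℕ) : Prop where
  lt : c < e
  le : pe f ≤ c
  le_rr : e ≤ rr f
  left : c = pe f ∨ hh c = hh f
  right : e = rr f ∨ hh e = hh f
  gap : ∀ z, c < z → z < e → hh f < hh z

/-- `f` is the first boundary of the node that has `b` as a boundary. -/
structure IsFirstOf (hh pe rr : ℕ → ℕ) (f b : ℕ) : Prop where
  pos : 0 < f
  le : f ≤ b
  eq : hh f = hh b
  first : IsFirst hh pe f
  rr_eq : rr f = rr b
  gap : ∀ y, f ≤ y → y ≤ b → hh f ≤ hh y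

theorem gap_first (ht : IsBoundaryTree n hh pe rr nx) {f : ℕ} (hf0 : 0 < f) (hfn : f < n) {z : ℕ}
    (h1 : pe f < z) (h2 : z < rr f) : hh f ≤ hh z := by
  rcases lt_trichotomy z f with h | rfl | h
  · exact (ht.pe_gap f hf0 hfn z h1 h).le
  · rfl
  · exact ht.rr_gap f hf0 hfn z h h2

theorem isFirstOf_self {f : ℕ} (hf0 : 0 < f) (hf : IsFirst hh pe f) :
    IsFirstOf hh pe rr f f :=
  ⟨hf0, le_rfl, rfl, hf, rfl, fun y h1 h2 => by rw [le_antisymm h1 h2]⟩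

theorem isFirstOf_step (ht : IsBoundaryTree n hh pe rr nx) {f b : ℕ}
    (hb0 : 0 < b) (hbn : b < n)
    (he : ¬ hh (pe b) < hh b) (hf : IsFirstOf hh pe rr f (pe b)) : IsFirstOf hh pe rr f b := by
  have h1 := ht.pe_lt b hb0 hbn
  have h2 := ht.hh_pe b hb0 hbn
  have h3 : hh (pe b) = hh b := by omega
  have h4 : 0 < pe b := lt_of_lt_of_le hf.pos hf.le
  refine ⟨hf.pos, by have := hf.le; omega, hf.eq.trans h3, hf.first, ?_, fun y g1 g2 => ?_⟩
  · rw [hf.rr_eq]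
    have a1 := ht.lt_rr (pe b) h4 (by omega)
    have a2 := ht.hh_rr (pe b) h4 (by omega)
    have a3 := ht.rr_gap (pe b) h4 (by omega)
    have b1 := ht.lt_rr b hb0 hbn
    have b2 := ht.hh_rr b hb0 hbn
    have b3 := ht.rr_gap b hb0 hbn
    have a4 : b < rr (pe b) := by
      by_contra h
      rcases eq_or_lt_of_le (not_lt.mp h) with h | h
      · rw [h] at a2; omega
      · have := ht.pe_gap b hb0 hbn _ a1 h
        omega
    rcases lt_trichotomy (rr (pe b)) (rr b) with h | h | h
    · have := b3 _ a4 h; omega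
    · exact h
    · have := a3 _ (by omega) h; omega
  · rcases Nat.lt_or_ge (pe b) y with h | h
    · rcases eq_or_lt_of_le g2 with rfl | g2
      · rw [hf.eq, h3]
      · have := ht.pe_gap b hb0 hbn y h g2
        rw [hf.eq, h3]; omega
    · exact hf.gap y g1 h

/-- The end of the child that starts in the boundary `b`. -/
def childEnd (rr nx : ℕ → ℕ) (b : ℕ) : ℕ := if nx b = 0 then rr b else nx b

theorem childEnd_le (ht : IsBoundaryTree n hh pe rr nx) {b : ℕ} (hb0 : 0 < b) (hbn : b < n) :
    childEnd rr nx b ≤ n := by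
  have := ht.rr_le b hb0 hbn
  unfold childEnd
  split_ifs with h
  · exact this
  · have := ht.nx_lt b hb0 hbn h
    omega

theorem isChild_right (ht : IsBoundaryTree n hh pe rr nx) {f b : ℕ} (hbn : b < n)
    (hf : IsFirstOf hh pe rr f b) : IsChild hh pe rr f b (childEnd rr nx b) := by
  have h0 := hf.pos
  have h1 := hf.le
  have h2 := ht.pe_lt f h0 (by omega)
  have h3 := hf.rr_eq
  have h4 := hf.eq
  have hb0 : 0 < b := by omega
  unfold childEnd
  split_ifs with h
  · exact ⟨ht.lt_rr b hb0 hbn, by omega, by omega, Or.inr h4.symm, Or.inl h3.symm,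
      fun z g1 g2 => by rw [h4]; exact ht.nx_gap b hb0 hbn h z g1 g2⟩
  · have := ht.nx_lt b hb0 hbn h
    exact ⟨ht.lt_nx b hb0 hbn h, by omega, by omega, Or.inr h4.symm,
      Or.inr (by rw [h4]; exact ht.hh_nx b hb0 hbn h),
      fun z g1 g2 => by rw [h4]; exact ht.gap_nx b hb0 hbn h z g1 g2⟩

theorem isChild_left (ht : IsBoundaryTree n hh pe rr nx) {f : ℕ} (hf0 : 0 < f) (hfn : f < n) :
    IsChild hh pe rr f (pe f) f :=
  ⟨ht.pe_lt f hf0 hfn, le_rfl, (ht.lt_rr f hf0 hfn).le, Or.inl rfl, Or.inr rfl,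
    ht.pe_gap f hf0 hfn⟩

/-- Every position in the interval of a node belongs to the leftmost child or to a child that
starts in a boundary. -/
theorem exists_child (ht : IsBoundaryTree n hh pe rr nx) {f : ℕ} (hf0 : 0 < f) (hfn : f < n)
    (hf : IsFirst hh pe f) {x : ℕ} (hx : pe f ≤ x) (hxr : x < rr f) :
    x < f ∨ ∃ b, b < n ∧ f ≤ b ∧ hh b = hh f ∧ rr b = rr f ∧ b ≤ x ∧ x < childEnd rr nx b := by
  rcases Nat.lt_or_ge x f with h | h
  · exact Or.inl h
  right
  have hrn := ht.rr_le f hf0 hfn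
  have hgap := fun z => ht.gap_first hf0 hfn (z := z)
  have hpf := ht.pe_lt f hf0 hfn
  induction x, h using Nat.le_induction with
  | base =>
    refine ⟨f, hfn, le_rfl, rfl, rfl, le_rfl, ?_⟩
    exact (ht.isChild_right hfn (isFirstOf_self hf0 hf)).lt
  | succ x hfx ih =>
    obtain ⟨b, hbn, hfb, hhb, hrb, hbx, hxe⟩ := ih (by omega) (by omega)
    rcases Nat.lt_or_ge (x + 1) (childEnd rr nx b) with h | h
    · exact ⟨b, hbn, hfb, hhb, hrb, by omega, h⟩
    · have he : childEnd rr nx b = x + 1 := by omega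
      have hnx : nx b ≠ 0 := by
        intro h0
        rw [childEnd, if_pos h0] at he
        omega
      rw [childEnd, if_neg hnx] at he
      have h1 := ht.hh_nx b (by omega) hbn hnx
      rw [he] at h1
      have a1 := ht.lt_rr (x + 1) (by omega) (by omega)
      have a2 := ht.hh_rr (x + 1) (by omega) (by omega)
      have a3 := ht.rr_gap (x + 1) (by omega) (by omega)
      have b2 := ht.hh_rr f hf0 hfn
      have hr : rr (x + 1) = rr f := by
        rcases lt_trichotomy (rr (x + 1)) (rr f) with g | g | g
        · have := hgap _ (by omega) g; omega
        · exact g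
        · have := a3 _ (by omega) g; omega
      have hrb' : rr (x + 1) = rr b := by omega
      refine ⟨x + 1, by omega, by omega, by omega, hr, le_rfl, ?_⟩
      unfold childEnd
      split_ifs with g
      · exact a1
      · exact ht.lt_nx (x + 1) (by omega) (by omega) g

theorem hh_pe_le (hf : IsFirst hh pe f) : hh (pe f) ≤ hh f - 1 := by
  unfold IsFirst at hf; omega

theorem sameClass_iff (ht : IsBoundaryTree n hh pe rr nx) {f : ℕ} (hf0 : 0 < f) (hfn : f < n)
    (hf : IsFirst hh pe f) {x y : ℕ} (hx : pe f ≤ x) (hxr : x < rr f) :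
    SameClass hh (hh f - 1) x y ↔ pe f ≤ y ∧ y < rr f := by
  have h1 := ht.hh_rr f hf0 hfn
  refine sameClass_iff_of_interval (hh_pe_le hf) (by omega) (fun z g1 g2 => ?_) hx hxr
  have := ht.gap_first hf0 hfn g1 g2
  omega

theorem leafCount_node (ht : IsBoundaryTree n hh pe rr nx) {f : ℕ} (hf0 : 0 < f) (hfn : f < n)
    (hf : IsFirst hh pe f) {x : ℕ} (hx : pe f ≤ x) (hxr : x < rr f) :
    leafCount hh n m (hh f - 1) x = leavesBefore hh m (rr f) - leavesBefore hh m (pe f) := by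
  have h1 := ht.hh_rr f hf0 hfn
  refine leafCount_eq_of_interval (hh_pe_le hf) (by omega) (ht.rr_le f hf0 hfn)
    (fun z g1 g2 => ?_) hx hxr
  have := ht.gap_first hf0 hfn g1 g2
  omega

theorem leafCount_child (ht : IsBoundaryTree n hh pe rr nx) {f c e : ℕ} (hf0 : 0 < f) (hfn : f < n)
    (hf : IsFirst hh pe f) (hch : IsChild hh pe rr f c e) {x : ℕ} (hx : c ≤ x) (hxe : x < e) :
    leafCount hh n m (hh f) x = leavesBefore hh m e - leavesBefore hh m c := by
  have h1 := ht.hh_rr f hf0 hfn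
  have h2 := hh_pe_le hf
  have h3 := ht.rr_le f hf0 hfn
  have h4 := hch.le_rr
  refine leafCount_eq_of_interval ?_ ?_ (by omega) hch.gap hx hxe
  · rcases hch.left with h | h
    · rw [h]; omega
    · exact h.le
  · rcases hch.right with h | h
    · rw [h]; omega
    · exact h.le

/-- The child `[c, e)` of the node with first boundary `f` is heavy. -/
def IsHeavyChild (hh pe rr : ℕ → ℕ) (m f c e : ℕ) : Prop :=
  IsChild hh pe rr f c e ∧ leavesBefore hh m (rr f) - leavesBefore hh m (pe f) <
    2 * (leavesBefore hh m e - leavesBefore hh m c)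

theorem IsHeavyChild.unique {f c e c' e' : ℕ} (h : IsHeavyChild hh pe rr m f c e)
    (h' : IsHeavyChild hh pe rr m f c' e') {x : ℕ} (hx : c ≤ x) (hxe : x < e) :
    c' ≤ x ∧ x < e' := by
  obtain ⟨h, hh1⟩ := h
  obtain ⟨h', hh2⟩ := h'
  have m1 := leavesBefore_mono (hh := hh) (m := m) h.le
  have m2 := leavesBefore_mono (hh := hh) (m := m) h.lt.le
  have m3 := leavesBefore_mono (hh := hh) (m := m) h.le_rr
  have m1' := leavesBefore_mono (hh := hh) (m := m) h'.le
  have m2' := leavesBefore_mono (hh := hh) (m := m) h'.lt.le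
  have m3' := leavesBefore_mono (hh := hh) (m := m) h'.le_rr
  have hne : ¬ e ≤ c' := fun hec => by
    have := leavesBefore_mono (hh := hh) (m := m) hec
    omega
  have hne' : ¬ e' ≤ c := fun hec => by
    have := leavesBefore_mono (hh := hh) (m := m) hec
    omega
  have l1 := h.lt
  have l2 := h'.lt
  have l3 := h.le
  have l4 := h'.le
  have l5 := h.le_rr
  have l6 := h'.le_rr
  constructor
  · by_contra hlt
    rcases h'.left with g | g
    · omega
    · have := h.gap c' (by omega) (by omega)
      omega
  · by_contra hlt
    rcases h'.right with g | g
    · omega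
    · have := h.gap e' (by omega) (by omega)
      omega

theorem isLightAt_iff (ht : IsBoundaryTree n hh pe rr nx) {f : ℕ} (hf0 : 0 < f) (hfn : f < n)
    (hf : IsFirst hh pe f) {hs he : ℕ} (h1 : he ≠ 0 → IsHeavyChild hh pe rr m f hs he)
    (h2 : IsHeavyChild hh pe rr m f (pe f) f → he ≠ 0)
    (h3 : ∀ b < n, IsFirstOf hh pe rr f b → IsHeavyChild hh pe rr m f b (childEnd rr nx b) →
      he ≠ 0) {x : ℕ} (hx : pe f ≤ x)
    (hxr : x < rr f) : IsLightAt hh n m (hh f - 1) x ↔ ¬ (hs ≤ x ∧ x < he) := by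
  have hpos : hh f - 1 + 1 = hh f := by unfold IsFirst at hf; omega
  rw [IsLightAt, hpos, ht.leafCount_node hf0 hfn hf hx hxr, ← not_lt, not_iff_not]
  constructor
  · intro hlt
    rcases ht.exists_child hf0 hfn hf hx hxr with h | ⟨b, hbn, hfb, hhb, hrb, hbx, hxe⟩
    · have hch := ht.isChild_left hf0 hfn
      rw [ht.leafCount_child hf0 hfn hf hch hx h] at hlt
      exact IsHeavyChild.unique ⟨hch, hlt⟩ (h1 (h2 ⟨hch, hlt⟩)) hx h
    · have hfo : IsFirstOf hh pe rr f b := ⟨hf0, hfb, hhb.symm, hf, hrb.symm, fun y g1 g2 => by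
        have := ht.pe_lt f hf0 hfn
        exact ht.gap_first hf0 hfn (by omega) (by omega)⟩
      have hch := ht.isChild_right hbn hfo
      rw [ht.leafCount_child hf0 hfn hf hch hbx hxe] at hlt
      exact IsHeavyChild.unique ⟨hch, hlt⟩ (h1 (h3 b hbn hfo ⟨hch, hlt⟩)) hbx hxe
  · rintro ⟨g1, g2⟩
    have g3 := h1 (by omega)
    rw [ht.leafCount_child hf0 hfn hf g3.1 g1 g2]
    exact g3.2

theorem IsFirstOf.unique (ht : IsBoundaryTree n hh pe rr nx) {f f' b : ℕ} (hbn : b < n)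
    (h : IsFirstOf hh pe rr f b) (h' : IsFirstOf hh pe rr f' b) : f = f' := by
  have key : ∀ {f f' : ℕ}, IsFirstOf hh pe rr f b → IsFirstOf hh pe rr f' b → ¬ f < f' := by
    intro f f' h h' hlt
    have h1 := h.eq
    have h2 := h'.eq
    have h3 := h'.le
    have h4 := h.pos
    have h5 := h'.first
    have h6 := ht.pe_lt f' (by omega) (by omega)
    unfold IsFirst at h5
    rcases Nat.lt_or_ge (pe f') f with g | g
    · have := ht.pe_gap f' (by omega) (by omega) f g hlt
      omega
    · have := h.gap _ g (by omega)
      omega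
  have := key h h'
  have := key h' h
  omega

end IsBoundaryTree

-- Tables of the text, which survive the second run of the suffix array construction, on the
-- reversed text: `aSF` and `aHF` are copies of `aSA` and `aHH`; `aPE`, `aRR` and `aNX` hold the
-- boundary tree; `aD` counts leaves; `aFB` holds the first boundary of the node of a boundary; the
-- heavy child of the node with first boundary `f` is the interval from `aHS` to `aHE` at `f`.

notation "aSF" => (11 : ℕ)
notation "aHF" => (12 : ℕ)
notation "aPE" => (13 : ℕ)
notation "aRR" => (14 : ℕ)
notation "aNX" => (15 : ℕ)
notation "aD" => (16 : ℕ)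
notation "aFB" => (17 : ℕ)
notation "aHS" => (18 : ℕ)
notation "aHE" => (19 : ℕ)

/-- Computes the boundary tree of the array `aHF`. The stack consists of the positions that are
reached from `vk - 1` by iterating `aPE`. -/
def stackPass : Prog :=
  .for vk (.const 1) (.var vN +ₑ .const 1) (
    .assign vj (.var vk -ₑ .const 1) ;;
    .loop (.cell aHF (.var vk) <ₑ .cell aHF (.var vj)) (
      .store aRR (.var vj) (.var vk) ;;
      .assign vj (.cell aPE (.var vj))) ;;
    .store aPE (.var vk) (.var vj) ;;
    .ite (.cell aHF (.var vj) =ₑ .cell aHF (.var vk)) (.store aNX (.var vj) (.var vk)) .skip)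

/-- Counts the leaves that start before each position. -/
def leafPass : Prog :=
  .for vk (.const 0) (.var vN) (
    .ite (.var vM <ₑ .cell aHF (.var vk))
      (.store aD (.var vk +ₑ .const 1) (.cell aD (.var vk)))
      (.store aD (.var vk +ₑ .const 1) (.cell aD (.var vk) +ₑ .const 1)))

/-- Finds the first boundary of the node of the boundary `vk`, and the number of leaves below
this node. -/
def findNode : Prog :=
  .ite (.cell aHF (.cell aPE (.var vk)) <ₑ .cell aHF (.var vk))
    (.store aFB (.var vk) (.var vk))
    (.store aFB (.var vk) (.cell aFB (.cell aPE (.var vk)))) ;;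
  .assign vi (.cell aFB (.var vk)) ;;
  .assign vj (.cell aD (.cell aRR (.var vk)) -ₑ .cell aD (.cell aPE (.var vi)))

/-- Records the child that starts in the boundary `vk` if it is heavy. -/
def checkRight : Prog :=
  .assign vie (.cell aNX (.var vk)) ;;
  .ite (.var vie =ₑ .const 0) (.assign vie (.cell aRR (.var vk))) .skip ;;
  .assign vje (.cell aD (.var vie) -ₑ .cell aD (.var vk)) ;;
  .ite (.var vj <ₑ .var vje +ₑ .var vje)
    (.store aHS (.var vi) (.var vk) ;; .store aHE (.var vi) (.var vie)) .skip

/-- Records the leftmost child of the node with first boundary `vk` if it is heavy. -/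
def checkLeft : Prog :=
  .assign vje (.cell aD (.var vk) -ₑ .cell aD (.cell aPE (.var vk))) ;;
  .ite (.var vi =ₑ .var vk)
    (.ite (.var vj <ₑ .var vje +ₑ .var vje)
      (.store aHS (.var vi) (.cell aPE (.var vi)) ;; .store aHE (.var vi) (.var vi)) .skip) .skip

/-- Records in `aHS` and `aHE` the heavy children of the nodes. -/
def heavyPass : Prog :=
  .for vk (.const 1) (.var vN) (findNode ;; checkRight ;; checkLeft)

/-- The invariant after the position `k` has been pushed on top of `j`, the nearest position before
`k` with `hh j ≤ hh k`. -/
theorem StackInv.push {n k j : ℕ} {hh pe rr nx rr' : ℕ → ℕ} (h : StackInv n hh k pe rr nx)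
    (hj : j < k) (hle : hh j ≤ hh k) (hgap : ∀ y, j < y → y < k → hh k < hh y)
    (hrr : ∀ c y, 0 < c → c < y → y < k + 1 → hh y < hh c → (∀ z, c < z → z < y → hh c ≤ hh z) →
      rr' c = y) :
    StackInv n hh (k + 1) (Function.update pe k j) rr'
      (if hh j = hh k then Function.update nx j k else nx) := by
  have hpe : ∀ b, b < k → Function.update pe k j b = pe b := fun b hb =>
    Function.update_of_ne (by omega) _ _
  refine ⟨fun b hb hbk => ?_, fun b hb hbk => ?_, fun b hb hbk => ?_, hrr, fun c hc => ?_,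
    fun b hb hbk => ?_⟩
  · rcases eq_or_lt_of_le (Nat.lt_succ_iff.mp hbk) with rfl | h1
    · rwa [Function.update_self]
    · rw [hpe b h1]; exact h.pe_lt b hb h1
  · rcases eq_or_lt_of_le (Nat.lt_succ_iff.mp hbk) with rfl | h1
    · rwa [Function.update_self]
    · rw [hpe b h1]; exact h.hh_pe b hb h1
  · rcases eq_or_lt_of_le (Nat.lt_succ_iff.mp hbk) with rfl | h1
    · rwa [Function.update_self]
    · rw [hpe b h1]; exact h.pe_gap b hb h1
  · have old : nx c ≠ 0 → c < nx c ∧ nx c < k + 1 ∧ Function.update pe k j (nx c) = c ∧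
        hh (nx c) = hh c := by
      intro h0
      obtain ⟨h1, h2, h3, h4⟩ := h.nx_spec c hc h0
      exact ⟨h1, by omega, by rwa [hpe _ h2], h4⟩
    split_ifs with he
    · rw [Function.update_apply]
      split_ifs with hcj
      · intro _
        subst hcj
        exact ⟨hj, by omega, Function.update_self _ _ _, he.symm⟩
      · exact old
    · exact old
  · rcases eq_or_lt_of_le (Nat.lt_succ_iff.mp hbk) with rfl | h1
    · rw [Function.update_self]
      intro he
      rw [if_pos he, Function.update_self]
    · rw [hpe b h1]
      intro he
      have h2 := h.nx_pe b hb h1 he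
      split_ifs with he'
      · rw [Function.update_of_ne ?_]
        · exact h2
        · -- two boundaries with the same predecessor `j` cannot both have the value `hh j`
          rintro rfl
          have := hgap b (h.pe_lt b hb h1) h1
          omega
      · exact h2

theorem wp_stackPass {M : Machine α} {n : ℕ} (hM : M.Fits n) {σ : Store} {t : ℕ} {hh : ℕ → ℕ}
    {Q : Store → ℕ → Prop} (hn : σ.vars vN = n) (hl : IsLcpArray n hh) (hhh : σ.arrs aHF = hh)
    (hnx : ∀ i, σ.arrs aNX i = 0)
    (hQ : ∀ τ s, Frame stackPass σ τ → s ≤ t + 300 * n →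
      IsBoundaryTree n hh (τ.arrs aPE) (τ.arrs aRR) (τ.arrs aNX) → Q τ s) :
    wp M stackPass Q σ t := by
  obtain ⟨h1, hlen, hL, hB⟩ := id hM
  have key : wp M stackPass (fun τ s => s ≤ t + 300 * n ∧
      StackInv n hh (n + 1) (τ.arrs aPE) (τ.arrs aRR) (τ.arrs aNX)) σ t := by
    unfold stackPass
    -- the function `dep` is the height of the stack: each push pays for the pop of the same element
    refine wp_for_time 1 (n + 1) (fun k τ s => StackInv n hh k (τ.arrs aPE) (τ.arrs aRR)
        (τ.arrs aNX) ∧ ∃ dep : ℕ → ℕ, (∀ b, 0 < b → b < k → dep b = dep (τ.arrs aPE b) + 1) ∧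
        s + 30 * dep (k - 1) ≤ t + 100 * k) (by simp) rfl (by omega)
        (by omega) ?_ (by decide) (by simp) ?_ ?_ ?_
    · intro τ hf
      have : τ.vars vN = n := by rw [hf.1 vN (by decide)]; simpa using hn
      simp [this]
    · refine ⟨⟨fun b hb hb' => by omega, fun b hb hb' => by omega, fun b hb hb' => by omega,
        fun c y hc hy hy' => by omega, fun c hc h => absurd (hnx c) h,
        fun b hb hb' => by omega⟩, fun _ => 0, fun b hb hb' => by omega, ?_⟩
      simp only [Expr.cost]
      omega
    · intro k τ s hk0 hk hf hx ⟨hI, dep, hdep, hs⟩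
      have hh' : τ.arrs aHF = hh := by rw [hf.2 aHF (by decide)]; simpa using hhh
      clear hf
      simp only [Expr.cost]
      have hval : Expr.val M τ (.var vk -ₑ .const 1) = k - 1 := by simp [hx]
      refine ⟨⟨by simp, trivial, trivial⟩, by rw [hval]; omega, ?_⟩
      rw [hval]
      simp only [Expr.cost]
      refine wp_while (M := M) (fun τ' s' => τ'.arrs aHF = hh ∧ τ'.arrs aPE = τ.arrs aPE ∧
        τ'.arrs aNX = τ.arrs aNX ∧ τ'.vars vk = k ∧ τ'.vars vj < k ∧
        (∀ y, τ'.vars vj < y → y < k → hh k < hh y) ∧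
        (∀ y, τ'.vars vj < y → y < k → hh (τ'.vars vj) ≤ hh y) ∧
        (∀ c y, 0 < c → c < y → (y < k ∨ (y = k ∧ τ'.vars vj < c)) → hh y < hh c →
          (∀ z, c < z → z < y → hh c ≤ hh z) → τ'.arrs aRR c = y) ∧
        s' + 30 * dep (τ'.vars vj) ≤ t + 100 * k + 15) (fun τ' => τ'.vars vj) ?_ ?_
      · simp only [setVar_arrs, setVar_vars, if_true, Nat.reduceEqDiff, if_false]
        refine ⟨hh', trivial, trivial, hx, by omega, fun y hy hy' => by omega,
          fun y hy hy' => by omega, fun c y hc hy hyk => hI.rr_eq c y hc hy (by omega), by omega⟩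
      · rintro τ' s' - ⟨e1, e2, e3, e4, hj, hgap, hmono, hrr, hs'⟩
        refine ⟨⟨by simp, ⟨trivial, by simp only [Expr.val, e4]; omega⟩,
          ⟨trivial, by simp only [Expr.val]; omega⟩⟩, fun hc => ?_, fun hc => ?_⟩
        · have hc : hh (τ'.vars vj) ≤ hh k := by simpa [e1, e4] using hc
          have hrr' : ∀ c y, 0 < c → c < y → y < k + 1 → hh y < hh c →
              (∀ z, c < z → z < y → hh c ≤ hh z) → τ'.arrs aRR c = y := by
            intro c y hc0 hcy hy hlt hz
            refine hrr c y hc0 hcy ?_ hlt hz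
            rcases Nat.lt_or_ge y k with h | h
            · exact Or.inl h
            · refine Or.inr ⟨by omega, ?_⟩
              by_contra h'
              obtain rfl : y = k := by omega
              rcases eq_or_lt_of_le (not_lt.mp h') with h2 | h2
              · rw [h2] at hlt; omega
              · have := hz _ h2 hj
                omega
          have hfin := hI.push hj hc hgap hrr'
          have hdep' : ∃ dep' : ℕ → ℕ, (∀ b, 0 < b → b < k + 1 →
              dep' b = dep' (Function.update (τ.arrs aPE) k (τ'.vars vj) b) + 1) ∧
              dep' k = dep (τ'.vars vj) + 1 := by
            refine ⟨Function.update dep k (dep (τ'.vars vj) + 1), fun b hb hbk => ?_,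
              Function.update_self _ _ _⟩
            rcases eq_or_lt_of_le (Nat.lt_succ_iff.mp hbk) with rfl | h
            · rw [Function.update_self, Function.update_self, Function.update_of_ne (by omega)]
            · have := hI.pe_lt b hb h
              have e : Function.update (τ.arrs aPE) k (τ'.vars vj) b = τ.arrs aPE b :=
                Function.update_of_ne (by omega) _ _
              rw [e, Function.update_of_ne (by omega), Function.update_of_ne (by omega)]
              exact hdep b hb h
          obtain ⟨dep', hd1, hd2⟩ := hdep'
          simp only [wp, Expr.ok, Expr.val, Expr.cost, e1, e2, e3, e4, setCell_vars, setCell_arrs,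
            if_true, Nat.reduceEqDiff, if_false, app_eq_eq_zero, ne_eq, not_not, reduceCtorEq,
            not_false_eq_true, true_and, Nat.add_sub_cancel]
          refine ⟨by omega, by omega, by omega, fun he => ?_, fun he => ?_⟩
          · rw [if_pos he] at hfin
            exact ⟨by omega, by omega, hfin, dep', hd1, by omega⟩
          · rw [if_neg he] at hfin
            exact ⟨hfin, dep', hd1, by omega⟩
        · have hc : hh k < hh (τ'.vars vj) := by simpa [e1, e4] using hc
          have hj0 : 0 < τ'.vars vj := by
            rcases Nat.eq_zero_or_pos (τ'.vars vj) with h | h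
            · rw [h, hl.zero] at hc; omega
            · exact h
          have h2 := hI.pe_lt _ hj0 hj
          have h3 := hI.hh_pe _ hj0 hj
          have h4 := hI.pe_gap _ hj0 hj
          have h5 := hdep _ hj0 hj
          simp only [wp, Expr.ok, Expr.val, Expr.cost, e1, e2, e3, e4, setCell_vars, setCell_arrs,
            if_true, Nat.reduceEqDiff, if_false, true_and, setVar_vars, setVar_arrs]
          refine ⟨by omega, by omega, by omega, by omega, ⟨by omega, fun y hy hyk => ?_,
            fun y hy hyk => ?_, fun c y hc0 hcy hy hlt hz => ?_, by omega⟩, h2⟩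
          · rcases lt_trichotomy y (τ'.vars vj) with h | rfl | h
            · have := h4 y hy h; omega
            · exact hc
            · exact hgap y h hyk
          · rcases lt_trichotomy y (τ'.vars vj) with h | rfl | h
            · have := h4 y hy h; omega
            · exact h3
            · have := hmono y h hyk
              omega
          · rw [Function.update_apply]
            split_ifs with hcj
            · -- the popped position has its first smaller value at `k`
              rcases hy with hy | ⟨rfl, -⟩
              · have := hmono y (by omega) hy
                rw [hcj] at hlt
                omega
              · rfl
            · refine hrr c y hc0 hcy ?_ hlt hz
              rcases hy with hy | ⟨rfl, hy⟩
              · exact Or.inl hy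
              · rcases Nat.lt_or_ge (τ'.vars vj) c with h | h
                · exact Or.inr ⟨rfl, h⟩
                · have := hz (τ'.vars vj) (by omega) hj
                  have := h4 c hy (by omega)
                  omega
    · rintro τ s - - ⟨hI, dep, -, hs⟩
      simp only [Expr.cost]
      exact ⟨by omega, hI⟩
  refine wp_mono ?_ (wp_frame key)
  exact fun τ s h => hQ τ s h.2 h.1.1 (h.1.2.isBoundaryTree hl)

theorem wp_leafPass {M : Machine α} {n : ℕ} (hM : M.Fits n) {σ : Store} {t m : ℕ} {hh : ℕ → ℕ}
    {Q : Store → ℕ → Prop} (hn : σ.vars vN = n) (hm : σ.vars vM = m) (hhh : σ.arrs aHF = hh)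
    (h0 : σ.arrs aD 0 = 0)
    (hQ : ∀ τ s, Frame leafPass σ τ → s ≤ t + 100 * n →
      (∀ x ≤ n, τ.arrs aD x = leavesBefore hh m x) → Q τ s) :
    wp M leafPass Q σ t := by
  obtain ⟨h1, hlen, hL, hB⟩ := id hM
  have key : wp M leafPass (fun τ s => s ≤ t + 100 * n ∧
      ∀ x ≤ n, τ.arrs aD x = leavesBefore hh m x) σ t := by
    unfold leafPass
    refine wp_for 0 n 40 (fun k τ => ∀ x ≤ k, τ.arrs aD x = leavesBefore hh m x) (by simp) rfl
      (by omega) (by omega) ?_ (by decide) (by simp) ?_ ?_ ?_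
    · intro τ hf
      have := hf.1 vN (by decide)
      simp [this, hn]
    · intro x hx
      obtain rfl : x = 0 := by omega
      simp [h0, leavesBefore]
    · intro k τ s _ hk hf hx hI
      have hh' : τ.arrs aHF = hh := (hf.2 aHF (by decide)).trans hhh
      have hm' : τ.vars vM = m := (hf.1 vM (by decide)).trans hm
      have hle := leavesBefore_le hh m k
      have hs : leavesBefore hh m (k + 1) = leavesBefore hh m k + if hh k ≤ m then 1 else 0 :=
        card_filter_range_succ _ _
      simp only [wp, Expr.ok, Expr.val, Expr.cost, hx, hh', hm', hI k le_rfl, setCell_arrs, if_true,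
        app_lt_eq_zero, app_add, ne_eq, reduceCtorEq, not_false_eq_true, true_and, and_true,
        not_lt]
      refine ⟨by omega, fun hc => ⟨by omega, by omega, by omega, fun x hxk => ?_, by omega⟩,
        fun hc => ⟨by omega, by omega, by omega, fun x hxk => ?_, by omega⟩⟩
      · rw [Function.update_apply]
        split_ifs with h
        · rw [h, hs, if_neg (by omega), add_zero]
        · exact hI x (by omega)
      · rw [Function.update_apply]
        split_ifs with h
        · rw [h, hs, if_pos hc]
        · exact hI x (by omega)
    · intro τ s _ _ hI hs
      simp only [Expr.cost] at hs
      exact ⟨by omega, hI⟩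
  refine wp_mono ?_ (wp_frame key)
  exact fun τ s h => hQ τ s h.2 h.1.1 h.1.2

open IsBoundaryTree in
/-- The tables `hs` and `he` record the heavy children of all nodes whose first boundary is less
than `k`. -/
structure HeavyInv (n m : ℕ) (hh pe rr nx : ℕ → ℕ) (k : ℕ) (fb hs he : ℕ → ℕ) : Prop where
  fb_spec : ∀ b, 0 < b → b < k → IsFirstOf hh pe rr (fb b) b
  sound : ∀ f, he f ≠ 0 → IsHeavyChild hh pe rr m f (hs f) (he f)
  left : ∀ b, 0 < b → b < k → fb b = b → IsHeavyChild hh pe rr m b (pe b) b → he b ≠ 0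
  right : ∀ b, 0 < b → b < k → IsHeavyChild hh pe rr m (fb b) b (childEnd rr nx b) → he (fb b) ≠ 0

open IsBoundaryTree in
theorem HeavyInv.update {n m k : ℕ} {hh pe rr nx fb hs he : ℕ → ℕ}
    (h : HeavyInv n m hh pe rr nx k fb hs he) {f c e : ℕ} (hc : IsHeavyChild hh pe rr m f c e) :
    HeavyInv n m hh pe rr nx k fb (Function.update hs f c) (Function.update he f e) := by
  have he0 : e ≠ 0 := by have := hc.1.lt; omega
  have hne : ∀ g, he g ≠ 0 → Function.update he f e g ≠ 0 := by
    intro g hg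
    rw [Function.update_apply]
    split_ifs
    · exact he0
    · exact hg
  refine ⟨h.fb_spec, fun g => ?_, fun b hb hbk h1 h2 => hne _ (h.left b hb hbk h1 h2),
    fun b hb hbk h1 => hne _ (h.right b hb hbk h1)⟩
  rw [Function.update_apply, Function.update_apply]
  split_ifs with hg
  · intro _
    rwa [hg]
  · exact h.sound g

open IsBoundaryTree in
theorem HeavyInv.step {n m k f : ℕ} {hh pe rr nx fb hs he : ℕ → ℕ}
    (h : HeavyInv n m hh pe rr nx k fb hs he) (hf : IsFirstOf hh pe rr f k) {hs' he' : ℕ → ℕ}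
    (hinv : HeavyInv n m hh pe rr nx k fb hs he → HeavyInv n m hh pe rr nx k fb hs' he')
    (h1 : IsHeavyChild hh pe rr m f k (childEnd rr nx k) → he' f ≠ 0)
    (h2 : f = k → IsHeavyChild hh pe rr m f (pe f) f → he' f ≠ 0) :
    HeavyInv n m hh pe rr nx (k + 1) (Function.update fb k f) hs' he' := by
  have h := hinv h
  have hfb : ∀ b, b < k → Function.update fb k f b = fb b := fun b hb =>
    Function.update_of_ne (by omega) _ _
  refine ⟨fun b hb hbk => ?_, h.sound, fun b hb hbk => ?_, fun b hb hbk => ?_⟩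
  all_goals rcases eq_or_lt_of_le (Nat.lt_succ_iff.mp hbk) with rfl | hlt
  · rwa [Function.update_self]
  · rw [hfb b hlt]; exact h.fb_spec b hb hlt
  · rw [Function.update_self]
    rintro rfl
    exact h2 rfl
  · rw [hfb b hlt]; exact h.left b hb hlt
  · rw [Function.update_self]
    exact h1
  · rw [hfb b hlt]; exact h.right b hb hlt

/-- The boundary tree together with the tables of heavy children. -/
structure IsHeavyTree (n m : ℕ) (hh pe rr nx hs he : ℕ → ℕ) : Prop where
  tree : IsBoundaryTree n hh pe rr nx
  light_iff : ∀ f, 0 < f → f < n → IsBoundaryTree.IsFirst hh pe f → ∀ x, pe f ≤ x → x < rr f →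
    (IsLightAt hh n m (hh f - 1) x ↔ ¬ (hs f ≤ x ∧ x < he f))
  he_le : ∀ f, 0 < f → f < n → IsBoundaryTree.IsFirst hh pe f → he f ≠ 0 →
    pe f ≤ hs f ∧ hs f < he f ∧ he f ≤ rr f

open IsBoundaryTree in
theorem HeavyInv.isHeavyTree {n m : ℕ} {hh pe rr nx fb hs he : ℕ → ℕ}
    (ht : IsBoundaryTree n hh pe rr nx) (h : HeavyInv n m hh pe rr nx n fb hs he) :
    IsHeavyTree n m hh pe rr nx hs he := by
  refine ⟨ht, fun f hf0 hfn hf x hx hxr => ?_, fun f hf0 hfn hf h0 => ?_⟩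
  · have huniq : ∀ b, b < n → IsFirstOf hh pe rr f b → fb b = f := fun b hbn hfb =>
      IsFirstOf.unique ht hbn (h.fb_spec b (lt_of_lt_of_le hfb.pos hfb.le) hbn) hfb
    refine ht.isLightAt_iff hf0 hfn hf (h.sound f)
      (h.left f hf0 hfn (huniq f hfn (isFirstOf_self hf0 hf))) (fun b hbn hfb hch => ?_) hx hxr
    have := h.right b (lt_of_lt_of_le hfb.pos hfb.le) hbn
    rw [huniq b hbn hfb] at this
    exact this hch
  · have := (h.sound f h0).1
    exact ⟨this.le, this.lt, this.le_rr⟩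

open IsBoundaryTree in
theorem wp_heavyPass {M : Machine α} {n : ℕ} (hM : M.Fits n) {σ : Store} {t m : ℕ}
    {hh pe rr nx : ℕ → ℕ}
    {Q : Store → ℕ → Prop} (hn : σ.vars vN = n) (hl : IsLcpArray n hh) (hhh : σ.arrs aHF = hh)
    (hpe : σ.arrs aPE = pe)
    (hrr : σ.arrs aRR = rr) (hnx : σ.arrs aNX = nx)
    (hD : ∀ x ≤ n, σ.arrs aD x = leavesBefore hh m x) (ht : IsBoundaryTree n hh pe rr nx)
    (hhe : ∀ i, σ.arrs aHE i = 0)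
    (hQ : ∀ τ s, Frame heavyPass σ τ → s ≤ t + 200 * n →
      IsHeavyTree n m hh pe rr nx (τ.arrs aHS) (τ.arrs aHE) → Q τ s) :
    wp M heavyPass Q σ t := by
  obtain ⟨hpos, hlen, hL, hB⟩ := id hM
  have key : wp M heavyPass (fun τ s => s ≤ t + 200 * n ∧
      HeavyInv n m hh pe rr nx n (τ.arrs aFB) (τ.arrs aHS) (τ.arrs aHE)) σ t := by
    unfold heavyPass
    refine wp_for 1 n 150 (fun k τ => HeavyInv n m hh pe rr nx k (τ.arrs aFB) (τ.arrs aHS)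
      (τ.arrs aHE)) (by simp) rfl (by omega) (by omega) ?_ (by decide) (by simp) ?_ ?_ ?_
    · intro τ hf
      have := hf.1 vN (by decide)
      simp [this, hn]
    · exact ⟨fun b hb hb' => by omega, fun f hf => absurd (hhe f) hf, fun b hb hb' => by omega,
        fun b hb hb' => by omega⟩
    · intro k τ s hk0 hk hf hx hI
      have hhh' : τ.arrs aHF = hh := (hf.2 aHF (by decide)).trans hhh
      have hpe' : τ.arrs aPE = pe := (hf.2 aPE (by decide)).trans hpe
      have hrr' : τ.arrs aRR = rr := (hf.2 aRR (by decide)).trans hrr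
      have hnx' : τ.arrs aNX = nx := (hf.2 aNX (by decide)).trans hnx
      have hD' : ∀ x ≤ n, τ.arrs aD x = leavesBefore hh m x := by rwa [hf.2 aD (by decide)]
      clear hf
      have hpk := ht.pe_lt k hk0 hk
      have hrk := ht.rr_le k hk0 hk
      obtain ⟨f, hfo, hfval⟩ : ∃ f, IsFirstOf hh pe rr f k ∧
          f = if hh (pe k) < hh k then k else τ.arrs aFB (pe k) := by
        refine ⟨_, ?_, rfl⟩
        split_ifs with hc
        · exact isFirstOf_self hk0 hc
        · have hp0 : 0 < pe k := by
            rcases Nat.eq_zero_or_pos (pe k) with h | h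
            · have := hl.pos k hk0 hk
              rw [h, hl.zero] at hc; omega
            · exact h
          exact ht.isFirstOf_step hk0 hk hc (hI.fb_spec _ hp0 hpk)
      have hf0 := hfo.pos
      have hfk := hfo.le
      have hpf := ht.pe_lt f hf0 (by omega)
      have hDle : ∀ x ≤ n, leavesBefore hh m x ≤ n := fun x hx =>
        (leavesBefore_le hh m x).trans hx
      have hD1 := hDle (rr k) hrk
      have hD2 := hDle (pe f) (by omega)
      -- the number of leaves below the node
      obtain ⟨U, hU⟩ : ∃ U, U = leavesBefore hh m (rr f) - leavesBefore hh m (pe f) := ⟨_, rfl⟩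
      have hUr : U = leavesBefore hh m (rr k) - leavesBefore hh m (pe f) := by rw [hU, hfo.rr_eq]
      refine wp_mono (p := findNode) (Q := fun τ' s' => s' ≤ s + 40 ∧ τ'.vars vi = f ∧
        τ'.vars vj = U ∧ τ'.arrs aFB = Function.update (τ.arrs aFB) k f ∧ Frame findNode τ τ') ?_ ?_
      · rintro τ1 s1 ⟨hs1, hi1, hj1, hfb1, hf1⟩
        have hx1 : τ1.vars vk = k := (hf1.1 vk (by decide)).trans hx
        have hpe1 : τ1.arrs aPE = pe := (hf1.2 aPE (by decide)).trans hpe'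
        have hrr1 : τ1.arrs aRR = rr := (hf1.2 aRR (by decide)).trans hrr'
        have hnx1 : τ1.arrs aNX = nx := (hf1.2 aNX (by decide)).trans hnx'
        have hD1' : ∀ x ≤ n, τ1.arrs aD x = leavesBefore hh m x := by rwa [hf1.2 aD (by decide)]
        have hhs1 : τ1.arrs aHS = τ.arrs aHS := hf1.2 aHS (by decide)
        have hhe1 : τ1.arrs aHE = τ.arrs aHE := hf1.2 aHE (by decide)
        clear hf1
        have hce := ht.childEnd_le hk0 hk
        have hchr := ht.isChild_right hk hfo
        have hD3 := hDle k (by omega)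
        have hD4 := hDle _ hce
        refine wp_mono (p := checkRight) (Q := fun τ' s' => s' ≤ s + 90 ∧
          (HeavyInv n m hh pe rr nx k (τ.arrs aFB) (τ.arrs aHS) (τ.arrs aHE) →
            HeavyInv n m hh pe rr nx k (τ.arrs aFB) (τ'.arrs aHS) (τ'.arrs aHE)) ∧
          (IsHeavyChild hh pe rr m f k (childEnd rr nx k) → τ'.arrs aHE f ≠ 0) ∧
          Frame checkRight τ1 τ') ?_ ?_
        · rintro τ2 s2 ⟨hs2, hinv2, hr2, hf2⟩
          have hx2 : τ2.vars vk = k := (hf2.1 vk (by decide)).trans hx1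
          have hi2 : τ2.vars vi = f := (hf2.1 vi (by decide)).trans hi1
          have hj2 : τ2.vars vj = U := (hf2.1 vj (by decide)).trans hj1
          have hpe2 : τ2.arrs aPE = pe := (hf2.2 aPE (by decide)).trans hpe1
          have hfb2 : τ2.arrs aFB = Function.update (τ.arrs aFB) k f :=
            (hf2.2 aFB (by decide)).trans hfb1
          have hD2' : ∀ x ≤ n, τ2.arrs aD x = leavesBefore hh m x := by rwa [hf2.2 aD (by decide)]
          clear hf2
          have hD5 := hDle (pe k) (by omega)
          simp only [checkLeft, wp, Expr.ok, Expr.val, Expr.cost, hx2, hi2, hj2, hpe2, hfb2,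
            hD2' k (by omega), hD2' (pe k) (by omega), setVar_arrs, setVar_vars, setCell_vars,
            setCell_arrs, if_true, Nat.reduceEqDiff, if_false, app_sub, app_add, app_lt_eq_zero,
            app_eq_eq_zero, ne_eq, not_not, reduceCtorEq, not_false_eq_true, true_and, and_true]
          refine ⟨by omega, by omega, fun hfk' => ⟨fun hlt => ?_, fun hlt => ?_⟩, fun hfk' => ?_⟩
          · subst hfk'
            have hch : IsHeavyChild hh pe rr m f (pe f) f :=
              ⟨ht.isChild_left hf0 hk, by rw [← hU]; omega⟩
            refine ⟨by omega, by omega, by omega, by omega, by omega, ?_, by omega⟩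
            refine hI.step hfo (fun h => (hinv2 h).update hch) (fun h => ?_) (fun _ _ => ?_)
            · rw [Function.update_self]; omega
            · rw [Function.update_self]; omega
          · refine ⟨hI.step hfo hinv2 hr2 fun _ h => ?_, by omega⟩
            have := h.2
            rw [← hU, hfk'] at this
            omega
          · exact ⟨hI.step hfo hinv2 hr2 fun h => absurd h hfk', by omega⟩
        · have fin : ∀ e, e = childEnd rr nx k → ∀ τ' s', s' ≤ s + 90 → Frame checkRight τ1 τ' →
              (U < 2 * (leavesBefore hh m e - leavesBefore hh m k) →
                τ'.arrs aHS = Function.update (τ.arrs aHS) f k ∧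
                τ'.arrs aHE = Function.update (τ.arrs aHE) f e) →
              (¬ U < 2 * (leavesBefore hh m e - leavesBefore hh m k) →
                τ'.arrs aHS = τ.arrs aHS ∧ τ'.arrs aHE = τ.arrs aHE) →
              s' ≤ s + 90 ∧
              (HeavyInv n m hh pe rr nx k (τ.arrs aFB) (τ.arrs aHS) (τ.arrs aHE) →
                HeavyInv n m hh pe rr nx k (τ.arrs aFB) (τ'.arrs aHS) (τ'.arrs aHE)) ∧
              (IsHeavyChild hh pe rr m f k (childEnd rr nx k) → τ'.arrs aHE f ≠ 0) ∧
              Frame checkRight τ1 τ' := by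
            rintro e rfl τ' s' g1 g2 g3 g4
            by_cases hc : U < 2 * (leavesBefore hh m (childEnd rr nx k) - leavesBefore hh m k)
            · rw [(g3 hc).1, (g3 hc).2]
              refine ⟨g1, fun h => h.update ⟨hchr, by rw [← hU]; exact hc⟩, fun _ => ?_, g2⟩
              rw [Function.update_self]
              have := hchr.lt
              omega
            · rw [(g4 hc).1, (g4 hc).2]
              refine ⟨g1, id, fun h => ?_, g2⟩
              have := h.2
              rw [← hU] at this
              omega
          have hkey : wp M checkRight (fun τ' s' => s' ≤ s + 90 ∧ ∃ e, e = childEnd rr nx k ∧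
              (U < 2 * (leavesBefore hh m e - leavesBefore hh m k) →
                τ'.arrs aHS = Function.update (τ.arrs aHS) f k ∧
                τ'.arrs aHE = Function.update (τ.arrs aHE) f e) ∧
              (¬ U < 2 * (leavesBefore hh m e - leavesBefore hh m k) →
                τ'.arrs aHS = τ.arrs aHS ∧ τ'.arrs aHE = τ.arrs aHE)) τ1 s1 := by
            simp only [checkRight, wp, Expr.ok, Expr.val, Expr.cost, hx1, hi1, hj1, hnx1, hrr1,
              setVar_arrs, setVar_vars, setCell_vars, hhs1, hhe1,
              setCell_arrs, if_true, Nat.reduceEqDiff, if_false, app_sub, app_add, app_lt_eq_zero,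
              app_eq_eq_zero, ne_eq, not_not, reduceCtorEq, not_false_eq_true, true_and, and_true]
            have hnxle : nx k ≤ n := by
              by_cases h : nx k = 0
              · omega
              · have := ht.nx_lt k hk0 hk h
                omega
            refine ⟨by omega, by omega, fun hz => ?_, fun hz => ?_⟩
            · have he : rr k = childEnd rr nx k := by rw [childEnd, if_pos hz]
              rw [hD1' _ hrk, hD1' k (by omega)]
              refine ⟨by omega, by omega, by omega, by omega, fun hlt => ?_, fun hlt => ?_⟩
              · exact ⟨by omega, by omega, by omega, by omega, by omega, _, he, fun _ => rfl,
                  fun h => by omega⟩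
              · exact ⟨by omega, _, he, fun h => by omega, fun _ => trivial⟩
            · have he : nx k = childEnd rr nx k := by rw [childEnd, if_neg hz]
              have := hDle _ hnxle
              rw [hD1' _ hnxle, hD1' k (by omega)]
              refine ⟨by omega, by omega, fun hlt => ?_, fun hlt => ?_⟩
              · exact ⟨by omega, by omega, by omega, by omega, by omega, _, he, fun _ => rfl,
                  fun h => by omega⟩
              · exact ⟨by omega, _, he, fun h => by omega, fun _ => trivial⟩
          refine wp_mono ?_ (wp_frame hkey)
          rintro τ' s' ⟨⟨g1, e, g2, g3, g4⟩, g5⟩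
          exact fin e g2 τ' s' g1 g5 g3 g4
      · have hkey : wp M findNode (fun τ' s' => s' ≤ s + 40 ∧ τ'.vars vi = f ∧
            τ'.vars vj = U ∧ τ'.arrs aFB = Function.update (τ.arrs aFB) k f) τ s := by
          simp only [findNode, wp, Expr.ok, Expr.val, Expr.cost, hx, hhh', hpe', hrr',
            setVar_arrs, setVar_vars, setCell_vars, setCell_arrs, if_true, Nat.reduceEqDiff,
            if_false, app_sub, app_lt_eq_zero, ne_eq, not_not, reduceCtorEq, not_false_eq_true,
            true_and, Function.update_self]
          refine ⟨by omega, fun hc => ?_, fun hc => ?_⟩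
          · rw [if_pos hc] at hfval
            subst hfval
            rw [hD' _ hrk, hD' _ (by omega)]
            exact ⟨by omega, by omega, by omega, by omega, by omega, by omega, by omega, rfl,
              hUr.symm, rfl⟩
          · rw [if_neg hc] at hfval
            rw [← hfval, hD' _ hrk, hD' _ (by omega)]
            exact ⟨by omega, by omega, by omega, by omega, by omega, by omega, by omega,
              by omega, rfl, hUr.symm, rfl⟩
        refine wp_mono ?_ (wp_frame hkey)
        rintro τ' s' ⟨⟨g1, g2, g3, g4⟩, g5⟩
        exact ⟨g1, g2, g3, g4, g5⟩
    · intro τ s _ _ hI hs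
      simp only [Expr.cost] at hs
      exact ⟨by omega, hI⟩
  refine wp_mono ?_ (wp_frame key)
  exact fun τ s h => hQ τ s h.2 h.1.1 (h.1.2.isHeavyTree ht)

/-! ### The tables for the text and for its reversal -/

-- The boundaries of the text and of the reversed text, sorted by depth.

notation "aNB" => (20 : ℕ)
notation "aRB" => (21 : ℕ)

/-- Copies the first `n` cells of the array `b` to the array `a`. -/
def copyArray (a b : ℕ) : Prog :=
  .for vk (.const 0) (.var vN) (.store a (.var vk) (.cell b (.var vk)))

theorem wp_copyArray {M : Machine α} {n a b : ℕ} (hM : M.Fits n) {σ : Store} {t : ℕ}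
    {Q : Store → ℕ → Prop} (hab : b ≠ a) (hn : σ.vars vN = n) (hb : ∀ i < n, σ.arrs b i ≤ M.B)
    (hQ : ∀ τ s, Frame (copyArray a b) σ τ → s ≤ t + 30 * n →
      (∀ i < n, τ.arrs a i = σ.arrs b i) → (∀ i, n ≤ i → τ.arrs a i = σ.arrs a i) → Q τ s) :
    wp M (copyArray a b) Q σ t := by
  obtain ⟨h1, hlen, hL, hB⟩ := id hM
  have key : wp M (copyArray a b) (fun τ s => s ≤ t + 30 * n ∧
      (∀ i < n, τ.arrs a i = σ.arrs b i) ∧ (∀ i, n ≤ i → τ.arrs a i = σ.arrs a i)) σ t := by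
    unfold copyArray
    refine wp_for 0 n 10 (fun k τ => τ.arrs b = σ.arrs b ∧ (∀ i < k, τ.arrs a i = σ.arrs b i) ∧
      ∀ i, n ≤ i → τ.arrs a i = σ.arrs a i) (by simp) rfl (by omega) (by omega)
      ?_ (by simp [Prog.wv]) (by simp) ⟨rfl, by simp, by simp⟩ ?_ ?_
    · intro τ hf
      have := hf.1 vN (by simp [Prog.for, Prog.wv])
      simp [this, hn]
    · intro k τ s _ hk hf hx ⟨hI0, hI, hI'⟩
      have := hb k hk
      simp only [wp, Expr.ok, Expr.val, hx, setCell_arrs, if_true, Expr.cost, hI0, if_neg hab]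
      refine ⟨trivial, by omega, ⟨trivial, by omega⟩, by omega, ⟨trivial, fun i hi => ?_,
        fun i hi => ?_⟩, by omega⟩
      · rw [Function.update_apply]
        split_ifs with h
        · rw [h]
        · exact hI i (by omega)
      · rw [Function.update_of_ne (by omega)]
        exact hI' i hi
    · intro τ s _ _ ⟨_, hI, hI'⟩ hs
      simp only [Expr.cost] at hs
      exact ⟨by omega, hI, hI'⟩
  refine wp_mono ?_ (wp_frame key)
  exact fun τ s h => hQ τ s h.2 h.1.1 h.1.2.1 h.1.2.2

/-- `A` lists the numbers less than `n` in the order of increasing keys. -/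
structure IsSorting (n : ℕ) (K A : ℕ → ℕ) : Prop where
  perm : IsPerm n A
  mono : ∀ x y, x < y → y < n → K (A x) ≤ K (A y)

/-- Sorts the numbers less than `n` by the keys in the array `k`. -/
def sortBy (k a : ℕ) : Prog :=
  copyArray aKEY k ;;
  .for vk (.const 0) (.var vN) (.store aA (.var vk) (.var vk)) ;;
  csort ;;
  copyArray a aB

theorem wp_sortBy {M : Machine α} {n a k : ℕ} (hM : M.Fits n) {σ : Store} {t : ℕ}
    {Q : Store → ℕ → Prop} (hk : k ≠ aKEY) (ha : a ≠ aB) (hn : σ.vars vN = n)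
    (hK : ∀ i < n, σ.arrs k i ≤ n)
    (hQ : ∀ τ s, Frame (sortBy k a) σ τ → s ≤ t + 500 * n →
      IsSorting n (σ.arrs k) (τ.arrs a) → Q τ s) :
    wp M (sortBy k a) Q σ t := by
  obtain ⟨h1, hlen, hL, hB⟩ := id hM
  have key : wp M (sortBy k a) (fun τ s => s ≤ t + 500 * n ∧
      IsSorting n (σ.arrs k) (τ.arrs a)) σ t := by
    unfold sortBy
    refine wp_copyArray hM hk hn (fun i hi => by have := hK i hi; omega) ?_
    intro τ1 s1 hf1 hs1 hk1 _
    have hn1 : τ1.vars vN = n := (hf1.1 vN (by simp [copyArray, Prog.for, Prog.wv])).trans hn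
    refine wp_for 0 n 10 (fun k τ => ∀ i < k, τ.arrs aA i = i) (by simp) rfl (by omega) (by omega)
      ?_ (by decide) (by simp) (by simp) ?_ ?_
    · intro τ hf
      have := hf.1 vN (by decide)
      simp [this, hn1]
    · intro k τ s _ hk hf hx hI
      simp only [wp, Expr.ok, Expr.val, hx, setCell_arrs, if_true, Expr.cost]
      refine ⟨trivial, by omega, trivial, by omega, fun i hi => ?_, by omega⟩
      rw [Function.update_apply]
      split_ifs with h
      · exact h.symm
      · exact hI i (by omega)
    · intro τ2 s2 hf2 _ hA hs2
      simp only [Expr.cost] at hs2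
      have hn2 : τ2.vars vN = n := (hf2.1 vN (by decide)).trans hn1
      have hk2 : ∀ i < n, τ2.arrs aKEY i = σ.arrs k i := by rwa [hf2.2 aKEY (by decide)]
      refine wp_csort hM hn2 (isPerm_of_surj (fun x hx => by rwa [hA x hx])
        fun y hy => ⟨y, hy, hA y hy⟩) (fun i hi => by rw [hk2 i hi]; exact hK i hi) ?_
      intro τ3 s3 hf3 hs3 hsort
      refine wp_copyArray hM (Ne.symm ha) ((hf3.1 vN (by decide)).trans hn2)
        (fun i hi => by have := hsort.perm.1 i hi; omega) ?_
      intro τ s _ hs hc _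
      refine ⟨by omega, isPerm_of_surj (fun x hx => ?_) fun y hy => ?_, fun x y hxy hy => ?_⟩
      · rw [hc x hx]
        exact hsort.perm.1 x hx
      · obtain ⟨x, hx, he⟩ := hsort.perm.surj hy
        exact ⟨x, hx, by rw [hc x hx, he]⟩
      · rw [hc x (by omega), hc y hy]
        obtain ⟨_, _, _, _, _, _, h⟩ := hsort.sorted x y hxy hy
        rw [hk2 _ (hsort.perm.1 x (by omega)), hk2 _ (hsort.perm.1 y hy)] at h
        omega
  refine wp_mono ?_ (wp_frame key)
  exact fun τ s h => hQ τ s h.2 h.1.1 h.1.2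

theorem IsSuffixArray.congr {n : ℕ} {T sa rk hh sa' hh' : ℕ → ℕ} (h : IsSuffixArray n T sa rk hh)
    (hn : 1 ≤ n) (hsa : ∀ x < n, sa' x = sa x) (hhh : ∀ x < n, hh' x = hh x) :
    IsSuffixArray n T sa' rk hh' := by
  refine ⟨fun x hx => ?_, h.rk_lt, fun x hx => ?_, fun i hi => ?_, fun x h0 hx d => ?_, ?_,
    fun x hx => ?_, fun d x y z hxy hyz hz => ?_⟩
  · rw [hsa x hx]; exact h.sa_lt x hx
  · rw [hsa x hx]; exact h.rk_sa x hx
  · rw [hsa _ (h.rk_lt i hi)]; exact h.sa_rk i hi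
  · rw [hsa x hx, hsa (x - 1) (by omega), hhh x hx]; exact h.lcp x h0 hx d
  · rw [hhh 0 hn]; exact h.hh_zero
  · rw [hhh x hx]; exact h.hh_le x hx
  · rw [hsa x (by omega), hsa y (by omega), hsa z hz]; exact h.between d x y z hxy hyz hz

theorem IsSuffixArray.isLcpArray {n : ℕ} {T sa rk hh : ℕ → ℕ} (h : IsSuffixArray n T sa rk hh)
    (hl : hh n = 0) : IsLcpArray n hh := by
  refine ⟨h.hh_zero, hl, fun x h0 hx => ?_, fun x hx => ?_⟩
  · exact (h.lcp x h0 hx 0).mp fun k hk => by omega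
  · rcases Nat.lt_or_ge x n with h' | h'
    · exact h.hh_le x h'
    · rw [show x = n by omega, hl]; omega

/-- The suffix array of the text and the suffix tree with its heavy edges. -/
def buildTree : Prog :=
  letterNames ;; suffixArray ;; copyArray aSF aSA ;; copyArray aHF aHH ;; stackPass ;; leafPass ;;
    heavyPass

/-- All arrays are zero at the start. This provides the sentinels: the names `0` behind the end of
the text, the common prefixes `0` at `0` and `n`, and the marks for missing boundaries and heavy
children. -/
theorem wp_buildTree {M : Machine α} {n : ℕ} (hM : M.Fits n) {σ : Store} {t m : ℕ} {ℓ : ℕ → α}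
    {Q : Store → ℕ → Prop} (hℓ : ∀ i < n, M.S[i]? = some (ℓ i)) (hn : σ.vars vN = n)
    (hm : σ.vars vM = m) (h0 : ∀ a i, σ.arrs a i = 0)
    (hQ : ∀ τ s rk, Frame buildTree σ τ → s ≤ t + 4200 * (n * (Nat.log 2 n + 1)) →
      IsText n (τ.arrs aT) →
      (∀ i < n, ∀ j < n, τ.arrs aT i < τ.arrs aT j ↔ ℓ i < ℓ j) →
      IsSuffixArray n (τ.arrs aT) (τ.arrs aSF) rk (τ.arrs aHF) → τ.arrs aHF n = 0 →
      IsHeavyTree n m (τ.arrs aHF) (τ.arrs aPE) (τ.arrs aRR) (τ.arrs aNX) (τ.arrs aHS)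
        (τ.arrs aHE) →
      (∀ i, n ≤ i → τ.arrs aN i = 0) → τ.arrs aHH 0 = 0 → Q τ s) :
    wp M buildTree Q σ t := by
  obtain ⟨h1, hlen, hL, hB⟩ := id hM
  have hnn : n ≤ n * (Nat.log 2 n + 1) := Nat.le_mul_of_pos_right _ (by omega)
  have key : wp M buildTree (fun τ s => ∃ rk, s ≤ t + 4200 * (n * (Nat.log 2 n + 1)) ∧
      IsText n (τ.arrs aT) ∧
      (∀ i < n, ∀ j < n, τ.arrs aT i < τ.arrs aT j ↔ ℓ i < ℓ j) ∧
      IsSuffixArray n (τ.arrs aT) (τ.arrs aSF) rk (τ.arrs aHF) ∧ τ.arrs aHF n = 0 ∧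
      IsHeavyTree n m (τ.arrs aHF) (τ.arrs aPE) (τ.arrs aRR) (τ.arrs aNX) (τ.arrs aHS)
        (τ.arrs aHE) ∧
      (∀ i, n ≤ i → τ.arrs aN i = 0) ∧ τ.arrs aHH 0 = 0) σ t := by
    unfold buildTree
    refine wp_letterNames hM hℓ hn (fun i _ => h0 _ i) ?_
    intro τ1 s1 hf1 hs1 hT1 hlt1
    have hz1 : ∀ a, a ∉ letterNames.wa → ∀ i, τ1.arrs a i = 0 := fun a ha i => by
      rw [hf1.2 a ha]; exact h0 a i
    have hn1 : τ1.vars vN = n := (hf1.1 vN (by decide)).trans hn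
    have hm1 : τ1.vars vM = m := (hf1.1 vM (by decide)).trans hm
    clear hf1
    refine wp_suffixArray hM hn1 hT1 (fun i _ => hz1 aN (by decide) i) (hz1 aHH (by decide) 0) ?_
    intro τ2 s2 hf2 hs2 hsa2 hN2
    have hn2 : τ2.vars vN = n := (hf2.1 vN (by decide)).trans hn1
    have hm2 : τ2.vars vM = m := (hf2.1 vM (by decide)).trans hm1
    have hT2 : τ2.arrs aT = τ1.arrs aT := hf2.2 aT (by decide)
    have hHF2 : ∀ i, τ2.arrs aHF i = 0 := fun i => by
      rw [hf2.2 aHF (by decide)]; exact hz1 _ (by decide) i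
    have hNX2 : ∀ i, τ2.arrs aNX i = 0 := fun i => by
      rw [hf2.2 aNX (by decide)]; exact hz1 _ (by decide) i
    have hHE2 : ∀ i, τ2.arrs aHE i = 0 := fun i => by
      rw [hf2.2 aHE (by decide)]; exact hz1 _ (by decide) i
    have hD2 : ∀ i, τ2.arrs aD i = 0 := fun i => by
      rw [hf2.2 aD (by decide)]; exact hz1 _ (by decide) i
    clear hf2 hz1
    refine wp_copyArray hM (by decide) hn2 (fun i hi => by have := hsa2.sa_lt i hi; omega) ?_
    intro τ3 s3 hf3 hs3 hSF3 _
    refine wp_copyArray hM (by decide) ((hf3.1 vN (by decide)).trans hn2)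
      (fun i hi => by rw [hf3.2 aHH (by decide)]; have := hsa2.hh_le i hi; omega) ?_
    intro τ4 s4 hf4 hs4 hHF4 hHF4'
    rw [hf3.2 aHH (by decide)] at hHF4
    rw [hf3.2 aHF (by decide)] at hHF4'
    have hn4 : τ4.vars vN = n := by rw [hf4.1 vN (by decide), hf3.1 vN (by decide), hn2]
    have hm4 : τ4.vars vM = m := by rw [hf4.1 vM (by decide), hf3.1 vM (by decide), hm2]
    have hT4 : τ4.arrs aT = τ1.arrs aT := by rw [hf4.2 aT (by decide), hf3.2 aT (by decide), hT2]
    have hSF4 : τ4.arrs aSF = τ3.arrs aSF := hf4.2 aSF (by decide)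
    have hNX4 : ∀ i, τ4.arrs aNX i = 0 := by rwa [hf4.2 aNX (by decide), hf3.2 aNX (by decide)]
    have hHE4 : ∀ i, τ4.arrs aHE i = 0 := by rwa [hf4.2 aHE (by decide), hf3.2 aHE (by decide)]
    have hD4 : τ4.arrs aD 0 = 0 := by rw [hf4.2 aD (by decide), hf3.2 aD (by decide)]; exact hD2 0
    have hN4 : ∀ i, n ≤ i → τ4.arrs aN i = 0 := by
      rwa [hf4.2 aN (by decide), hf3.2 aN (by decide)]
    have hHH4 : τ4.arrs aHH 0 = 0 := by
      rw [hf4.2 aHH (by decide), hf3.2 aHH (by decide)]; exact hsa2.hh_zero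
    have hsa4 : IsSuffixArray n (τ1.arrs aT) (τ4.arrs aSF) (τ2.arrs aRK) (τ4.arrs aHF) :=
      hsa2.congr h1 (by rwa [hSF4]) hHF4
    have hlast : τ4.arrs aHF n = 0 := by rw [hHF4' n le_rfl]; exact hHF2 n
    have hl4 := hsa4.isLcpArray hlast
    clear hf4 hf3 hHF4' hHF4 hSF4 hSF3
    refine wp_stackPass hM hn4 hl4 rfl hNX4 ?_
    intro τ5 s5 hf5 hs5 ht5
    have hn5 : τ5.vars vN = n := (hf5.1 vN (by decide)).trans hn4
    have hHF5 : τ5.arrs aHF = τ4.arrs aHF := hf5.2 aHF (by decide)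
    refine wp_leafPass hM hn5 ((hf5.1 vM (by decide)).trans hm4) hHF5
      (by rw [hf5.2 aD (by decide)]; exact hD4) ?_
    intro τ6 s6 hf6 hs6 hD6
    refine wp_heavyPass hM ((hf6.1 vN (by decide)).trans hn5) hl4
      ((hf6.2 aHF (by decide)).trans hHF5) (hf6.2 aPE (by decide)) (hf6.2 aRR (by decide))
      (hf6.2 aNX (by decide)) hD6 ht5
      (by rwa [hf6.2 aHE (by decide), hf5.2 aHE (by decide)]) ?_
    intro τ s hf hs ht
    have e : ∀ a, a ∉ stackPass.wa → a ∉ leafPass.wa → a ∉ heavyPass.wa →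
        τ.arrs a = τ4.arrs a := fun a g1 g2 g3 => by rw [hf.2 a g3, hf6.2 a g2, hf5.2 a g1]
    have e' : ∀ a, a ∉ leafPass.wa → a ∉ heavyPass.wa → τ.arrs a = τ5.arrs a :=
      fun a g2 g3 => by rw [hf.2 a g3, hf6.2 a g2]
    refine ⟨τ2.arrs aRK, by omega, ?_⟩
    rw [e aT (by decide) (by decide) (by decide), e aSF (by decide) (by decide) (by decide),
      e aHF (by decide) (by decide) (by decide), e aN (by decide) (by decide) (by decide),
      e aHH (by decide) (by decide) (by decide), e' aPE (by decide) (by decide),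
      e' aRR (by decide) (by decide), e' aNX (by decide) (by decide), hT4]
    exact ⟨hT1, hlt1, hsa4, hlast, ht, hN4, hHH4⟩
  refine wp_mono ?_ (wp_frame key)
  rintro τ s ⟨⟨rk, g1, g2, g3, g4, g5, g6, g7, g8⟩, hf⟩
  exact hQ τ s rk hf g1 g2 g3 g4 g5 g6 g7 g8

/-- The reversal of the text of length `n`. -/
def reversed (n : ℕ) (T : ℕ → ℕ) (p : ℕ) : ℕ := if p < n then T (n - 1 - p) else 0

theorem IsText.reversed {n : ℕ} {T : ℕ → ℕ} (h : IsText n T) : IsText n (reversed n T) := by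
  refine ⟨fun i hi => ?_, fun i hi => ?_, fun i hi => ?_⟩
  · rw [Mappability.reversed, if_pos hi]; exact h.pos _ (by omega)
  · rw [Mappability.reversed, if_pos hi]; exact h.le _ (by omega)
  · rw [Mappability.reversed, if_neg (by omega)]

/-- The factor of length `d` at `i`, read backwards, is the prefix of length `d` of the suffix
number `n - d - i` of the reversed text. -/
theorem agree_reversed {n : ℕ} {T : ℕ → ℕ} {d i j : ℕ} (hi : i + d ≤ n) (hj : j + d ≤ n) :
    Agree (reversed n T) d (n - d - i) (n - d - j) ↔ Agree T d i j := by
  have h : ∀ k < d, ∀ i, i + d ≤ n → reversed n T (n - d - i + k) = T (i + (d - 1 - k)) := by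
    intro k hk i hi
    rw [reversed, if_pos (by omega)]
    congr 1
    omega
  refine ⟨fun hA k hk => ?_, fun hA k hk => ?_⟩
  · have := hA (d - 1 - k) (by omega)
    rw [h _ (by omega) i hi, h _ (by omega) j hj] at this
    rwa [show d - 1 - (d - 1 - k) = k by omega] at this
  · rw [h k hk i hi, h k hk j hj]
    exact hA _ (by omega)

/-- Replaces the text by its reversal. -/
def reverseText : Prog :=
  .for vk (.const 0) (.var vN) (.store aM (.var vk) (.cell aT (.var vN -ₑ .const 1 -ₑ .var vk))) ;;
  copyArray aT aM

theorem wp_reverseText {M : Machine α} {n : ℕ} (hM : M.Fits n) {σ : Store} {t : ℕ} {T : ℕ → ℕ}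
    {Q : Store → ℕ → Prop} (hn : σ.vars vN = n) (hTσ : σ.arrs aT = T) (hT : IsText n T)
    (hQ : ∀ τ s, Frame reverseText σ τ → s ≤ t + 100 * n → τ.arrs aT = reversed n T → Q τ s) :
    wp M reverseText Q σ t := by
  obtain ⟨h1, hlen, hL, hB⟩ := id hM
  have key : wp M reverseText (fun τ s => s ≤ t + 100 * n ∧ τ.arrs aT = reversed n T) σ t := by
    unfold reverseText
    refine wp_for 0 n 10 (fun k τ => ∀ i < k, τ.arrs aM i = T (n - 1 - i)) (by simp) rfl
      (by omega) (by omega) ?_ (by decide) (by simp) (by simp) ?_ ?_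
    · intro τ hf
      have := hf.1 vN (by decide)
      simp [this, hn]
    · intro k τ s _ hk hf hx hI
      have hT' : τ.arrs aT = T := (hf.2 aT (by decide)).trans hTσ
      have hn' : τ.vars vN = n := (hf.1 vN (by decide)).trans hn
      have := hT.le (n - 1 - k) (by omega)
      simp only [wp, Expr.ok, Expr.val, Expr.cost, hx, hT', hn', setCell_arrs, if_true, app_sub,
        ne_eq, reduceCtorEq, not_false_eq_true, true_and, and_true]
      refine ⟨by omega, by omega, by omega, fun i hi => ?_, by omega⟩
      rw [Function.update_apply]
      split_ifs with h
      · rw [h]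
      · exact hI i (by omega)
    · intro τ1 s1 hf1 _ hI hs1
      simp only [Expr.cost] at hs1
      refine wp_copyArray hM (by decide) ((hf1.1 vN (by decide)).trans hn)
        (fun i hi => by rw [hI i hi]; have := hT.le (n - 1 - i) (by omega); omega) ?_
      intro τ s hf hs hc hc'
      refine ⟨by omega, funext fun i => ?_⟩
      rw [reversed]
      split_ifs with h
      · rw [hc i h, hI i h]
      · rw [hc' i (by omega), hf1.2 aT (by decide), hTσ]
        exact hT.pad i (by omega)
  refine wp_mono ?_ (wp_frame key)
  exact fun τ s h => hQ τ s h.2 h.1.1 h.1.2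

/-- The tables that the main loop works with. Here `T` is the text with letters replaced by
numbers, and `rk` its suffixes' ranks; the arrays `aSA`, `aRK` and `aHH` belong to the reversed
text. -/
structure Prepared (n m : ℕ) (T rk : ℕ → ℕ) (σ : Store) : Prop where
  text : IsText n T
  sufs : IsSuffixArray n T (σ.arrs aSF) rk (σ.arrs aHF)
  last : σ.arrs aHF n = 0
  tree : IsHeavyTree n m (σ.arrs aHF) (σ.arrs aPE) (σ.arrs aRR) (σ.arrs aNX) (σ.arrs aHS)
    (σ.arrs aHE)
  nodes : IsSorting n (σ.arrs aHF) (σ.arrs aNB)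
  rev : IsSuffixArray n (reversed n T) (σ.arrs aSA) (σ.arrs aRK) (σ.arrs aHH)
  bounds : IsSorting n (σ.arrs aHH) (σ.arrs aRB)

/-- Computes all tables. -/
def prepare : Prog :=
  buildTree ;; sortBy aHF aNB ;; reverseText ;; suffixArray ;; sortBy aHH aRB

theorem wp_prepare {M : Machine α} {n : ℕ} (hM : M.Fits n) {σ : Store} {t m : ℕ} {ℓ : ℕ → α}
    {Q : Store → ℕ → Prop} (hℓ : ∀ i < n, M.S[i]? = some (ℓ i)) (hn : σ.vars vN = n)
    (hm : σ.vars vM = m) (h0 : ∀ a i, σ.arrs a i = 0)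
    (hQ : ∀ τ s T rk, Frame prepare σ τ → s ≤ t + 7800 * (n * (Nat.log 2 n + 1)) →
      Prepared n m T rk τ → (∀ i < n, ∀ j < n, T i < T j ↔ ℓ i < ℓ j) → Q τ s) :
    wp M prepare Q σ t := by
  obtain ⟨h1, hlen, hL, hB⟩ := id hM
  have hnn : n ≤ n * (Nat.log 2 n + 1) := Nat.le_mul_of_pos_right _ (by omega)
  have key : wp M prepare (fun τ s => ∃ T rk, s ≤ t + 7800 * (n * (Nat.log 2 n + 1)) ∧
      Prepared n m T rk τ ∧ (∀ i < n, ∀ j < n, T i < T j ↔ ℓ i < ℓ j)) σ t := by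
    unfold prepare
    refine wp_buildTree hM hℓ hn hm h0 ?_
    intro τ1 s1 rk hf1 hs1 hT1 hlt hsa1 hl1 ht1 hN1 hz1
    have hn1 : τ1.vars vN = n := (hf1.1 vN (by decide)).trans hn
    clear hf1
    refine wp_sortBy hM (by decide) (by decide) hn1 hsa1.hh_le ?_
    intro τ2 s2 hf2 hs2 hF2
    have hn2 : τ2.vars vN = n := (hf2.1 vN (by decide)).trans hn1
    refine wp_reverseText hM hn2 (hf2.2 aT (by decide)) hT1 ?_
    intro τ3 s3 hf3 hs3 hT3
    have hn3 : τ3.vars vN = n := (hf3.1 vN (by decide)).trans hn2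
    refine wp_suffixArray hM hn3 (by rw [hT3]; exact hT1.reversed)
      (by rwa [hf3.2 aN (by decide), hf2.2 aN (by decide)])
      (by rwa [hf3.2 aHH (by decide), hf2.2 aHH (by decide)]) ?_
    intro τ4 s4 hf4 hs4 hsa4 _
    rw [hT3] at hsa4
    refine wp_sortBy hM (by decide) (by decide) ((hf4.1 vN (by decide)).trans hn3) hsa4.hh_le ?_
    intro τ s hf hs hG
    have e : ∀ a, a ∉ (sortBy aHF aNB).wa → a ∉ reverseText.wa → a ∉ suffixArray.wa →
        a ∉ (sortBy aHH aRB).wa → τ.arrs a = τ1.arrs a := fun a g1 g2 g3 g4 => by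
      rw [hf.2 a g4, hf4.2 a g3, hf3.2 a g2, hf2.2 a g1]
    refine ⟨τ1.arrs aT, rk, by omega, ⟨hT1, ?_, ?_, ?_, ?_, ?_, ?_⟩, hlt⟩
    · rwa [e aSF (by decide) (by decide) (by decide) (by decide),
        e aHF (by decide) (by decide) (by decide) (by decide)]
    · rwa [e aHF (by decide) (by decide) (by decide) (by decide)]
    · rwa [e aHF (by decide) (by decide) (by decide) (by decide),
        e aPE (by decide) (by decide) (by decide) (by decide),
        e aRR (by decide) (by decide) (by decide) (by decide),
        e aNX (by decide) (by decide) (by decide) (by decide),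
        e aHS (by decide) (by decide) (by decide) (by decide),
        e aHE (by decide) (by decide) (by decide) (by decide)]
    · rwa [e aHF (by decide) (by decide) (by decide) (by decide), hf.2 aNB (by decide),
        hf4.2 aNB (by decide), hf3.2 aNB (by decide)]
    · rwa [hf.2 aSA (by decide), hf.2 aRK (by decide), hf.2 aHH (by decide)]
    · rwa [hf.2 aHH (by decide)]
  refine wp_mono ?_ (wp_frame key)
  rintro τ s ⟨⟨T, rk, g1, g2, g3⟩, hf⟩
  exact hQ τ s T rk hf g1 g2 g3

/-! ### Merging classes of suffixes, smaller into larger -/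

/-- A partition of the numbers less than `n` into intervals: `x` belongs to the class with label
`lab x`, and the class with label `c` is `[lo c, hi c)`. The boundary before `z` lies inside a
class exactly if `P z`. -/
structure IsPartition (n : ℕ) (P : ℕ → Prop) (lab lo hi : ℕ → ℕ) : Prop where
  lab_lt : ∀ x < n, lab x < n
  mem : ∀ x < n, lo (lab x) ≤ x ∧ x < hi (lab x) ∧ hi (lab x) ≤ n
  lab_eq : ∀ x < n, ∀ y, lo (lab x) ≤ y → y < hi (lab x) → lab y = lab x
  inner : ∀ x < n, ∀ z, lo (lab x) < z → z < hi (lab x) → P z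
  lo_outer : ∀ x < n, 0 < lo (lab x) → ¬ P (lo (lab x))
  hi_outer : ∀ x < n, hi (lab x) < n → ¬ P (hi (lab x))

/-- The potential of a partition: an element that is moved to a class of at least twice the size
of its old class raises the potential by at least one. -/
def partitionWeight (n : ℕ) (lab lo hi : ℕ → ℕ) : ℕ :=
  ∑ x ∈ Finset.range n, Nat.log 2 (hi (lab x) - lo (lab x))

namespace IsPartition

variable {n : ℕ} {P : ℕ → Prop} {lab lo hi : ℕ → ℕ}

theorem congr (h : IsPartition n P lab lo hi) {P' : ℕ → Prop}
    (hP : ∀ z, 0 < z → z < n → (P' z ↔ P z)) : IsPartition n P' lab lo hi := by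
  refine ⟨h.lab_lt, h.mem, h.lab_eq, fun x hx z h1 h2 => ?_, fun x hx h0 => ?_, fun x hx h0 => ?_⟩
  · have := h.mem x hx
    exact (hP z (by omega) (by omega)).mpr (h.inner x hx z h1 h2)
  · have := h.mem x hx
    exact fun h' => h.lo_outer x hx h0 ((hP _ h0 (by omega)).mp h')
  · have := h.mem x hx
    exact fun h' => h.hi_outer x hx h0 ((hP _ (by omega) h0).mp h')

theorem lab_eq_iff (h : IsPartition n P lab lo hi) {x y : ℕ} (hx : x < n) (hy : y < n) :
    lab y = lab x ↔ lo (lab x) ≤ y ∧ y < hi (lab x) := by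
  refine ⟨fun he => ?_, fun h' => h.lab_eq x hx y h'.1 h'.2⟩
  have := h.mem y hy
  rw [he] at this
  exact ⟨this.1, this.2.1⟩

theorem lab_eq_iff_inner (h : IsPartition n P lab lo hi) {x y : ℕ} (hx : x < n) (hy : y < n) :
    lab y = lab x ↔ ∀ z, (x < z ∧ z ≤ y) ∨ (y < z ∧ z ≤ x) → P z := by
  have hm := h.mem x hx
  rw [h.lab_eq_iff hx hy]
  refine ⟨fun h' z hz => h.inner x hx z (by omega) (by omega), fun h' => ⟨?_, ?_⟩⟩
  · by_contra hc
    exact h.lo_outer x hx (by omega) (h' _ (by omega))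
  · by_contra hc
    exact h.hi_outer x hx (by omega) (h' _ (by omega))

theorem card_class (h : IsPartition n P lab lo hi) {x : ℕ} (hx : x < n) :
    ((Finset.range n).filter fun y => lab y = lab x).card = hi (lab x) - lo (lab x) := by
  rw [← Nat.card_Ico]
  congr 1
  ext y
  have := h.mem x hx
  simp only [Finset.mem_filter, Finset.mem_range, Finset.mem_Ico]
  constructor
  · rintro ⟨hy, he⟩
    exact (h.lab_eq_iff hx hy).mp he
  · intro he
    exact ⟨by omega, (h.lab_eq_iff hx (by omega)).mpr he⟩

theorem hi_left (h : IsPartition n P lab lo hi) {b : ℕ} (hb0 : 0 < b) (hb : b < n) (hP : ¬ P b) :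
    hi (lab (b - 1)) = b := by
  have h1 := h.mem (b - 1) (by omega)
  by_contra hne
  exact hP (h.inner (b - 1) (by omega) b (by omega) (by omega))

theorem lo_right (h : IsPartition n P lab lo hi) {b : ℕ} (hb : b < n) (hP : ¬ P b) :
    lo (lab b) = b := by
  have h1 := h.mem b hb
  by_contra hne
  exact hP (h.inner b hb b (by omega) (by omega))

theorem merge (h : IsPartition n P lab lo hi) {b w : ℕ} (hb0 : 0 < b) (hb : b < n) (hP : ¬ P b)
    (hw : w = lab (b - 1) ∨ w = lab b) {lab' lo' hi' : ℕ → ℕ}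
    (hlab : ∀ x < n, lab' x = if lo (lab (b - 1)) ≤ x ∧ x < hi (lab b) then w else lab x)
    (hlo : lo' = Function.update lo w (lo (lab (b - 1))))
    (hhi : hi' = Function.update hi w (hi (lab b))) :
    IsPartition n (fun z => P z ∨ z = b) lab' lo' hi' := by
  have hu := h.mem (b - 1) (by omega)
  have hv := h.mem b hb
  have hhu := h.hi_left hb0 hb hP
  have hlv := h.lo_right hb hP
  have hwn : w < n := by
    rcases hw with rfl | rfl
    · exact h.lab_lt _ (by omega)
    · exact h.lab_lt _ hb
  have hlow : lo' w = lo (lab (b - 1)) := by rw [hlo, Function.update_self]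
  have hhiw : hi' w = hi (lab b) := by rw [hhi, Function.update_self]
  -- elements outside the new class keep their class
  have hout : ∀ x < n, ¬ (lo (lab (b - 1)) ≤ x ∧ x < hi (lab b)) →
      lab' x = lab x ∧ lo' (lab x) = lo (lab x) ∧ hi' (lab x) = hi (lab x) ∧
        (hi (lab x) ≤ lo (lab (b - 1)) ∨ hi (lab b) ≤ lo (lab x)) := by
    intro x hx hc
    have hxm := h.mem x hx
    have h1 : lab x ≠ lab (b - 1) := fun he => by rw [he] at hxm; omega
    have h2 : lab x ≠ lab b := fun he => by rw [he] at hxm; omega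
    have hne : lab x ≠ w := by
      rcases hw with rfl | rfl
      · exact h1
      · exact h2
    refine ⟨by rw [hlab x hx, if_neg hc], by rw [hlo, Function.update_of_ne hne],
      by rw [hhi, Function.update_of_ne hne], ?_⟩
    by_contra hcc
    rw [not_or, not_le, not_le] at hcc
    rcases Nat.lt_or_ge x (lo (lab (b - 1))) with hlt | hge
    · refine h1 ?_
      have e1 := h.lab_eq x hx (lo (lab (b - 1))) (by omega) (by omega)
      have e2 := h.lab_eq (b - 1) (by omega) (lo (lab (b - 1))) (by omega) (by omega)
      omega
    · refine h2 ?_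
      have e1 := h.lab_eq x hx (hi (lab b) - 1) (by omega) (by omega)
      have e2 := h.lab_eq b hb (hi (lab b) - 1) (by omega) (by omega)
      omega
  have hin : ∀ x < n, lo (lab (b - 1)) ≤ x ∧ x < hi (lab b) → lab' x = w := fun x hx hc => by
    rw [hlab x hx, if_pos hc]
  refine ⟨fun x hx => ?_, fun x hx => ?_, fun x hx y h1 h2 => ?_, fun x hx z h1 h2 => ?_,
    fun x hx h0 => ?_, fun x hx h0 => ?_⟩
  all_goals by_cases hc : lo (lab (b - 1)) ≤ x ∧ x < hi (lab b)
  · rw [hin x hx hc]; exact hwn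
  · rw [(hout x hx hc).1]; exact h.lab_lt x hx
  · rw [hin x hx hc, hlow, hhiw]; omega
  · obtain ⟨e1, e2, e3, -⟩ := hout x hx hc
    rw [e1, e2, e3]
    exact h.mem x hx
  · rw [hin x hx hc, hlow, hhiw] at *
    exact hin y (by omega) ⟨h1, h2⟩
  · obtain ⟨e1, e2, e3, e4⟩ := hout x hx hc
    simp only [e1, e2, e3] at h1 h2 ⊢
    have := h.mem x hx
    rw [(hout y (by omega) (by omega)).1]
    exact h.lab_eq x hx y h1 h2
  · rw [hin x hx hc, hlow, hhiw] at *
    rcases lt_trichotomy z b with hz | hz | hz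
    · exact Or.inl (h.inner (b - 1) (by omega) z h1 (by omega))
    · exact Or.inr hz
    · exact Or.inl (h.inner b hb z (by omega) h2)
  · obtain ⟨e1, e2, e3, e4⟩ := hout x hx hc
    simp only [e1, e2, e3] at h1 h2 ⊢
    exact Or.inl (h.inner x hx z h1 h2)
  · rw [hin x hx hc, hlow] at *
    rintro (h' | h')
    · exact h.lo_outer (b - 1) (by omega) h0 h'
    · omega
  · obtain ⟨e1, e2, e3, e4⟩ := hout x hx hc
    simp only [e1, e2] at h0 ⊢
    have := h.mem x hx
    rintro (h' | h')
    · exact h.lo_outer x hx h0 h'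
    · omega
  · rw [hin x hx hc, hhiw] at *
    rintro (h' | h')
    · exact h.hi_outer b hb h0 h'
    · omega
  · obtain ⟨e1, e2, e3, e4⟩ := hout x hx hc
    simp only [e1, e3] at h0 ⊢
    have := h.mem x hx
    rintro (h' | h')
    · exact h.hi_outer x hx h0 h'
    · omega

/-- When two neighbouring classes are merged, with `[p, q)` the smaller one, the potential grows by
at least the length of `[p, q)`. -/
theorem weight_merge (h : IsPartition n P lab lo hi) {b w p q : ℕ} (hb0 : 0 < b) (hb : b < n)
    (hP : ¬ P b) (hw : w = lab (b - 1) ∨ w = lab b) {lab' lo' hi' : ℕ → ℕ}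
    (hlab : ∀ x < n, lab' x = if lo (lab (b - 1)) ≤ x ∧ x < hi (lab b) then w else lab x)
    (hlo : lo' = Function.update lo w (lo (lab (b - 1))))
    (hhi : hi' = Function.update hi w (hi (lab b)))
    (hpq : p = lo (lab (b - 1)) ∧ q = b ∨ p = b ∧ q = hi (lab b))
    (hsmall : 2 * (q - p) ≤ hi (lab b) - lo (lab (b - 1))) :
    partitionWeight n lab lo hi + (q - p) ≤ partitionWeight n lab' lo' hi' := by
  have hu := h.mem (b - 1) (by omega)
  have hv := h.mem b hb
  have hhu := h.hi_left hb0 hb hP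
  have hlv := h.lo_right hb hP
  have hcard : q - p = ∑ x ∈ Finset.range n, if p ≤ x ∧ x < q then 1 else 0 := by
    rw [← Finset.card_filter, ← Nat.card_Ico]
    congr 1
    ext x
    simp only [Finset.mem_filter, Finset.mem_range, Finset.mem_Ico]
    omega
  unfold partitionWeight
  rw [hcard, ← Finset.sum_add_distrib]
  refine Finset.sum_le_sum fun x hx => ?_
  have hx := Finset.mem_range.mp hx
  have hxm := h.mem x hx
  rw [hlab x hx]
  by_cases hc : lo (lab (b - 1)) ≤ x ∧ x < hi (lab b)
  · rw [if_pos hc, hlo, hhi, Function.update_self, Function.update_self]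
    have hxl : lab x = lab (b - 1) ∧ x < b ∨ lab x = lab b ∧ b ≤ x := by
      rcases Nat.lt_or_ge x b with hlt | hge
      · exact Or.inl ⟨h.lab_eq (b - 1) (by omega) x hc.1 (by omega), hlt⟩
      · exact Or.inr ⟨h.lab_eq b hb x (by omega) hc.2, hge⟩
    split_ifs with hpx
    · have hsz : hi (lab x) - lo (lab x) = q - p := by
        rcases hxl with ⟨e, _⟩ | ⟨e, _⟩ <;> rw [e] <;> omega
      rw [hsz, ← Nat.log_mul_base (by norm_num) (by omega)]
      exact Nat.log_mono_right (by omega)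
    · refine le_of_eq_of_le (add_zero _) (Nat.log_mono_right ?_)
      rcases hxl with ⟨e, -⟩ | ⟨e, -⟩ <;> rw [e] <;> omega
  · have h1 : lab x ≠ lab (b - 1) := fun he => by rw [he] at hxm; omega
    have h2 : lab x ≠ lab b := fun he => by rw [he] at hxm; omega
    have hne : lab x ≠ w := by
      rcases hw with rfl | rfl
      · exact h1
      · exact h2
    rw [if_neg hc, hlo, hhi, Function.update_of_ne hne, Function.update_of_ne hne,
      if_neg (by omega), add_zero]

theorem weight_le (h : IsPartition n P lab lo hi) :
    partitionWeight n lab lo hi ≤ n * Nat.log 2 n := by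
  unfold partitionWeight
  calc _ ≤ ∑ x ∈ Finset.range n, Nat.log 2 n := Finset.sum_le_sum fun x hx => by
        have := h.mem x (Finset.mem_range.mp hx)
        exact Nat.log_mono_right (by omega)
    _ = n * Nat.log 2 n := by simp

end IsPartition

-- The class of `x` has the label `aLAB` at `x`, and the class with label `c` reaches from `aLO` to
-- `aHI` at `c`. The boundaries that have been merged are those from number `vg` on in `aRB`.

notation "aLAB" => (22 : ℕ)
notation "aLO" => (23 : ℕ)
notation "aHI" => (24 : ℕ)
notation "vg" => (9 : ℕ)
notation "vthr" => (10 : ℕ)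
notation "vb" => (11 : ℕ)
notation "vu" => (12 : ℕ)
notation "vv" => (13 : ℕ)

/-- Merges the classes to the left and to the right of the boundary `vb`. -/
def mergeAt : Prog :=
  .assign vu (.cell aLAB (.var vb -ₑ .const 1)) ;;
  .assign vv (.cell aLAB (.var vb)) ;;
  .ite (.cell aHI (.var vv) -ₑ .var vb <ₑ .var vb -ₑ .cell aLO (.var vu))
    (.for vk (.var vb) (.cell aHI (.var vv)) (.store aLAB (.var vk) (.var vu)) ;;
      .store aHI (.var vu) (.cell aHI (.var vv)))
    (.for vk (.cell aLO (.var vu)) (.var vb) (.store aLAB (.var vk) (.var vv)) ;;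
      .store aLO (.var vv) (.cell aLO (.var vu)))

/-- A merger takes constant time plus the number of relabelled elements, which the potential pays
for. -/
theorem wp_mergeAt {M : Machine α} {n b : ℕ} (hM : M.Fits n) {σ : Store} {t : ℕ} {P : ℕ → Prop}
    {Q : Store → ℕ → Prop} (hb : σ.vars vb = b) (hb0 : 0 < b) (hbn : b < n) (hPb : ¬ P b)
    (h : IsPartition n P (σ.arrs aLAB) (σ.arrs aLO) (σ.arrs aHI))
    (hQ : ∀ τ s, Frame mergeAt σ τ →
      s + 20 * partitionWeight n (σ.arrs aLAB) (σ.arrs aLO) (σ.arrs aHI) ≤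
        t + 60 + 20 * partitionWeight n (τ.arrs aLAB) (τ.arrs aLO) (τ.arrs aHI) →
      IsPartition n (fun z => P z ∨ z = b) (τ.arrs aLAB) (τ.arrs aLO) (τ.arrs aHI) → Q τ s) :
    wp M mergeAt Q σ t := by
  obtain ⟨h1, hlen, hL, hB⟩ := id hM
  obtain ⟨lab, hlab⟩ : ∃ lab, lab = σ.arrs aLAB := ⟨_, rfl⟩
  obtain ⟨lo, hlo⟩ : ∃ lo, lo = σ.arrs aLO := ⟨_, rfl⟩
  obtain ⟨hi, hhi⟩ : ∃ hi, hi = σ.arrs aHI := ⟨_, rfl⟩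
  rw [← hlab, ← hlo, ← hhi] at h hQ
  have hu := h.mem (b - 1) (by omega)
  have hv := h.mem b hbn
  have hhu := h.hi_left hb0 hbn hPb
  have hlv := h.lo_right hbn hPb
  have hun := h.lab_lt (b - 1) (by omega)
  have hvn := h.lab_lt b hbn
  obtain ⟨u, hudef⟩ : ∃ u, u = lab (b - 1) := ⟨_, rfl⟩
  obtain ⟨v, hvdef⟩ : ∃ v, v = lab b := ⟨_, rfl⟩
  have hlabu : ∀ x, lo u ≤ x → x < b → lab x = u := fun x g1 g2 => by
    rw [hudef] at *; exact h.lab_eq _ (by omega) x g1 (by omega)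
  have hlabv : ∀ x, b ≤ x → x < hi v → lab x = v := fun x g1 g2 => by
    rw [hvdef] at *; exact h.lab_eq _ (by omega) x (by omega) g2
  have key : wp M mergeAt (fun τ s =>
      s + 20 * partitionWeight n lab lo hi ≤
        t + 60 + 20 * partitionWeight n (τ.arrs aLAB) (τ.arrs aLO) (τ.arrs aHI) ∧
      IsPartition n (fun z => P z ∨ z = b) (τ.arrs aLAB) (τ.arrs aLO) (τ.arrs aHI)) σ t := by
    unfold mergeAt
    refine ⟨⟨⟨by simp, trivial, trivial⟩, by simp only [Expr.val, hb, app_sub]; omega⟩,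
      by simp only [Expr.val, hb, app_sub, ← hlab]; omega, ?_⟩
    refine ⟨⟨trivial, by simp only [Expr.val]; simp [hb]; omega⟩,
      by simp only [Expr.val]; simp [hb, ← hlab]; omega, ?_⟩
    generalize hσ' : (Store.setVar _ vv _) = σ'
    have e1 : σ'.vars vb = b := by rw [← hσ']; simp [hb]
    have e2 : σ'.vars vu = u := by rw [← hσ']; simp [hb, ← hlab, hudef]
    have e3 : σ'.vars vv = v := by rw [← hσ']; simp [hb, ← hlab, hvdef]
    have e4 : σ'.arrs = σ.arrs := by rw [← hσ']; rfl
    rw [← hudef] at hu hhu hun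
    rw [← hvdef] at hv hlv hvn
    refine ⟨?_, fun hc => ?_, fun hc => ?_⟩
    · simp only [Expr.ok, Expr.val, e2, e3]
      refine ⟨by simp, ⟨by simp, ⟨trivial, by omega⟩, trivial⟩, by simp, trivial, trivial, by omega⟩
    · simp only [Expr.val, e1, e2, e3, e4, ← hlo, ← hhi, app_sub, ne_eq, app_lt_eq_zero,
        not_not] at hc
      refine wp_for b (hi v) 3 (fun k τ => ∀ x, τ.arrs aLAB x =
        if b ≤ x ∧ x < k then u else lab x) trivial e1 (by omega) (by omega) ?_
        (by decide) (by simp) ?_ ?_ ?_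
      · intro τ hf
        have g1 : τ.vars vv = v := (hf.1 vv (by decide)).trans e3
        have g2 : τ.arrs aHI = hi := by rw [hf.2 aHI (by decide), e4, hhi]
        simp only [Expr.ok, Expr.val, g1, g2, true_and, and_true]
        omega
      · intro x
        rw [if_neg (by omega), e4, hlab]
      · intro k τ s hk0 hk hf hx hI
        have g1 : τ.vars vu = u := (hf.1 vu (by decide)).trans e2
        simp only [wp, Expr.ok, Expr.val, Expr.cost, hx, g1, setCell_arrs, if_true]
        refine ⟨trivial, by omega, trivial, by omega, fun x => ?_, by omega⟩
        rw [Function.update_apply, hI]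
        split_ifs <;> omega
      · intro τ s hf _ hI hs
        have g1 : τ.vars vu = u := (hf.1 vu (by decide)).trans e2
        have g2 : τ.vars vv = v := (hf.1 vv (by decide)).trans e3
        have g3 : τ.arrs aHI = hi := by rw [hf.2 aHI (by decide), e4, hhi]
        have g4 : τ.arrs aLO = lo := by rw [hf.2 aLO (by decide), e4, hlo]
        simp only [Expr.cost] at hs
        have hn1 : ∀ x < n, τ.arrs aLAB x = if lo (lab (b - 1)) ≤ x ∧ x < hi (lab b) then u
            else lab x := by
          intro x hx
          rw [hI, ← hudef, ← hvdef]
          by_cases hxb : x < b ∧ lo u ≤ x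
          · have := hlabu x hxb.2 hxb.1
            split_ifs <;> omega
          · split_ifs <;> omega
        have hn2 : lo = Function.update lo u (lo (lab (b - 1))) := by
          rw [← hudef, Function.update_eq_self]
        have hn3 : Function.update hi u (hi v) = Function.update hi u (hi (lab b)) := by
          rw [← hvdef]
        simp only [wp, Expr.ok, Expr.val, Expr.cost, g1, g2, g3, g4, setCell_arrs, if_true,
          Nat.reduceEqDiff, if_false]
        refine ⟨trivial, by omega, ⟨trivial, by omega⟩, by omega, ?_,
          h.merge hb0 hbn hPb (Or.inl hudef) hn1 hn2 hn3⟩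
        have := h.weight_merge hb0 hbn hPb (Or.inl hudef) hn1 hn2 hn3 (p := b) (q := hi v)
          (Or.inr ⟨rfl, by rw [hvdef]⟩) (by rw [← hudef, ← hvdef]; omega)
        omega
    · simp only [Expr.val, e1, e2, e3, e4, ← hlo, ← hhi, app_sub, app_lt_eq_zero] at hc
      refine wp_for (lo u) b 3 (fun k τ => ∀ x, τ.arrs aLAB x =
        if lo u ≤ x ∧ x < k then v else lab x) ?_ ?_ (by omega) (by omega) ?_
        (by decide) (by simp) ?_ ?_ ?_
      · simp only [Expr.ok, Expr.val, e2, true_and]; omega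
      · simp only [Expr.val, e2, e4, hlo]
      · intro τ hf
        exact ⟨trivial, (hf.1 vb (by decide)).trans e1⟩
      · intro x
        rw [if_neg (by omega), e4, hlab]
      · intro k τ s hk0 hk hf hx hI
        have g1 : τ.vars vv = v := (hf.1 vv (by decide)).trans e3
        simp only [wp, Expr.ok, Expr.val, Expr.cost, hx, g1, setCell_arrs, if_true]
        refine ⟨trivial, by omega, trivial, by omega, fun x => ?_, by omega⟩
        rw [Function.update_apply, hI]
        split_ifs <;> omega
      · intro τ s hf _ hI hs
        have g1 : τ.vars vu = u := (hf.1 vu (by decide)).trans e2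
        have g2 : τ.vars vv = v := (hf.1 vv (by decide)).trans e3
        have g3 : τ.arrs aHI = hi := by rw [hf.2 aHI (by decide), e4, hhi]
        have g4 : τ.arrs aLO = lo := by rw [hf.2 aLO (by decide), e4, hlo]
        simp only [Expr.cost] at hs
        have hn1 : ∀ x < n, τ.arrs aLAB x = if lo (lab (b - 1)) ≤ x ∧ x < hi (lab b) then v
            else lab x := by
          intro x hx
          rw [hI, ← hudef, ← hvdef]
          by_cases hxb : b ≤ x ∧ x < hi v
          · have := hlabv x hxb.1 hxb.2
            split_ifs <;> omega
          · split_ifs <;> omega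
        have hn2 : hi = Function.update hi v (hi (lab b)) := by
          rw [← hvdef, Function.update_eq_self]
        have hn3 : Function.update lo v (lo u) = Function.update lo v (lo (lab (b - 1))) := by
          rw [← hudef]
        simp only [wp, Expr.ok, Expr.val, Expr.cost, g1, g2, g3, g4, setCell_arrs, if_true,
          Nat.reduceEqDiff, if_false]
        refine ⟨trivial, by omega, ⟨trivial, by omega⟩, by omega, ?_,
          h.merge hb0 hbn hPb (Or.inr hvdef) hn1 hn3 hn2⟩
        have := h.weight_merge hb0 hbn hPb (Or.inr hvdef) hn1 hn3 hn2 (p := lo u) (q := b)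
          (Or.inl ⟨by rw [hudef], rfl⟩) (by rw [← hudef, ← hvdef]; omega)
        omega
  refine wp_mono ?_ (wp_frame key)
  exact fun τ s h => hQ τ s h.2 h.1.1 h.1.2

/-- Merges at all boundaries of more than `vthr`. The boundaries from number `vg` on are done. -/
def mergeTo : Prog :=
  .loop (.var vthr <ₑ .cell aHH (.cell aRB (.var vg -ₑ .const 1))) (
    .assign vg (.var vg -ₑ .const 1) ;;
    .assign vb (.cell aRB (.var vg)) ;;
    mergeAt)

/-- Besides the potential, each merger is paid for by the decrease of `vg`. The boundary with number
`0` in sorted order is the sentinel `0`, which stops the loop. -/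
theorem wp_mergeTo {M : Machine α} {n g l : ℕ} (hM : M.Fits n) {σ : Store} {t : ℕ}
    {hh G : ℕ → ℕ} {Q : Store → ℕ → Prop} (hg : σ.vars vg = g) (hl : σ.vars vthr = l)
    (hg1 : 1 ≤ g) (hgn : g ≤ n) (hhh : σ.arrs aHH = hh) (hG : σ.arrs aRB = G) (h0 : hh 0 = 0)
    (hs : IsSorting n hh G) (hdone : ∀ x, g ≤ x → x < n → l < hh (G x))
    (h : IsPartition n (fun z => ∃ x, g ≤ x ∧ x < n ∧ G x = z) (σ.arrs aLAB) (σ.arrs aLO)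
      (σ.arrs aHI))
    (hQ : ∀ τ s g', Frame mergeTo σ τ → τ.vars vg = g' → 1 ≤ g' → g' ≤ n →
      s + 100 * g' + 20 * partitionWeight n (σ.arrs aLAB) (σ.arrs aLO) (σ.arrs aHI) ≤
        t + 20 + 100 * g + 20 * partitionWeight n (τ.arrs aLAB) (τ.arrs aLO) (τ.arrs aHI) →
      (∀ x, g' ≤ x → x < n → l < hh (G x)) →
      IsPartition n (fun z => ∃ x, g' ≤ x ∧ x < n ∧ G x = z) (τ.arrs aLAB) (τ.arrs aLO)
        (τ.arrs aHI) →
      IsPartition n (fun z => l < hh z) (τ.arrs aLAB) (τ.arrs aLO) (τ.arrs aHI) → Q τ s) :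
    wp M mergeTo Q σ t := by
  obtain ⟨h1, hlen, hL, hB⟩ := id hM
  generalize hW : partitionWeight n (σ.arrs aLAB) (σ.arrs aLO) (σ.arrs aHI) = W at hQ
  have hG0 : hh (G 0) = 0 := by
    obtain ⟨x, hx, he⟩ := hs.perm.surj h1
    rcases Nat.eq_zero_or_pos x with rfl | hx0
    · rw [he, h0]
    · have := hs.mono 0 x hx0 hx
      rw [he, h0] at this
      omega
  have key : wp M mergeTo (fun τ s => ∃ g', τ.vars vg = g' ∧ 1 ≤ g' ∧ g' ≤ n ∧
      s + 100 * g' + 20 * W ≤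
        t + 20 + 100 * g + 20 * partitionWeight n (τ.arrs aLAB) (τ.arrs aLO) (τ.arrs aHI) ∧
      (∀ x, g' ≤ x → x < n → l < hh (G x)) ∧
      IsPartition n (fun z => ∃ x, g' ≤ x ∧ x < n ∧ G x = z) (τ.arrs aLAB) (τ.arrs aLO)
        (τ.arrs aHI) ∧
      IsPartition n (fun z => l < hh z) (τ.arrs aLAB) (τ.arrs aLO) (τ.arrs aHI)) σ t := by
    unfold mergeTo
    refine wp_while (fun τ s => 1 ≤ τ.vars vg ∧ τ.vars vg ≤ n ∧
      s + 100 * τ.vars vg + 20 * W ≤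
        t + 100 * g + 20 * partitionWeight n (τ.arrs aLAB) (τ.arrs aLO) (τ.arrs aHI) ∧
      (∀ x, τ.vars vg ≤ x → x < n → l < hh (G x)) ∧
      IsPartition n (fun z => ∃ x, τ.vars vg ≤ x ∧ x < n ∧ G x = z) (τ.arrs aLAB) (τ.arrs aLO)
        (τ.arrs aHI)) (fun τ => τ.vars vg) ?_ ?_
    · rw [hg, hW]
      exact ⟨hg1, hgn, le_rfl, hdone, h⟩
    · rintro τ s hf ⟨k1, kn, ks, kd, kp⟩
      have e1 : τ.vars vthr = l := (hf.1 vthr (by decide)).trans hl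
      have e2 : τ.arrs aHH = hh := (hf.2 aHH (by decide)).trans hhh
      have e3 : τ.arrs aRB = G := (hf.2 aRB (by decide)).trans hG
      clear hf
      generalize hk : τ.vars vg = k at *
      have hGk := hs.perm.1 (k - 1) (by omega)
      refine ⟨?_, fun hc => ?_, fun hc => ?_⟩
      · simp only [Expr.ok, Expr.val, hk, e3, app_sub]
        exact ⟨by simp, trivial, ⟨⟨by simp, trivial, trivial⟩, by omega⟩, by omega⟩
      · simp only [Expr.val, hk, e1, e2, e3, app_sub, app_lt_eq_zero, not_lt] at hc
        refine ⟨k, rfl, k1, kn, by simp only [Expr.cost]; omega, kd, kp, ?_⟩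
        refine kp.congr fun z hz0 hzn => ⟨fun hz => ?_, ?_⟩
        · obtain ⟨x, hx, rfl⟩ := hs.perm.surj hzn
          refine ⟨x, ?_, hx, rfl⟩
          by_contra hxk
          rcases Nat.lt_or_ge x (k - 1) with hlt | hge
          · have := hs.mono x (k - 1) hlt (by omega)
            omega
          · rw [show x = k - 1 by omega] at hz
            omega
        · rintro ⟨x, hx, hxn, rfl⟩
          exact kd x hx hxn
      · simp only [Expr.val, hk, e1, e2, e3, app_sub, app_lt_eq_zero, ne_eq, not_not] at hc
        have hk2 : 2 ≤ k := by
          by_contra hlt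
          rw [show k - 1 = 0 by omega, hG0] at hc
          omega
        refine ⟨⟨by simp, trivial, trivial⟩, by simp only [Expr.val, app_sub, hk]; omega, ?_⟩
        refine ⟨⟨trivial, by simp [hk]; omega⟩, by simp [hk, e3]; omega, ?_⟩
        generalize hσ' : (Store.setVar _ vb _) = σ'
        have c1 : σ'.vars vb = G (k - 1) := by rw [← hσ']; simp [hk, e3]
        have c2 : σ'.vars vg = k - 1 := by rw [← hσ']; simp [hk]
        have c3 : σ'.arrs = τ.arrs := by rw [← hσ']; rfl
        have hne : ¬ ∃ x, k ≤ x ∧ x < n ∧ G x = G (k - 1) := by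
          rintro ⟨x, hx, hxn, he⟩
          have := hs.perm.2 x hxn (k - 1) (by omega) he
          omega
        refine wp_mergeAt hM c1 ?_ hGk hne (by rw [c3]; exact kp) ?_
        · by_contra h'
          rw [show G (k - 1) = 0 by omega, h0] at hc
          omega
        · intro τ' s' hf hs' hp
          have c4 : τ'.vars vg = k - 1 := (hf.1 vg (by decide)).trans c2
          rw [c3] at hs'
          simp only [Expr.cost] at hs'
          rw [c4]
          refine ⟨⟨by omega, by omega, by omega, fun x hx hxn => ?_, hp.congr fun z _ _ => ?_⟩,
            by omega⟩
          · rcases Nat.lt_or_ge x k with hlt | hge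
            · rwa [show x = k - 1 by omega]
            · exact kd x hge hxn
          · constructor
            · rintro ⟨x, hx, hxn, he⟩
              rcases Nat.lt_or_ge x k with hlt | hge
              · exact Or.inr (by rw [← he, show x = k - 1 by omega])
              · exact Or.inl ⟨x, hge, hxn, he⟩
            · rintro (⟨x, hx, hxn, he⟩ | rfl)
              · exact ⟨x, by omega, hxn, he⟩
              · exact ⟨k - 1, le_rfl, by omega, rfl⟩
  refine wp_mono ?_ (wp_frame key)
  rintro τ s ⟨⟨g', a1, a2, a3, a4, a5, a6, a7⟩, hf⟩
  exact hQ τ s g' hf a1 a2 a3 a4 a5 a6 a7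

/-! ### Light pairs of positions -/

theorem SameClass.trans {hh : ℕ → ℕ} {d x y z : ℕ} (h : SameClass hh d x y)
    (h' : SameClass hh d y z) : SameClass hh d x z := by
  intro w hw
  by_cases h1 : (x < w ∧ w ≤ y) ∨ (y < w ∧ w ≤ x)
  · exact h w h1
  · exact h' w (by omega)

theorem leafCount_congr {hh : ℕ → ℕ} {n m d x y : ℕ} (h : SameClass hh d x y) :
    leafCount hh n m d x = leafCount hh n m d y := by
  unfold leafCount
  congr 1
  ext z
  simp only [Finset.mem_filter]
  exact and_congr_right fun _ => and_congr_left fun _ =>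
    ⟨fun h1 => h.symm.trans h1, fun h1 => h.trans h1⟩

theorem isLightAt_congr {hh : ℕ → ℕ} {n m d x y : ℕ} (h : SameClass hh (d + 1) x y) :
    IsLightAt hh n m d x ↔ IsLightAt hh n m d y := by
  unfold IsLightAt
  rw [leafCount_congr h, leafCount_congr (h.mono (Nat.le_succ d))]

theorem IsSuffixArray.agree_sa_iff {n : ℕ} {T sa rk hh : ℕ → ℕ} (h : IsSuffixArray n T sa rk hh)
    {d x y : ℕ} (hxy : x ≤ y) (hy : y < n) : Agree T d (sa x) (sa y) ↔ SameClass hh d x y := by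
  constructor
  · intro ha z hz
    have h1 := h.between d x (z - 1) y (by omega) (by omega) hy ha
    have h2 := h.between d x z y (by omega) (by omega) hy ha
    exact (h.lcp z (by omega) (by omega) d).mp (h1.symm.trans h2)
  · intro hs
    induction y, hxy using Nat.le_induction with
    | base => exact Agree.refl _ _ _
    | succ y hxy ih =>
      have h1 := ih (by omega) fun z hz => hs z (by omega)
      refine h1.trans ?_
      have h2 := (h.lcp (y + 1) (by omega) hy d).mpr (hs (y + 1) (by omega))
      simpa using h2

/-- The classes of suffixes with a common prefix are intervals of the suffix array. -/
theorem IsSuffixArray.agree_iff {n : ℕ} {T sa rk hh : ℕ → ℕ} (h : IsSuffixArray n T sa rk hh)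
    {d i j : ℕ} (hi : i < n) (hj : j < n) : Agree T d i j ↔ SameClass hh d (rk i) (rk j) := by
  rcases le_total (rk i) (rk j) with hle | hle
  · rw [← h.agree_sa_iff hle (h.rk_lt j hj), h.sa_rk i hi, h.sa_rk j hj]
  · have := h.agree_sa_iff (d := d) hle (h.rk_lt i hi)
    rw [h.sa_rk i hi, h.sa_rk j hj] at this
    exact ⟨fun ha => (this.mp ha.symm).symm, fun hs => (this.mpr hs.symm).symm⟩

theorem one_le_leafCount {hh : ℕ → ℕ} {n m d x : ℕ} (h0 : hh 0 = 0) (hd : d ≤ m) (hx : x < n) :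
    1 ≤ leafCount hh n m d x := by
  classical
  have hex : ∃ c, SameClass hh d x c := ⟨x, SameClass.refl _ _ _⟩
  have h1 := Nat.find_spec hex
  have h2 : Nat.find hex ≤ x := Nat.find_min' hex (SameClass.refl _ _ _)
  refine Finset.card_pos.mpr ⟨Nat.find hex, ?_⟩
  simp only [Finset.mem_filter, Finset.mem_range]
  refine ⟨by omega, h1, ?_⟩
  by_contra hc
  have h3 : 0 < Nat.find hex := by
    rcases Nat.eq_zero_or_pos (Nat.find hex) with h | h
    · rw [h] at hc; omega
    · exact h
  refine Nat.find_min hex (m := Nat.find hex - 1) (by omega) (h1.trans fun z hz => ?_)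
  rw [show z = Nat.find hex by omega]
  omega

theorem leafCount_le (hh : ℕ → ℕ) (n m d x : ℕ) : leafCount hh n m d x ≤ n := by
  classical
  exact (Finset.card_filter_le _ _).trans (by simp)

open Classical in
/-- Every step of a path into a light child halves the number of leaves, so that a path contains
at most `log n` light edges. -/
theorem card_isLightAt_le {hh : ℕ → ℕ} {n m x : ℕ} (h0 : hh 0 = 0) (hx : x < n) :
    ((Finset.range m).filter fun d => IsLightAt hh n m d x).card ≤ Nat.log 2 n := by
  have key : ∀ k ≤ m, ((Finset.range k).filter fun d => IsLightAt hh n m d x).card +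
      Nat.log 2 (leafCount hh n m k x) ≤ Nat.log 2 n := by
    intro k
    induction k with
    | zero =>
      intro _
      simpa using Nat.log_mono_right (leafCount_le hh n m 0 x)
    | succ k ih =>
      intro hk
      have h1 := ih (by omega)
      have h2 := one_le_leafCount (hh := hh) (n := n) h0 hk hx
      rw [Finset.range_add_one, Finset.filter_insert]
      split_ifs with hl
      · rw [Finset.card_insert_of_notMem (by simp)]
        have h3 : Nat.log 2 (leafCount hh n m (k + 1) x) + 1 ≤
            Nat.log 2 (leafCount hh n m k x) := by
          rw [← Nat.log_mul_base (by norm_num) (by omega), mul_comm]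
          exact Nat.log_mono_right hl
        omega
      · have h3 : leafCount hh n m (k + 1) x ≤ leafCount hh n m k x := by
          refine Finset.card_le_card fun y hy => ?_
          simp only [Finset.mem_filter] at hy ⊢
          exact ⟨hy.1, hy.2.1.mono (Nat.le_succ k), hy.2.2⟩
        have := Nat.log_mono_right (b := 2) h3
        omega
  have := key m le_rfl
  omega

namespace IsBoundaryTree

variable {n : ℕ} {hh pe rr nx : ℕ → ℕ}

theorem exists_isFirstOf (ht : IsBoundaryTree n hh pe rr nx) (h0 : hh 0 = 0)
    (hpos : ∀ x, 0 < x → x < n → 0 < hh x) (b : ℕ) (hb0 : 0 < b) (hbn : b < n) :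
    ∃ f, IsFirstOf hh pe rr f b := by
  induction b using Nat.strong_induction_on with
  | _ b ih =>
    by_cases hc : hh (pe b) < hh b
    · exact ⟨b, isFirstOf_self hb0 hc⟩
    · have h1 := ht.pe_lt b hb0 hbn
      have h2 : 0 < pe b := by
        rcases Nat.eq_zero_or_pos (pe b) with h | h
        · have := hpos b hb0 hbn
          rw [h, h0] at hc
          omega
        · exact h
      obtain ⟨f, hf⟩ := ih (pe b) h1 h2 (by omega)
      exact ⟨f, ht.isFirstOf_step hb0 hbn hc hf⟩

/-- A node is determined by its depth and one of the suffixes below it. -/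
theorem first_unique (ht : IsBoundaryTree n hh pe rr nx) {f f' x : ℕ} (hf0 : 0 < f) (hfn : f < n)
    (hf : IsFirst hh pe f) (hf0' : 0 < f') (hfn' : f' < n) (hf' : IsFirst hh pe f')
    (he : hh f = hh f') (h1 : pe f ≤ x) (h2 : x < rr f) (h1' : pe f' ≤ x) (h2' : x < rr f') :
    f = f' := by
  have key : ∀ y, pe f ≤ y ∧ y < rr f ↔ pe f' ≤ y ∧ y < rr f' := fun y => by
    rw [← ht.sameClass_iff hf0 hfn hf h1 h2, ← ht.sameClass_iff hf0' hfn' hf' h1' h2', he]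
  have k1 := (key (pe f)).mp (by omega)
  have k2 := (key (pe f')).mpr (by omega)
  have k3 : pe f = pe f' := by omega
  have g1 := ht.pe_lt f hf0 hfn
  have g2 := ht.pe_lt f' hf0' hfn'
  rcases lt_trichotomy f f' with h | h | h
  · have := ht.pe_gap f' hf0' hfn' f (by omega) h
    omega
  · exact h
  · have := ht.pe_gap f hf0 hfn f' (by omega) h
    omega

end IsBoundaryTree

/-- The boundary `b` is the first one of a node of depth less than `m`. -/
def IsActive (m : ℕ) (hh pe : ℕ → ℕ) (b : ℕ) : Prop :=
  0 < b ∧ IsBoundaryTree.IsFirst hh pe b ∧ hh b ≤ m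

/-- The suffix number `x` passes through the node with first boundary `b`. -/
def IsInside (pe rr : ℕ → ℕ) (b x : ℕ) : Prop := pe b ≤ x ∧ x < rr b

open Classical in
/-- The number of the suffixes below a light child of the node with first boundary `b`. -/
noncomputable def lightSize (hh : ℕ → ℕ) (n m : ℕ) (pe rr : ℕ → ℕ) (b : ℕ) : ℕ :=
  if IsActive m hh pe b then
    ((Finset.range n).filter fun x => IsInside pe rr b x ∧ IsLightAt hh n m (hh b - 1) x).card
  else 0

open Classical in
/-- A suffix passes through at most `log n` light edges, each of which at least halves the
number of leaves. -/
theorem sum_lightSize_le {n m : ℕ} {hh pe rr nx : ℕ → ℕ} (ht : IsBoundaryTree n hh pe rr nx)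
    (h0 : hh 0 = 0) : ∑ b ∈ Finset.range n, lightSize hh n m pe rr b ≤ n * Nat.log 2 n := by
  have h1 : ∀ b, lightSize hh n m pe rr b = ∑ x ∈ Finset.range n,
      if IsActive m hh pe b ∧ IsInside pe rr b x ∧ IsLightAt hh n m (hh b - 1) x then 1 else 0 := by
    intro b
    unfold lightSize
    split_ifs with h
    · simp only [h, true_and, Finset.card_filter]
    · simp [h]
  simp only [h1]
  rw [Finset.sum_comm]
  calc _ ≤ ∑ x ∈ Finset.range n, Nat.log 2 n := by
        refine Finset.sum_le_sum fun x hx => ?_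
        have hx := Finset.mem_range.mp hx
        rw [← Finset.card_filter]
        refine le_trans ?_ (card_isLightAt_le (m := m) h0 hx)
        refine Finset.card_le_card_of_injOn (fun b => hh b - 1) (fun b hb => ?_) ?_
        · simp only [Finset.coe_filter, Finset.mem_range, Set.mem_ofPred_eq] at hb ⊢
          obtain ⟨-, ⟨h2, h3, h4⟩, -, h5⟩ := hb
          unfold IsBoundaryTree.IsFirst at h3
          exact ⟨by omega, h5⟩
        · intro b hb b' hb' he
          simp only [Finset.coe_filter, Finset.mem_range, Set.mem_ofPred_eq] at hb hb' he
          obtain ⟨hbn, ⟨h2, h3, -⟩, h5, -⟩ := hb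
          obtain ⟨hbn', ⟨h2', h3', -⟩, h5', -⟩ := hb'
          refine ht.first_unique h2 hbn h3 h2' hbn' h3' ?_ h5.1 h5.2 h5'.1 h5'.2
          unfold IsBoundaryTree.IsFirst at h3 h3'
          omega
    _ = n * Nat.log 2 n := by simp

/-- The factors of length `m` at the positions `i` and `j` differ exactly in their letters number
`d`, and both suffixes pass through light edges at their common prefix of length `d`. -/
structure LightPair (n m : ℕ) (T rk hh : ℕ → ℕ) (d i j : ℕ) : Prop where
  le_left : i + m ≤ n
  le_right : j + m ≤ n
  lt : d < m
  agree : Agree T d i j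
  ne : T (i + d) ≠ T (j + d)
  tail : Agree T (m - (d + 1)) (i + (d + 1)) (j + (d + 1))
  light_left : IsLightAt hh n m d (rk i)
  light_right : IsLightAt hh n m d (rk j)

theorem LightPair.depth_unique {n m : ℕ} {T rk hh : ℕ → ℕ} {d d' i j : ℕ}
    (h : LightPair n m T rk hh d i j) (h' : LightPair n m T rk hh d' i j) : d = d' := by
  rcases lt_trichotomy d d' with hlt | he | hlt
  · exact absurd (h'.agree d hlt) h.ne
  · exact he
  · exact absurd (h.agree d' hlt) h'.ne

theorem LightPair.exists_active {n m : ℕ} {T sa rk hh pe rr nx : ℕ → ℕ} (hm : 1 ≤ m)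
    (hA : IsSuffixArray n T sa rk hh) (hl : hh n = 0) (ht : IsBoundaryTree n hh pe rr nx)
    {d i j : ℕ} (h : LightPair n m T rk hh d i j) :
    ∃ b < n, IsActive m hh pe b ∧ hh b = d + 1 ∧ IsInside pe rr b (rk i) := by
  have hi : i < n := by have := h.le_left; omega
  have hj : j < n := by have := h.le_right; omega
  have hL := hA.isLcpArray hl
  have h1 := (hA.agree_iff hi hj).mp h.agree
  have h2 : ¬ SameClass hh (d + 1) (rk i) (rk j) := fun h2 => by
    have := (hA.agree_iff hi hj).mpr h2
    exact h.ne (this d (by omega))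
  simp only [SameClass, not_forall, not_lt] at h2
  obtain ⟨z, hz, hzd⟩ := h2
  have hzd' := h1 z hz
  have hri := hA.rk_lt i hi
  have hrj := hA.rk_lt j hj
  have hzn : z < n := by omega
  obtain ⟨f, hf⟩ := ht.exists_isFirstOf hL.zero hL.pos z (by omega) hzn
  have hf1 := hf.le
  have hf2 := hf.eq
  have hfn : f < n := by omega
  have hzin : IsInside pe rr f z := by
    have g1 := ht.pe_lt f hf.pos hfn
    have g2 := ht.lt_rr z (by omega) hzn
    exact ⟨by omega, by rw [hf.rr_eq]; exact g2⟩
  refine ⟨f, hfn, ⟨hf.pos, hf.first, by have := h.lt; omega⟩, by omega, ?_⟩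
  rw [IsInside, ← ht.sameClass_iff hf.pos hfn hf.first hzin.1 hzin.2]
  intro w hw
  have := h1 w
  rcases hz with hz | hz <;> exact lt_of_le_of_lt (by omega) (this (by omega))

/-- The tables tell which suffixes lie below light children of a node. -/
theorem IsHeavyTree.isLightAt_iff {n m : ℕ} {hh pe rr nx hs he : ℕ → ℕ}
    (ht : IsHeavyTree n m hh pe rr nx hs he) {b : ℕ} (hbn : b < n) (hb : IsActive m hh pe b)
    {x : ℕ} (hx : IsInside pe rr b x) :
    IsLightAt hh n m (hh b - 1) x ↔ ¬ (hs b ≤ x ∧ x < he b) :=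
  ht.light_iff b hb.1 hbn hb.2.1 x hx.1 hx.2

/-- The positions whose factors of length `m` pass through a light child of the node with first
boundary `b`. -/
def lightPositions (n m : ℕ) (rk hh pe rr : ℕ → ℕ) (b : ℕ) : Set ℕ :=
  {i | i + m ≤ n ∧ IsInside pe rr b (rk i) ∧ IsLightAt hh n m (hh b - 1) (rk i)}

/-- The light pairs at a node, among all pairs of factors that agree behind the letter in which
they branch: those with equal factors have to be subtracted. -/
theorem ncard_lightPair {n m : ℕ} {T sa rk hh pe rr nx : ℕ → ℕ} (hm : 1 ≤ m)
    (hA : IsSuffixArray n T sa rk hh) (ht : IsBoundaryTree n hh pe rr nx)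
    {b i : ℕ} (hbn : b < n) (hb : IsActive m hh pe b)
    (hi : i ∈ lightPositions n m rk hh pe rr b) :
    {j | LightPair n m T rk hh (hh b - 1) i j}.ncard + {j | j + m ≤ n ∧ Agree T m i j}.ncard =
      {j | j ∈ lightPositions n m rk hh pe rr b ∧
        Agree T (m - hh b) (i + hh b) (j + hh b)}.ncard := by
  obtain ⟨hb0, hbf, hbm⟩ := hb
  obtain ⟨hi1, hi2, hi3⟩ := hi
  have hin : i < n := by omega
  have hpos : hh b - 1 + 1 = hh b := by unfold IsBoundaryTree.IsFirst at hbf; omega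
  have fin : ∀ s : Set ℕ, (∀ j ∈ s, j + m ≤ n) → s.Finite := fun s hs =>
    (Set.finite_Iio (n + 1)).subset fun j hj => by have := hs j hj; simp only [Set.mem_Iio]; omega
  have hinside : ∀ j < n, Agree T (hh b - 1) i j ↔ IsInside pe rr b (rk j) := fun j hj => by
    rw [hA.agree_iff hin hj, ht.sameClass_iff hb0 hbn hbf hi2.1 hi2.2, IsInside]
  rw [← Set.ncard_union_eq ?_ (fin _ fun j hj => hj.le_right) (fin _ fun j hj => hj.1)]
  · congr 1
    ext j
    simp only [Set.mem_union, Set.mem_ofPred_eq]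
    constructor
    · rintro (h | ⟨h1, h2⟩)
      · have hjn : j < n := by have := h.le_right; omega
        refine ⟨⟨h.le_right, (hinside j hjn).mp h.agree, h.light_right⟩, ?_⟩
        have := h.tail
        rwa [hpos] at this
      · have hjn : j < n := by omega
        refine ⟨⟨h1, (hinside j hjn).mp (h2.mono (by omega)), ?_⟩, ?_⟩
        · refine (isLightAt_congr ?_).mp hi3
          rw [hpos, ← hA.agree_iff hin hjn]
          exact h2.mono hbm
        · have : m = hh b + (m - hh b) := by omega
          rw [this, agree_add] at h2
          exact h2.2
    · rintro ⟨⟨h1, h2, h3⟩, h4⟩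
      have hjn : j < n := by omega
      have h5 := (hinside j hjn).mpr h2
      by_cases hc : T (i + (hh b - 1)) = T (j + (hh b - 1))
      · right
        refine ⟨h1, ?_⟩
        rw [show m = hh b + (m - hh b) by omega, agree_add]
        refine ⟨?_, h4⟩
        rw [← hpos, agree_succ]
        exact ⟨h5, hc⟩
      · left
        exact ⟨hi1, h1, by omega, h5, hc, by rwa [hpos], hi3, h3⟩
  · rw [Set.disjoint_left]
    rintro j h ⟨-, h2⟩
    exact h.ne (h2 _ (by omega))

/-- The pairs that are accounted for by the nodes that satisfy `R`. -/
def countedPairs (n m : ℕ) (T rk hh pe rr : ℕ → ℕ) (R : ℕ → Prop) (i : ℕ) : Set ℕ :=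
  {j | ∃ b < n, R b ∧ IsActive m hh pe b ∧ IsInside pe rr b (rk i) ∧
    LightPair n m T rk hh (hh b - 1) i j}

theorem countedPairs_finite {n m : ℕ} {T rk hh pe rr : ℕ → ℕ} {R : ℕ → Prop} {i : ℕ} :
    (countedPairs n m T rk hh pe rr R i).Finite :=
  (Set.finite_Iio (n + 1)).subset fun j ⟨b, _, _, _, _, hj⟩ => by
    have := hj.le_right
    simp only [Set.mem_Iio]
    omega

theorem ncard_countedPairs_le {n m : ℕ} {T rk hh pe rr : ℕ → ℕ} {R : ℕ → Prop} {i : ℕ}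
    (hm : 1 ≤ m) : (countedPairs n m T rk hh pe rr R i).ncard ≤ n := by
  have h : countedPairs n m T rk hh pe rr R i ⊆ ↑(Finset.range n) := fun j ⟨b, _, _, _, _, hj⟩ => by
    have := hj.le_right
    simp only [Finset.coe_range, Set.mem_Iio]
    omega
  have := Set.ncard_le_ncard h (Finset.finite_toSet _)
  rwa [Set.ncard_coe_finset, Finset.card_range] at this

theorem countedPairs_congr {n m : ℕ} {T rk hh pe rr : ℕ → ℕ} {R R' : ℕ → Prop} {i : ℕ}
    (h : ∀ b < n, IsActive m hh pe b → IsInside pe rr b (rk i) →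
      IsLightAt hh n m (hh b - 1) (rk i) → i + m ≤ n → (R b ↔ R' b)) :
    countedPairs n m T rk hh pe rr R i = countedPairs n m T rk hh pe rr R' i := by
  ext j
  constructor
  · rintro ⟨b, h1, h2, h3, h4, h5⟩
    exact ⟨b, h1, (h b h1 h3 h4 h5.light_left h5.le_left).mp h2, h3, h4, h5⟩
  · rintro ⟨b, h1, h2, h3, h4, h5⟩
    exact ⟨b, h1, (h b h1 h3 h4 h5.light_left h5.le_left).mpr h2, h3, h4, h5⟩

theorem ncard_countedPairs_add {n m : ℕ} {T rk hh pe rr nx : ℕ → ℕ}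
    (ht : IsBoundaryTree n hh pe rr nx) {R : ℕ → Prop} {b i : ℕ} (hbn : b < n)
    (hb : IsActive m hh pe b) (hR : ¬ R b) (hi : i ∈ lightPositions n m rk hh pe rr b) :
    (countedPairs n m T rk hh pe rr (fun c => R c ∨ c = b) i).ncard =
      (countedPairs n m T rk hh pe rr R i).ncard +
        {j | LightPair n m T rk hh (hh b - 1) i j}.ncard := by
  have fin : {j | LightPair n m T rk hh (hh b - 1) i j}.Finite :=
    (Set.finite_Iio (n + 1)).subset fun j hj => by
      have := LightPair.le_right hj
      simp only [Set.mem_Iio]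
      omega
  rw [← Set.ncard_union_eq ?_ countedPairs_finite fin]
  · congr 1
    ext j
    constructor
    · rintro ⟨c, h1, h2 | rfl, h3, h4, h5⟩
      · exact Or.inl ⟨c, h1, h2, h3, h4, h5⟩
      · exact Or.inr h5
    · rintro (⟨c, h1, h2, h3, h4, h5⟩ | h)
      · exact ⟨c, h1, Or.inl h2, h3, h4, h5⟩
      · exact ⟨b, hbn, Or.inr rfl, hb, hi.2.1, h⟩
  · rw [Set.disjoint_left]
    rintro j ⟨c, h1, h2, h3, h4, h5⟩ h
    refine hR ?_
    have he : hh c - 1 = hh b - 1 := h5.depth_unique h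
    have g1 := h3.2.1
    have g2 := hb.2.1
    unfold IsBoundaryTree.IsFirst at g1 g2
    rwa [← ht.first_unique h3.1 h1 h3.2.1 hb.1 hbn hb.2.1 (by omega) h4.1 h4.2 hi.2.1.1 hi.2.1.2]

/-! ### Counting the light pairs at a node -/

-- Answers are collected in `aANS`. The number of listed positions of a class is `aSUM`, the number
-- of occurrences of the factor of length `m` at a position is `aOCC`. The list is in `aQ`, its
-- length is `vq`; `vf` is the first boundary of the current node, which has number `vy`.

notation "aANS" => (0 : ℕ)
notation "aSUM" => (25 : ℕ)
notation "aOCC" => (26 : ℕ)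
notation "aQ" => (27 : ℕ)
notation "vq" => (14 : ℕ)
notation "ve" => (15 : ℕ)
notation "vl" => (16 : ℕ)
notation "vf" => (17 : ℕ)
notation "vy" => (18 : ℕ)

/-- The first `q` cells of `A` list the elements of `X`, without repetitions. -/
structure Lists (q : ℕ) (A : ℕ → ℕ) (X : Set ℕ) : Prop where
  inj : ∀ a < q, ∀ b < q, A a = A b → a = b
  mem_iff : ∀ i, i ∈ X ↔ ∃ a < q, A a = i

theorem Lists.congr {q : ℕ} {A : ℕ → ℕ} {X Y : Set ℕ} (h : Lists q A X)
    (hXY : ∀ i, i ∈ Y ↔ i ∈ X) : Lists q A Y :=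
  ⟨h.inj, fun i => (hXY i).trans (h.mem_iff i)⟩

theorem Lists.push {q y : ℕ} {A : ℕ → ℕ} {X Y : Set ℕ} (h : Lists q A X) (hy : y ∉ X)
    (hY : ∀ i, i ∈ Y ↔ i ∈ X ∨ i = y) : Lists (q + 1) (Function.update A q y) Y := by
  have hA : ∀ a < q, Function.update A q y a = A a := fun a ha =>
    Function.update_of_ne (by omega) _ _
  refine ⟨fun a ha b hb hab => ?_, fun i => ?_⟩
  · rcases eq_or_lt_of_le (Nat.lt_succ_iff.mp ha) with rfl | ha' <;>
      rcases eq_or_lt_of_le (Nat.lt_succ_iff.mp hb) with rfl | hb'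
    · rfl
    · rw [Function.update_self, hA b hb'] at hab
      exact absurd ((h.mem_iff y).mpr ⟨b, hb', hab.symm⟩) hy
    · rw [Function.update_self, hA a ha'] at hab
      exact absurd ((h.mem_iff y).mpr ⟨a, ha', hab⟩) hy
    · rw [hA a ha', hA b hb'] at hab
      exact h.inj a ha' b hb' hab
  · rw [hY, h.mem_iff]
    constructor
    · rintro (⟨a, ha, rfl⟩ | rfl)
      · exact ⟨a, by omega, hA a ha⟩
      · exact ⟨q, by omega, Function.update_self ..⟩
    · rintro ⟨a, ha, rfl⟩
      rcases eq_or_lt_of_le (Nat.lt_succ_iff.mp ha) with rfl | ha'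
      · exact Or.inr (Function.update_self ..)
      · exact Or.inl ⟨a, ha', (hA a ha').symm⟩

theorem Lists.le {q n : ℕ} {A : ℕ → ℕ} {X : Set ℕ} (h : Lists q A X) (hX : ∀ i ∈ X, i < n) :
    q ≤ n := by
  have := Finset.card_le_card_of_injOn (s := Finset.range q) (t := Finset.range n) A
    (fun a ha => by
      simp only [Finset.coe_range, Set.mem_Iio] at ha ⊢
      exact hX _ ((h.mem_iff _).mpr ⟨a, ha, rfl⟩))
    (fun a ha b hb => by
      simp only [Finset.coe_range, Set.mem_Iio] at ha hb
      exact h.inj a ha b hb)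
  simpa using this

theorem Lists.card_filter {q : ℕ} {A : ℕ → ℕ} {X : Set ℕ} (h : Lists q A X) (key : ℕ → ℕ) (c : ℕ) :
    ((Finset.range q).filter fun r => key (A r) = c).card = {j | j ∈ X ∧ key j = c}.ncard := by
  have : {j | j ∈ X ∧ key j = c} = A '' ↑((Finset.range q).filter fun r => key (A r) = c) := by
    ext j
    simp only [Set.mem_ofPred_eq, Set.mem_image, Finset.mem_coe, Finset.mem_filter,
      Finset.mem_range, h.mem_iff]
    constructor
    · rintro ⟨⟨a, ha, rfl⟩, hc⟩
      exact ⟨a, ⟨ha, hc⟩, rfl⟩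
    · rintro ⟨a, ⟨ha, hc⟩, rfl⟩
      exact ⟨⟨a, ha, rfl⟩, hc⟩
  rw [this, Set.InjOn.ncard_image, Set.ncard_coe_finset]
  intro a ha b hb
  simp only [Finset.mem_coe, Finset.mem_filter, Finset.mem_range] at ha hb
  exact h.inj a ha.1 b hb.1

/-- Appends to the list in `aQ` the positions of the suffixes number `lo`, ..., `hi - 1` at which
a factor of length `m` starts. -/
def gather (lo hi : Expr) : Prog :=
  .for vk lo hi (.ite (.var vN <ₑ .cell aSF (.var vk) +ₑ .var vM) .skip
    (.store aQ (.var vq) (.cell aSF (.var vk)) ;; .assign vq (.var vq +ₑ .const 1)))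

theorem wp_gather {M : Machine α} {n m a N : ℕ} (hM : M.Fits n) {σ : Store} {t : ℕ}
    {T sa rk hh : ℕ → ℕ} {lo hi : Expr} {R : ℕ → Prop} {Q : Store → ℕ → Prop}
    (hn : σ.vars vN = n) (hm : σ.vars vM = m) (hm1 : 1 ≤ m)
    (hsa : σ.arrs aSF = sa) (hA : IsSuffixArray n T sa rk hh)
    (hlo : lo.ok M σ) (hloa : lo.val M σ = a) (haN : a ≤ N) (hN : N ≤ n)
    (hlc : lo.cost ≤ 5) (hhc : hi.cost ≤ 5)
    (hhi : ∀ τ, Frame (gather lo hi) σ τ → hi.ok M τ ∧ hi.val M τ = N)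
    (hR : ∀ x, R x → x < a)
    (hL : Lists (σ.vars vq) (σ.arrs aQ) {i | i + m ≤ n ∧ R (rk i)})
    (hQ : ∀ τ s, Frame (gather lo hi) σ τ → s ≤ t + 20 + 50 * (N - a) →
      Lists (τ.vars vq) (τ.arrs aQ) {i | i + m ≤ n ∧ (R (rk i) ∨ a ≤ rk i ∧ rk i < N)} → Q τ s) :
    wp M (gather lo hi) Q σ t := by
  obtain ⟨h1, hlen, hcell, hB⟩ := id hM
  have key : wp M (gather lo hi) (fun τ s => s ≤ t + 20 + 50 * (N - a) ∧
      Lists (τ.vars vq) (τ.arrs aQ) {i | i + m ≤ n ∧ (R (rk i) ∨ a ≤ rk i ∧ rk i < N)}) σ t := by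
    unfold gather
    refine wp_for a N 30 (fun k τ => Lists (τ.vars vq) (τ.arrs aQ)
      {i | i + m ≤ n ∧ (R (rk i) ∨ a ≤ rk i ∧ rk i < k)}) hlo hloa haN (by omega) hhi (by decide)
      (fun k τ v h => by simpa using h) ?_ ?_ ?_
    · refine hL.congr fun i => ?_
      have : ¬ (a ≤ rk i ∧ rk i < a) := by omega
      simp [this]
    · intro k τ s hak hk hf hx hI
      have g1 : τ.vars vN = n := (hf.1 vN (by simp [Prog.for, Prog.wv])).trans hn
      have g2 : τ.vars vM = m := (hf.1 vM (by simp [Prog.for, Prog.wv])).trans hm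
      have g3 : τ.arrs aSF = sa := (hf.2 aSF (by simp [Prog.for, Prog.wa])).trans hsa
      clear hf
      have hkn : k < n := by omega
      have hq : τ.vars vq ≤ n := hI.le fun i hi => by
        have := hi.1
        omega
      have hsk := hA.sa_lt k hkn
      have hrs := hA.rk_sa k hkn
      -- the only new candidate is the position of the suffix number `k`
      have hnew : ∀ i, i + m ≤ n → (rk i = k ↔ i = sa k) := fun i hi =>
        ⟨fun h => by rw [← h, hA.sa_rk i (by omega)], fun h => by rw [h, hrs]⟩
      simp only [wp, Expr.ok, Expr.val, Expr.cost, hx, g1, g2, g3, setCell_arrs, setCell_vars,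
        setVar_arrs, setVar_vars, if_true, app_add, app_lt_eq_zero,
        ne_eq, not_not, reduceCtorEq, not_false_eq_true, true_and, and_true]
      refine ⟨by omega, fun hc => ⟨?_, by omega⟩, fun hc => ⟨by omega, by omega, by omega,
        by omega, ?_, by omega⟩⟩
      · refine hI.congr fun i => ?_
        simp only [Set.mem_ofPred_eq]
        refine and_congr_right fun hi => or_congr_right ?_
        have := hnew i hi
        constructor
        · rintro ⟨h2, h3⟩
          refine ⟨h2, lt_of_le_of_ne (by omega) fun h4 => ?_⟩
          rw [this.mp h4] at hi
          omega
        · rintro ⟨h2, h3⟩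
          exact ⟨h2, by omega⟩
      · refine hI.push ?_ fun i => ?_
        · rintro ⟨-, h2 | h2⟩
          · have := hR _ h2
            omega
          · omega
        · simp only [Set.mem_ofPred_eq]
          constructor
          · rintro ⟨h2, h3 | h3⟩
            · exact Or.inl ⟨h2, Or.inl h3⟩
            · rcases eq_or_ne (rk i) k with h4 | h4
              · exact Or.inr ((hnew i h2).mp h4)
              · exact Or.inl ⟨h2, Or.inr (by omega)⟩
          · rintro (⟨h2, h3 | h3⟩ | rfl)
            · exact ⟨h2, Or.inl h3⟩
            · exact ⟨h2, Or.inr (by omega)⟩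
            · exact ⟨by omega, Or.inr (by omega)⟩
    · intro τ s _ _ hI hs
      refine ⟨?_, hI⟩
      have : (30 + hi.cost + 7) * (N - a) ≤ 50 * (N - a) := Nat.mul_le_mul_right _ (by omega)
      omega
  refine wp_mono ?_ (wp_frame key)
  exact fun τ s h => hQ τ s h.2 h.1.1 h.1.2

/-- The part of the interval of the node `vf` that precedes the heavy child ends in `ve`, the part
behind it starts in `vl`. -/
def lightRanges : Prog :=
  .assign vq (.const 0) ;;
  .assign ve (.cell aRR (.var vf)) ;;
  .assign vl (.cell aRR (.var vf)) ;;
  .ite (.cell aHE (.var vf) =ₑ .const 0) .skip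
    (.assign ve (.cell aHS (.var vf)) ;; .assign vl (.cell aHE (.var vf)))

/-- Lists the positions whose factors pass through light children of the node `vf`. -/
def listLight : Prog :=
  lightRanges ;; gather (.cell aPE (.var vf)) (.var ve) ;; gather (.var vl) (.cell aRR (.var vf))

theorem wp_listLight {M : Machine α} {n m b : ℕ} (hM : M.Fits n) {σ : Store} {t : ℕ}
    {T rk hh pe rr nx hs he sa : ℕ → ℕ} {Q : Store → ℕ → Prop}
    (hn : σ.vars vN = n) (hm : σ.vars vM = m) (hm1 : 1 ≤ m)
    (hsa : σ.arrs aSF = sa) (hpe : σ.arrs aPE = pe) (hrr : σ.arrs aRR = rr)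
    (hhs : σ.arrs aHS = hs) (hhe : σ.arrs aHE = he) (hA : IsSuffixArray n T sa rk hh)
    (ht : IsHeavyTree n m hh pe rr nx hs he) (hb : σ.vars vf = b) (hbn : b < n)
    (hact : IsActive m hh pe b)
    (hQ : ∀ τ s, Frame listLight σ τ → s ≤ t + 100 + 50 * lightSize hh n m pe rr b →
      Lists (τ.vars vq) (τ.arrs aQ) (lightPositions n m rk hh pe rr b) → Q τ s) :
    wp M listLight Q σ t := by
  obtain ⟨h1, hlen, hcell, hB⟩ := id hM
  have hrn := ht.tree.rr_le b hact.1 hbn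
  have hpb := ht.tree.pe_lt b hact.1 hbn
  have hbr := ht.tree.lt_rr b hact.1 hbn
  have hhe' := ht.he_le b hact.1 hbn hact.2.1
  have key : wp M listLight (fun τ s => s ≤ t + 100 + 50 * lightSize hh n m pe rr b ∧
      Lists (τ.vars vq) (τ.arrs aQ) (lightPositions n m rk hh pe rr b)) σ t := by
    unfold listLight
    refine wp_mono (p := lightRanges) (Q := fun τ s => (s ≤ t + 40 ∧ τ.vars vq = 0 ∧
      pe b ≤ τ.vars ve ∧ τ.vars ve ≤ τ.vars vl ∧ τ.vars vl ≤ rr b ∧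
      ∀ x, pe b ≤ x → x < rr b → (¬ (hs b ≤ x ∧ x < he b) ↔ x < τ.vars ve ∨ τ.vars vl ≤ x)) ∧
      Frame lightRanges σ τ) ?_ (wp_frame ?_)
    · rintro τ1 s1 ⟨⟨hs1, hq1, hpe1, hel1, hlr1, hlight⟩, hf1⟩
      generalize hedef : τ1.vars ve = e at *
      generalize hldef : τ1.vars vl = l at *
      have c1 : τ1.vars vf = b := (hf1.1 vf (by decide)).trans hb
      have c2 : τ1.arrs aPE = pe := (hf1.2 aPE (by decide)).trans hpe
      have c3 : τ1.vars vN = n := (hf1.1 vN (by decide)).trans hn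
      have c4 : τ1.vars vM = m := (hf1.1 vM (by decide)).trans hm
      have c5 : τ1.arrs aSF = sa := (hf1.2 aSF (by decide)).trans hsa
      have c6 : τ1.arrs aRR = rr := (hf1.2 aRR (by decide)).trans hrr
      refine wp_gather hM (R := fun _ => False) (a := pe b) (N := e) c3 c4 hm1 c5 hA
        ⟨trivial, by simp only [Expr.val, c1]; omega⟩ (by simp only [Expr.val, c1, c2]) hpe1
        (by omega) (by simp) (by simp) ?_ (by simp) ?_ ?_
      · intro τ hf
        exact ⟨trivial, (hf.1 ve (by decide)).trans hedef⟩
      · exact ⟨fun a ha => by omega, fun i => by simp [hq1]⟩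
      · intro τ2 s2 hf2 hs2 hL2
        have d1 : τ2.vars vf = b := (hf2.1 vf (by decide)).trans c1
        have d2 : τ2.arrs aRR = rr := (hf2.2 aRR (by decide)).trans c6
        refine wp_gather hM (R := fun x => pe b ≤ x ∧ x < e) (a := l) (N := rr b)
          ((hf2.1 vN (by decide)).trans c3) ((hf2.1 vM (by decide)).trans c4) hm1
          ((hf2.2 aSF (by decide)).trans c5) hA trivial
          ((hf2.1 vl (by decide)).trans hldef) hlr1
          (by omega) (by simp) (by simp) ?_ (fun x hx => by omega) ?_ ?_
        · intro τ hf
          have e1 : τ.vars vf = b := (hf.1 vf (by decide)).trans d1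
          have e2 : τ.arrs aRR = rr := (hf.2 aRR (by decide)).trans d2
          simp only [Expr.ok, Expr.val, e1, e2, true_and, and_true]
          omega
        · simpa using hL2
        · intro τ s hf hs hL
          have hsize : lightSize hh n m pe rr b = (e - pe b) + (rr b - l) := by
            classical
            rw [lightSize, if_pos hact, ← Nat.card_Ico (pe b) e, ← Nat.card_Ico l,
              ← Finset.card_union_of_disjoint]
            · congr 1
              ext x
              simp only [Finset.mem_filter, Finset.mem_range, Finset.mem_union, Finset.mem_Ico]
              constructor
              · rintro ⟨g1, g2, g3⟩
                rw [ht.isLightAt_iff hbn hact g2, hlight x g2.1 g2.2] at g3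
                have := g2.1
                have := g2.2
                omega
              · intro g
                have g2 : IsInside pe rr b x := ⟨by omega, by omega⟩
                refine ⟨by omega, g2, ?_⟩
                rw [ht.isLightAt_iff hbn hact g2, hlight x g2.1 g2.2]
                omega
            · rw [Finset.disjoint_left]
              intro x hx hx'
              rw [Finset.mem_Ico] at hx hx'
              omega
          refine ⟨by omega, ?_⟩
          refine hL.congr fun i => ?_
          simp only [lightPositions, Set.mem_ofPred_eq]
          refine and_congr_right fun hi => ?_
          constructor
          · rintro ⟨g2, g3⟩
            rw [ht.isLightAt_iff hbn hact g2, hlight _ g2.1 g2.2] at g3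
            have := g2.1
            have := g2.2
            omega
          · intro g
            have g2 : IsInside pe rr b (rk i) := ⟨by omega, by omega⟩
            refine ⟨g2, ?_⟩
            rw [ht.isLightAt_iff hbn hact g2, hlight _ g2.1 g2.2]
            omega
    · simp only [lightRanges, wp, Expr.ok, Expr.val, Expr.cost, hb, hrr, hhs, hhe, setVar_arrs,
        setVar_vars, if_true, Nat.reduceEqDiff, if_false, app_eq_eq_zero,
        ne_eq, not_not, reduceCtorEq, not_false_eq_true, true_and, and_true]
      refine ⟨by omega, by omega, by omega, by omega, by omega, by omega, fun hc =>
        ⟨by omega, by omega, by omega, by omega, fun x g1 g2 => by omega⟩, fun hc => ?_⟩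
      have := hhe' hc
      exact ⟨by omega, by omega, by omega, by omega, by omega, by omega, by omega, by omega,
        fun x g1 g2 => by omega⟩
  refine wp_mono ?_ (wp_frame key)
  exact fun τ s h => hQ τ s h.2 h.1.1 h.1.2

/-- The class of a tail of the factor of length `m` at position `e`: this factor, read backwards, is
a prefix of the suffix number `n - m - e` of the reversed text, and so are its tails. -/
def tailLabel (e : Expr) : Expr := .cell aLAB (.cell aRK (.var vN -ₑ .var vM -ₑ e))

/-- Counts the listed positions of every class. -/
def tally : Prog :=
  .for vk (.const 0) (.var vq) (
    .assign vi (tailLabel (.cell aQ (.var vk))) ;;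
    .store aSUM (.var vi) (.cell aSUM (.var vi) +ₑ .const 1))

/-- Adds to the answers of the listed positions the number of listed positions of the same class,
without those with equal factors. -/
def credit : Prog :=
  .for vk (.const 0) (.var vq) (
    .assign vi (tailLabel (.cell aQ (.var vk))) ;;
    .store aANS (.cell aQ (.var vk)) (.cell aANS (.cell aQ (.var vk)) +ₑ
      (.cell aSUM (.var vi) -ₑ .cell aOCC (.cell aQ (.var vk)))))

/-- Undoes `tally`. -/
def clearSums : Prog :=
  .for vk (.const 0) (.var vq) (.store aSUM (tailLabel (.cell aQ (.var vk))) (.const 0))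

/-- The parts of a store that `tally`, `credit` and `clearSums` read but do not write. -/
structure ListState (n m q : ℕ) (A rk lab occ : ℕ → ℕ) (σ : Store) : Prop where
  n_eq : σ.vars vN = n
  m_eq : σ.vars vM = m
  q_eq : σ.vars vq = q
  list : σ.arrs aQ = A
  rank : σ.arrs aRK = rk
  label : σ.arrs aLAB = lab
  occ_eq : σ.arrs aOCC = occ

theorem ListState.of_frame {n m q : ℕ} {A rk lab occ : ℕ → ℕ} {σ τ : Store} {p : Prog}
    (h : ListState n m q A rk lab occ σ) (hf : Frame p σ τ)
    (hv : ∀ x ∈ [vN, vM, vq], x ∉ p.wv) (ha : ∀ a ∈ [aQ, aRK, aLAB, aOCC], a ∉ p.wa) :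
    ListState n m q A rk lab occ τ :=
  ⟨(hf.1 _ (hv _ (by simp))).trans h.n_eq, (hf.1 _ (hv _ (by simp))).trans h.m_eq,
    (hf.1 _ (hv _ (by simp))).trans h.q_eq, (hf.2 _ (ha _ (by simp))).trans h.list,
    (hf.2 _ (ha _ (by simp))).trans h.rank, (hf.2 _ (ha _ (by simp))).trans h.label,
    (hf.2 _ (ha _ (by simp))).trans h.occ_eq⟩

theorem wp_tally {M : Machine α} {n m q : ℕ} (hM : M.Fits n) {σ : Store} {t : ℕ}
    {A rk lab occ : ℕ → ℕ} {Q : Store → ℕ → Prop} (hm1 : 1 ≤ m)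
    (hσ : ListState n m q A rk lab occ σ) (hq : q ≤ n) (hA : ∀ r < q, A r < n)
    (hrk : ∀ p < n, rk p < n) (hlab : ∀ x < n, lab x < n) (h0 : ∀ c, σ.arrs aSUM c = 0)
    (hQ : ∀ τ s, Frame tally σ τ → s ≤ t + 20 + 50 * q →
      (∀ c, τ.arrs aSUM c =
        ((Finset.range q).filter fun r => lab (rk (n - m - A r)) = c).card) → Q τ s) :
    wp M tally Q σ t := by
  obtain ⟨h1, hlen, hcell, hB⟩ := id hM
  have key : wp M tally (fun τ s => s ≤ t + 20 + 50 * q ∧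
      (∀ c, τ.arrs aSUM c =
        ((Finset.range q).filter fun r => lab (rk (n - m - A r)) = c).card)) σ t := by
    unfold tally
    refine wp_for 0 q 35 (fun k τ => ∀ c, τ.arrs aSUM c =
      ((Finset.range k).filter fun r => lab (rk (n - m - A r)) = c).card) trivial rfl (by omega)
      (by omega) (fun τ hf => ⟨trivial, (hf.1 vq (by decide)).trans hσ.q_eq⟩) (by decide)
      (fun k τ v h => by simpa using h) (by simpa using h0) ?_ ?_
    · intro k τ s _ hk hf hx hI
      obtain ⟨g1, g2, g3, g4, g5, g6, -⟩ := hσ.of_frame hf (by decide) (by decide)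
      clear hf
      have hAk := hA k hk
      have hr := hrk (n - m - A k) (by omega)
      have hl := hlab _ hr
      have hcard := (Finset.card_filter_le (Finset.range k) fun r => lab (rk (n - m - A r)) =
        lab (rk (n - m - A k)))
      rw [Finset.card_range] at hcard
      simp only [tailLabel, wp, Expr.ok, Expr.val, Expr.cost, hx, g1, g2, g4, g5, g6, hI,
        setCell_arrs, setVar_arrs, setVar_vars, if_true, app_add, app_sub,
        ne_eq, reduceCtorEq, not_false_eq_true, true_and, and_true]
      refine ⟨by omega, by omega, by omega, by omega, by omega, fun c => ?_, by omega⟩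
      rw [Function.update_apply, card_filter_range_succ]
      split_ifs with e1 e2 e2
      · rw [e1]
      · exact absurd e1.symm e2
      · exact absurd e2.symm e1
      · rw [hI, add_zero]
    · intro τ s _ _ hI hs
      simp only [Expr.cost] at hs
      exact ⟨by omega, hI⟩
  refine wp_mono ?_ (wp_frame key)
  exact fun τ s h => hQ τ s h.2 h.1.1 h.1.2

theorem wp_credit {M : Machine α} {n m q : ℕ} (hM : M.Fits n) {σ : Store} {t : ℕ}
    {A rk lab occ : ℕ → ℕ} {Q : Store → ℕ → Prop} (hm1 : 1 ≤ m)
    (hσ : ListState n m q A rk lab occ σ) (hq : q ≤ n) (hA : ∀ r < q, A r < n)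
    (hinj : ∀ a < q, ∀ b < q, A a = A b → a = b)
    (hrk : ∀ p < n, rk p < n) (hlab : ∀ x < n, lab x < n)
    (hle : ∀ r < q, σ.arrs aANS (A r) +
      (σ.arrs aSUM (lab (rk (n - m - A r))) - occ (A r)) ≤ M.B)
    (hQ : ∀ τ s, Frame credit σ τ → s ≤ t + 20 + 60 * q →
      (∀ r < q, τ.arrs aANS (A r) = σ.arrs aANS (A r) +
        (σ.arrs aSUM (lab (rk (n - m - A r))) - occ (A r))) →
      (∀ i, (∀ r < q, A r ≠ i) → τ.arrs aANS i = σ.arrs aANS i) → Q τ s) :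
    wp M credit Q σ t := by
  obtain ⟨h1, hlen, hcell, hB⟩ := id hM
  have key : wp M credit (fun τ s => s ≤ t + 20 + 60 * q ∧
      (∀ r < q, τ.arrs aANS (A r) = σ.arrs aANS (A r) +
        (σ.arrs aSUM (lab (rk (n - m - A r))) - occ (A r))) ∧
      (∀ i, (∀ r < q, A r ≠ i) → τ.arrs aANS i = σ.arrs aANS i)) σ t := by
    unfold credit
    refine wp_for 0 q 45 (fun k τ =>
      (∀ r < k, τ.arrs aANS (A r) = σ.arrs aANS (A r) +
        (σ.arrs aSUM (lab (rk (n - m - A r))) - occ (A r))) ∧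
      (∀ i, (∀ r < k, A r ≠ i) → τ.arrs aANS i = σ.arrs aANS i)) trivial rfl (by omega)
      (by omega) (fun τ hf => ⟨trivial, (hf.1 vq (by decide)).trans hσ.q_eq⟩) (by decide)
      (fun k τ v h => by simpa using h) (by simp) ?_ ?_
    · intro k τ s _ hk hf hx ⟨hI, hI'⟩
      obtain ⟨g1, g2, g3, g4, g5, g6, g7⟩ := hσ.of_frame hf (by decide) (by decide)
      have g8 : τ.arrs aSUM = σ.arrs aSUM := hf.2 aSUM (by decide)
      clear hf
      have hAk := hA k hk
      have hr := hrk (n - m - A k) (by omega)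
      have hl := hlab _ hr
      have hlek := hle k hk
      have hne : ∀ r < k, A r ≠ A k := fun r hr he => by
        have := hinj r (by omega) k hk he
        omega
      have hold := hI' (A k) hne
      simp only [tailLabel, wp, Expr.ok, Expr.val, Expr.cost, hx, g1, g2, g4, g5, g6, g7, g8, hold,
        setCell_arrs, setVar_arrs, setVar_vars, if_true, Nat.reduceEqDiff, if_false, app_add,
        app_sub, ne_eq, reduceCtorEq, not_false_eq_true, true_and, and_true]
      refine ⟨by omega, by omega, by omega, by omega, by omega, by omega,
        ⟨fun r hrk => ?_, fun i hi => ?_⟩, by omega⟩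
      · rcases eq_or_lt_of_le (Nat.lt_succ_iff.mp hrk) with rfl | hlt
        · rw [Function.update_self]
        · rw [Function.update_of_ne (hne r hlt)]
          exact hI r hlt
      · rw [Function.update_of_ne (Ne.symm (hi k (by omega)))]
        exact hI' i fun r hr => hi r (by omega)
    · intro τ s _ _ hI hs
      simp only [Expr.cost] at hs
      exact ⟨by omega, hI⟩
  refine wp_mono ?_ (wp_frame key)
  exact fun τ s h => hQ τ s h.2 h.1.1 h.1.2.1 h.1.2.2

/-- Only the cells of listed classes can be nonzero, so the time is linear in the length of the list
and not in `n`. -/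
theorem wp_clearSums {M : Machine α} {n m q : ℕ} (hM : M.Fits n) {σ : Store} {t : ℕ}
    {A rk lab occ : ℕ → ℕ} {Q : Store → ℕ → Prop} (hm1 : 1 ≤ m) (hmn : m ≤ n)
    (hσ : ListState n m q A rk lab occ σ) (hq : q ≤ n) (hA : ∀ r < q, A r < n)
    (hrk : ∀ p < n, rk p < n) (hlab : ∀ x < n, lab x < n)
    (h0 : ∀ c, σ.arrs aSUM c =
      ((Finset.range q).filter fun r => lab (rk (n - m - A r)) = c).card)
    (hQ : ∀ τ s, Frame clearSums σ τ → s ≤ t + 20 + 40 * q → (∀ c, τ.arrs aSUM c = 0) → Q τ s) :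
    wp M clearSums Q σ t := by
  obtain ⟨h1, hlen, hcell, hB⟩ := id hM
  have key : wp M clearSums (fun τ s => s ≤ t + 20 + 40 * q ∧ (∀ c, τ.arrs aSUM c = 0)) σ t := by
    unfold clearSums
    refine wp_for 0 q 25 (fun k τ => ∀ c, τ.arrs aSUM c ≠ 0 →
      ∃ r < q, k ≤ r ∧ lab (rk (n - m - A r)) = c) trivial rfl (by omega)
      (by omega) (fun τ hf => ⟨trivial, (hf.1 vq (by decide)).trans hσ.q_eq⟩) (by decide)
      (fun k τ v h => by simpa using h) ?_ ?_ ?_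
    · intro c hc
      rw [h0] at hc
      obtain ⟨r, hr⟩ := Finset.card_pos.mp (Nat.pos_of_ne_zero hc)
      rw [Finset.mem_filter, Finset.mem_range] at hr
      exact ⟨r, hr.1, by omega, hr.2⟩
    · intro k τ s _ hk hf hx hI
      obtain ⟨g1, g2, g3, g4, g5, g6, -⟩ := hσ.of_frame hf (by decide) (by decide)
      clear hf
      have hAk := hA k hk
      have hr := hrk (n - m - A k) (by omega)
      have hl := hlab _ hr
      simp only [tailLabel, wp, Expr.ok, Expr.val, Expr.cost, hx, g1, g2, g4, g5, g6,
        setCell_arrs, if_true, app_sub,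
        ne_eq, reduceCtorEq, not_false_eq_true, true_and, and_true]
      refine ⟨by omega, by omega, by omega, fun c hc => ?_, by omega⟩
      rw [Function.update_apply] at hc
      split_ifs at hc with he
      · exact absurd rfl hc
      · obtain ⟨r, hr1, hr2, hr3⟩ := hI c hc
        refine ⟨r, hr1, lt_of_le_of_ne hr2 ?_, hr3⟩
        rintro rfl
        exact he hr3.symm
    · intro τ s _ _ hI hs
      simp only [Expr.cost] at hs
      refine ⟨by omega, fun c => ?_⟩
      by_contra hc
      obtain ⟨r, hr1, hr2, -⟩ := hI c hc
      omega
  refine wp_mono ?_ (wp_frame key)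
  exact fun τ s h => hQ τ s h.2 h.1.1 h.1.2

/-! ### The main loop -/

theorem Prepared.congr {n m : ℕ} {T rk : ℕ → ℕ} {σ τ : Store} (h : Prepared n m T rk σ)
    (ha : ∀ a ∈ [aSF, aHF, aPE, aRR, aNX, aHS, aHE, aNB, aSA, aRK, aHH, aRB],
      τ.arrs a = σ.arrs a) : Prepared n m T rk τ := by
  simp only [List.forall_mem_cons, List.not_mem_nil, false_implies, implies_true, and_true] at ha
  obtain ⟨e1, e2, e3, e4, e5, e6, e7, e8, e9, e10, e11, e12⟩ := ha
  obtain ⟨h1, h2, h3, h4, h5, h6, h7⟩ := h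
  refine ⟨h1, ?_, ?_, ?_, ?_, ?_, ?_⟩
  · rwa [e1, e2]
  · rwa [e2]
  · rwa [e2, e3, e4, e5, e6, e7]
  · rwa [e2, e8]
  · rwa [e9, e10, e11]
  · rwa [e11, e12]

/-- Equal labels mean that the last `l` of the `m` letters of the two factors agree. -/
theorem IsPartition.label_tail_iff {n m h l : ℕ} {T sa rk hh lab lo hi : ℕ → ℕ}
    (hA : IsSuffixArray n (reversed n T) sa rk hh)
    (hP : IsPartition n (fun z => l < hh z) lab lo hi) (hm : 1 ≤ m) (hlm : h + l = m) {i j : ℕ}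
    (hi : i + m ≤ n) (hj : j + m ≤ n) :
    lab (rk (n - m - j)) = lab (rk (n - m - i)) ↔ Agree T l (i + h) (j + h) := by
  rw [hP.lab_eq_iff_inner (hA.rk_lt _ (by omega)) (hA.rk_lt _ (by omega))]
  have h1 := hA.agree_iff (d := l) (i := n - m - i) (j := n - m - j) (by omega) (by omega)
  have h2 := agree_reversed (n := n) (T := T) (d := l) (i := i + h) (j := j + h) (by omega)
    (by omega)
  rw [show n - l - (i + h) = n - m - i by omega, show n - l - (j + h) = n - m - j by omega] at h2
  rw [← h2, h1]
  rfl

/-- The size of the class of a factor of length `m` is its number of occurrences. -/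
theorem IsPartition.size_eq {n m : ℕ} {T sa rk hh lab lo hi : ℕ → ℕ} (hT : IsText n T)
    (hA : IsSuffixArray n (reversed n T) sa rk hh)
    (hP : IsPartition n (fun z => m < hh z) lab lo hi) (hm : 1 ≤ m) {i : ℕ} (hi' : i + m ≤ n) :
    hi (lab (rk (n - m - i))) - lo (lab (rk (n - m - i))) =
      {j | j + m ≤ n ∧ Agree T m i j}.ncard := by
  have hx : rk (n - m - i) < n := hA.rk_lt _ (by omega)
  rw [← hP.card_class hx, ← Set.ncard_coe_finset]
  symm
  refine Set.ncard_congr (fun j _ => rk (n - m - j)) ?_ ?_ ?_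
  · rintro j ⟨h1, h2⟩
    simp only [Finset.coe_filter, Finset.mem_range, Set.mem_ofPred_eq]
    exact ⟨hA.rk_lt _ (by omega), (hP.label_tail_iff hA hm (zero_add m) hi' h1).mpr h2⟩
  · rintro j j' ⟨h1, -⟩ ⟨h1', -⟩ he
    have : sa (rk (n - m - j)) = sa (rk (n - m - j')) := congrArg sa he
    rw [hA.sa_rk _ (by omega), hA.sa_rk _ (by omega)] at this
    omega
  · intro y hy
    simp only [Finset.coe_filter, Finset.mem_range, Set.mem_ofPred_eq] at hy
    obtain ⟨hyn, hy⟩ := hy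
    have hp := hA.sa_lt y hyn
    have hrp := hA.rk_sa y hyn
    have h1 : sa y + m ≤ n := by
      rcases eq_or_ne (sa y) (n - m - i) with h | h
      · omega
      · rw [hP.lab_eq_iff_inner hx hyn] at hy
        have h2 := (hA.agree_iff (d := m) (i := n - m - i) (j := sa y) (by omega) hp).mpr
          (by rw [hrp]; exact hy)
        exact (hT.reversed.agree_le (by omega) hp (Ne.symm h) h2).2
    obtain ⟨j, hj⟩ : ∃ j, j = n - m - sa y := ⟨_, rfl⟩
    have h3 : n - m - j = sa y := by omega
    refine ⟨j, ⟨by omega, ?_⟩, by rw [h3, hrp]⟩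
    refine (hP.label_tail_iff hA hm (zero_add m) hi' (by omega)).mp ?_
    rw [h3, hrp]
    exact hy

/-- Handles the node with first boundary `vf`: brings the classes to the right depth, lists the
positions below light children, and counts the pairs. -/
def scanNode : Prog :=
  .assign vthr (.var vM -ₑ .cell aHF (.var vf)) ;; mergeTo ;; listLight ;; tally ;; credit ;;
    clearSums

/-- The time for a node is, up to a constant, the number of its light suffixes plus the decrease of
`vg` and the increase of the potential of the partition. -/
theorem wp_scanNode {M : Machine α} {n m b : ℕ} (hM : M.Fits n) {σ : Store} {t : ℕ}
    {T rk : ℕ → ℕ} {Q : Store → ℕ → Prop} (hp : Prepared n m T rk σ)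
    (hn : σ.vars vN = n) (hm : σ.vars vM = m) (hm1 : 1 ≤ m) (hmn : m ≤ n)
    (hb : σ.vars vf = b) (hbn : b < n) (hact : IsActive m (σ.arrs aHF) (σ.arrs aPE) b)
    (hg1 : 1 ≤ σ.vars vg) (hgn : σ.vars vg ≤ n)
    (hdone : ∀ x, σ.vars vg ≤ x → x < n → m - σ.arrs aHF b < σ.arrs aHH (σ.arrs aRB x))
    (hpart : IsPartition n (fun z => ∃ x, σ.vars vg ≤ x ∧ x < n ∧ σ.arrs aRB x = z)
      (σ.arrs aLAB) (σ.arrs aLO) (σ.arrs aHI))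
    (h0 : ∀ c, σ.arrs aSUM c = 0)
    (hocc : ∀ i, i + m ≤ n → σ.arrs aOCC i = {j | j + m ≤ n ∧ Agree T m i j}.ncard)
    (hle : ∀ i ∈ lightPositions n m rk (σ.arrs aHF) (σ.arrs aPE) (σ.arrs aRR) b,
      σ.arrs aANS i + {j | LightPair n m T rk (σ.arrs aHF) (σ.arrs aHF b - 1) i j}.ncard ≤ M.B)
    (hQ : ∀ τ s, Frame scanNode σ τ → 1 ≤ τ.vars vg → τ.vars vg ≤ n →
      s + 100 * τ.vars vg + 20 * partitionWeight n (σ.arrs aLAB) (σ.arrs aLO) (σ.arrs aHI) ≤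
        t + 300 + 100 * σ.vars vg +
        20 * partitionWeight n (τ.arrs aLAB) (τ.arrs aLO) (τ.arrs aHI) +
        200 * lightSize (σ.arrs aHF) n m (σ.arrs aPE) (σ.arrs aRR) b →
      (∀ x, τ.vars vg ≤ x → x < n → m - σ.arrs aHF b < σ.arrs aHH (σ.arrs aRB x)) →
      IsPartition n (fun z => ∃ x, τ.vars vg ≤ x ∧ x < n ∧ σ.arrs aRB x = z)
        (τ.arrs aLAB) (τ.arrs aLO) (τ.arrs aHI) →
      (∀ c, τ.arrs aSUM c = 0) →
      (∀ i ∈ lightPositions n m rk (σ.arrs aHF) (σ.arrs aPE) (σ.arrs aRR) b,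
        τ.arrs aANS i = σ.arrs aANS i +
          {j | LightPair n m T rk (σ.arrs aHF) (σ.arrs aHF b - 1) i j}.ncard) →
      (∀ i ∉ lightPositions n m rk (σ.arrs aHF) (σ.arrs aPE) (σ.arrs aRR) b,
        τ.arrs aANS i = σ.arrs aANS i) → Q τ s) :
    wp M scanNode Q σ t := by
  obtain ⟨h1, hlen, hcell, hB⟩ := id hM
  have key : wp M scanNode (fun τ s => (1 ≤ τ.vars vg ∧ τ.vars vg ≤ n ∧
      s + 100 * τ.vars vg + 20 * partitionWeight n (σ.arrs aLAB) (σ.arrs aLO) (σ.arrs aHI) ≤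
        t + 300 + 100 * σ.vars vg +
        20 * partitionWeight n (τ.arrs aLAB) (τ.arrs aLO) (τ.arrs aHI) +
        200 * lightSize (σ.arrs aHF) n m (σ.arrs aPE) (σ.arrs aRR) b) ∧
      (∀ x, τ.vars vg ≤ x → x < n → m - σ.arrs aHF b < σ.arrs aHH (σ.arrs aRB x)) ∧
      IsPartition n (fun z => ∃ x, τ.vars vg ≤ x ∧ x < n ∧ σ.arrs aRB x = z)
        (τ.arrs aLAB) (τ.arrs aLO) (τ.arrs aHI) ∧
      (∀ c, τ.arrs aSUM c = 0) ∧
      (∀ i ∈ lightPositions n m rk (σ.arrs aHF) (σ.arrs aPE) (σ.arrs aRR) b,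
        τ.arrs aANS i = σ.arrs aANS i +
          {j | LightPair n m T rk (σ.arrs aHF) (σ.arrs aHF b - 1) i j}.ncard) ∧
      (∀ i ∉ lightPositions n m rk (σ.arrs aHF) (σ.arrs aPE) (σ.arrs aRR) b,
        τ.arrs aANS i = σ.arrs aANS i)) σ t := by
    have hbm := hact.2.2
    unfold scanNode
    refine ⟨⟨by simp, trivial, trivial, by simp only [Expr.val, hb]; omega⟩, by
      simp only [Expr.val, hm, app_sub]; omega, ?_⟩
    generalize hσ' : (Store.setVar _ vthr _) = σ'
    have a1 : σ'.vars vthr = m - σ.arrs aHF b := by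
      rw [← hσ']; simp only [Expr.val, hm, hb, app_sub, setVar_vars, if_true]
    have a2 : ∀ x, x ≠ vthr → σ'.vars x = σ.vars x := fun x hx => by
      rw [← hσ', setVar_vars, if_neg hx]
    have a3 : σ'.arrs = σ.arrs := by rw [← hσ']; rfl
    refine wp_mergeTo hM (a2 vg (by decide)) a1 hg1 hgn (by rw [a3]) (by rw [a3])
      hp.rev.hh_zero hp.bounds hdone (by rw [a3]; exact hpart) ?_
    intro τ1 s1 g' hf1 hg' hg1' hgn' hs1 hdone1 hpart1 hpart1'
    rw [a3] at hs1
    simp only [Expr.cost] at hs1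
    have hp1 : Prepared n m T rk τ1 := hp.congr fun a ha => by
      rw [hf1.2 a (by revert a; decide), a3]
    have b1 : τ1.vars vf = b := by rw [hf1.1 vf (by decide), a2 vf (by decide), hb]
    have b2 : τ1.vars vN = n := by rw [hf1.1 vN (by decide), a2 vN (by decide), hn]
    have b3 : τ1.vars vM = m := by rw [hf1.1 vM (by decide), a2 vM (by decide), hm]
    have b4 : τ1.arrs aHF = σ.arrs aHF := by rw [hf1.2 aHF (by decide), a3]
    have b5 : τ1.arrs aPE = σ.arrs aPE := by rw [hf1.2 aPE (by decide), a3]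
    have b6 : τ1.arrs aRR = σ.arrs aRR := by rw [hf1.2 aRR (by decide), a3]
    have b7 : τ1.arrs aSUM = σ.arrs aSUM := by rw [hf1.2 aSUM (by decide), a3]
    have b8 : τ1.arrs aANS = σ.arrs aANS := by rw [hf1.2 aANS (by decide), a3]
    have b9 : τ1.arrs aOCC = σ.arrs aOCC := by rw [hf1.2 aOCC (by decide), a3]
    have b10 : τ1.arrs aHH = σ.arrs aHH := by rw [hf1.2 aHH (by decide), a3]
    clear hf1
    have hsufs := hp.sufs
    have htree := hp1.tree
    rw [b4, b5, b6] at htree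
    generalize hHF : σ.arrs aHF = hh at *
    generalize hPE : σ.arrs aPE = pe at *
    generalize hRR : σ.arrs aRR = rr at *
    refine wp_listLight hM b2 b3 hm1 rfl b5 b6 rfl rfl (by rw [← b4]; exact hp1.sufs) htree b1 hbn
      hact ?_
    intro τ2 s2 hf2 hs2 hL
    generalize hq2 : τ2.vars vq = q at hL
    generalize hA2 : τ2.arrs aQ = A at hL
    have hp2 : Prepared n m T rk τ2 := hp1.congr fun a ha => hf2.2 a (by revert a; decide)
    have c0 : ∀ a, a ∉ listLight.wa → τ2.arrs a = τ1.arrs a := hf2.2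
    have hst : ListState n m q A (τ2.arrs aRK) (τ1.arrs aLAB) (σ.arrs aOCC) τ2 :=
      ⟨(hf2.1 vN (by decide)).trans b2, (hf2.1 vM (by decide)).trans b3, hq2, hA2, rfl,
        c0 _ (by decide), (c0 _ (by decide)).trans b9⟩
    have c1 : τ2.vars vg = g' := (hf2.1 vg (by decide)).trans hg'
    clear hf2
    have hrev := hp2.rev
    rw [c0 aHH (by decide), b10] at hrev
    generalize hRKd : τ2.arrs aRK = rk' at *
    have hqle : ∀ r < q, A r ∈ lightPositions n m rk hh pe rr b := fun r hr =>
      (hL.mem_iff _).mpr ⟨r, hr, rfl⟩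
    have hAle : ∀ r < q, A r + m ≤ n := fun r hr => (hqle r hr).1
    have hAlt : ∀ r < q, A r < n := fun r hr => by have := hAle r hr; omega
    have hlsz : q ≤ n := hL.le fun i hi => by have := hi.1; omega
    have hqsize : q ≤ lightSize hh n m pe rr b := by
      classical
      rw [lightSize, if_pos hact]
      have := Finset.card_le_card_of_injOn (s := Finset.range q)
        (t := (Finset.range n).filter fun x => IsInside pe rr b x ∧ IsLightAt hh n m (hh b - 1) x)
        (fun r => rk (A r)) (fun r hr => by
          simp only [Finset.coe_range, Set.mem_Iio] at hr
          simp only [Finset.coe_filter, Finset.mem_range, Set.mem_ofPred_eq]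
          have := hqle r hr
          exact ⟨hsufs.rk_lt _ (hAlt r hr), this.2.1, this.2.2⟩)
        (fun r hr r' hr' he => by
          simp only [Finset.coe_range, Set.mem_Iio] at hr hr'
          have : σ.arrs aSF (rk (A r)) = σ.arrs aSF (rk (A r')) := congrArg (σ.arrs aSF) he
          rw [hsufs.sa_rk _ (hAlt r hr), hsufs.sa_rk _ (hAlt r' hr')] at this
          exact hL.inj r hr r' hr' this)
      simpa using this
    -- the number that is credited
    have hcount : ∀ r < q, ((Finset.range q).filter fun r' =>
        τ1.arrs aLAB (rk' (n - m - A r')) = τ1.arrs aLAB (rk' (n - m - A r))).card -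
          σ.arrs aOCC (A r) = {j | LightPair n m T rk hh (hh b - 1) (A r) j}.ncard := by
      intro r hr
      rw [hL.card_filter (fun j => τ1.arrs aLAB (rk' (n - m - j))), hocc _ (hAle r hr)]
      have h2 := ncard_lightPair hm1 (sa := σ.arrs aSF) hsufs
        htree.tree hbn hact (hqle r hr)
      have h3 : {j | j ∈ lightPositions n m rk hh pe rr b ∧
          τ1.arrs aLAB (rk' (n - m - j)) = τ1.arrs aLAB (rk' (n - m - A r))} =
          {j | j ∈ lightPositions n m rk hh pe rr b ∧
            Agree T (m - hh b) (A r + hh b) (j + hh b)} := by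
        ext j
        simp only [Set.mem_ofPred_eq]
        exact and_congr_right fun hj => hpart1'.label_tail_iff hrev hm1 (by omega) (hAle r hr) hj.1
      rw [h3]
      omega
    refine wp_tally hM hm1 hst hlsz hAlt hrev.rk_lt hpart1.lab_lt
      (by rw [c0 aSUM (by decide), b7]; exact h0) ?_
    intro τ3 s3 hf3 hs3 hsum3
    have d1 : τ3.arrs aANS = σ.arrs aANS := by rw [hf3.2 aANS (by decide), c0 aANS (by decide), b8]
    have hst3 := hst.of_frame hf3 (by decide) (by decide)
    refine wp_credit hM hm1 hst3 hlsz hAlt hL.inj hrev.rk_lt hpart1.lab_lt ?_ ?_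
    · intro r hr
      rw [hsum3, hcount r hr, d1]
      exact hle _ (hqle r hr)
    intro τ4 s4 hf4 hs4 hans4 hans4'
    refine wp_clearSums hM hm1 hmn (hst3.of_frame hf4 (by decide) (by decide)) hlsz hAlt
      hrev.rk_lt hpart1.lab_lt (by rw [hf4.2 aSUM (by decide)]; exact hsum3) ?_
    intro τ s hf hs hsum
    have e1 : τ.vars vg = g' := by
      rw [hf.1 vg (by decide), hf4.1 vg (by decide), hf3.1 vg (by decide), c1]
    have e2 : ∀ a ∈ [aLAB, aLO, aHI], τ.arrs a = τ1.arrs a := by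
      intro a ha
      rw [hf.2 a (by revert a; decide), hf4.2 a (by revert a; decide),
        hf3.2 a (by revert a; decide), c0 a (by revert a; decide)]
    rw [e1, e2 aLAB (by simp), e2 aLO (by simp), e2 aHI (by simp), hf.2 aANS (by decide)]
    refine ⟨⟨hg1', hgn', ?_⟩, hdone1, hpart1, hsum, fun i hi => ?_, fun i hi => ?_⟩
    · omega
    · obtain ⟨r, hr, rfl⟩ := (hL.mem_iff i).mp hi
      rw [hans4 r hr, hsum3, hcount r hr, d1]
    · rw [hans4' i fun r hr he => hi (he ▸ hqle r hr), d1]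
  refine wp_mono ?_ (wp_frame key)
  rintro τ s ⟨⟨⟨k1, k2, k3⟩, k4, k5, k6, k7, k8⟩, hf⟩
  exact hQ τ s hf k1 k2 k3 k4 k5 k6 k7 k8

/-- Starts with classes of one element, merges them to the classes of equal factors of length
`m`, and counts the occurrences of these factors. -/
def countOccurrences : Prog :=
  .for vk (.const 0) (.var vN) (
    .store aLAB (.var vk) (.var vk) ;; .store aLO (.var vk) (.var vk) ;;
    .store aHI (.var vk) (.var vk +ₑ .const 1)) ;;
  .assign vg (.var vN) ;;
  .assign vthr (.var vM) ;;
  mergeTo ;;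
  .for vk (.const 0) (.var vN -ₑ .var vM +ₑ .const 1) (
    .assign vi (tailLabel (.var vk)) ;;
    .store aOCC (.var vk) (.cell aHI (.var vi) -ₑ .cell aLO (.var vi)))

/-- The threshold `m` gives the classes of suffixes of the reversed text that agree on `m` letters,
whose sizes are the numbers of occurrences of the factors of length `m`. -/
theorem wp_countOccurrences {M : Machine α} {n m : ℕ} (hM : M.Fits n) {σ : Store} {t : ℕ}
    {T rk : ℕ → ℕ} {Q : Store → ℕ → Prop} (hp : Prepared n m T rk σ)
    (hn : σ.vars vN = n) (hm : σ.vars vM = m) (hm1 : 1 ≤ m) (hmn : m ≤ n)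
    (hQ : ∀ τ s, Frame countOccurrences σ τ → 1 ≤ τ.vars vg → τ.vars vg ≤ n →
      s + 100 * τ.vars vg ≤
        t + 300 * n + 20 * partitionWeight n (τ.arrs aLAB) (τ.arrs aLO) (τ.arrs aHI) →
      (∀ x, τ.vars vg ≤ x → x < n → m < σ.arrs aHH (σ.arrs aRB x)) →
      IsPartition n (fun z => ∃ x, τ.vars vg ≤ x ∧ x < n ∧ σ.arrs aRB x = z)
        (τ.arrs aLAB) (τ.arrs aLO) (τ.arrs aHI) →
      (∀ i, i + m ≤ n → τ.arrs aOCC i = {j | j + m ≤ n ∧ Agree T m i j}.ncard) → Q τ s) :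
    wp M countOccurrences Q σ t := by
  obtain ⟨h1, hlen, hcell, hB⟩ := id hM
  have key : wp M countOccurrences (fun τ s => (1 ≤ τ.vars vg ∧ τ.vars vg ≤ n ∧
      s + 100 * τ.vars vg ≤
        t + 300 * n + 20 * partitionWeight n (τ.arrs aLAB) (τ.arrs aLO) (τ.arrs aHI)) ∧
      (∀ x, τ.vars vg ≤ x → x < n → m < σ.arrs aHH (σ.arrs aRB x)) ∧
      IsPartition n (fun z => ∃ x, τ.vars vg ≤ x ∧ x < n ∧ σ.arrs aRB x = z)
        (τ.arrs aLAB) (τ.arrs aLO) (τ.arrs aHI) ∧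
      (∀ i, i + m ≤ n → τ.arrs aOCC i = {j | j + m ≤ n ∧ Agree T m i j}.ncard)) σ t := by
    unfold countOccurrences
    refine wp_for 0 n 20 (fun k τ => ∀ i < k, τ.arrs aLAB i = i ∧ τ.arrs aLO i = i ∧
      τ.arrs aHI i = i + 1) trivial rfl (by omega) (by omega) (fun τ hf => ⟨trivial,
      (hf.1 vN (by decide)).trans hn⟩) (by decide) (fun k τ v h => by simpa using h) (by simp) ?_ ?_
    · intro k τ s _ hk hf hx hI
      simp only [wp, Expr.ok, Expr.val, Expr.cost, hx, setCell_arrs, setCell_vars, if_true,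
        Nat.reduceEqDiff, if_false, app_add, ne_eq, reduceCtorEq, not_false_eq_true, true_and,
        and_true]
      refine ⟨by omega, by omega, by omega, by omega, by omega, by omega, fun i hi => ?_, by omega⟩
      simp only [Function.update_apply]
      split_ifs with h
      · simp [h]
      · exact hI i (by omega)
    intro τ1 s1 hf1 _ hI1 hs1
    simp only [Expr.cost] at hs1
    have b1 : τ1.vars vN = n := (hf1.1 vN (by decide)).trans hn
    have b2 : τ1.vars vM = m := (hf1.1 vM (by decide)).trans hm
    have b3 : τ1.arrs aHH = σ.arrs aHH := hf1.2 aHH (by decide)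
    have b4 : τ1.arrs aRB = σ.arrs aRB := hf1.2 aRB (by decide)
    have b5 : τ1.arrs aRK = σ.arrs aRK := hf1.2 aRK (by decide)
    clear hf1
    have hpart : IsPartition n (fun z => ∃ x, n ≤ x ∧ x < n ∧ σ.arrs aRB x = z)
        (τ1.arrs aLAB) (τ1.arrs aLO) (τ1.arrs aHI) := by
      have g1 : ∀ x < n, τ1.arrs aLAB x = x := fun x hx => (hI1 x hx).1
      have g2 : ∀ x < n, τ1.arrs aLO (τ1.arrs aLAB x) = x := fun x hx => by
        rw [g1 x hx, (hI1 x hx).2.1]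
      have g3 : ∀ x < n, τ1.arrs aHI (τ1.arrs aLAB x) = x + 1 := fun x hx => by
        rw [g1 x hx, (hI1 x hx).2.2]
      refine ⟨fun x hx => ?_, fun x hx => ?_, fun x hx y h2 h3 => ?_, fun x hx z h2 h3 => ?_,
        fun x hx _ => ?_, fun x hx _ => ?_⟩
      · rwa [g1 x hx]
      · rw [g2 x hx, g3 x hx]; omega
      · rw [g2 x hx] at h2
        rw [g3 x hx] at h3
        rw [show y = x by omega]
      · rw [g2 x hx] at h2
        rw [g3 x hx] at h3
        omega
      · rintro ⟨y, hy, hy', -⟩; omega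
      · rintro ⟨y, hy, hy', -⟩; omega
    refine ⟨trivial, by simp only [Expr.val, b1]; omega, ?_⟩
    refine ⟨trivial, by simp [b2]; omega, ?_⟩
    generalize hσ' : (Store.setVar _ vthr _) = σ'
    have a1 : σ'.vars vthr = m := by rw [← hσ']; simp [b2]
    have a2 : σ'.vars vg = n := by rw [← hσ']; simp [b1]
    have a2' : σ'.vars vN = n := by rw [← hσ']; simp [b1]
    have a2'' : σ'.vars vM = m := by rw [← hσ']; simp [b2]
    have a3 : σ'.arrs = τ1.arrs := by rw [← hσ']; rfl
    refine wp_mergeTo hM a2 a1 h1 le_rfl (by rw [a3]; exact b3) (by rw [a3]; exact b4)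
      hp.rev.hh_zero hp.bounds (fun x hx hxn => by omega) (by rw [a3]; exact hpart) ?_
    intro τ2 s2 g' hf2 hg' hg1' hgn' hs2 hdone2 hpart2 hpart2'
    simp only [Expr.cost] at hs2
    have c1 : τ2.vars vN = n := (hf2.1 vN (by decide)).trans a2'
    have c2 : τ2.vars vM = m := (hf2.1 vM (by decide)).trans a2''
    have c3 : τ2.arrs aRK = σ.arrs aRK := by rw [hf2.2 aRK (by decide), a3, b5]
    clear hf2
    have hfor : ∀ τ, Frame (.for vk (.const 0) (.var vN -ₑ .var vM +ₑ .const 1) (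
        .assign vi (tailLabel (.var vk)) ;;
        .store aOCC (.var vk) (.cell aHI (.var vi) -ₑ .cell aLO (.var vi)))) τ2 τ →
        τ.vars vN = n ∧ τ.vars vM = m ∧ τ.vars vg = g' ∧ τ.arrs aRK = σ.arrs aRK ∧
        τ.arrs aLAB = τ2.arrs aLAB ∧ τ.arrs aLO = τ2.arrs aLO ∧ τ.arrs aHI = τ2.arrs aHI :=
      fun τ hf => ⟨(hf.1 vN (by decide)).trans c1, (hf.1 vM (by decide)).trans c2,
        (hf.1 vg (by decide)).trans hg', (hf.2 aRK (by decide)).trans c3, hf.2 aLAB (by decide),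
        hf.2 aLO (by decide), hf.2 aHI (by decide)⟩
    refine wp_for 0 (n - m + 1) 30 (fun k τ => ∀ i < k,
      τ.arrs aOCC i = {j | j + m ≤ n ∧ Agree T m i j}.ncard) trivial rfl (by omega) (by omega)
      ?_ (by decide) (fun k τ v h => by simpa using h) (by simp) ?_ ?_
    · intro τ hf
      obtain ⟨g1, g2, -⟩ := hfor τ hf
      simp [g1, g2]
    · intro k τ s _ hk hf hx hI
      obtain ⟨g1, g2, g3, g4, g5, g6, g7⟩ := hfor τ hf
      have hr := hp.rev.rk_lt (n - m - k) (by omega)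
      have hl := hpart2.lab_lt _ hr
      have hsz := hpart2'.size_eq hp.text hp.rev hm1 (i := k) (by omega)
      have hmem := hpart2.mem _ hr
      simp only [tailLabel, wp, Expr.ok, Expr.val, Expr.cost, hx, g1, g2, g4, g5, g6, g7,
        setCell_arrs, setVar_arrs, setVar_vars, if_true, Nat.reduceEqDiff, if_false, app_sub,
        ne_eq, reduceCtorEq, not_false_eq_true, true_and, and_true]
      refine ⟨by omega, by omega, by omega, by omega, by omega, fun i hi => ?_, by omega⟩
      rw [Function.update_apply]
      split_ifs with h
      · rw [h, hsz]
      · exact hI i (by omega)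
    · intro τ s hf _ hI hs
      obtain ⟨g1, g2, g3, g4, g5, g6, g7⟩ := hfor τ hf
      simp only [Expr.cost] at hs
      rw [g3, g5, g6, g7]
      refine ⟨⟨hg1', hgn', by omega⟩, hdone2, hpart2, fun i hi => hI i (by omega)⟩
  refine wp_mono ?_ (wp_frame key)
  rintro τ s ⟨⟨⟨k1, k2, k3⟩, k4, k5, k6⟩, hf⟩
  exact hQ τ s hf k1 k2 k3 k4 k5 k6

/-- Handles the nodes of depth less than `m`, in the order of increasing depth. -/
def scanNodes : Prog :=
  .for vy (.const 0) (.var vN) (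
    .assign vf (.cell aNB (.var vy)) ;;
    .ite (.const 0 <ₑ .cell aHF (.var vf))
      (.ite (.cell aHF (.cell aPE (.var vf)) <ₑ .cell aHF (.var vf))
        (.ite (.var vM <ₑ .cell aHF (.var vf)) .skip scanNode) .skip) .skip)

/-- Summed over all nodes, the light suffixes, the merged boundaries and the potential are each at
most `n * log n` or `n`. A pair is counted at the one node where its members branch. -/
theorem wp_scanNodes {M : Machine α} {n m : ℕ} (hM : M.Fits n) {σ : Store} {t : ℕ}
    {T rk : ℕ → ℕ} {Q : Store → ℕ → Prop} (hp : Prepared n m T rk σ)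
    (hn : σ.vars vN = n) (hm : σ.vars vM = m) (hm1 : 1 ≤ m) (hmn : m ≤ n)
    (hg1 : 1 ≤ σ.vars vg) (hgn : σ.vars vg ≤ n)
    (hdone : ∀ x, σ.vars vg ≤ x → x < n → m < σ.arrs aHH (σ.arrs aRB x))
    (hpart : IsPartition n (fun z => ∃ x, σ.vars vg ≤ x ∧ x < n ∧ σ.arrs aRB x = z)
      (σ.arrs aLAB) (σ.arrs aLO) (σ.arrs aHI))
    (h0 : ∀ c, σ.arrs aSUM c = 0) (hans : ∀ i, σ.arrs aANS i = 0)
    (hocc : ∀ i, i + m ≤ n → σ.arrs aOCC i = {j | j + m ≤ n ∧ Agree T m i j}.ncard)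
    (hQ : ∀ τ s, Frame scanNodes σ τ →
      s + 20 * partitionWeight n (σ.arrs aLAB) (σ.arrs aLO) (σ.arrs aHI) ≤
        t + 100 * σ.vars vg + 600 * (n * (Nat.log 2 n + 1)) →
      (∀ i, τ.arrs aANS i =
        (countedPairs n m T rk (σ.arrs aHF) (σ.arrs aPE) (σ.arrs aRR) (fun _ => True) i).ncard) →
      Q τ s) :
    wp M scanNodes Q σ t := by
  obtain ⟨h1, hlen, hcell, hB⟩ := id hM
  have hnl : n * (Nat.log 2 n + 1) = n * Nat.log 2 n + n := Nat.mul_succ _ _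
  obtain ⟨F, hF⟩ : ∃ F, σ.arrs aNB = F := ⟨_, rfl⟩
  obtain ⟨hh, hHF⟩ : ∃ hh, σ.arrs aHF = hh := ⟨_, rfl⟩
  obtain ⟨pe, hPE⟩ : ∃ pe, σ.arrs aPE = pe := ⟨_, rfl⟩
  obtain ⟨rr, hRR⟩ : ∃ rr, σ.arrs aRR = rr := ⟨_, rfl⟩
  obtain ⟨hhr, hHH⟩ : ∃ hhr, σ.arrs aHH = hhr := ⟨_, rfl⟩
  obtain ⟨G, hG⟩ : ∃ G, σ.arrs aRB = G := ⟨_, rfl⟩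
  have hnodes := hp.nodes
  have htree := hp.tree.tree
  have hsufs := hp.sufs
  have hlcp := hp.sufs.isLcpArray hp.last
  rw [hHF, hF] at hnodes
  rw [hHF, hPE, hRR] at htree
  rw [hHF] at hsufs hlcp
  rw [hHF, hPE, hRR] at hQ
  rw [hHH, hG] at hdone
  rw [hG] at hpart
  generalize hW : partitionWeight n (σ.arrs aLAB) (σ.arrs aLO) (σ.arrs aHI) = W at hQ
  have key : wp M scanNodes (fun τ s => s + 20 * W ≤
        t + 100 * σ.vars vg + 600 * (n * (Nat.log 2 n + 1)) ∧
      (∀ i, τ.arrs aANS i = (countedPairs n m T rk hh pe rr (fun _ => True) i).ncard)) σ t := by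
    unfold scanNodes
    -- the boundaries merged so far are deep enough for all nodes to come, because nodes of larger
    -- depth have smaller thresholds
    refine wp_for_time 0 n (fun y τ s => 1 ≤ τ.vars vg ∧ τ.vars vg ≤ n ∧
      s + 100 * τ.vars vg + 20 * W ≤ t + 10 + 100 * σ.vars vg +
        20 * partitionWeight n (τ.arrs aLAB) (τ.arrs aLO) (τ.arrs aHI) + 400 * y +
        200 * ∑ y' ∈ Finset.range y, lightSize hh n m pe rr (F y') ∧
      (∀ x, τ.vars vg ≤ x → x < n → ∀ y', y ≤ y' → y' < n → m - hh (F y') < hhr (G x)) ∧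
      IsPartition n (fun z => ∃ x, τ.vars vg ≤ x ∧ x < n ∧ G x = z)
        (τ.arrs aLAB) (τ.arrs aLO) (τ.arrs aHI) ∧
      (∀ c, τ.arrs aSUM c = 0) ∧
      (∀ i, i + m ≤ n → τ.arrs aOCC i = {j | j + m ≤ n ∧ Agree T m i j}.ncard) ∧
      (∀ i, τ.arrs aANS i = (countedPairs n m T rk hh pe rr
        (fun b => ∃ y' < y, F y' = b) i).ncard)) trivial rfl (by omega) (by omega) (fun τ hf =>
        ⟨trivial, (hf.1 vN (by decide)).trans hn⟩) (by decide)
      (fun k τ s v h => by simpa using h) ?_ ?_ ?_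
    · refine ⟨hg1, hgn, by rw [hW]; simp, fun x hx hxn y' _ _ => ?_, hpart, h0, hocc,
        fun i => ?_⟩
      · have := hdone x hx hxn
        omega
      · have : countedPairs n m T rk hh pe rr (fun b => ∃ y' < 0, F y' = b) i = ∅ := by
          ext j
          simp [countedPairs]
        rw [hans i, this, Set.ncard_empty]
    · intro y τ s _ hy hf hx ⟨k1, k2, k3, k4, k5, k6, k7, k8⟩
      have hp' : Prepared n m T rk τ := hp.congr fun a ha => hf.2 a (by revert a; decide)
      have g1 : τ.vars vN = n := (hf.1 vN (by decide)).trans hn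
      have g2 : τ.vars vM = m := (hf.1 vM (by decide)).trans hm
      have g3 : τ.arrs aNB = F := (hf.2 aNB (by decide)).trans hF
      have g4 : τ.arrs aHF = hh := (hf.2 aHF (by decide)).trans hHF
      have g5 : τ.arrs aPE = pe := (hf.2 aPE (by decide)).trans hPE
      have g6 : τ.arrs aRR = rr := (hf.2 aRR (by decide)).trans hRR
      have g7 : τ.arrs aHH = hhr := (hf.2 aHH (by decide)).trans hHH
      have g8 : τ.arrs aRB = G := (hf.2 aRB (by decide)).trans hG
      clear hf
      obtain ⟨b, hb⟩ : ∃ b, F y = b := ⟨_, rfl⟩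
      have hbn : b < n := by rw [← hb]; exact hnodes.perm.1 y hy
      have hsum : ∑ y' ∈ Finset.range (y + 1), lightSize hh n m pe rr (F y') =
          ∑ y' ∈ Finset.range y, lightSize hh n m pe rr (F y') + lightSize hh n m pe rr b := by
        rw [Finset.sum_range_succ, hb]
      have hR : ∀ c, (∃ y' < y + 1, F y' = c) ↔ (∃ y' < y, F y' = c) ∨ c = b := by
        intro c
        constructor
        · rintro ⟨y', hy', rfl⟩
          rcases eq_or_lt_of_le (Nat.lt_succ_iff.mp hy') with rfl | hlt
          · exact Or.inr hb
          · exact Or.inl ⟨y', hlt, rfl⟩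
        · rintro (⟨y', hy', rfl⟩ | rfl)
          · exact ⟨y', by omega, rfl⟩
          · exact ⟨y, by omega, hb⟩
      have hRb : ¬ ∃ y' < y, F y' = b := by
        rintro ⟨y', hy', he⟩
        have := hnodes.perm.2 y' (by omega) y hy (he.trans hb.symm)
        omega
      -- nothing is counted at a boundary that is not the first one of a node of small depth
      have hskip : ¬ IsActive m hh pe b → ∀ i,
          countedPairs n m T rk hh pe rr (fun c => ∃ y' < y + 1, F y' = c) i =
          countedPairs n m T rk hh pe rr (fun c => ∃ y' < y, F y' = c) i := by
        intro hna i
        refine countedPairs_congr fun c _ hc _ _ _ => ?_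
        rw [hR]
        refine ⟨fun h => h.resolve_right ?_, Or.inl⟩
        rintro rfl
        exact hna hc
      have skip : ¬ IsActive m hh pe b → ∀ (σ' : Store) s', σ'.arrs = τ.arrs →
          σ'.vars vg = τ.vars vg → s' ≤ s + 100 → 1 ≤ σ'.vars vg ∧ σ'.vars vg ≤ n ∧
          s' + 4 + 100 * σ'.vars vg + 20 * W ≤ t + 10 + 100 * σ.vars vg +
            20 * partitionWeight n (σ'.arrs aLAB) (σ'.arrs aLO) (σ'.arrs aHI) + 400 * (y + 1) +
            200 * ∑ y' ∈ Finset.range (y + 1), lightSize hh n m pe rr (F y') ∧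
          (∀ x, σ'.vars vg ≤ x → x < n → ∀ y', y + 1 ≤ y' → y' < n → m - hh (F y') < hhr (G x)) ∧
          IsPartition n (fun z => ∃ x, σ'.vars vg ≤ x ∧ x < n ∧ G x = z)
            (σ'.arrs aLAB) (σ'.arrs aLO) (σ'.arrs aHI) ∧
          (∀ c, σ'.arrs aSUM c = 0) ∧
          (∀ i, i + m ≤ n → σ'.arrs aOCC i = {j | j + m ≤ n ∧ Agree T m i j}.ncard) ∧
          (∀ i, σ'.arrs aANS i = (countedPairs n m T rk hh pe rr
            (fun b => ∃ y' < y + 1, F y' = b) i).ncard) := by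
        intro hna σ' s' e1 e2 e3
        rw [e1, e2, hsum]
        refine ⟨k1, k2, by omega, fun x hx hxn y' hy' => k4 x hx hxn y' (by omega), k5, k6, k7,
          fun i => ?_⟩
        rw [k8, hskip hna]
      refine ⟨⟨trivial, by simp only [Expr.val, hx]; omega⟩, by
        simp only [Expr.val, hx, g3, hb]; omega, ?_⟩
      generalize hσ' : (Store.setVar _ vf _) = σ'
      have a1 : σ'.vars vf = b := by
        rw [← hσ']; simp only [Expr.val, hx, g3, hb, setVar_vars, if_true]
      have a2 : ∀ x, x ≠ vf → σ'.vars x = τ.vars x := fun x hx => by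
        rw [← hσ', setVar_vars, if_neg hx]
      have a3 : σ'.arrs = τ.arrs := by rw [← hσ']; rfl
      have hvM : σ'.vars vM = m := (a2 vM (by decide)).trans g2
      have hcb : b < M.L := by omega
      refine ⟨⟨by simp, trivial, trivial, by simp only [Expr.val, a1]; exact hcb⟩, fun hc0 => ?_,
        fun hc0 => ?_⟩
      · simp only [Expr.val, a1, a3, g4, ne_eq, app_lt_eq_zero, not_not] at hc0
        have hb0 : 0 < b := by
          rcases Nat.eq_zero_or_pos b with h | h
          · rw [h, hlcp.zero] at hc0; omega
          · exact h
        have hpb := htree.pe_lt b hb0 hbn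
        refine ⟨⟨by simp, ⟨⟨trivial, by simp only [Expr.val, a1]; exact hcb⟩,
          by simp only [Expr.val, a1, a3, g5]; omega⟩, trivial,
          by simp only [Expr.val, a1]; exact hcb⟩, fun hc1 => ?_, fun hc1 => ?_⟩
        · simp only [Expr.val, a1, a3, g4, g5, ne_eq, app_lt_eq_zero, not_not] at hc1
          refine ⟨⟨by simp, trivial, trivial, by simp only [Expr.val, a1]; exact hcb⟩,
            fun hc2 => ?_, fun hc2 => ?_⟩
          · simp only [Expr.val, a1, a3, g4, hvM, ne_eq, app_lt_eq_zero, not_not] at hc2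
            exact skip (fun h => by have := h.2.2; omega) σ' _ a3 (a2 vg (by decide)) (by
              simp only [Expr.cost]; omega)
          · simp only [Expr.val, a1, a3, g4, hvM, app_lt_eq_zero] at hc2
            have hact : IsActive m hh pe b := ⟨hb0, hc1, by omega⟩
            have hvg : σ'.vars vg = τ.vars vg := a2 vg (by decide)
            refine wp_scanNode hM (hp'.congr fun a _ => by rw [a3])
              ((a2 vN (by decide)).trans g1) hvM hm1 hmn a1 hbn (by rw [a3, g4, g5]; exact hact)
              (by rw [hvg]; exact k1) (by rw [hvg]; exact k2) ?_ ?_ (by rw [a3]; exact k6)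
              (by rw [a3]; exact k7) ?_ ?_
            · rw [hvg, a3, g4, g7, g8, ← hb]
              exact fun x hx hxn => k4 x hx hxn y le_rfl hy
            · rw [hvg, a3, g8]
              exact k5
            · rw [a3, g4, g5, g6]
              intro i hi
              rw [k8, ← ncard_countedPairs_add htree hbn hact hRb hi]
              have := ncard_countedPairs_le (T := T) (rk := rk) (hh := hh) (pe := pe) (rr := rr)
                (R := fun c => (∃ y' < y, F y' = c) ∨ c = b) (n := n) (i := i) hm1
              omega
            · intro τ' s' hf' q1 q2 q3 q4 q5 q6 q7 q8
              have hocc' : τ'.arrs aOCC = τ.arrs aOCC := by rw [hf'.2 aOCC (by decide), a3]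
              rw [a3, hvg, g4, g5, g6] at q3
              rw [a3, g4, g7, g8] at q4
              rw [a3, g8] at q5
              rw [a3, g4, g5, g6] at q7 q8
              simp only [Expr.cost] at q3
              refine ⟨q1, q2, by rw [hsum]; omega, fun x hx hxn y' hy' hyn' => ?_, q5, q6,
                by rw [hocc']; exact k7, fun i => ?_⟩
              · have e1 := q4 x hx hxn
                have e2 := hnodes.mono y y' (by omega) hyn'
                rw [hb] at e2
                omega
              · by_cases hi : i ∈ lightPositions n m rk hh pe rr b
                · rw [q7 i hi, k8, ← ncard_countedPairs_add htree hbn hact hRb hi]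
                  congr 2
                  funext c
                  exact propext (hR c).symm
                · rw [q8 i hi, k8]
                  congr 1
                  refine countedPairs_congr fun c _ _ e1 e2 e3 => ?_
                  rw [hR]
                  refine ⟨Or.inl, fun h => h.resolve_right ?_⟩
                  rintro rfl
                  exact hi ⟨e3, e1, e2⟩
        · simp only [Expr.val, a1, a3, g4, g5, app_lt_eq_zero] at hc1
          exact skip (fun h => hc1 h.2.1) σ' _ a3 (a2 vg (by decide)) (by
            simp only [Expr.cost]; omega)
      · simp only [Expr.val, a1, a3, g4, app_lt_eq_zero] at hc0
        refine skip (fun h => hc0 ?_) σ' _ a3 (a2 vg (by decide)) (by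
          simp only [Expr.cost]; omega)
        exact hlcp.pos b h.1 hbn
    · intro τ s hf hx ⟨k1, k2, k3, k4, k5, k6, k7, k8⟩
      have hsum : ∑ y' ∈ Finset.range n, lightSize hh n m pe rr (F y') ≤ n * Nat.log 2 n := by
        have e : ∑ y' ∈ Finset.range n, lightSize hh n m pe rr (F y') =
            ∑ b ∈ Finset.range n, lightSize hh n m pe rr b := by
          have e := Finset.sum_image (s := Finset.range n) (g := F)
            (f := lightSize hh n m pe rr) fun a ha b hb =>
              hnodes.perm.2 a (by simpa using ha) b (by simpa using hb)
          rw [hnodes.perm.image] at e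
          exact e.symm
        rw [e]
        exact sum_lightSize_le htree hlcp.zero
      have hwt := k5.weight_le
      simp only [Expr.cost]
      refine ⟨by omega, fun i => ?_⟩
      rw [k8]
      congr 1
      refine countedPairs_congr fun c hc _ _ _ _ => ?_
      simp only [iff_true]
      obtain ⟨y, hy, he⟩ := hnodes.perm.surj hc
      exact ⟨y, hy, he⟩
  refine wp_mono ?_ (wp_frame key)
  exact fun τ s h => hQ τ s h.2 h.1.1 h.1.2

/-- The program that computes the numbers of light occurrences; they are left in the array `0`. -/
def lightMappability : Prog := prepare ;; countOccurrences ;; scanNodes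

/-- The program counts, for every position, the positions that form a light pair with it. -/
theorem wp_lightMappability {M : Machine α} {n : ℕ} (hM : M.Fits n) {σ : Store} {m : ℕ}
    {ℓ : ℕ → α} (hℓ : ∀ i < n, M.S[i]? = some (ℓ i)) (hn : σ.vars vN = n)
    (hm : σ.vars vM = m) (hm1 : 1 ≤ m) (hmn : m ≤ n) (h0 : ∀ a i, σ.arrs a i = 0) :
    wp M lightMappability (fun τ s => s ≤ 9000 * (n * (Nat.log 2 n + 1)) ∧
      ∃ T sa rk hh, IsText n T ∧ (∀ i < n, ∀ j < n, T i < T j ↔ ℓ i < ℓ j) ∧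
        IsSuffixArray n T sa rk hh ∧ hh n = 0 ∧
        ∀ i, τ.arrs aANS i = {j | ∃ d, LightPair n m T rk hh d i j}.ncard) σ 0 := by
  obtain ⟨h1, hlen, hcell, hB⟩ := id hM
  have hnn : n ≤ n * (Nat.log 2 n + 1) := Nat.le_mul_of_pos_right _ (by omega)
  unfold lightMappability
  refine wp_prepare hM hℓ hn hm h0 ?_
  intro τ1 s1 T rk hf1 hs1 hp1 hlt
  have a1 : τ1.vars vN = n := (hf1.1 vN (by decide)).trans hn
  have a2 : τ1.vars vM = m := (hf1.1 vM (by decide)).trans hm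
  refine wp_countOccurrences hM hp1 a1 a2 hm1 hmn ?_
  intro τ2 s2 hf2 hg1 hgn hs2 hdone hpart hocc
  have e : ∀ a ∈ [aSF, aHF, aPE, aRR, aNX, aHS, aHE, aNB, aSA, aRK, aHH, aRB],
      τ2.arrs a = τ1.arrs a := fun a ha => hf2.2 a (by revert a; decide)
  have z : ∀ a ∈ [aSUM, aANS], ∀ i, τ2.arrs a i = 0 := fun a ha i => by
    rw [hf2.2 a (by revert a; decide), hf1.2 a (by revert a; decide), h0]
  refine wp_scanNodes hM (hp1.congr e) ((hf2.1 vN (by decide)).trans a1)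
    ((hf2.1 vM (by decide)).trans a2) hm1 hmn hg1 hgn ?_ ?_ (z _ (by simp)) (z _ (by simp)) hocc ?_
  · rwa [e aHH (by simp), e aRB (by simp)]
  · rwa [e aRB (by simp)]
  intro τ s _ hs hans
  rw [e aHF (by simp), e aPE (by simp), e aRR (by simp)] at hans
  refine ⟨by omega, T, τ1.arrs aSF, rk, τ1.arrs aHF, hp1.text, hlt, hp1.sufs, hp1.last,
    fun i => ?_⟩
  rw [hans i]
  congr 1
  ext j
  constructor
  · rintro ⟨b, _, _, _, _, h⟩
    exact ⟨_, h⟩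
  · rintro ⟨d, h⟩
    obtain ⟨b, hbn, hb, hd, hi⟩ := h.exists_active hm1 hp1.sufs hp1.last hp1.tree.tree
    exact ⟨b, hbn, trivial, hb, hi, by rwa [show τ1.arrs aHF b - 1 = d by omega]⟩

/-! ### Nodes, leaves and edges of the trimmed suffix tree -/

variable {β : Type*}

theorem suffixWord_length {S : List β} {i : ℕ} : (suffixWord S i).length = S.length - i + 1 := by
  simp [suffixWord]

/-- Behind the last letter of the text, `S[i + k]?` is `none`, which also stands for the end
marker. -/
theorem suffixWord_getElem? {S : List β} {i k : ℕ} (h : i + k ≤ S.length) :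
    (suffixWord S i)[k]? = some (S[i + k]?) := by
  rw [suffixWord, List.getElem?_append]
  simp only [List.length_map, List.length_drop, List.getElem?_map, List.getElem?_drop]
  split_ifs with hk
  · rw [List.getElem?_eq_getElem (show i + k < S.length by omega)]
    rfl
  · have h1 : S[i + k]? = none := List.getElem?_eq_none (by omega)
    rw [show k - (S.length - i) = 0 by omega, h1]
    rfl

theorem suffixWord_getElem?_eq_some_none {S : List β} {i k : ℕ} (hi : i < S.length) :
    (suffixWord S i)[k]? = some none ↔ i + k = S.length := by
  rcases Nat.lt_or_ge S.length (i + k) with h | h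
  · rw [List.getElem?_eq_none (by rw [suffixWord_length]; omega)]
    simp only [reduceCtorEq, false_iff]
    omega
  · rw [suffixWord_getElem? h, Option.some_inj, List.getElem?_eq_none_iff]
    omega

theorem eq_of_suffixWord_prefix {S : List β} {i j : ℕ} (hi : i < S.length) (hj : j < S.length)
    (h : suffixWord S i <+: suffixWord S j) : i = j := by
  have h1 : (suffixWord S i)[S.length - i]? = some none :=
    (suffixWord_getElem?_eq_some_none hi).mpr (by omega)
  have hk : S.length - i < (suffixWord S i).length := by rw [suffixWord_length]; omega
  have h2 := List.prefix_iff_getElem?.mp h _ hk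
  rw [← List.getElem?_eq_getElem hk, h1] at h2
  have := (suffixWord_getElem?_eq_some_none hj).mp h2
  omega

/-- The label of the leaf of the suffix number `i`. -/
def leafWord (S : List β) (m i : ℕ) : Word β := (suffixWord S i).take m

theorem IsNode.isLocus {S : List β} {m : ℕ} {u : Word β} (h : IsNode S m u) : IsLocus S u := by
  rcases h with h | h
  · exact h.1.1
  · exact h.1

theorem IsNode.length_le {S : List β} {m : ℕ} {u : Word β} (h : IsNode S m u) : u.length ≤ m := by
  rcases h with h | h
  · exact h.2
  · exact h.2.le

theorem IsLocus.of_prefix {S : List β} {u v : Word β} (h : IsLocus S v) (huv : u <+: v) :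
    IsLocus S u := by
  obtain ⟨i, hi, hv⟩ := h
  exact ⟨i, hi, huv.trans hv⟩

theorem IsNode.exists_prefix {S : List β} {m : ℕ} {u : Word β} (h : IsNode S m u) :
    ∃ i < S.length, u <+: leafWord S m i := by
  obtain ⟨i, hi, hu⟩ := h.isLocus
  exact ⟨i, hi, List.prefix_take_iff.mpr ⟨hu, h.length_le⟩⟩

theorem isNode_leafWord {S : List β} {m i : ℕ} (hi : i < S.length) :
    IsNode S m (leafWord S m i) := by
  have hl : IsLocus S (leafWord S m i) := ⟨i, hi, List.take_prefix _ _⟩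
  rcases Nat.lt_or_ge (suffixWord S i).length m with h | h
  · have he : leafWord S m i = suffixWord S i := List.take_of_length_le h.le
    exact Or.inl ⟨⟨hl, Or.inr (Or.inl ⟨i, hi, he⟩)⟩, by rw [he]; exact h.le⟩
  · exact Or.inr ⟨hl, List.length_take_of_le h⟩

theorem exists_edge {S : List β} {m : ℕ} {u : Word β} (hu : IsNode S m u) :
    ∀ {w : Word β}, IsNode S m w → u <+: w → u ≠ w → ∃ v, IsEdge S m u v ∧ v <+: w := by
  intro w
  induction h : w.length using Nat.strong_induction_on generalizing w with
  | _ k ih =>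
    intro hw huw hne
    by_cases hc : ∃ x, IsNode S m x ∧ u <+: x ∧ x <+: w ∧ x ≠ u ∧ x ≠ w
    · obtain ⟨x, h1, h2, h3, h4, h5⟩ := hc
      have hlt : x.length < k := by
        rw [← h]
        refine lt_of_le_of_ne h3.length_le fun he => h5 (h3.eq_of_length he)
      obtain ⟨v, hv, hvx⟩ := ih _ hlt rfl h1 h2 (Ne.symm h4)
      exact ⟨v, hv, hvx.trans h3⟩
    · refine ⟨w, ⟨hu, hw, huw, hne, fun x h1 h2 h3 => ?_⟩, List.prefix_refl w⟩
      by_contra hx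
      rw [not_or] at hx
      exact hc ⟨x, h1, h2, h3, hx.1, hx.2⟩

theorem isLeaf_iff {S : List β} {m : ℕ} {z : Word β} :
    IsLeaf S m z ↔ ∃ i < S.length, z = leafWord S m i := by
  constructor
  · rintro ⟨hz, hno⟩
    obtain ⟨i, hi, hp⟩ := hz.exists_prefix
    refine ⟨i, hi, ?_⟩
    by_contra hne
    obtain ⟨v, hv, -⟩ := exists_edge hz (isNode_leafWord hi) hp hne
    exact hno v hv
  · rintro ⟨i, hi, rfl⟩
    refine ⟨isNode_leafWord hi, fun v hv => ?_⟩
    obtain ⟨-, hv, hp, hne, -⟩ := hv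
    have hlt : (leafWord S m i).length < v.length :=
      lt_of_le_of_ne hp.length_le fun he => hne (hp.eq_of_length he)
    have hvm := hv.length_le
    obtain ⟨j, hj, hvj⟩ := hv.isLocus
    have he : leafWord S m i = suffixWord S i := by
      refine List.take_of_length_le ?_
      rw [leafWord, List.length_take] at hlt
      omega
    rw [he] at hp hlt
    have := eq_of_suffixWord_prefix hi hj (hp.trans hvj)
    subst this
    have := hvj.length_le
    omega

/-- A leaf is the label of the leaf of every suffix that starts with it. -/
theorem IsLeaf.eq_leafWord {S : List β} {m : ℕ} {z : Word β} (hz : IsLeaf S m z) {i : ℕ}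
    (hi : i < S.length) (h : z <+: suffixWord S i) : z = leafWord S m i := by
  obtain ⟨j, hj, rfl⟩ := isLeaf_iff.mp hz
  rcases Nat.lt_or_ge (suffixWord S j).length m with hl | hl
  · have he : leafWord S m j = suffixWord S j := List.take_of_length_le hl.le
    rw [he] at h
    rw [eq_of_suffixWord_prefix hj hi h]
  · have hlen : (leafWord S m j).length = m := List.length_take_of_le hl
    have := List.prefix_iff_eq_take.mp h
    rwa [hlen] at this

/-- Two words branch unless one of them is a prefix of the other. -/
theorem prefix_or_branch {γ : Type*} (x y : List γ) :
    x <+: y ∨ y <+: x ∨ ∃ p a b, a ≠ b ∧ p ++ [a] <+: x ∧ p ++ [b] <+: y := by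
  induction x generalizing y with
  | nil => exact Or.inl List.nil_prefix
  | cons a x ih =>
    rcases y with - | ⟨b, y⟩
    · exact Or.inr (Or.inl List.nil_prefix)
    · by_cases hab : a = b
      · subst hab
        rcases ih y with h | h | ⟨p, c, d, h1, h2, h3⟩
        · exact Or.inl (List.cons_prefix_cons.mpr ⟨rfl, h⟩)
        · exact Or.inr (Or.inl (List.cons_prefix_cons.mpr ⟨rfl, h⟩))
        · exact Or.inr (Or.inr ⟨a :: p, c, d, h1, List.cons_prefix_cons.mpr ⟨rfl, h2⟩,
            List.cons_prefix_cons.mpr ⟨rfl, h3⟩⟩)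
      · refine Or.inr (Or.inr ⟨[], a, b, hab, ?_, ?_⟩) <;> simp

/-- The first symbol of an edge determines the leaves below the edge. -/
theorem IsEdge.prefix_iff {S : List β} {m : ℕ} {u v z : Word β} {c : Option β}
    (h : IsEdge S m u v) (hc : u ++ [c] <+: v) (hz : IsLeaf S m z) :
    v <+: z ↔ u ++ [c] <+: z := by
  refine ⟨fun h' => hc.trans h', fun h' => ?_⟩
  obtain ⟨hu, hv, huv, hne, hmin⟩ := h
  by_contra hn
  have hcl : u.length < (u ++ [c]).length := by simp
  rcases prefix_or_branch v z with h1 | h1 | ⟨p, a, b, hab, h1, h2⟩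
  · exact hn h1
  · rcases hmin z hz.1 ((List.prefix_append u [c]).trans h') h1 with rfl | rfl
    · have := h'.length_le
      omega
    · exact hn h1
  · have hpv : p <+: v := (List.prefix_append p [a]).trans h1
    have hlen : u.length < p.length := by
      by_contra hlt
      have h3 : p ++ [a] <+: u ++ [c] := List.prefix_of_prefix_length_le h1 hc (by simp; omega)
      have h4 : p ++ [a] = p ++ [b] :=
        List.IsPrefix.eq_of_length (List.prefix_of_prefix_length_le (h3.trans h') h2 (by simp))
          (by simp)
      exact hab (by simpa using h4)
    have hup : u <+: p := List.prefix_of_prefix_length_le huv hpv hlen.le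
    have hpl : p.length < v.length := by
      have := h1.length_le
      simp only [List.length_append, List.length_singleton] at this
      omega
    have hp : IsNode S m p := by
      refine Or.inl ⟨⟨hv.isLocus.of_prefix hpv, Or.inr (Or.inr ⟨a, b, hab, ?_, ?_⟩)⟩, ?_⟩
      · exact hv.isLocus.of_prefix h1
      · exact hz.1.isLocus.of_prefix h2
      · have := hv.length_le
        omega
    rcases hmin p hp hup hpv with rfl | rfl <;> omega

theorem IsEdge.leavesBelow_eq {S : List β} {m : ℕ} {u v : Word β} {c : Option β}
    (h : IsEdge S m u v) (hc : u ++ [c] <+: v) :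
    leavesBelow S m v = leavesBelow S m (u ++ [c]) := by
  ext z
  exact and_congr_right fun hz => h.prefix_iff hc hz

/-- A descent along heavy edges can be continued to a heavy path. -/
theorem exists_isHeavyPath {S : List β} {m : ℕ} {u : Word β} (hu : IsNode S m u) :
    ∃ P, IsHeavyPath S m P ∧ u ∈ P := by
  classical
  let good : List (Word β) → Prop := fun P =>
    u ∈ P ∧ (∀ v ∈ P, IsNode S m v) ∧ P.IsChain (IsHeavyEdge S m)
  have hlt : ∀ {x y : Word β}, IsHeavyEdge S m x y → x.length < y.length := fun {x y} h =>
    lt_of_le_of_ne h.1.2.2.1.length_le fun he => h.1.2.2.2.1 (h.1.2.2.1.eq_of_length he)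
  -- the depths along a chain increase, and they are at most `m`
  have hbound : ∀ P, good P → P.length ≤ m + 1 := by
    rintro P ⟨-, h1, h2⟩
    have h3 : (P.map List.length).IsChain (· < ·) :=
      (List.isChain_map _).mpr (h2.imp fun x y h => hlt h)
    have h4 : (P.map List.length).Nodup := (List.isChain_iff_pairwise.mp h3).imp fun h => ne_of_lt h
    have h5 : (P.map List.length).toFinset ⊆ Finset.range (m + 1) := by
      intro k hk
      simp only [List.mem_toFinset, List.mem_map] at hk
      obtain ⟨v, hv, rfl⟩ := hk
      rw [Finset.mem_range]
      have := (h1 v hv).length_le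
      omega
    have h6 := Finset.card_le_card h5
    rwa [List.toFinset_card_of_nodup h4, Finset.card_range, List.length_map] at h6
  have hex : ∃ k, ∃ P, good P ∧ P.length = k :=
    ⟨1, [u], ⟨by simp, by simpa using hu, by simp⟩, rfl⟩
  obtain ⟨k, ⟨P, hP, hk⟩, hmax⟩ : ∃ k, (∃ P, good P ∧ P.length = k) ∧
      ∀ P, good P → P.length ≤ k := by
    refine ⟨Nat.findGreatest (fun k => ∃ P, good P ∧ P.length = k) (m + 1), ?_, fun P hP => ?_⟩
    · exact Nat.findGreatest_spec (P := fun k => ∃ P, good P ∧ P.length = k) (m := 1) (by omega)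
        ⟨[u], ⟨by simp, by simpa using hu, by simp⟩, rfl⟩
    · exact Nat.le_findGreatest (hbound P hP) ⟨P, hP, rfl⟩
  refine ⟨P, ⟨List.ne_nil_of_mem hP.1, hP.2.1, hP.2.2, fun x hx v hv => ?_, fun x hx v hv => ?_⟩,
    hP.1⟩
  · have := hmax (v :: P) ⟨List.mem_cons_of_mem _ hP.1, fun y hy => ?_, ?_⟩
    · rw [List.length_cons] at this; omega
    · rcases List.mem_cons.mp hy with rfl | hy
      · exact hv.1.1
      · exact hP.2.1 y hy
    · rcases P with - | ⟨y, P⟩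
      · simp at hx
      · simp only [List.head?_cons, Option.mem_def, Option.some.injEq] at hx
        subst hx
        exact List.isChain_cons_cons.mpr ⟨hv, hP.2.2⟩
  · have := hmax (P ++ [v]) ⟨List.mem_append_left _ hP.1, fun y hy => ?_, ?_⟩
    · rw [List.length_append, List.length_singleton] at this; omega
    · rcases List.mem_append.mp hy with hy | hy
      · exact hP.2.1 y hy
      · rw [List.mem_singleton.mp hy]
        exact hv.1.2.1
    · refine List.isChain_append.mpr ⟨hP.2.2, by simp, fun y hy w hw => ?_⟩
      simp only [List.head?_cons, Option.mem_def, Option.some.injEq] at hw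
      subst hw
      rw [Option.mem_def] at hx hy
      rw [hx] at hy
      obtain rfl := Option.some_inj.mp hy
      exact hv

theorem hamDist_replace [DecidableEq β] (u s : Word β) (a b : Option β) :
    hamDist (u ++ a :: s) (u ++ b :: s) ≤ 1 := by
  have h0 : ∀ w : Word β, (w.zip w).countP (fun p => p.1 ≠ p.2) = 0 := fun w => by
    induction w with
    | nil => rfl
    | cons c w ih => rw [List.zip_cons_cons, List.countP_cons_of_neg (by simp), ih]
  rw [hamDist, List.zip_append rfl, List.countP_append, h0, List.zip_cons_cons,
    List.countP_cons, h0]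
  split_ifs <;> omega

/-! ### Light occurrences as light pairs -/

/-- The numbers in `T` stand for the letters of the text `S`. -/
structure Encodes (S : List α) (T : ℕ → ℕ) : Prop where
  text : IsText S.length T
  eq_iff : ∀ i < S.length, ∀ j < S.length, T i = T j ↔ S[i]? = S[j]?

theorem encodes_of_lt_iff {S : List α} {T : ℕ → ℕ} {ℓ : ℕ → α} (hT : IsText S.length T)
    (hℓ : ∀ i < S.length, S[i]? = some (ℓ i))
    (hlt : ∀ i < S.length, ∀ j < S.length, T i < T j ↔ ℓ i < ℓ j) : Encodes S T := by
  refine ⟨hT, fun i hi j hj => ?_⟩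
  rw [hℓ i hi, hℓ j hj, Option.some_inj]
  have h1 := hlt i hi j hj
  have h2 := hlt j hj i hi
  constructor
  · intro h
    refine le_antisymm (not_lt.mp fun h' => ?_) (not_lt.mp fun h' => ?_)
    · have := h2.mpr h'; omega
    · have := h1.mpr h'; omega
  · intro h
    have h3 : ¬ T i < T j := fun h' => absurd (h1.mp h') (by rw [h]; exact lt_irrefl _)
    have h4 : ¬ T j < T i := fun h' => absurd (h2.mp h') (by rw [h]; exact lt_irrefl _)
    omega

theorem Encodes.agree_iff {S : List β} {T : ℕ → ℕ} (h : Encodes S T) {d i j : ℕ}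
    (hi : i < S.length) (hj : j < S.length) :
    Agree T d i j ↔ (suffixWord S i).take d = (suffixWord S j).take d := by
  rcases eq_or_ne i j with rfl | hij
  · simp [Agree.refl T d i]
  constructor
  · intro ha
    obtain ⟨h1, h2⟩ := h.text.agree_le hi hj hij ha
    refine List.ext_getElem? fun k => ?_
    rw [List.getElem?_take, List.getElem?_take]
    split_ifs with hk
    · rw [suffixWord_getElem? (by omega), suffixWord_getElem? (by omega),
        (h.eq_iff (i + k) (by omega) (j + k) (by omega)).mp (ha k hk)]
    · rfl
  · intro he
    have hget : ∀ k < d, (suffixWord S i)[k]? = (suffixWord S j)[k]? := fun k hk => by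
      have := congrArg (fun l => l[k]?) he
      simpa only [List.getElem?_take, if_pos hk] using this
    have h1 : i + d ≤ S.length := by
      by_contra hc
      have h2 := (suffixWord_getElem?_eq_some_none (S := S) (k := S.length - i) hi).mpr (by omega)
      rw [hget _ (by omega)] at h2
      have := (suffixWord_getElem?_eq_some_none hj).mp h2
      omega
    have h2 : j + d ≤ S.length := by
      by_contra hc
      have h2 := (suffixWord_getElem?_eq_some_none (S := S) (k := S.length - j) hj).mpr (by omega)
      rw [← hget _ (by omega)] at h2
      have := (suffixWord_getElem?_eq_some_none hi).mp h2
      omega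
    intro k hk
    rw [h.eq_iff (i + k) (by omega) (j + k) (by omega)]
    have := hget k hk
    rwa [suffixWord_getElem? (by omega), suffixWord_getElem? (by omega), Option.some_inj] at this

theorem leafWord_take {S : List β} {m d i : ℕ} (hd : d ≤ m) :
    (leafWord S m i).take d = (suffixWord S i).take d := by
  rw [leafWord, List.take_take, min_eq_left hd]

theorem leafWord_length {S : List β} {m i : ℕ} (hi : i + m ≤ S.length) :
    (leafWord S m i).length = m := by
  rw [leafWord, List.length_take, suffixWord_length]
  omega

theorem take_prefix_leafWord_iff {S : List β} {m d i j : ℕ} (hd : d ≤ m)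
    (hi : i + d ≤ S.length) :
    (suffixWord S i).take d <+: leafWord S m j ↔
      (suffixWord S i).take d = (suffixWord S j).take d := by
  have hl : ((suffixWord S i).take d).length = d := by
    rw [List.length_take, suffixWord_length]
    omega
  rw [List.prefix_iff_eq_take, hl, leafWord_take hd]

/-- The leaves below a locus are in bijection with the suffixes in its interval that come first
among those with the same leaf. -/
theorem ncard_leavesBelow {S : List β} {T sa rk hh : ℕ → ℕ} (hT : Encodes S T)
    (hA : IsSuffixArray S.length T sa rk hh) {m d i : ℕ} (hd : d ≤ m) (hi : i < S.length)
    (hid : i + d ≤ S.length) :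
    (leavesBelow S m ((suffixWord S i).take d)).ncard = leafCount hh S.length m d (rk i) := by
  classical
  rw [leafCount, ← Set.ncard_coe_finset]
  symm
  refine Set.ncard_congr (fun y _ => leafWord S m (sa y)) ?_ ?_ ?_
  · intro y hy
    simp only [Finset.coe_filter, Finset.mem_range, Set.mem_ofPred_eq] at hy
    obtain ⟨hyn, hs, -⟩ := hy
    have hsy := hA.sa_lt y hyn
    refine ⟨isLeaf_iff.mpr ⟨_, hsy, rfl⟩, ?_⟩
    rw [take_prefix_leafWord_iff hd hid, ← hT.agree_iff hi hsy, hA.agree_iff hi hsy,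
      hA.rk_sa y hyn]
    exact hs
  · intro y y' hy hy' he
    simp only [Finset.coe_filter, Finset.mem_range, Set.mem_ofPred_eq] at hy hy'
    have h1 := (hT.agree_iff (d := m) (hA.sa_lt y hy.1) (hA.sa_lt y' hy'.1)).mpr he
    rw [hA.agree_iff (hA.sa_lt y hy.1) (hA.sa_lt y' hy'.1), hA.rk_sa y hy.1,
      hA.rk_sa y' hy'.1] at h1
    rcases lt_trichotomy y y' with h | h | h
    · have := h1 y' (by omega)
      have := hy'.2.2
      omega
    · exact h
    · have := h1 y (by omega)
      have := hy.2.2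
      omega
  · rintro z ⟨hz, hp⟩
    obtain ⟨j, hj, rfl⟩ := isLeaf_iff.mp hz
    rw [take_prefix_leafWord_iff hd hid, ← hT.agree_iff hi hj, hA.agree_iff hi hj] at hp
    have hex : ∃ c, SameClass hh m (rk j) c := ⟨rk j, SameClass.refl _ _ _⟩
    have h1 := Nat.find_spec hex
    have h2 : Nat.find hex ≤ rk j := Nat.find_min' hex (SameClass.refl _ _ _)
    have hrj := hA.rk_lt j hj
    have hfn : Nat.find hex < S.length := by omega
    refine ⟨Nat.find hex, ?_, ?_⟩
    · simp only [Finset.coe_filter, Finset.mem_range, Set.mem_ofPred_eq]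
      refine ⟨hfn, hp.trans (h1.mono hd), ?_⟩
      by_contra hc
      have h3 : 0 < Nat.find hex := by
        rcases Nat.eq_zero_or_pos (Nat.find hex) with h | h
        · rw [h, hA.hh_zero] at hc; omega
        · exact h
      refine Nat.find_min hex (m := Nat.find hex - 1) (by omega) (h1.trans fun z hz => ?_)
      rw [show z = Nat.find hex by omega]
      omega
    · refine ((hT.agree_iff hj (hA.sa_lt _ hfn)).mp ?_).symm
      rw [hA.agree_iff hj (hA.sa_lt _ hfn), hA.rk_sa _ hfn]
      exact h1

theorem take_succ_suffixWord {S : List β} {i d : ℕ} (h : i + d ≤ S.length) :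
    (suffixWord S i).take (d + 1) = (suffixWord S i).take d ++ [S[i + d]?] := by
  rw [List.take_add_one, suffixWord_getElem? h]
  rfl

/-- The first symbol of the edge from the locus of depth `d` towards a leaf. -/
theorem IsEdge.take_succ_prefix {S : List β} {m d i : ℕ} {v : Word β} (hd : d < m)
    (hi : i + m ≤ S.length) (h : IsEdge S m ((suffixWord S i).take d) v)
    (hv : v <+: leafWord S m i) : (suffixWord S i).take (d + 1) <+: v := by
  have h1 : (suffixWord S i).take (d + 1) <+: leafWord S m i :=
    (take_prefix_leafWord_iff (by omega) (by omega)).mpr rfl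
  refine List.prefix_of_prefix_length_le h1 hv ?_
  have h2 : ((suffixWord S i).take d).length < v.length :=
    lt_of_le_of_ne h.2.2.1.length_le fun he => h.2.2.2.1 (h.2.2.1.eq_of_length he)
  rw [List.length_take, suffixWord_length] at h2 ⊢
  omega

theorem isLightEdge_iff {S : List β} {T sa rk hh : ℕ → ℕ} (hT : Encodes S T)
    (hA : IsSuffixArray S.length T sa rk hh) {m d i : ℕ} {v : Word β} (hd : d < m)
    (hi : i + m ≤ S.length) (h : IsEdge S m ((suffixWord S i).take d) v)
    (hv : v <+: leafWord S m i) :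
    IsLightEdge S m ((suffixWord S i).take d) v ↔ IsLightAt hh S.length m d (rk i) := by
  have h1 := h.take_succ_prefix hd hi hv
  rw [take_succ_suffixWord (by omega)] at h1
  have h2 := h.leavesBelow_eq h1
  rw [← take_succ_suffixWord (by omega)] at h2
  rw [IsLightEdge, IsHeavyEdge, h2, ncard_leavesBelow hT hA hd.le (by omega) (by omega),
    ncard_leavesBelow hT hA (by omega) (by omega) (by omega), IsLightAt]
  simp only [h, true_and, not_lt]

theorem leafWord_eq_factor {S : List β} {m i : ℕ} (hi : i + m ≤ S.length) :
    leafWord S m i = factor S i m := by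
  rw [leafWord, suffixWord, factor, List.take_append_of_le_length (by simp; omega), List.map_take]

theorem leafWord_eq_append {S : List β} {m d i : ℕ} (hd : d < m) (hi : i + m ≤ S.length)
    (hid : i + d < S.length) :
    leafWord S m i = (suffixWord S i).take d ++
      some S[i + d] :: ((S.drop (i + (d + 1))).take (m - (d + 1))).map some := by
  have h1 : (suffixWord S i).take d = (((S.drop i).take m).take d).map some := by
    rw [← leafWord_take hd.le, leafWord_eq_factor hi, factor, ← List.map_take]
  have h2 : ((S.drop i).take m).drop d =
      S[i + d] :: (S.drop (i + (d + 1))).take (m - (d + 1)) := by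
    rw [List.drop_eq_getElem_cons (by simp; omega)]
    simp only [List.getElem_take, List.getElem_drop, List.drop_take, List.drop_drop]
  rw [h1, ← List.map_cons, ← List.map_append, ← h2, List.take_append_drop,
    leafWord_eq_factor hi, factor]

/-- The light occurrences of the leaf of the suffix number `i` are the positions that form a light
pair with `i`. -/
theorem lightHamOccs_leafWord {S : List α} {T sa rk hh : ℕ → ℕ} (hT : Encodes S T)
    (hA : IsSuffixArray S.length T sa rk hh) {m i : ℕ} (hm : 1 ≤ m) (hi : i < S.length) :
    lightHamOccs S m (leafWord S m i) = {j | ∃ d, LightPair S.length m T rk hh d i j} := by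
  ext j
  constructor
  · rintro ⟨⟨hj, -⟩, P, -, z', ⟨-, -, u, -, v, huv, hvz, c, c', s, hz, hz', hcc, hheavy⟩, hf⟩
    -- the end marker can only be the last symbol of `z`, which is a letter
    have him : i + m ≤ S.length := by
      by_contra hc
      have he : leafWord S m i = suffixWord S i :=
        List.take_of_length_le (by rw [suffixWord_length]; omega)
      have h1 : (leafWord S m i)[S.length - i]? = some none := by
        rw [he]
        exact (suffixWord_getElem?_eq_some_none hi).mpr (by omega)
      have h2 := congrArg List.length hz
      rw [he, suffixWord_length] at h2
      simp only [List.length_append, List.length_cons] at h2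
      rw [hz, List.getElem?_append_right (by omega), ← List.map_cons, List.getElem?_map] at h1
      simp at h1
    have hlen := leafWord_length him
    rw [hlen] at hj hf
    rw [← leafWord_eq_factor hj] at hf
    rw [← hf] at hz'
    obtain ⟨d, hud⟩ : ∃ d, d = u.length := ⟨_, rfl⟩
    have hdm : d < m := by
      have := congrArg List.length hz
      rw [hlen] at this
      simp only [List.length_append, List.length_cons] at this
      omega
    have hui : u = (suffixWord S i).take d := by
      rw [← leafWord_take hdm.le, hz, hud, List.take_left]
    have huj : u = (suffixWord S j).take d := by
      rw [← leafWord_take hdm.le, hz', hud, List.take_left]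
    have hget : ∀ i, i + m ≤ S.length → ∀ k < m, (leafWord S m i)[k]? = some (S[i + k]?) :=
      fun i hi k hk => by
        rw [leafWord, List.getElem?_take, if_pos hk, suffixWord_getElem? (by omega)]
    have hci : S[i + d]? = some c := by
      have := hget i him d hdm
      rw [hz, List.getElem?_append_right (by omega), ← hud, Nat.sub_self] at this
      simpa using this.symm
    have hcj : S[j + d]? = some c' := by
      have := hget j hj d hdm
      rw [hz', List.getElem?_append_right (by omega), ← hud, Nat.sub_self] at this
      simpa using this.symm
    refine ⟨d, him, hj, hdm, ?_, ?_, ?_, ?_, ?_⟩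
    · rw [hT.agree_iff hi (by omega), ← hui, ← huj]
    · rw [ne_eq, hT.eq_iff _ (by omega) _ (by omega), hci, hcj, Option.some_inj]
      exact Ne.symm hcc
    · intro k hk
      rw [hT.eq_iff _ (by omega) _ (by omega)]
      have h1 := hget i him (d + 1 + k) (by omega)
      have h2 := hget j hj (d + 1 + k) (by omega)
      rw [hz, List.getElem?_append_right (by omega), ← hud, show d + 1 + k - d = k + 1 by omega,
        List.getElem?_cons_succ] at h1
      rw [hz', List.getElem?_append_right (by omega), ← hud, show d + 1 + k - d = k + 1 by omega,
        List.getElem?_cons_succ] at h2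
      rw [h1, Option.some_inj] at h2
      rwa [add_assoc i, add_assoc j]
    · rw [hui] at huv
      exact (isLightEdge_iff hT hA hdm him huv.1 hvz).mp huv
    · have hne : u ≠ leafWord S m j := fun he => by
        have := congrArg List.length he
        rw [leafWord_length hj] at this
        omega
      obtain ⟨v', hv', hvj⟩ := exists_edge huv.1.1 (isNode_leafWord (m := m) (i := j) (by omega))
        (by rw [hz']; exact List.prefix_append _ _) hne
      rw [huj] at hv'
      refine (isLightEdge_iff hT hA hdm hj hv' hvj).mp ⟨hv', fun hh' => ?_⟩
      rw [← huj] at hh'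
      refine hheavy v' hh' ?_
      have := hv'.take_succ_prefix hdm hj hvj
      rwa [take_succ_suffixWord (by omega), ← huj, hcj] at this
  · rintro ⟨d, him, hj, hdm, hag, hne, htail, hli, hlj⟩
    have hjn : j < S.length := by omega
    have hzi := leafWord_eq_append hdm him (by omega)
    have hzj := leafWord_eq_append hdm hj (by omega)
    have huij := (hT.agree_iff hi hjn).mp hag
    have hs : (S.drop (j + (d + 1))).take (m - (d + 1)) =
        (S.drop (i + (d + 1))).take (m - (d + 1)) := by
      refine List.ext_getElem? fun k => ?_
      rw [List.getElem?_take, List.getElem?_take]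
      split_ifs with hk
      · rw [List.getElem?_drop, List.getElem?_drop]
        exact ((hT.eq_iff _ (by omega) _ (by omega)).mp (htail k hk)).symm
      · rfl
    rw [← huij, hs] at hzj
    have hcc : S[j + d]'(by omega) ≠ S[i + d]'(by omega) := by
      intro he
      refine hne ((hT.eq_iff _ (by omega) _ (by omega)).mpr ?_)
      rw [List.getElem?_eq_getElem (show i + d < S.length by omega),
        List.getElem?_eq_getElem (show j + d < S.length by omega), he]
    generalize hu : (suffixWord S i).take d = u at *
    have hul : u.length = d := by
      rw [← hu, List.length_take, suffixWord_length]
      omega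
    have hloci : ∀ {i}, i < S.length → ∀ {a t}, leafWord S m i = u ++ a :: t →
        IsLocus S (u ++ [a]) := fun {i} hi {a t} he =>
      (isNode_leafWord (m := m) hi).isLocus.of_prefix (by rw [he]; simp)
    have hnode : IsNode S m u := by
      refine Or.inl ⟨⟨(hloci hi hzi).of_prefix (List.prefix_append _ _), Or.inr (Or.inr
        ⟨_, _, ?_, hloci hi hzi, hloci hjn hzj⟩)⟩, by omega⟩
      simpa using Ne.symm hcc
    have hpre : ∀ {i}, ∀ {t}, leafWord S m i = u ++ t → u <+: leafWord S m i := fun {i t} he => by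
      rw [he]; exact List.prefix_append _ _
    have hneq : ∀ {i}, i + m ≤ S.length → u ≠ leafWord S m i := fun {i} hi he => by
      have := congrArg List.length he
      rw [leafWord_length hi] at this
      omega
    obtain ⟨P, hP, huP⟩ := exists_isHeavyPath hnode
    obtain ⟨v, hv, hvi⟩ := exists_edge hnode (isNode_leafWord hi) (hpre hzi) (hneq him)
    refine ⟨⟨by rw [leafWord_length him]; exact hj, ?_⟩, P, hP, leafWord S m j,
      ⟨isLeaf_iff.mpr ⟨i, hi, rfl⟩, isNode_leafWord hjn, u, huP, v, ?_, hvi, _, _, _, hzi, hzj,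
        hcc, fun x hx hpx => ?_⟩, ?_⟩
    · rw [leafWord_length him, ← leafWord_eq_factor hj, hzi, hzj]
      exact hamDist_replace _ _ _ _
    · rw [← hu] at hv ⊢
      exact (isLightEdge_iff hT hA hdm him hv hvi).mpr hli
    · -- the heavy edge would be the edge towards the leaf of `j`
      have hxj : x <+: leafWord S m j := by
        refine (hx.1.prefix_iff hpx (isLeaf_iff.mpr ⟨j, hjn, rfl⟩)).mpr ?_
        rw [hzj]
        simp
      rw [huij] at hx
      exact ((isLightEdge_iff hT hA hdm hj hx.1 hxj).mpr hlj).2 hx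
    · rw [leafWord_length him, leafWord_eq_factor hj]

end Mappability

/-- There are one program and one constant `C` such that, on every text `S` of length `n` over
every linearly ordered alphabet and for every `1 ≤ m ≤ n`, the program runs in at most
`C * n * (log n + 1)` steps, on words of `C * (log n + 1)` bits and on arrays of `C * n` cells
(finitely many arrays, named in the program), and leaves in array `0`, at every position `i` at
which the label of a leaf `z` of the `m`-trimmed suffix tree starts, the number of 1-ham
occurrences of that label that correspond to `P`-light occurrences of `z` over all heavy
paths `P`. -/
theorem theoremt :
    ∃ (prog : Mappability.Prog) (C : ℕ),
      ∀ (α : Type*) [LinearOrder α] (S : List α) (m : ℕ), 1 ≤ m → m ≤ S.length →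
        ∃ (t : ℕ) (τ : Mappability.Store),
          Mappability.Exec S (C * (Nat.log 2 S.length + 1)) (C * S.length) prog
            (Mappability.Store.init S.length m) t τ ∧
          t ≤ C * S.length * (Nat.log 2 S.length + 1) ∧
          ∀ z : Mappability.Word α, Mappability.IsLeaf S m z →
            ∀ i < S.length, z <+: Mappability.suffixWord S i →
              τ.arrs 0 i = (Mappability.lightHamOccs S m z).ncard := by
  open Mappability in
  refine ⟨lightMappability, 9000, fun α _ S m hm hmn => ?_⟩
  obtain ⟨n, hn⟩ : ∃ n, n = S.length := ⟨_, rfl⟩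
  have hn1 : 1 ≤ n := by omega
  let M : Machine α := ⟨S, 9000 * n, 8 * n⟩
  have hM : M.Fits n := ⟨hn1, hn.symm, by show 8 * n ≤ 9000 * n; omega, le_rfl⟩
  let ℓ : ℕ → α := fun i => S.getD i (S[0]'(by omega))
  have hℓ : ∀ i < n, S[i]? = some (ℓ i) := fun i hi => by
    simp only [ℓ, List.getD_eq_getElem?_getD]
    rw [List.getElem?_eq_getElem (by omega), Option.getD_some]
  have hwp := wp_lightMappability (σ := Store.init n m) hM hℓ (by simp [Store.init])
    (by simp [Store.init]) hm (by omega) (fun _ _ => rfl)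
  -- the words are long enough for the values of all expressions
  have hw : lightMappability.wt * M.B < 2 ^ (9000 * (Nat.log 2 n + 1)) := by
    have h1 : lightMappability.wt ≤ 32 := by decide
    have h2 : n < 2 ^ (Nat.log 2 n + 1) := Nat.lt_pow_succ_log_self (by norm_num) n
    calc lightMappability.wt * (8 * n) ≤ 32 * (8 * n) := Nat.mul_le_mul_right _ h1
      _ = 2 ^ 8 * n := by ring
      _ < 2 ^ 8 * 2 ^ (Nat.log 2 n + 1) := by omega
      _ = 2 ^ (8 + (Nat.log 2 n + 1)) := by rw [← pow_add]
      _ ≤ 2 ^ (9000 * (Nat.log 2 n + 1)) := Nat.pow_le_pow_right (by norm_num) (by omega)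
  have hσ : Bounded M.B (Store.init n m) := by
    refine ⟨fun x => ?_, fun _ _ => Nat.zero_le _⟩
    show (if x = 0 then n else if x = 1 then m else 0) ≤ 8 * n
    split_ifs <;> omega
  obtain ⟨t, τ, hexec, -, ht, T, sa, rk, hh, hT, hlt, hA, -, hans⟩ :=
    exec_of_wp (M := M) (by show 1 ≤ 8 * n; omega) hw hσ hwp
  subst hn
  refine ⟨t, τ, hexec, by rw [mul_assoc]; omega, fun z hz i hi hzi => ?_⟩
  rw [hz.eq_leafWord hi hzi, lightHamOccs_leafWord (encodes_of_lt_iff hT hℓ hlt) hA hm hi, hans]
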